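/- Let $\Bbbk$ be a field of characteristic $0$; everything is $\mathbb Z$-graded with differentials of degree $+1$. A dg Lie algebra $\mathfrak g$ is *complete* if $\mathfrak g\cong\varprojlim_N\mathfrak g/F_N\mathfrak g$ in graded vector spaces, i.e. in every degree, where $F_N\mathfrak g$ is spanned by all bracketings of at least $N$ elements. *The complex $C_\bullet$.* Let $\Omega_n=\Bbbk[t_0,\dots,t_n,dt_0,\dots,dt_n]/(\sum t_i=1,\sum dt_i=0)$ be the simplicial Sullivan algebra, and $C_n\subset\Omega_n$ the span of the basic forms $$\omega_I=p!\sum_{j=0}^p(-1)^jt_{i_j}dt_{i_0}\cdots\widehat{dt_{i_j}}\cdots dt_{i_p},\qquad \emptyset\neq I=\{i_0<\dots<i_p\}\subseteq\{0,\dots,n\}.$$ Let $i_n:C_n\to\Omega_n$ be the inclusion, $p_n(\eta)=\sum_I\big(\int_{\Delta^I}\eta\big)\omega_I$, and let $h_n$ be Dupont's homotopy $$h_n=\sum_{p}\sum_{i_0<\dots<i_p}(-1)^p\,\omega_{i_0\cdots i_p}h^{i_p}\cdots h^{i_0},$$ where $h^i\eta$ is the integral over $u\in[0,1]$ of the $du$-component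 of the pullback of $\eta$ along $(u,t)\mapsto ut+(1-u)e_i$ (with $du$ moved to the left); it satisfies $dh_n+h_nd=1-i_np_n$. *The two transferred structures.* For a complete dg Lie algebra $\mathfrak g$, equip $\mathfrak g\otimes C_n$ with the $L_\infty$-structure $(\ell_r)$ transferred from the dg Lie algebra $\mathfrak g\otimes\Omega_n$ along $(1\otimes i_n,1\otimes p_n,1\otimes h_n)$, by the usual sum over binary trees, and let $\mathrm{MC}(\mathfrak g\otimes C_n)$ be the set of elements $x$ of degree $1$ with $dx+\sum_{r\ge2}\frac1{r!}\ell_r(x,\dots,x)=0$, the sum converging for the filtration $F_N\mathfrak g\otimes C_n$. Likewise equip $C_n$ with the $C_\infty$-structure transferred from the product of $\Omega_n$ along $(i_n,p_n,h_n)$, regarded as operations $b_r:C_n[1]^{\otimes r}\to C_n[1]$ of degree $+1$. *The algebra $\mathfrak{mc}_n$.* Let $v_I=s\omega_I^\vee$, of degree $1-|\omega_I|$, be the basis of $sC_n^\vee=C_n[1]^\vee$ dual to $(\omega_I)$. Let $\mathfrak{mc}_n$ be the completed free graded Lie algebra $\widehat{\mathrm{Lie}}(sC_n^\vee)$, i.e.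 in each degree the Lie series in the completed tensor algebra on the $v_I$, with $d$ the restriction of the continuous derivation of the completed tensor algebra determined by $d v_I=\sum_{r\ge1}(-1)^{|v_I|}\,v_I\circ b_r$ (the transpose of the $C_\infty$-structure, i.e. the complete cobar construction of the dual of $C_n$). **Theorem.** The derivation $d$ preserves Lie series, so that each $\mathfrak{mc}_n$ is a complete dg Lie algebra, and the transposes of the simplicial maps of $C_\bullet$ make $\mathfrak{mc}_\bullet$ a cosimplicial dg Lie algebra. For every complete dg Lie algebra $\mathfrak g$, the sets $\mathrm{MC}(\mathfrak g\otimes C_n)$ form a simplicial set under the maps $1\otimes\theta^*$, and $$\hom_{\mathsf{dgLie}}(\mathfrak{mc}_\bullet,\mathfrak g)\longrightarrow\mathrm{MC}(\mathfrak g\otimes C_\bullet),\qquad \varphi\longmapsto\sum_I\varphi(v_I)\otimes\omega_I,$$ is an isomorphism of simplicial sets, natural with respect to morphisms of complete dg Lie algebras $\mathfrak g\to\mathfrak g'$. -/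

import Mathlib

open scoped TensorProduct

noncomputable section

namespace DGL

/-! ## Differential graded Lie algebras (cohomological grading, differential of degree `+1`) -/

/-- `IsBracketing br S m x`: the element `x` is obtained from exactly `m` elements of `S`
by some (arbitrarily parenthesised) iterated bracketing. -/
inductive IsBracketing {L : Type*} (br : L → L → L) (S : Set L) : ℕ → L → Prop
  | of (x : L) (hx : x ∈ S) : IsBracketing br S 1 x
  | bracket (a b : ℕ) (x y : L) (hx : IsBracketing br S a x) (hy : IsBracketing br S b y) :
      IsBracketing br S (a + b) (br x y)

/-- A `ℤ`-graded vector space `L = ⨁ gr i` with a bilinear bracket and a linear endomorphism `d`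
(the data underlying a dg Lie algebra; the laws are in `IsDGLie`). -/
structure DGLieData (k : Type*) (L : Type*) [Field k] [AddCommGroup L] [Module k L] where
  gr : ℤ → Submodule k L
  internal : DirectSum.IsInternal gr
  bracket : L →ₗ[k] L →ₗ[k] L
  d : L →ₗ[k] L

section

variable {k : Type*} [Field k] {L : Type*} [AddCommGroup L] [Module k L]
variable {L' : Type*} [AddCommGroup L'] [Module k L']

/-- The laws of a dg Lie algebra. -/
structure DGLieData.IsDGLie (D : DGLieData k L) : Prop where
  bracket_mem : ∀ i j : ℤ, ∀ x ∈ D.gr i, ∀ y ∈ D.gr j, D.bracket x y ∈ D.gr (i + j)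
  d_mem : ∀ i : ℤ, ∀ x ∈ D.gr i, D.d x ∈ D.gr (i + 1)
  antisymm : ∀ i j : ℤ, ∀ x ∈ D.gr i, ∀ y ∈ D.gr j,
    D.bracket x y = -(((i * j).negOnePow : ℤ) • D.bracket y x)
  jacobi : ∀ i j : ℤ, ∀ x ∈ D.gr i, ∀ y ∈ D.gr j, ∀ z : L,
    D.bracket x (D.bracket y z) =
      D.bracket (D.bracket x y) z + ((i * j).negOnePow : ℤ) • D.bracket y (D.bracket x z)
  leibniz : ∀ i : ℤ, ∀ x ∈ D.gr i, ∀ y : L,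
    D.d (D.bracket x y) = D.bracket (D.d x) y + (i.negOnePow : ℤ) • D.bracket x (D.d y)
  d_d : ∀ x : L, D.d (D.d x) = 0

/-- The canonical filtration: `D.filt N` is spanned by all bracketings of at least `N` elements. -/
def DGLieData.filt (D : DGLieData k L) (N : ℕ) : Submodule k L :=
  Submodule.span k {x | ∃ m, N ≤ m ∧ IsBracketing (fun a b => D.bracket a b) Set.univ m x}

/-- Completeness: in each degree `i`, the canonical map from `gr i` to the limit of the quotients
`gr i / (gr i ∩ filt N)` is injective and surjective. -/
structure DGLieData.IsComplete (D : DGLieData k L) : Prop where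
  separated : ∀ i : ℤ, ∀ x ∈ D.gr i, (∀ N, x ∈ D.filt N) → x = 0
  exists_limit : ∀ i : ℤ, ∀ x : ℕ → L, (∀ N, x N ∈ D.gr i) →
    (∀ N, x (N + 1) - x N ∈ D.filt N) → ∃ y ∈ D.gr i, ∀ N, y - x N ∈ D.filt N

/-- Morphisms of dg Lie algebras. -/
structure IsDGLieHom (D : DGLieData k L) (D' : DGLieData k L') (f : L →ₗ[k] L') : Prop where
  map_gr : ∀ i : ℤ, ∀ x ∈ D.gr i, f x ∈ D'.gr i
  map_bracket : ∀ x y : L, f (D.bracket x y) = D'.bracket (f x) (f y)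
  map_d : ∀ x : L, f (D.d x) = D'.d (f x)

/-- The parity operator `x ↦ (-1)^|x| x`. -/
def DGLieData.par (D : DGLieData k L) : L →ₗ[k] L :=
  DirectSum.toModule k ℤ L (fun i => ((i.negOnePow : ℤ) : k) • (D.gr i).subtype) ∘ₗ
    (LinearEquiv.ofBijective (DirectSum.coeLinearMap D.gr) D.internal).symm.toLinearMap

/-- The restriction of `f` to a map `A → B`; meaningful only if `f` maps `A` into `B`. -/
def restrictTo (A : Submodule k L) (B : Submodule k L') (f : L →ₗ[k] L') : A →ₗ[k] B :=
  open Classical in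
  if h : ∀ x ∈ A, f x ∈ B then f.restrict h else 0

end

/-! ## The Sullivan algebra `Ω_n` in the affine coordinates `t_1, …, t_n` -/

section

variable (k : Type*) [Field k]

/-- Polynomial functions on the `n`-simplex: `k[t_0,…,t_n]/(∑ t_i = 1) = k[t_1,…,t_n]`. -/
abbrev Pol (n : ℕ) : Type _ := MvPolynomial (Fin n) k

/-- Forms with constant coefficients: the exterior algebra on `dt_1, …, dt_n`. -/
abbrev Lam (n : ℕ) : Type _ := ExteriorAlgebra k (Fin n → k)

/-- Polynomial differential forms on the `n`-simplex. -/
abbrev Om (n : ℕ) : Type _ := Pol k n ⊗[k] Lam k n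

/-- Barycentric coordinates as polynomials; `t_0 = 1 - t_1 - ⋯ - t_n`. -/
def tPol (n : ℕ) : Fin (n + 1) → Pol k n :=
  Fin.cases (1 - ∑ j, MvPolynomial.X j) (fun j => MvPolynomial.X j)

/-- The vectors `dt_0 = -dt_1 - ⋯ - dt_n` and `dt_1, …, dt_n`. -/
def dtVec (n : ℕ) : Fin (n + 1) → (Fin n → k) :=
  Fin.cases (-∑ j, Pi.single j 1) (fun j => Pi.single j 1)

/-- The function `t_i` in `Ω_n`. -/
def tOm (n : ℕ) (i : Fin (n + 1)) : Om k n := tPol k n i ⊗ₜ[k] 1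

/-- The one-form `dt_i` in `Ω_n`. -/
def dtOm (n : ℕ) (i : Fin (n + 1)) : Om k n := 1 ⊗ₜ[k] ExteriorAlgebra.ι k (dtVec k n i)

/-- The de Rham differential `d(f η) = ∑_j ∂_j f dt_j ∧ η`. -/
def dOm (n : ℕ) : Om k n →ₗ[k] Om k n :=
  ∑ j : Fin n, TensorProduct.map (MvPolynomial.pderiv j).toLinearMap
    (LinearMap.mulLeft k (ExteriorAlgebra.ι k (Pi.single j 1 : Fin n → k)))

/-- The parity operator `ω ↦ (-1)^|ω| ω`. -/
def parOm (n : ℕ) : Om k n →ₗ[k] Om k n :=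
  TensorProduct.map LinearMap.id
    (CliffordAlgebra.involute (Q := (0 : QuadraticForm k (Fin n → k)))).toLinearMap

/-- The simplicial structure: pullback along the affine map `Δ^m → Δ^n` given by a monotone map `θ`
of vertices, `t_j ↦ ∑_{θ i = j} t_i` and `dt_j ↦ ∑_{θ i = j} dt_i`. -/
def pullOm {m n : ℕ} (θ : Fin (m + 1) →o Fin (n + 1)) : Om k n →ₐ[k] Om k m :=
  Algebra.TensorProduct.map
    (MvPolynomial.aeval fun j : Fin n =>
      ∑ i ∈ Finset.univ.filter (fun i => θ i = j.succ), tPol k m i)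
    (ExteriorAlgebra.map (Fintype.linearCombination k fun j : Fin n =>
      ∑ i ∈ Finset.univ.filter (fun i => θ i = j.succ), dtVec k m i))

/-- The functional on polynomials
`t_1^{a_1} ⋯ t_n^{a_n} ↦ a_1! ⋯ a_n! / (a_1 + ⋯ + a_n + n)!`. -/
def intPol (n : ℕ) : Pol k n →ₗ[k] k :=
  (MvPolynomial.basisMonomials (Fin n) k).constr k fun a =>
    (∏ j, ((a j).factorial : k)) / (((∑ j, a j) + n).factorial : k)

/-- The coefficient of `dt_1 ∧ ⋯ ∧ dt_n`. -/
def topLam (n : ℕ) : Lam k n →ₗ[k] k :=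
  ExteriorAlgebra.liftAlternating (Pi.single n Matrix.detRowAlternating)

/-- Integration of forms over the `n`-simplex (zero on forms of degree different from `n`). -/
def integ (n : ℕ) : Om k n →ₗ[k] k :=
  LinearMap.mul' k k ∘ₗ TensorProduct.map (intPol k n) (topLam k n)

/-! ## Basic forms and the cellular cochain complex `C_n` -/

/-- The faces of the `n`-simplex: nonempty subsets `I` of `{0, …, n}`. -/
abbrev Face (n : ℕ) : Type := {I : Finset (Fin (n + 1)) // I.Nonempty}

/-- The dimension `|I| - 1` of a face. -/
def Face.dim {n : ℕ} (I : Face n) : ℕ := I.1.card - 1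

theorem Face.card_eq {n : ℕ} (I : Face n) : I.1.card = I.dim + 1 := by
  have := I.2.card_pos
  unfold Face.dim
  omega

/-- The increasing enumeration `i_0 < ⋯ < i_p` of a face. -/
def Face.vert {n : ℕ} (I : Face n) : Fin (I.dim + 1) →o Fin (n + 1) :=
  (I.1.orderEmbOfFin I.card_eq).toOrderHom

/-- The basic form
`ω_I = p! ∑_{j=0}^p (-1)^j t_{i_j} dt_{i_0} ⋯ (omit dt_{i_j}) ⋯ dt_{i_p}`. -/
def basicForm (n : ℕ) (I : Face n) : Om k n :=
  (I.dim.factorial : k) • ∑ j : Fin (I.dim + 1),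
    ((-1 : k) ^ (j : ℕ)) • (tOm k n (I.vert j) *
      (List.ofFn fun l : Fin I.dim => dtOm k n (I.vert (j.succAbove l))).prod)

/-- The underlying vector space of `C_n`, with basis indexed by the faces: the basis vector
`Pi.single I 1` stands for `ω_I`, in degree `I.dim`. -/
abbrev Cc (n : ℕ) : Type _ := Face n → k

/-- The inclusion `i_n : C_n → Ω_n`. -/
def incl (n : ℕ) : Cc k n →ₗ[k] Om k n := Fintype.linearCombination k (basicForm k n)

/-- The projection `p_n : Ω_n → C_n`; its coefficient at `ω_I` is the integral over the face `I`. -/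
def proj (n : ℕ) : Om k n →ₗ[k] Cc k n :=
  LinearMap.pi fun I : Face n => integ k I.dim ∘ₗ (pullOm k I.vert).toLinearMap

/-- The differential of `C_n`, restricted from `Ω_n`. -/
def dC (n : ℕ) : Cc k n →ₗ[k] Cc k n := proj k n ∘ₗ dOm k n ∘ₗ incl k n

/-- The simplicial structure of `C_n`, restricted from `Ω_n`. -/
def pullC {m n : ℕ} (θ : Fin (m + 1) →o Fin (n + 1)) : Cc k n →ₗ[k] Cc k m :=
  proj k m ∘ₗ (pullOm k θ).toLinearMap ∘ₗ incl k n

/-! ## Dupont's homotopy `h_n` -/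

/-- `f ↦ ∫_0^1 u^q f(u t + (1 - u) e_i) du`, where `e_i` is the `i`-th vertex. -/
def coneInt (n : ℕ) (i : Fin (n + 1)) (q : ℕ) : Pol k n →ₗ[k] Pol k n :=
  Polynomial.lsum (fun a => ((a + q + 1 : ℕ) : k)⁻¹ • (LinearMap.id : Pol k n →ₗ[k] Pol k n)) ∘ₗ
    (MvPolynomial.aeval (R := k) (S₁ := Polynomial (Pol k n)) fun j : Fin n =>
      Polynomial.X * Polynomial.C (MvPolynomial.X j) +
        (1 - Polynomial.X) * (if i = j.succ then 1 else 0)).toLinearMap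

/-- The Poincaré homotopy `h^i` for the contraction of the simplex onto its vertex `e_i`: pullback
along `(u, t) ↦ u t + (1 - u) e_i` followed by integration over `u ∈ [0, 1]`. As the pullback sends
`dt_j` to `u dt_j + (t_j - (e_i)_j) du`, on `f η` with `η` constant of degree `q + 1` it is
`∑_j (t_j - (e_i)_j) (∫_0^1 u^q f(u t + (1 - u) e_i) du) (∂_j ⌟ η)`. -/
def poincare (n : ℕ) (i : Fin (n + 1)) : Om k n →ₗ[k] Om k n :=
  ∑ j : Fin n, ∑ q ∈ Finset.range (n + 1),
    TensorProduct.map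
      (LinearMap.mulLeft k (MvPolynomial.X j - (if i = j.succ then 1 else 0) : Pol k n) ∘ₗ
        coneInt k n i q)
      (GradedAlgebra.proj (fun p : ℕ => ⋀[k]^p (Fin n → k)) q ∘ₗ
        CliffordAlgebra.contractLeft (Q := (0 : QuadraticForm k (Fin n → k))) (LinearMap.proj j))

/-- Dupont's homotopy
`h_n = ∑_p ∑_{i_0 < ⋯ < i_p} (-1)^p ω_{i_0 ⋯ i_p} h^{i_p} ⋯ h^{i_0}`, normalised so that
`d h_n + h_n d = 1 - i_n p_n`. -/
def dupont (n : ℕ) : Om k n →ₗ[k] Om k n :=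
  ∑ I : Face n, ((-1 : k) ^ I.dim) • (LinearMap.mulLeft k (basicForm k n I) ∘ₗ
    ((List.ofFn fun j => poincare k n (I.vert j)).reverse.prod : Module.End k (Om k n)))

end

/-! ## Homotopy transfer along binary trees -/

section

variable {k : Type*} [Field k] {V W : Type*} [AddCommGroup V] [Module k V]
  [AddCommGroup W] [Module k W]

/-- Data for the transfer of a binary operation from a complex `V` to a retract `W`; `b` is the
operation of degree `+1` that the multiplication of `V` induces on the suspension `V[1]`. -/
structure TransferData (k V W : Type*) [Field k] [AddCommGroup V] [Module k V]
    [AddCommGroup W] [Module k W] where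
  i : W →ₗ[k] V
  p : V →ₗ[k] W
  h : V →ₗ[k] V
  b : V →ₗ[k] V →ₗ[k] V

/-- The sum over planar binary trees with leaves decorated by the given list, with `i` at the
leaves, `b` at the vertices and `-h` at the internal edges and at the root
(just `i` for the tree without vertices). -/
def TransferData.inner (T : TransferData k V W) : List W → V
  | [] => 0
  | [w] => T.i w
  | w :: w' :: l =>
      -T.h (∑ a : Fin (l.length + 1),
        T.b (T.inner ((w :: w' :: l).take (a + 1))) (T.inner ((w :: w' :: l).drop (a + 1))))
termination_by l => l.length
decreasing_by
  · have := a.2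
    simp only [List.length_take, List.length_cons]
    omega
  · simp only [List.length_drop, List.length_cons]
    omega

/-- The sum over planar binary trees with at least one vertex, with `i` at the leaves, `b` at the
vertices, `-h` at the internal edges and `p` at the root (zero on lists of length `< 2`). -/
def TransferData.outer (T : TransferData k V W) (l : List W) : W :=
  T.p (∑ a ∈ Finset.range (l.length - 1),
    T.b (T.inner (l.take (a + 1))) (T.inner (l.drop (a + 1))))

end

/-! ## The transferred `C_∞`-structure on `C_n` -/

section

variable (k : Type*) [Field k]

/-- Transfer of the product of `Ω_n` along the Dupont contraction;
on `Ω_n[1]` the product is the operation `b(x, y) = (-1)^{|x|-1} x y`. -/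
def comTransfer (n : ℕ) : TransferData k (Om k n) (Cc k n) where
  i := incl k n
  p := proj k n
  h := dupont k n
  b := (-1 : k) • ((LinearMap.mul k (Om k n)) ∘ₗ parOm k n)

/-- The transferred `C_∞`-structure on `C_n`, as operations `C_n[1]^{⊗ r} → C_n[1]` of degree `+1`
(`r ≥ 1` the length of the list) which form an `A_∞`-structure that vanishes on shuffles. -/
def cInfty (n : ℕ) : List (Cc k n) → Cc k n
  | [] => 0
  | [c] => dC k n c
  | c :: c' :: l => (comTransfer k n).outer (c :: c' :: l)

/-! ## The cosimplicial dg Lie algebra `mc_n`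

The letters `v_I` are the basis of `C_n[1]^∨ = s C_n^∨` dual to the `ω_I`, with `|v_I| = 1 - dim I`.
The completed free graded Lie algebra on them is realised, as usual in characteristic zero, as the
Lie series in the completed tensor algebra (noncommutative power series). -/

/-- The completed tensor algebra `∏_r (s C_n^∨)^{⊗ r}`: families of coefficients of words. -/
abbrev TSer (n : ℕ) : Type _ := List (Face n) → k

/-- The degree of a word, `|v_I| = 1 - dim I`. -/
def wdeg {n : ℕ} (w : List (Face n)) : ℤ := (w.map fun I => 1 - (I.dim : ℤ)).sum

/-- The series consisting of a single letter `v_I`. -/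
def letter (n : ℕ) (I : Face n) : TSer k n := fun w => if w = [I] then 1 else 0

/-- The graded commutator; on words `[u, v] = u v - (-1)^{|u||v|} v u`. -/
def tbr (n : ℕ) : TSer k n →ₗ[k] TSer k n →ₗ[k] TSer k n :=
  LinearMap.mk₂ k
    (fun f g w => ∑ a ∈ Finset.range (w.length + 1),
      (f (w.take a) * g (w.drop a) -
        (((wdeg (w.take a) * wdeg (w.drop a)).negOnePow : ℤ) : k) *
          (g (w.take a) * f (w.drop a))))
    (by
      intro f f' g; funext w; simp only [Pi.add_apply, ← Finset.sum_add_distrib]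
      exact Finset.sum_congr rfl fun a _ => by ring)
    (by
      intro c f g; funext w; simp only [Pi.smul_apply, smul_eq_mul, Finset.mul_sum]
      exact Finset.sum_congr rfl fun a _ => by ring)
    (by
      intro f g g'; funext w; simp only [Pi.add_apply, ← Finset.sum_add_distrib]
      exact Finset.sum_congr rfl fun a _ => by ring)
    (by
      intro c f g; funext w; simp only [Pi.smul_apply, smul_eq_mul, Finset.mul_sum]
      exact Finset.sum_congr rfl fun a _ => by ring)

theorem tbr_apply (n : ℕ) (f g : TSer k n) (w : List (Face n)) :
    tbr k n f g w = ∑ a ∈ Finset.range (w.length + 1),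
      (f (w.take a) * g (w.drop a) -
        (((wdeg (w.take a) * wdeg (w.drop a)).negOnePow : ℤ) : k) *
          (g (w.take a) * f (w.drop a))) := rfl

/-- Lie polynomials of length `r`: the span of all iterated brackets of `r` letters. -/
def liePoly (n r : ℕ) : Submodule k (TSer k n) :=
  Submodule.span k {f | IsBracketing (fun a b => tbr k n a b) (Set.range (letter k n)) r f}

/-- The part of a series of word length `r`. -/
def lenPart (n r : ℕ) : TSer k n →ₗ[k] TSer k n where
  toFun f w := if w.length = r then f w else 0
  map_add' f g := by funext w; by_cases h : w.length = r <;> simp [h]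
  map_smul' c f := by funext w; by_cases h : w.length = r <;> simp [h]

/-- Lie series of degree `m`: series supported on words of degree `m` all of whose parts of fixed
length are Lie polynomials. -/
def lieDeg (n : ℕ) (m : ℤ) : Submodule k (TSer k n) where
  carrier := {f | (∀ w, wdeg w ≠ m → f w = 0) ∧ ∀ r, lenPart k n r f ∈ liePoly k n r}
  zero_mem' := ⟨fun _ _ => rfl, fun r => by rw [map_zero]; exact zero_mem _⟩
  add_mem' := by
    rintro f g ⟨hf, hf'⟩ ⟨hg, hg'⟩
    refine ⟨fun w hw => ?_, fun r => ?_⟩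
    · rw [Pi.add_apply, hf w hw, hg w hw, add_zero]
    · rw [map_add]; exact add_mem (hf' r) (hg' r)
  smul_mem' := by
    rintro c f ⟨hf, hf'⟩
    refine ⟨fun w hw => ?_, fun r => ?_⟩
    · rw [Pi.smul_apply, hf w hw, smul_zero]
    · rw [map_smul]; exact Submodule.smul_mem _ _ (hf' r)

/-- The completed free graded Lie algebra on `s C_n^∨`: the direct sum over all degrees `m` of the
spaces of Lie series of degree `m`. -/
def lieSer (n : ℕ) : Submodule k (TSer k n) := ⨆ m : ℤ, lieDeg k n m

/-- The Koszul sign `∏_{a < b} (-1)^{|v_a||v_b|}` of the pairing of a word `v_1 ⋯ v_r` with the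
tensor `ω_1 ⊗ ⋯ ⊗ ω_r` of the dual basis vectors of `C_n[1]`. -/
def pairSign {n : ℕ} (w : List (Face n)) : ℤ :=
  ∏ a : Fin w.length, ∏ b ∈ Finset.univ.filter (fun b => a < b),
    (((1 - ((w.get a).dim : ℤ)) * (1 - ((w.get b).dim : ℤ))).negOnePow : ℤ)

/-- The differential of a letter: the coefficient at the word `w` of the transpose
`(-1)^{|v_I|} v_I ∘ b` of the `C_∞`-structure `b`. -/
def dLetter (n : ℕ) (I : Face n) : TSer k n := fun w =>
  (((1 - (I.dim : ℤ)).negOnePow : ℤ) : k) * (pairSign w : k) *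
    cInfty k n (w.map fun J => Pi.single J 1) I

/-- The continuous derivation of the completed tensor algebra with value `dLetter I` on `v_I`:
a word `u v_I v` is sent to the sum of the `(-1)^{|u|} u (d v_I) v`. -/
def dSer (n : ℕ) : TSer k n →ₗ[k] TSer k n where
  toFun f w := ∑ a ∈ Finset.range (w.length + 1), ∑ b ∈ Finset.range (w.length + 1 - a),
    ∑ I : Face n, (((wdeg (w.take a)).negOnePow : ℤ) : k) * dLetter k n I ((w.drop a).take b) *
      f (w.take a ++ I :: (w.drop a).drop b)
  map_add' f g := by
    funext w; simp only [Pi.add_apply, mul_add, Finset.sum_add_distrib]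
  map_smul' c f := by
    funext w
    simp only [Pi.smul_apply, smul_eq_mul, RingHom.id_apply, Finset.mul_sum]
    refine Finset.sum_congr rfl fun a _ => Finset.sum_congr rfl fun b _ =>
      Finset.sum_congr rfl fun I _ => by ring

/-- The continuous algebra map of completed tensor algebras induced by the transpose of
`C_n → C_m`, that is by `v_J ↦ v_J ∘ pullC θ`. -/
def pushSer {m n : ℕ} (θ : Fin (m + 1) →o Fin (n + 1)) : TSer k m →ₗ[k] TSer k n where
  toFun f w := ∑ u : Fin w.length → Face m,
    f (List.ofFn u) * ∏ a : Fin w.length, pullC k θ (Pi.single (w.get a) 1) (u a)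
  map_add' f g := by
    funext w; simp only [Pi.add_apply, add_mul, Finset.sum_add_distrib]
  map_smul' c f := by
    funext w; simp only [Pi.smul_apply, smul_eq_mul, RingHom.id_apply, Finset.mul_sum, mul_assoc]

/-! ### The graded Lie algebra of Lie series -/

theorem lieDeg_le (n : ℕ) (m : ℤ) : lieDeg k n m ≤ lieSer k n := le_iSup (lieDeg k n) m

theorem lieSer_internal (n : ℕ) :
    DirectSum.IsInternal fun m : ℤ => (lieDeg k n m).comap (lieSer k n).subtype := by
  rw [DirectSum.isInternal_submodule_iff_iSupIndep_and_iSup_eq_top]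
  constructor
  · intro m
    rw [Submodule.disjoint_def]
    intro x hx hx'
    have key : (⨆ j : ℤ, ⨆ _ : j ≠ m, (lieDeg k n j).comap (lieSer k n).subtype) ≤
        (LinearMap.pi fun w : {w : List (Face n) // wdeg w = m} =>
          (LinearMap.proj w.1 : TSer k n →ₗ[k] k) ∘ₗ (lieSer k n).subtype).ker := by
      refine iSup₂_le fun j hj y hy => ?_
      rw [LinearMap.mem_ker]
      funext w
      exact hy.1 w.1 (by rw [w.2]; exact hj.symm)
    have h0 := LinearMap.mem_ker.1 (key hx')
    apply Subtype.ext
    funext w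
    by_cases hw : wdeg w = m
    · exact congrFun h0 ⟨w, hw⟩
    · exact hx.1 w hw
  · apply Submodule.map_injective_of_injective (lieSer k n).injective_subtype
    rw [Submodule.map_iSup, Submodule.map_top, Submodule.range_subtype]
    refine iSup_congr fun m => ?_
    rw [Submodule.map_comap_subtype]
    exact inf_eq_right.2 (lieDeg_le k n m)

theorem liePoly_bracket (n a b : ℕ) (f g : TSer k n) (hf : f ∈ liePoly k n a)
    (hg : g ∈ liePoly k n b) : tbr k n f g ∈ liePoly k n (a + b) := by
  have h := Submodule.apply_mem_map₂ (tbr k n) hf hg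
  rw [liePoly, liePoly, Submodule.map₂_span_span] at h
  refine Submodule.span_mono ?_ h
  rintro _ ⟨x, hx, y, hy, rfl⟩
  exact IsBracketing.bracket a b x y hx hy

theorem wdeg_take_add_drop {n : ℕ} (w : List (Face n)) (a : ℕ) :
    wdeg (w.take a) + wdeg (w.drop a) = wdeg w := by
  unfold wdeg
  rw [← List.sum_append, ← List.map_append, List.take_append_drop]

theorem lenPart_bracket (n r : ℕ) (f g : TSer k n) : lenPart k n r (tbr k n f g) =
    ∑ a ∈ Finset.range (r + 1), tbr k n (lenPart k n a f) (lenPart k n (r - a) g) := by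
  have hl (a : ℕ) (f : TSer k n) (w : List (Face n)) :
      lenPart k n a f w = if w.length = a then f w else 0 := rfl
  funext w
  rw [hl, Finset.sum_apply]
  simp only [tbr_apply, hl]
  rw [Finset.sum_comm]
  split_ifs with hw
  · refine Finset.sum_congr rfl fun a ha => ?_
    have ha' : a ≤ r := by have := Finset.mem_range.1 ha; omega
    have h1 : (w.take a).length = a := by rw [List.length_take]; omega
    have h2 : (w.drop a).length = r - a := by rw [List.length_drop]; omega
    rw [Finset.sum_sub_distrib, ← Finset.mul_sum]
    congr 1
    · rw [Finset.sum_eq_single a]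
      · rw [if_pos h1, if_pos h2]
      · intro b _ hb
        rw [if_neg (by omega), zero_mul]
      · intro h
        exact absurd (Finset.mem_range.2 (by omega)) h
    · congr 1
      rw [Finset.sum_eq_single (r - a)]
      · rw [if_pos (by omega), if_pos h2]
      · intro b _ hb
        rw [if_neg (c := (w.drop a).length = b) (by omega), mul_zero]
      · intro h
        exact absurd (Finset.mem_range.2 (by omega)) h
  · refine (Finset.sum_eq_zero fun a ha => Finset.sum_eq_zero fun b hb => ?_).symm
    have ha' : a ≤ w.length := by have := Finset.mem_range.1 ha; omega
    have hb' : b ≤ r := by have := Finset.mem_range.1 hb; omega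
    have h1 : (w.take a).length = a := by rw [List.length_take]; omega
    have h2 : (w.drop a).length = w.length - a := by rw [List.length_drop]
    have e1 : (if (w.take a).length = b then f (w.take a) else 0) *
        (if (w.drop a).length = r - b then g (w.drop a) else 0) = 0 := by
      by_cases h : (w.take a).length = b
      · rw [if_neg (c := (w.drop a).length = r - b) (by omega), mul_zero]
      · rw [if_neg h, zero_mul]
    have e2 : (if (w.take a).length = r - b then g (w.take a) else 0) *
        (if (w.drop a).length = b then f (w.drop a) else 0) = 0 := by
      by_cases h : (w.drop a).length = b
      · rw [if_neg (c := (w.take a).length = r - b) (by omega), zero_mul]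
      · rw [if_neg h, mul_zero]
    rw [e1, e2, mul_zero, sub_zero]

theorem lieDeg_bracket (n : ℕ) (i j : ℤ) (f g : TSer k n) (hf : f ∈ lieDeg k n i)
    (hg : g ∈ lieDeg k n j) : tbr k n f g ∈ lieDeg k n (i + j) := by
  refine ⟨fun w hw => ?_, fun r => ?_⟩
  · rw [tbr_apply]
    refine Finset.sum_eq_zero fun a _ => ?_
    have hd := wdeg_take_add_drop w a
    have h1 : f (w.take a) * g (w.drop a) = 0 := by
      by_cases h : wdeg (w.take a) = i
      · rw [hg.1 (w.drop a) (by omega), mul_zero]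
      · rw [hf.1 _ h, zero_mul]
    have h2 : g (w.take a) * f (w.drop a) = 0 := by
      by_cases h : wdeg (w.take a) = j
      · rw [hf.1 (w.drop a) (by omega), mul_zero]
      · rw [hg.1 _ h, zero_mul]
    rw [h1, h2, mul_zero, sub_zero]
  · rw [lenPart_bracket]
    refine Submodule.sum_mem _ fun a ha => ?_
    have := liePoly_bracket k n a (r - a) _ _ (hf.2 a) (hg.2 (r - a))
    rwa [Nat.add_sub_cancel' (Nat.lt_succ_iff.1 (Finset.mem_range.1 ha))] at this

theorem lieSer_bracket (n : ℕ) (f g : TSer k n) (hf : f ∈ lieSer k n) (hg : g ∈ lieSer k n) :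
    tbr k n f g ∈ lieSer k n := by
  have h := Submodule.apply_mem_map₂ (tbr k n) hf hg
  rw [lieSer, Submodule.map₂_iSup_left] at h
  refine (iSup_le fun i => ?_ : _ ≤ lieSer k n) h
  rw [Submodule.map₂_iSup_right]
  refine iSup_le fun j => Submodule.map₂_le.2 fun x hx y hy => ?_
  exact lieDeg_le k n (i + j) (lieDeg_bracket k n i j x y hx hy)

/-- The data of the complete dg Lie algebra `mc_n`, the complete cobar construction of the dual
of the `C_∞`-algebra `C_n`. -/
def mc (n : ℕ) : DGLieData k (lieSer k n) where
  gr m := (lieDeg k n m).comap (lieSer k n).subtype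
  internal := lieSer_internal k n
  bracket := LinearMap.mk₂ k
    (fun x y => ⟨tbr k n x y, lieSer_bracket k n x y x.2 y.2⟩)
    (fun x x' y => Subtype.ext (by simp))
    (fun c x y => Subtype.ext (by simp))
    (fun x y y' => Subtype.ext (by simp))
    (fun c x y => Subtype.ext (by simp))
  d := restrictTo (lieSer k n) (lieSer k n) (dSer k n)

/-- The cosimplicial structure maps `mc_m → mc_n`. -/
def mcMap {m n : ℕ} (θ : Fin (m + 1) →o Fin (n + 1)) : lieSer k m →ₗ[k] lieSer k n :=
  restrictTo (lieSer k m) (lieSer k n) (pushSer k θ)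

theorem letter_mem (n : ℕ) (I : Face n) : letter k n I ∈ lieSer k n := by
  refine lieDeg_le k n (1 - (I.dim : ℤ)) ⟨fun w hw => ?_, fun r => ?_⟩
  · refine if_neg ?_
    rintro rfl
    exact hw (by simp [wdeg])
  · by_cases h : r = 1
    · subst h
      have : lenPart k n 1 (letter k n I) = letter k n I := by
        funext w
        refine ite_eq_left_iff.2 fun hw => (if_neg ?_).symm
        rintro rfl
        exact hw rfl
      rw [this]
      exact Submodule.subset_span (IsBracketing.of _ ⟨I, rfl⟩)
    · have : lenPart k n r (letter k n I) = 0 := by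
        funext w
        refine ite_eq_right_iff.2 fun hw => if_neg ?_
        rintro rfl
        exact h hw.symm
      rw [this]
      exact zero_mem _

/-- The generator `v_I = s ω_I^∨` of `mc_n`. -/
def gen (n : ℕ) (I : Face n) : lieSer k n := ⟨letter k n I, letter_mem k n I⟩

end

/-! ## The transferred `L_∞`-structure on `𝔤 ⊗ C_n` and its Maurer–Cartan elements -/

section

variable {k : Type*} [Field k] {L : Type*} [AddCommGroup L] [Module k L] (D : DGLieData k L)

/-- The bracket `[a ⊗ ω, b ⊗ η] = (-1)^{|ω||b|} [a, b] ⊗ ω η` of `𝔤 ⊗ Ω_n`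
(the first summand is for even `ω`, the second for odd `ω`). -/
def brOm (n : ℕ) : L ⊗[k] Om k n →ₗ[k] L ⊗[k] Om k n →ₗ[k] L ⊗[k] Om k n :=
  TensorProduct.map₂ D.bracket
      (LinearMap.mul k (Om k n) ∘ₗ ((2 : k)⁻¹ • (LinearMap.id + parOm k n))) +
    TensorProduct.map₂ (D.bracket.compl₂ D.par)
      (LinearMap.mul k (Om k n) ∘ₗ ((2 : k)⁻¹ • (LinearMap.id - parOm k n)))

/-- Transfer of the bracket of `𝔤 ⊗ Ω_n` along the contraction `1 ⊗ i_n, 1 ⊗ p_n, 1 ⊗ h_n`, where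
`(1 ⊗ h_n)(a ⊗ ω) = (-1)^{|a|} a ⊗ h_n ω`; on `(𝔤 ⊗ Ω_n)[1]` the bracket is the graded symmetric
operation `b(x, y) = (-1)^{|x|-1} [x, y]`. -/
def lieTransfer (n : ℕ) : TransferData k (L ⊗[k] Om k n) (L ⊗[k] Cc k n) where
  i := TensorProduct.map LinearMap.id (incl k n)
  p := TensorProduct.map LinearMap.id (proj k n)
  h := TensorProduct.map D.par (dupont k n)
  b := (-1 : k) • (brOm D n ∘ₗ TensorProduct.map D.par (parOm k n))

/-- The Koszul sign of the permutation of elements of degrees `e` in the suspension. -/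
def permSign {r : ℕ} (e : Fin r → ℤ) (σ : Equiv.Perm (Fin r)) : ℤ :=
  ∏ a : Fin r, ∏ b ∈ Finset.univ.filter (fun b => a < b ∧ σ b < σ a),
    (((e (σ a) - 1) * (e (σ b) - 1)).negOnePow : ℤ)

/-- The transferred bracket `ℓ_r`, `r ≥ 2`, of `𝔤 ⊗ C_n`, on homogeneous elements `x_a` of degrees
`e_a`, as a graded symmetric operation on the suspension: the sum over all non-planar binary trees
with leaves labelled by `x_1, …, x_r`, each of which has `2^{r-1}` planar representatives. -/
def lBr (n r : ℕ) (e : Fin r → ℤ) (x : Fin r → L ⊗[k] Cc k n) : L ⊗[k] Cc k n :=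
  ((2 : k) ^ (r - 1))⁻¹ • ∑ σ : Equiv.Perm (Fin r),
    permSign e σ • (lieTransfer D n).outer (List.ofFn fun a => x (σ a))

/-- The differential `d(a ⊗ c) = d a ⊗ c + (-1)^{|a|} a ⊗ d c` of `𝔤 ⊗ C_n`. -/
def dTens (n : ℕ) : L ⊗[k] Cc k n →ₗ[k] L ⊗[k] Cc k n :=
  TensorProduct.map D.d LinearMap.id + TensorProduct.map D.par (dC k n)

/-- The elements of degree `m` of `𝔤 ⊗ C_n`. -/
def grTens (n : ℕ) (m : ℤ) : Submodule k (L ⊗[k] Cc k n) :=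
  ⨆ I : Face n, (D.gr (m - I.dim)).map
    ((TensorProduct.mk k L (Cc k n)).flip (Pi.single I 1))

/-- The filtration `F_N 𝔤 ⊗ C_n` of `𝔤 ⊗ C_n`. -/
def filtTens (n N : ℕ) : Submodule k (L ⊗[k] Cc k n) :=
  LinearMap.range (TensorProduct.map (D.filt N).subtype (LinearMap.id : Cc k n →ₗ[k] Cc k n))

/-- Maurer–Cartan elements of `𝔤 ⊗ C_n`: elements `x` of degree `1` with
`d x + ∑_{r ≥ 2} (1 / r!) ℓ_r(x, …, x) = 0`, where the series converges for the filtration. -/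
def MC (n : ℕ) : Set (L ⊗[k] Cc k n) :=
  {x | x ∈ grTens D n 1 ∧ ∀ N : ℕ, ∃ R₀ : ℕ, ∀ R ≥ R₀,
    dTens D n x + ∑ r ∈ Finset.Icc 2 R,
      ((r.factorial : k)⁻¹) • lBr D n r (fun _ => 1) (fun _ => x) ∈ filtTens D n N}

/-- The simplicial structure `1 ⊗ θ^*` of `𝔤 ⊗ C_•`. -/
def pullTens (k L : Type*) [Field k] [AddCommGroup L] [Module k L] {m n : ℕ}
    (θ : Fin (m + 1) →o Fin (n + 1)) : L ⊗[k] Cc k n →ₗ[k] L ⊗[k] Cc k m :=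
  TensorProduct.map LinearMap.id (pullC k θ)

/-- The element `∑_I φ(v_I) ⊗ ω_I` of `𝔤 ⊗ C_n` attached to `φ : mc_n → 𝔤`. -/
def canon (n : ℕ) (φ : lieSer k n →ₗ[k] L) : L ⊗[k] Cc k n :=
  ∑ I : Face n, φ (gen k n I) ⊗ₜ[k] Pi.single I 1

end

end DGL

end

/-!
The proof rests on one universal object: the form-valued series `α = ∑_w ± (tree sum of w) w` in the
words on the letters `v_I` (`univForm`). Cutting a tree at its root shows that `α` is the solution
of the fixed point equation `α = i(∑_I ω_I v_I) - h(α α)` (`univForm_eq`), and the differential of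
`mc_n` is, by definition of the transferred `C_∞`-structure, read off from
`d(∑_I ω_I v_I) + p(α α)` (`dLetter_eq`). Three facts follow.

* The homotopy identity `d h + h d = 1 - i p` (`dupont_homotopy`) turns the fixed point equation
  into the Maurer–Cartan equation `Dα + α α = 0` (`totD_univForm`), whence the square of the
  differential is zero (`serD_dLetter`, `dSer_dSer`).
* Since `i`, `p` and `h` are natural for the simplicial maps (`pullOm_incl`, `proj_pullOm`,
  `pullOm_dupont`), so is `α`, and the transposes of the simplicial maps commute with the
  differentials (`serPush_univForm`, `serPush_dLetter`).
* The bracket of `mc_n ⊗ Ω_n` is the graded commutator of form-valued series (`lieTransfer_mc_b`).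
  Therefore the transferred brackets of the universal element `∑_I v_I ⊗ ω_I` are, up to the factor
  `2^{r-1}` that counts planar representatives of trees, the tree sums in `α`: the component of word
  length `r` of `-d v_I` is the `ω_I`-coefficient of `(1 / r!) ℓ_r` at the universal element
  (`coef_mcTerm_univ`). In particular `d v_I` is a Lie series (`dLetter_mem`), without any appeal
  to the vanishing of the `C_∞`-operations on shuffles.

The properties of Dupont's homotopy come from the radial case. The homotopy `h^0` is the contraction
with the Euler field divided by the weight (`poincare_zero_basis`), and the other `h^i` are
conjugate to it by translations (`poincare_eq`). Integration over a simplex is iterated radial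
integration (`integ_eq`), so the boundary terms of `d` on `h^{i_p} ⋯ h^{i_0}` are exactly the coefficients of
`p_n` (`commutator_iterH`, `proj_eq`), and the other terms cancel in pairs.

For the correspondence with Maurer–Cartan elements, `mc_n` is shown to be the completed free graded
Lie algebra on the `v_I`. Dynkin's lemma (`IsEval.dynTh_eq`) makes the evaluation of Lie polynomials
in a graded Lie algebra well defined, and shows that a homogeneous Lie series supported on words of
length `≥ N` is a finite sum of iterated brackets of at least `N` elements (`mem_mc_filt`), so that
the filtrations by brackets and by word length agree in each degree. Hence `mc_n` is complete
(`mc_isComplete`), and morphisms of graded Lie algebras from `mc_n` to a complete `𝔤` are arbitrary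
choices of elements of degree `1 - dim I` (`exists_gradedLieHom`, `IsGradedLieHom.ext_gen`), which
together form an element of degree one of `𝔤 ⊗ C_n`. By naturality of the transfer the
Maurer–Cartan series of this element has the coefficients `d (φ v_I) - φ (d v_I)` (`IsGradedLieHom.coef_mcSum_canon`), so it is a Maurer–Cartan
element exactly when `φ` commutes with the differentials. The simplicial structure and the
naturality of the sets of Maurer–Cartan elements are then obtained by composing morphisms.
-/

open scoped TensorProduct

set_option linter.unusedSectionVars false

noncomputable section

namespace DGL

/-! ### Skew derivations of graded algebras -/

section SkewDerivations

variable {k : Type*} [Field k] {A B C : Type*} [Ring A] [Algebra k A] [Ring B] [Algebra k B]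
  [Ring C] [Algebra k C]

/-- A `(φ, σ)`-derivation: `D (a b) = D a · φ b + σ a · D b`. With `σ` the composite of `φ` and the
parity involution these are the odd derivations along `φ`, with `σ = φ` the even ones. -/
def IsSkewDer (φ σ : A →ₐ[k] B) (D : A →ₗ[k] B) : Prop :=
  ∀ a b, D (a * b) = D a * φ b + σ a * D b

theorem IsSkewDer.map_one {φ σ : A →ₐ[k] B} {D : A →ₗ[k] B} (h : IsSkewDer φ σ D) : D 1 = 0 := by
  simpa using h 1 1

theorem IsSkewDer.sum {ι : Type*} {φ σ : A →ₐ[k] B} (s : Finset ι) {D : ι → A →ₗ[k] B}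
    (h : ∀ i, IsSkewDer φ σ (D i)) : IsSkewDer φ σ (∑ i ∈ s, D i) := by
  intro a b
  simp only [LinearMap.sum_apply, Finset.sum_mul, Finset.mul_sum, ← Finset.sum_add_distrib]
  exact Finset.sum_congr rfl fun i _ => h i a b

theorem IsSkewDer.comp_algHom {φ σ : B →ₐ[k] C} {D : B →ₗ[k] C} (h : IsSkewDer φ σ D)
    (f : A →ₐ[k] B) : IsSkewDer (φ.comp f) (σ.comp f) (D ∘ₗ f.toLinearMap) := by
  intro a b
  simp [h (f a) (f b)]

theorem IsSkewDer.algHom_comp {φ σ : A →ₐ[k] B} {D : A →ₗ[k] B} (h : IsSkewDer φ σ D)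
    (f : B →ₐ[k] C) : IsSkewDer (f.comp φ) (f.comp σ) (f.toLinearMap ∘ₗ D) := by
  intro a b
  simp [h a b]

/-- A skew derivation is determined by its values on generators. -/
theorem IsSkewDer.ext {φ σ : A →ₐ[k] B} {D D' : A →ₗ[k] B} (h : IsSkewDer φ σ D)
    (h' : IsSkewDer φ σ D') {s : Set A} (hs : Algebra.adjoin k s = ⊤)
    (hD : ∀ a ∈ s, D a = D' a) : D = D' := by
  ext a
  have ha : a ∈ Algebra.adjoin k s := hs ▸ trivial
  induction ha using Algebra.adjoin_induction with
  | mem x hx => exact hD x hx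
  | algebraMap r => rw [Algebra.algebraMap_eq_smul_one, map_smul, map_smul, h.map_one, h'.map_one]
  | add x y _ _ hx hy => rw [map_add, map_add, hx, hy]
  | mul x y _ _ hx hy => rw [h, h', hx, hy]

/-- The anticommutator of two odd derivations is an even derivation. -/
theorem IsSkewDer.anticomm {π : A →ₐ[k] A} {D E : A →ₗ[k] A}
    (hD : IsSkewDer (AlgHom.id k A) π D) (hE : IsSkewDer (AlgHom.id k A) π E)
    (hπ : ∀ a, π (π a) = a)
    (hDπ : ∀ a, D (π a) = -π (D a)) (hEπ : ∀ a, E (π a) = -π (E a)) :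
    IsSkewDer (AlgHom.id k A) (AlgHom.id k A) (D ∘ₗ E + E ∘ₗ D) := by
  intro a b
  have h1 := hD a b; have h2 := hE a b
  simp only [AlgHom.coe_id, id] at h1 h2
  simp only [LinearMap.add_apply, LinearMap.comp_apply, h1, h2, map_add, AlgHom.coe_id, id]
  rw [hD (E a), hD (π a), hE (D a), hE (π a), hDπ, hEπ, hπ]
  simp only [AlgHom.coe_id, id, neg_mul, add_mul, mul_add]
  abel

/-- The square of an odd derivation is an even derivation. -/
theorem IsSkewDer.sq {π : A →ₐ[k] A} {D : A →ₗ[k] A}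
    (hD : IsSkewDer (AlgHom.id k A) π D) (hπ : ∀ a, π (π a) = a)
    (hDπ : ∀ a, D (π a) = -π (D a)) :
    IsSkewDer (AlgHom.id k A) (AlgHom.id k A) (D ∘ₗ D) := by
  intro a b
  have h1 := hD a b
  simp only [AlgHom.coe_id, id] at h1
  simp only [LinearMap.comp_apply, h1, map_add, AlgHom.coe_id, id]
  rw [hD (D a), hD (π a), hDπ, hπ]
  simp only [AlgHom.coe_id, id, neg_mul]
  abel

end SkewDerivations

/-! ### Odd derivations of the Sullivan algebra -/

section Forms

variable (k : Type*) [Field k]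

/-- The parity involution of `Ω_n` as an algebra map. -/
def parAlg (n : ℕ) : Om k n →ₐ[k] Om k n :=
  Algebra.TensorProduct.map (AlgHom.id k (Pol k n))
    (CliffordAlgebra.involute (Q := (0 : QuadraticForm k (Fin n → k))))

/-- The coordinate `x_j`, as a form. -/
def xOm (n : ℕ) (j : Fin n) : Om k n := (MvPolynomial.X j) ⊗ₜ[k] 1

/-- A one-form with constant coefficients. -/
def dvOm (n : ℕ) (v : Fin n → k) : Om k n := 1 ⊗ₜ[k] ExteriorAlgebra.ι k v

/-- The generators `x_j` and `dx_j` of `Ω_n`. -/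
def omGens (n : ℕ) : Set (Om k n) :=
  Set.range (xOm k n) ∪ Set.range fun j => dvOm k n (Pi.single j 1)

theorem adjoin_omGens (n : ℕ) : Algebra.adjoin k (omGens k n) = ⊤ := by
  rw [eq_top_iff]
  rintro x -
  have hf (f : Pol k n) : f ⊗ₜ[k] (1 : Lam k n) ∈ Algebra.adjoin k (omGens k n) := by
    induction f using MvPolynomial.induction_on with
    | C a =>
      have : (MvPolynomial.C a : Pol k n) ⊗ₜ[k] (1 : Lam k n) = algebraMap k (Om k n) a := rfl
      rw [this]; exact Subalgebra.algebraMap_mem _ _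
    | add p q hp hq => rw [TensorProduct.add_tmul]; exact add_mem hp hq
    | mul_X p j hp =>
      have : (p * MvPolynomial.X j) ⊗ₜ[k] (1 : Lam k n) = p ⊗ₜ[k] (1 : Lam k n) * xOm k n j := by
        simp [xOm]
      rw [this]
      exact mul_mem hp (Algebra.subset_adjoin (Or.inl ⟨j, rfl⟩))
  have hη (η : Lam k n) : (1 : Pol k n) ⊗ₜ[k] η ∈ Algebra.adjoin k (omGens k n) := by
    induction η using ExteriorAlgebra.induction with
    | algebraMap r =>
      rw [Algebra.algebraMap_eq_smul_one, TensorProduct.tmul_smul]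
      exact Subalgebra.smul_mem _ (one_mem _) _
    | ι v =>
      rw [pi_eq_sum_univ' v, map_sum, TensorProduct.tmul_sum]
      refine sum_mem fun j _ => ?_
      rw [map_smul, TensorProduct.tmul_smul]
      refine Subalgebra.smul_mem _ (Algebra.subset_adjoin ?_) _
      exact Or.inr ⟨j, rfl⟩
    | mul a b ha hb =>
      have : (1 : Pol k n) ⊗ₜ[k] (a * b) = (1 ⊗ₜ[k] a) * (1 ⊗ₜ[k] b) := by simp
      rw [this]; exact mul_mem ha hb
    | add a b ha hb => rw [TensorProduct.tmul_add]; exact add_mem ha hb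
  induction x using TensorProduct.induction_on with
  | zero => exact zero_mem _
  | tmul f η =>
    have : f ⊗ₜ[k] η = (f ⊗ₜ[k] 1) * ((1 : Pol k n) ⊗ₜ[k] η) := by simp
    rw [this]; exact mul_mem (hf f) (hη η)
  | add x y hx hy => exact add_mem hx hy

/-- Skew derivations on `Ω_n` which agree on the coordinates and their differentials are equal. -/
theorem om_ext {B : Type*} [Ring B] [Algebra k B] {n : ℕ} {φ σ : Om k n →ₐ[k] B}
    {D D' : Om k n →ₗ[k] B} (h : IsSkewDer φ σ D) (h' : IsSkewDer φ σ D')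
    (hx : ∀ j, D (xOm k n j) = D' (xOm k n j))
    (hd : ∀ j, D (dvOm k n (Pi.single j 1)) = D' (dvOm k n (Pi.single j 1))) : D = D' := by
  refine h.ext h' (adjoin_omGens k n) ?_
  rintro _ (⟨j, rfl⟩ | ⟨j, rfl⟩)
  exacts [hx j, hd j]

theorem om_algHom_ext {B : Type*} [Ring B] [Algebra k B] {n : ℕ} {φ ψ : Om k n →ₐ[k] B}
    (hx : ∀ j, φ (xOm k n j) = ψ (xOm k n j))
    (hd : ∀ j, φ (dvOm k n (Pi.single j 1)) = ψ (dvOm k n (Pi.single j 1))) : φ = ψ := by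
  refine AlgHom.ext_of_adjoin_eq_top (adjoin_omGens k n) ?_
  rintro _ (⟨j, rfl⟩ | ⟨j, rfl⟩)
  exacts [hx j, hd j]

variable {k}

theorem om_smul_mul {n : ℕ} (c : k) (a b : Om k n) : c • a * b = c • (a * b) :=
  Algebra.smul_mul_assoc c a b

theorem om_mul_smul {n : ℕ} (c : k) (a b : Om k n) : a * c • b = c • (a * b) :=
  Algebra.mul_smul_comm c a b

theorem om_neg_mul {n : ℕ} (a b : Om k n) : -a * b = -(a * b) := neg_mul a b

theorem om_mul_neg {n : ℕ} (a b : Om k n) : a * -b = -(a * b) := mul_neg a b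

theorem involute_mul_ι {n : ℕ} (v : Fin n → k) (η : Lam k n) :
    CliffordAlgebra.involute η * ExteriorAlgebra.ι k v = ExteriorAlgebra.ι k v * η := by
  induction η using ExteriorAlgebra.induction with
  | algebraMap r =>
    rw [AlgHom.commutes]; exact Algebra.commutes r _
  | ι w =>
    have h1 : CliffordAlgebra.involute (ExteriorAlgebra.ι k w) = -ExteriorAlgebra.ι k w :=
      CliffordAlgebra.involute_ι _
    rw [h1, neg_mul, neg_eq_iff_add_eq_zero]
    exact ExteriorAlgebra.ι_add_mul_swap w v
  | mul a b ha hb => rw [map_mul, mul_assoc, hb, ← mul_assoc, ha, mul_assoc]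
  | add a b ha hb => rw [map_add, add_mul, ha, hb, mul_add]

/-- Contraction with a covector is an odd derivation of the exterior algebra. -/
theorem contract_mul {n : ℕ} (c : Module.Dual k (Fin n → k)) (η ξ : Lam k n) :
    CliffordAlgebra.contractLeft (Q := (0 : QuadraticForm k (Fin n → k))) c (η * ξ) =
      CliffordAlgebra.contractLeft (Q := (0 : QuadraticForm k (Fin n → k))) c η * ξ +
      CliffordAlgebra.involute η *
        CliffordAlgebra.contractLeft (Q := (0 : QuadraticForm k (Fin n → k))) c ξ := by
  have key (v : Fin n → k) (x : Lam k n) :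
      CliffordAlgebra.contractLeft (Q := (0 : QuadraticForm k (Fin n → k))) c
        (ExteriorAlgebra.ι k v * x) = c v • x - ExteriorAlgebra.ι k v *
        CliffordAlgebra.contractLeft (Q := (0 : QuadraticForm k (Fin n → k))) c x :=
    CliffordAlgebra.contractLeft_ι_mul ..
  have key1 (v : Fin n → k) :
      CliffordAlgebra.contractLeft (Q := (0 : QuadraticForm k (Fin n → k))) c
        (ExteriorAlgebra.ι k v) = algebraMap k _ (c v) :=
    CliffordAlgebra.contractLeft_ι ..
  have key2 (v : Fin n → k) :
    CliffordAlgebra.involute (ExteriorAlgebra.ι k v) = -ExteriorAlgebra.ι k v :=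
      CliffordAlgebra.involute_ι _
  induction η using ExteriorAlgebra.induction generalizing ξ with
  | algebraMap r =>
    simp only [Algebra.algebraMap_eq_smul_one, smul_mul_assoc, one_mul, map_smul, map_one,
      CliffordAlgebra.contractLeft_one, smul_zero, zero_mul, zero_add]
  | ι v =>
    rw [key, key1, key2, Algebra.algebraMap_eq_smul_one, smul_mul_assoc, one_mul, neg_mul,
      sub_eq_add_neg]
  | mul a b ha hb =>
    rw [mul_assoc, ha, hb, ha b, map_mul]
    simp only [mul_add, add_mul, mul_assoc]
    abel
  | add a b ha hb => rw [add_mul, map_add, ha, hb, map_add, map_add, add_mul, add_mul]; abel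

/-- Contraction with the Euler vector field `∑_j x_j ∂_j` centred at the vertex `e_0`. -/
def eul (k : Type*) [Field k] (n : ℕ) : Om k n →ₗ[k] Om k n :=
  ∑ j : Fin n, TensorProduct.map (LinearMap.mulLeft k (MvPolynomial.X j : Pol k n))
    (CliffordAlgebra.contractLeft (Q := (0 : QuadraticForm k (Fin n → k))) (LinearMap.proj j))

theorem parAlg_tmul {n : ℕ} (f : Pol k n) (η : Lam k n) :
    parAlg k n (f ⊗ₜ η) = f ⊗ₜ CliffordAlgebra.involute η := rfl

theorem parOm_eq (n : ℕ) : parOm k n = (parAlg k n).toLinearMap := by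
  apply TensorProduct.ext'
  intro f η
  rfl

theorem parAlg_parAlg {n : ℕ} (a : Om k n) : parAlg k n (parAlg k n a) = a := by
  have : (parAlg k n).comp (parAlg k n) = AlgHom.id k _ := by
    apply om_algHom_ext
    · intro j; simp [xOm, parAlg_tmul]
    · intro j
      have key2 (v : Fin n → k) :
        CliffordAlgebra.involute (ExteriorAlgebra.ι k v) = -ExteriorAlgebra.ι k v :=
          CliffordAlgebra.involute_ι _
      simp [dvOm, parAlg_tmul, key2]
  exact DFunLike.congr_fun this a

theorem isSkewDer_of_tmul {n : ℕ} {D : Om k n →ₗ[k] Om k n}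
    (h : ∀ f η g ξ, D ((f ⊗ₜ η) * (g ⊗ₜ ξ)) =
      D (f ⊗ₜ η) * (g ⊗ₜ ξ) + parAlg k n (f ⊗ₜ η) * D (g ⊗ₜ ξ)) :
    IsSkewDer (AlgHom.id k _) (parAlg k n) D := by
  intro a b
  induction a using TensorProduct.induction_on with
  | zero => simp
  | add x y hx hy => simp only [add_mul, map_add, hx, hy]; abel
  | tmul f η =>
    induction b using TensorProduct.induction_on with
    | zero => simp
    | add x y hx hy => simp only [mul_add, map_add, hx, hy]; abel
    | tmul g ξ => exact h f η g ξ

theorem dOm_skew (n : ℕ) : IsSkewDer (AlgHom.id k _) (parAlg k n) (dOm k n) := by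
  refine IsSkewDer.sum _ fun j => isSkewDer_of_tmul fun f η g ξ => ?_
  simp only [Algebra.TensorProduct.tmul_mul_tmul, TensorProduct.map_tmul, parAlg_tmul,
    LinearMap.mulLeft_apply]
  rw [← mul_assoc (CliffordAlgebra.involute η), involute_mul_ι, Derivation.coeFn_coe,
    Derivation.leibniz, TensorProduct.add_tmul, add_comm, mul_assoc]
  simp [mul_comm]

theorem eul_skew (n : ℕ) : IsSkewDer (AlgHom.id k _) (parAlg k n) (eul k n) := by
  refine IsSkewDer.sum _ fun j => isSkewDer_of_tmul fun f η g ξ => ?_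
  simp only [Algebra.TensorProduct.tmul_mul_tmul, TensorProduct.map_tmul, parAlg_tmul,
    LinearMap.mulLeft_apply]
  rw [contract_mul, TensorProduct.tmul_add]
  congr 2 <;> ring

@[simp] theorem dOm_xOm {n : ℕ} (j : Fin n) : dOm k n (xOm k n j) = dvOm k n (Pi.single j 1) := by
  simp only [dOm, xOm, dvOm, LinearMap.sum_apply, TensorProduct.map_tmul]
  rw [Finset.sum_eq_single j]
  · simp
  · intro i _ hi
    simp [MvPolynomial.pderiv_X_of_ne hi.symm]
  · simp

@[simp] theorem dOm_dvOm {n : ℕ} (v : Fin n → k) : dOm k n (dvOm k n v) = 0 := by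
  simp [dOm, dvOm]

@[simp] theorem eul_xOm {n : ℕ} (j : Fin n) : eul k n (xOm k n j) = 0 := by
  simp [eul, xOm]

theorem eul_dvOm {n : ℕ} (v : Fin n → k) : eul k n (dvOm k n v) = ∑ j, v j • xOm k n j := by
  have key1 (c : Module.Dual k (Fin n → k)) (v : Fin n → k) :
      CliffordAlgebra.contractLeft (Q := (0 : QuadraticForm k (Fin n → k))) c
        (ExteriorAlgebra.ι k v) = algebraMap k _ (c v) :=
    CliffordAlgebra.contractLeft_ι ..
  simp only [eul, dvOm, xOm, LinearMap.sum_apply, TensorProduct.map_tmul, key1,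
    LinearMap.mulLeft_apply, mul_one, Algebra.algebraMap_eq_smul_one, TensorProduct.tmul_smul]
  rfl

@[simp] theorem eul_dvOm_single {n : ℕ} (j : Fin n) :
    eul k n (dvOm k n (Pi.single j 1)) = xOm k n j := by
  rw [eul_dvOm, Finset.sum_eq_single j]
  · simp
  · intro i _ hi; simp [hi]
  · simp

@[simp] theorem parAlg_xOm {n : ℕ} (j : Fin n) : parAlg k n (xOm k n j) = xOm k n j := by
  simp [xOm, parAlg_tmul]

@[simp] theorem parAlg_dvOm {n : ℕ} (v : Fin n → k) :
    parAlg k n (dvOm k n v) = -dvOm k n v := by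
  have key2 (v : Fin n → k) :
    CliffordAlgebra.involute (ExteriorAlgebra.ι k v) = -ExteriorAlgebra.ι k v :=
      CliffordAlgebra.involute_ι _
  simp [dvOm, parAlg_tmul, key2, TensorProduct.tmul_neg]

/-- An odd derivation that is odd on generators anticommutes with the parity involution. -/
theorem skew_parAlg {n : ℕ} {D : Om k n →ₗ[k] Om k n}
    (hD : IsSkewDer (AlgHom.id k _) (parAlg k n) D)
    (hx : ∀ j, parAlg k n (D (xOm k n j)) = -D (xOm k n j))
    (hd : ∀ j, parAlg k n (D (dvOm k n (Pi.single j 1))) = D (dvOm k n (Pi.single j 1)))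
    (a : Om k n) : D (parAlg k n a) = -parAlg k n (D a) := by
  have h1 := hD.comp_algHom (parAlg k n)
  have h2 : IsSkewDer ((AlgHom.id k _).comp (parAlg k n)) ((parAlg k n).comp (parAlg k n))
      (-((parAlg k n).toLinearMap ∘ₗ D)) := by
    intro a b
    have := hD a b
    simp only [AlgHom.coe_id, id] at this
    simp only [LinearMap.neg_apply, LinearMap.comp_apply, AlgHom.toLinearMap_apply, this,
      map_add, map_mul, AlgHom.comp_apply, AlgHom.coe_id, id, neg_add, om_neg_mul, om_mul_neg]
  refine LinearMap.congr_fun (om_ext k h1 h2 (fun j => ?_) (fun j => ?_)) a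
  · rw [LinearMap.neg_apply, LinearMap.comp_apply, LinearMap.comp_apply,
      AlgHom.toLinearMap_apply, AlgHom.toLinearMap_apply, hx, parAlg_xOm, neg_neg]
  · rw [LinearMap.neg_apply, LinearMap.comp_apply, LinearMap.comp_apply,
      AlgHom.toLinearMap_apply, AlgHom.toLinearMap_apply, hd, parAlg_dvOm, map_neg]

theorem dOm_parAlg {n : ℕ} (a : Om k n) :
    dOm k n (parAlg k n a) = -parAlg k n (dOm k n a) :=
  skew_parAlg (dOm_skew n) (by simp) (by simp) a

theorem eul_parAlg {n : ℕ} (a : Om k n) :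
    eul k n (parAlg k n a) = -parAlg k n (eul k n a) :=
  skew_parAlg (eul_skew n) (by simp) (by simp) a

theorem IsSkewDer.zero {A B : Type*} [Ring A] [Algebra k A] [Ring B] [Algebra k B]
    (φ σ : A →ₐ[k] B) : IsSkewDer φ σ (0 : A →ₗ[k] B) := by
  intro a b; simp

theorem dOm_dOm {n : ℕ} (a : Om k n) : dOm k n (dOm k n a) = 0 := by
  have := om_ext k ((dOm_skew n).sq parAlg_parAlg dOm_parAlg) (IsSkewDer.zero _ _)
    (by simp) (by simp)
  exact LinearMap.congr_fun this a

theorem eul_eul {n : ℕ} (a : Om k n) : eul k n (eul k n a) = 0 := by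
  have := om_ext k ((eul_skew n).sq parAlg_parAlg eul_parAlg) (IsSkewDer.zero _ _)
    (by simp) (by simp)
  exact LinearMap.congr_fun this a

/-- The Lie derivative along the Euler vector field, by Cartan's formula. -/
def wt (k : Type*) [Field k] (n : ℕ) : Om k n →ₗ[k] Om k n :=
  dOm k n ∘ₗ eul k n + eul k n ∘ₗ dOm k n

theorem wt_der (n : ℕ) : IsSkewDer (AlgHom.id k _) (AlgHom.id k _) (wt k n) :=
  (dOm_skew n).anticomm (eul_skew n) parAlg_parAlg dOm_parAlg eul_parAlg

theorem wt_mul_of_eigen {n : ℕ} {a b : Om k n} {u v : k} (ha : wt k n a = u • a)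
    (hb : wt k n b = v • b) : wt k n (a * b) = (u + v) • (a * b) := by
  rw [wt_der, ha, hb, AlgHom.coe_id, id, id, add_smul, om_smul_mul, om_mul_smul]

theorem wt_one (n : ℕ) : wt k n 1 = 0 := (wt_der n).map_one

theorem wt_monomial {n : ℕ} (a : Fin n →₀ ℕ) :
    wt k n (MvPolynomial.monomial a (1 : k) ⊗ₜ 1) =
      ((a.degree : ℕ) : k) • (MvPolynomial.monomial a (1 : k) ⊗ₜ[k] (1 : Lam k n)) := by
  induction a using Finsupp.induction_linear with
  | zero => simpa [← Algebra.TensorProduct.one_def] using wt_one n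
  | add f g hf hg =>
    have : (MvPolynomial.monomial (f + g) (1 : k)) ⊗ₜ[k] (1 : Lam k n) =
      (MvPolynomial.monomial f (1 : k)) ⊗ₜ[k] 1 * (MvPolynomial.monomial g (1 : k)) ⊗ₜ[k] 1 := by
      simp [MvPolynomial.monomial_mul]
    rw [this, wt_mul_of_eigen hf hg]
    simp [map_add]
  | single j m =>
    induction m with
    | zero => simpa [← Algebra.TensorProduct.one_def] using wt_one n
    | succ m ih =>
      have : (MvPolynomial.monomial (Finsupp.single j (m + 1)) (1 : k)) ⊗ₜ[k] (1 : Lam k n) =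
        (MvPolynomial.monomial (Finsupp.single j m) (1 : k)) ⊗ₜ[k] 1 * xOm k n j := by
        simp [xOm, MvPolynomial.X, MvPolynomial.monomial_mul, ← Finsupp.single_add]
      have h1 : wt k n (xOm k n j) = (1 : k) • xOm k n j := by simp [wt]
      rw [this, wt_mul_of_eigen ih h1]
      simp

theorem wt_ιMulti {n p : ℕ} (v : Fin p → Fin n → k) :
    wt k n (1 ⊗ₜ ExteriorAlgebra.ιMulti k p v) =
      (p : k) • ((1 : Pol k n) ⊗ₜ[k] ExteriorAlgebra.ιMulti k p v) := by
  induction p with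
  | zero => simpa [← Algebra.TensorProduct.one_def] using wt_one n
  | succ p ih =>
    rw [ExteriorAlgebra.ιMulti_succ_apply]
    have : (1 : Pol k n) ⊗ₜ[k] (ExteriorAlgebra.ι k (v 0) *
        ExteriorAlgebra.ιMulti k p (Matrix.vecTail v)) =
        dvOm k n (v 0) * 1 ⊗ₜ[k] ExteriorAlgebra.ιMulti k p (Matrix.vecTail v) := by
      simp [dvOm]
    have h1 : wt k n (dvOm k n (v 0)) = (1 : k) • dvOm k n (v 0) := by
      simp only [wt, LinearMap.add_apply, LinearMap.comp_apply, eul_dvOm, dOm_dvOm, map_zero,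
        add_zero, map_sum, map_smul, dOm_xOm, one_smul]
      simp only [dvOm, ← TensorProduct.tmul_smul, ← TensorProduct.tmul_sum, ← map_smul,
        ← map_sum]
      congr 2
      exact (pi_eq_sum_univ' (v 0)).symm
    rw [this, wt_mul_of_eigen h1 (ih _)]
    push_cast
    rw [add_comm]

/-- Polynomial forms are spanned by `x^a dv_1 ⋯ dv_p`. -/
theorem om_induction {n : ℕ} {C : Om k n → Prop} (hadd : ∀ a b, C a → C b → C (a + b))
    (hsmul : ∀ (c : k) a, C a → C (c • a))
    (h : ∀ (a : Fin n →₀ ℕ) (p : ℕ) (v : Fin p → Fin n → k),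
      C (MvPolynomial.monomial a 1 ⊗ₜ ExteriorAlgebra.ιMulti k p v)) (x : Om k n) : C x := by
  have h0 : C 0 := by simpa using hsmul 0 _ (h 0 0 ![])
  induction x using TensorProduct.induction_on with
  | zero => exact h0
  | add x y hx hy => exact hadd _ _ hx hy
  | tmul f η =>
    have hη : η ∈ Submodule.span k (Set.range fun x : Σ p, (Fin p → Fin n → k) =>
      ExteriorAlgebra.ιMulti k x.1 x.2) := by rw [ExteriorAlgebra.ιMulti_span]; trivial
    induction hη using Submodule.span_induction with
    | mem x hx =>
      obtain ⟨⟨p, v⟩, rfl⟩ := hx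
      induction f using MvPolynomial.induction_on' with
      | monomial a c =>
        have : MvPolynomial.monomial a c = c • MvPolynomial.monomial a (1 : k) := by
          rw [MvPolynomial.smul_monomial]; simp
        rw [this, ← TensorProduct.smul_tmul']
        exact hsmul _ _ (h a p v)
      | add p q hp hq => rw [TensorProduct.add_tmul]; exact hadd _ _ hp hq
    | zero => rw [TensorProduct.tmul_zero]; exact h0
    | add x y _ _ hx hy => rw [TensorProduct.tmul_add]; exact hadd _ _ hx hy
    | smul c x _ hx => rw [TensorProduct.tmul_smul]; exact hsmul _ _ hx

/-- The monomial forms are eigenvectors of the Lie derivative along the Euler field, with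
eigenvalue their weight. -/
theorem wt_basis {n p : ℕ} (a : Fin n →₀ ℕ) (v : Fin p → Fin n → k) :
    wt k n (MvPolynomial.monomial a 1 ⊗ₜ ExteriorAlgebra.ιMulti k p v) =
      ((a.degree + p : ℕ) : k) •
        (MvPolynomial.monomial a (1 : k) ⊗ₜ[k] ExteriorAlgebra.ιMulti k p v) := by
  have := wt_mul_of_eigen (wt_monomial a) (wt_ιMulti v)
  simpa using this

end Forms

/-! ### The Poincaré homotopies -/

section RadialHomotopy

variable {k : Type*} [Field k]

theorem contract_ι_mul {n : ℕ} (c : Module.Dual k (Fin n → k)) (v : Fin n → k) (x : Lam k n) :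
    CliffordAlgebra.contractLeft (Q := (0 : QuadraticForm k (Fin n → k))) c
      (ExteriorAlgebra.ι k v * x) = c v • x - ExteriorAlgebra.ι k v *
      CliffordAlgebra.contractLeft (Q := (0 : QuadraticForm k (Fin n → k))) c x :=
  CliffordAlgebra.contractLeft_ι_mul ..

theorem ιMulti_mem {n p : ℕ} (v : Fin p → Fin n → k) :
    ExteriorAlgebra.ιMulti k p v ∈ ⋀[k]^p (Fin n → k) :=
  ExteriorAlgebra.ιMulti_range k p ⟨v, rfl⟩

theorem ι_mul_mem {n p : ℕ} (v : Fin n → k) {x : Lam k n} (hx : x ∈ ⋀[k]^p (Fin n → k)) :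
    ExteriorAlgebra.ι k v * x ∈ ⋀[k]^(p + 1) (Fin n → k) := by
  have h1 : ExteriorAlgebra.ι k v ∈ ⋀[k]^1 (Fin n → k) := by
    simp
  rw [add_comm]
  exact SetLike.mul_mem_graded h1 hx

theorem extPow_induction {n p : ℕ} {C : Lam k n → Prop} (h0 : C 0)
    (hadd : ∀ a b, C a → C b → C (a + b))
    (hsmul : ∀ (c : k) a, C a → C (c • a)) (h : ∀ v, C (ExteriorAlgebra.ιMulti k p v))
    {x : Lam k n} (hx : x ∈ ⋀[k]^p (Fin n → k)) : C x := by
  rw [← ExteriorAlgebra.ιMulti_span_fixedDegree] at hx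
  induction hx using Submodule.span_induction with
  | mem x hx => obtain ⟨v, rfl⟩ := hx; exact h v
  | zero => exact h0
  | add x y _ _ hx hy => exact hadd _ _ hx hy
  | smul c x _ hx => exact hsmul _ _ hx

theorem contract_ιMulti_mem {n : ℕ} (p : ℕ) (c : Module.Dual k (Fin n → k))
    (v : Fin (p + 1) → Fin n → k) :
    CliffordAlgebra.contractLeft (Q := (0 : QuadraticForm k (Fin n → k))) c
      (ExteriorAlgebra.ιMulti k (p + 1) v) ∈ ⋀[k]^p (Fin n → k) := by
  induction p with
  | zero =>
    rw [ExteriorAlgebra.ιMulti_succ_apply, contract_ι_mul, ExteriorAlgebra.ιMulti_zero_apply]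
    have : CliffordAlgebra.contractLeft (Q := (0 : QuadraticForm k (Fin n → k))) c
      (1 : Lam k n) = 0 := CliffordAlgebra.contractLeft_one ..
    rw [this, mul_zero, sub_zero]
    refine Submodule.smul_mem _ _ ?_
    exact ιMulti_mem (k := k) (![] : Fin 0 → Fin n → k)
  | succ p ih =>
    rw [ExteriorAlgebra.ιMulti_succ_apply, contract_ι_mul]
    exact sub_mem (Submodule.smul_mem _ _ (ιMulti_mem _)) (ι_mul_mem _ (ih _))

theorem contract_mem {n p : ℕ} (c : Module.Dual k (Fin n → k)) {x : Lam k n}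
    (hx : x ∈ ⋀[k]^(p + 1) (Fin n → k)) :
    CliffordAlgebra.contractLeft (Q := (0 : QuadraticForm k (Fin n → k))) c x ∈
      ⋀[k]^p (Fin n → k) := by
  refine extPow_induction (C := fun x => CliffordAlgebra.contractLeft
    (Q := (0 : QuadraticForm k (Fin n → k))) c x ∈ ⋀[k]^p (Fin n → k)) ?_ ?_ ?_ ?_ hx
  · rw [map_zero]; exact zero_mem _
  · intro a b ha hb; rw [map_add]; exact add_mem ha hb
  · intro r a ha; rw [map_smul]; exact Submodule.smul_mem _ _ ha
  · exact contract_ιMulti_mem p c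

theorem contract_ιMulti_zero {n : ℕ} (c : Module.Dual k (Fin n → k)) (v : Fin 0 → Fin n → k) :
    CliffordAlgebra.contractLeft (Q := (0 : QuadraticForm k (Fin n → k))) c
      (ExteriorAlgebra.ιMulti k 0 v) = 0 := by
  rw [ExteriorAlgebra.ιMulti_zero_apply]
  exact CliffordAlgebra.contractLeft_one ..

theorem ιMulti_eq_zero {n p : ℕ} (h : n < p) (v : Fin p → Fin n → k) :
    ExteriorAlgebra.ιMulti k p v = 0 := by
  apply AlternatingMap.map_linearDependent
  intro hv
  have := hv.fintype_card_le_finrank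
  simp at this
  omega

theorem proj_of_mem {n p q : ℕ} {x : Lam k n} (hx : x ∈ ⋀[k]^p (Fin n → k)) :
    GradedAlgebra.proj (fun p : ℕ => ⋀[k]^p (Fin n → k)) q x = if q = p then x else 0 := by
  rw [GradedAlgebra.proj_apply]
  split_ifs with h
  · subst h; exact DirectSum.decompose_of_mem_same _ hx
  · exact DirectSum.decompose_of_mem_ne _ hx (Ne.symm h)

theorem coneInt_zero_monomial {n : ℕ} (q : ℕ) (a : Fin n →₀ ℕ) :
    coneInt k n 0 q (MvPolynomial.monomial a 1) =
      ((a.degree + q + 1 : ℕ) : k)⁻¹ • MvPolynomial.monomial a 1 := by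
  have h1 : (MvPolynomial.aeval (R := k) (S₁ := Polynomial (Pol k n)) fun j : Fin n =>
      Polynomial.X * Polynomial.C (MvPolynomial.X j) +
        (1 - Polynomial.X) * (if (0 : Fin (n + 1)) = j.succ then 1 else 0))
      (MvPolynomial.monomial a 1) =
      Polynomial.monomial a.degree (MvPolynomial.monomial a (1 : k)) := by
    rw [MvPolynomial.aeval_monomial, map_one, one_mul]
    simp only [(Fin.succ_ne_zero _).symm, if_false, mul_zero, add_zero, mul_pow]
    rw [Finsupp.prod_mul, ← Polynomial.C_mul_X_pow_eq_monomial, mul_comm]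
    congr 1
    · rw [MvPolynomial.monomial_eq, map_one, one_mul]
      simp only [Finsupp.prod, ← map_pow, map_prod]
    · rw [Finsupp.degree_apply, Finsupp.prod, Finset.prod_pow_eq_pow_sum]
  rw [coneInt, LinearMap.comp_apply, AlgHom.toLinearMap_apply, h1]
  simp [Polynomial.lsum_apply, Polynomial.sum_monomial_index]

/-- On `x^a dv_1 ⋯ dv_p` the radial homotopy is contraction with the Euler field divided by the
weight `|a| + p`. -/
theorem poincare_zero_basis {n p : ℕ} (a : Fin n →₀ ℕ) (v : Fin p → Fin n → k) :
    poincare k n 0 (MvPolynomial.monomial a 1 ⊗ₜ ExteriorAlgebra.ιMulti k p v) =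
      ((a.degree + p : ℕ) : k)⁻¹ •
        eul k n (MvPolynomial.monomial a 1 ⊗ₜ ExteriorAlgebra.ιMulti k p v) := by
  simp only [poincare, eul, LinearMap.sum_apply, TensorProduct.map_tmul, LinearMap.comp_apply,
    Finset.smul_sum]
  refine Finset.sum_congr rfl fun j _ => ?_
  cases p with
  | zero => simp only [contract_ιMulti_zero, map_zero, TensorProduct.tmul_zero, smul_zero,
      Finset.sum_const_zero]
  | succ p =>
    by_cases hp : n < p + 1
    · simp only [ιMulti_eq_zero hp, map_zero, TensorProduct.tmul_zero, smul_zero,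
        Finset.sum_const_zero]
    simp only [proj_of_mem (contract_ιMulti_mem p _ v)]
    rw [Finset.sum_eq_single p]
    · rw [if_pos rfl, coneInt_zero_monomial, ← add_assoc]
      simp only [(Fin.succ_ne_zero j).symm, if_false, sub_zero, map_smul,
        TensorProduct.smul_tmul']
    · intro q _ hq
      rw [if_neg hq, TensorProduct.tmul_zero]
    · intro h
      exact absurd (Finset.mem_range.2 (by omega)) h

theorem poincare_zero_one (n : ℕ) : poincare k n 0 1 = 0 := by
  have := poincare_zero_basis (k := k) (0 : Fin n →₀ ℕ) ![]
  simpa [← Algebra.TensorProduct.one_def, (eul_skew (k := k) n).map_one] using this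

theorem wt_eul (n : ℕ) (x : Om k n) : wt k n (eul k n x) = eul k n (wt k n x) := by
  simp [wt, eul_eul]

theorem wt_dOm (n : ℕ) (x : Om k n) : wt k n (dOm k n x) = dOm k n (wt k n x) := by
  simp [wt, dOm_dOm]

variable [CharZero k]

/-- On Lie derivatives along the Euler field the radial homotopy is the contraction with this
field. Together with `eq_of_wt` this reduces identities for the homotopy to identities for the
contraction. -/
theorem poincare_zero_wt (n : ℕ) (x : Om k n) : poincare k n 0 (wt k n x) = eul k n x := by
  induction x using om_induction with
  | hadd a b ha hb => simp only [map_add, ha, hb]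
  | hsmul c a ha => simp only [map_smul, ha]
  | h a p v =>
    rw [wt_basis, map_smul, poincare_zero_basis, smul_smul]
    by_cases h : a.degree + p = 0
    · obtain ⟨h1, rfl⟩ : a.degree = 0 ∧ p = 0 := by omega
      rw [Finsupp.degree_eq_zero_iff] at h1
      subst h1
      have := (eul_skew (k := k) n).map_one
      simpa [← Algebra.TensorProduct.one_def] using this.symm
    · rw [mul_inv_cancel₀ (Nat.cast_ne_zero.2 h), one_smul]

end RadialHomotopy

section RadialHomotopyIdentities

variable {k : Type*} [Field k]

/-- Evaluation at the vertex `e_0`, the origin of the affine coordinates. -/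
def aug (k : Type*) [Field k] (n : ℕ) : Om k n →ₐ[k] k :=
  Algebra.TensorProduct.productMap (MvPolynomial.aeval 0) ExteriorAlgebra.algebraMapInv

@[simp] theorem aug_xOm {n : ℕ} (j : Fin n) : aug k n (xOm k n j) = 0 := by
  simp [aug, xOm]

@[simp] theorem aug_dvOm {n : ℕ} (v : Fin n → k) : aug k n (dvOm k n v) = 0 := by
  simp [aug, dvOm, ExteriorAlgebra.algebraMapInv]

theorem aug_wt (n : ℕ) (x : Om k n) : aug k n (wt k n x) = 0 := by
  have h1 := (wt_der (k := k) n).algHom_comp (aug k n)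
  have h := om_ext k h1 (IsSkewDer.zero _ _) (by simp [wt]) (by simp [wt])
  exact LinearMap.congr_fun h x

variable [CharZero k]

/-- In characteristic zero every form is a constant plus a Lie derivative along the Euler field,
the only monomial form of weight zero being `1`. -/
theorem exists_wt (n : ℕ) (x : Om k n) : ∃ y, x = aug k n x • 1 + wt k n y := by
  suffices h : ∃ (c : k) (y : _), x = c • 1 + wt k n y by
    obtain ⟨c, y, hy⟩ := h
    refine ⟨y, ?_⟩
    have : aug k n x = c := by
      rw [hy, map_add, map_smul, aug_wt, map_one]; simp
    rw [this, ← hy]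
  induction x using om_induction with
  | hadd a b ha hb =>
    obtain ⟨c, y, h⟩ := ha; obtain ⟨c', y', h'⟩ := hb
    refine ⟨c + c', y + y', ?_⟩
    rw [h, h', map_add, add_smul]; abel
  | hsmul r a ha =>
    obtain ⟨c, y, h⟩ := ha
    exact ⟨r * c, r • y, by rw [h, map_smul, smul_add, smul_smul]⟩
  | h a p v =>
    by_cases h : a.degree + p = 0
    · obtain ⟨h1, rfl⟩ : a.degree = 0 ∧ p = 0 := by omega
      rw [Finsupp.degree_eq_zero_iff] at h1
      subst h1
      exact ⟨1, 0, by simp [← Algebra.TensorProduct.one_def]⟩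
    · refine ⟨0, ((a.degree + p : ℕ) : k)⁻¹ •
        (MvPolynomial.monomial a 1 ⊗ₜ ExteriorAlgebra.ιMulti k p v), ?_⟩
      rw [map_smul, wt_basis, smul_smul, inv_mul_cancel₀ (Nat.cast_ne_zero.2 h), one_smul]
      simp

/-- Two linear maps out of `Ω_n` agree if they agree on `1` and on all Lie derivatives along the
Euler field. -/
theorem eq_of_wt {n : ℕ} {M : Type*} [AddCommGroup M] [Module k M] {f g : Om k n →ₗ[k] M}
    (h1 : f 1 = g 1) (h : ∀ y, f (wt k n y) = g (wt k n y)) (x : Om k n) : f x = g x := by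
  obtain ⟨y, hy⟩ := exists_wt n x
  rw [hy, map_add, map_add, map_smul, map_smul, h1, h]

/-- The Poincaré lemma for the contraction onto the vertex `e_0`. -/
theorem poincare_zero_homotopy (n : ℕ) (x : Om k n) :
    dOm k n (poincare k n 0 x) + poincare k n 0 (dOm k n x) = x - aug k n x • 1 := by
  refine eq_of_wt (f := dOm k n ∘ₗ poincare k n 0 + poincare k n 0 ∘ₗ dOm k n)
    (g := LinearMap.id - LinearMap.smulRight (aug k n).toLinearMap 1) ?_ (fun y => ?_) x
  · simp [poincare_zero_one, (dOm_skew (k := k) n).map_one]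
  · simp only [LinearMap.add_apply, LinearMap.comp_apply, LinearMap.sub_apply, LinearMap.id_apply,
      LinearMap.smulRight_apply, AlgHom.toLinearMap_apply, aug_wt, zero_smul, sub_zero,
      ← wt_dOm, poincare_zero_wt]
    rfl

theorem eul_poincare_zero (n : ℕ) (x : Om k n) : eul k n (poincare k n 0 x) = 0 := by
  refine eq_of_wt (f := eul k n ∘ₗ poincare k n 0) (g := 0) ?_ (fun y => ?_) x
  · simp [poincare_zero_one]
  · simp [poincare_zero_wt, eul_eul]

theorem wt_poincare_zero (n : ℕ) (x : Om k n) : wt k n (poincare k n 0 x) = eul k n x := by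
  refine eq_of_wt (f := wt k n ∘ₗ poincare k n 0) (g := eul k n) ?_ (fun y => ?_) x
  · simp [poincare_zero_one, (eul_skew (k := k) n).map_one]
  · simp [poincare_zero_wt, wt_eul]

theorem poincare_zero_sq (n : ℕ) (x : Om k n) : poincare k n 0 (poincare k n 0 x) = 0 := by
  refine eq_of_wt (f := poincare k n 0 ∘ₗ poincare k n 0) (g := 0) ?_ (fun y => ?_) x
  · simp [poincare_zero_one]
  · simp only [LinearMap.comp_apply, poincare_zero_wt, LinearMap.zero_apply]
    rw [← wt_poincare_zero, poincare_zero_wt, eul_poincare_zero]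

/-- An algebra map compatible with the de Rham differentials and the Euler fields is compatible
with the radial homotopies. -/
theorem map_poincare_zero {m n : ℕ} (M : Om k n →ₐ[k] Om k m)
    (hd : ∀ x, M (dOm k n x) = dOm k m (M x)) (he : ∀ x, M (eul k n x) = eul k m (M x))
    (x : Om k n) : M (poincare k n 0 x) = poincare k m 0 (M x) := by
  have hw (x) : M (wt k n x) = wt k m (M x) := by
    simp only [wt, LinearMap.add_apply, LinearMap.comp_apply, map_add, hd, he]
  refine eq_of_wt (f := M.toLinearMap ∘ₗ poincare k n 0) (g := poincare k m 0 ∘ₗ M.toLinearMap)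
    ?_ (fun y => ?_) x
  · simp [poincare_zero_one]
  · simp [poincare_zero_wt, hw, he]

end RadialHomotopyIdentities

section Poincare

variable {k : Type*} [Field k]

/-- Translation of forms by the vertex `e_i`. -/
def trans (k : Type*) [Field k] (n : ℕ) (i : Fin (n + 1)) : Om k n →ₐ[k] Om k n :=
  Algebra.TensorProduct.map
    (MvPolynomial.aeval fun j : Fin n => MvPolynomial.X j + (if i = j.succ then 1 else 0))
    (AlgHom.id k (Lam k n))

/-- Translation of forms by `-e_i`. -/
def transInv (k : Type*) [Field k] (n : ℕ) (i : Fin (n + 1)) : Om k n →ₐ[k] Om k n :=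
  Algebra.TensorProduct.map
    (MvPolynomial.aeval fun j : Fin n => MvPolynomial.X j - (if i = j.succ then 1 else 0))
    (AlgHom.id k (Lam k n))

theorem trans_xOm {n : ℕ} (i : Fin (n + 1)) (j : Fin n) :
    trans k n i (xOm k n j) = xOm k n j + (if i = j.succ then 1 else 0) := by
  simp only [trans, xOm, Algebra.TensorProduct.map_tmul, MvPolynomial.aeval_X, map_one,
    TensorProduct.add_tmul]
  split_ifs <;> simp [Algebra.TensorProduct.one_def]

theorem transInv_xOm {n : ℕ} (i : Fin (n + 1)) (j : Fin n) :
    transInv k n i (xOm k n j) = xOm k n j - (if i = j.succ then 1 else 0) := by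
  simp only [transInv, xOm, Algebra.TensorProduct.map_tmul, MvPolynomial.aeval_X, map_one,
    TensorProduct.sub_tmul]
  split_ifs <;> simp [Algebra.TensorProduct.one_def]

@[simp] theorem trans_dvOm {n : ℕ} (i : Fin (n + 1)) (v : Fin n → k) :
    trans k n i (dvOm k n v) = dvOm k n v := by
  simp [trans, dvOm]

@[simp] theorem transInv_dvOm {n : ℕ} (i : Fin (n + 1)) (v : Fin n → k) :
    transInv k n i (dvOm k n v) = dvOm k n v := by
  simp [transInv, dvOm]

@[simp] theorem trans_transInv {n : ℕ} (i : Fin (n + 1)) (x : Om k n) :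
    trans k n i (transInv k n i x) = x := by
  have : (trans k n i).comp (transInv k n i) = AlgHom.id k _ := by
    apply om_algHom_ext
    · intro j
      simp only [AlgHom.comp_apply, transInv_xOm, map_sub, trans_xOm]
      split_ifs <;> simp
    · intro j; simp
  exact DFunLike.congr_fun this x

@[simp] theorem transInv_trans {n : ℕ} (i : Fin (n + 1)) (x : Om k n) :
    transInv k n i (trans k n i x) = x := by
  have : (transInv k n i).comp (trans k n i) = AlgHom.id k _ := by
    apply om_algHom_ext
    · intro j
      simp only [AlgHom.comp_apply, transInv_xOm, map_add, trans_xOm]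
      split_ifs <;> simp
    · intro j; simp
  exact DFunLike.congr_fun this x

/-- An algebra map that sends each coordinate to a function and each `dx_j` to the constant
one-form which is the differential of the image of `x_j` commutes with `d`. -/
theorem map_dOm {m n : ℕ} (M : Om k n →ₐ[k] Om k m)
    (hx : ∀ j, M (dvOm k n (Pi.single j 1)) = dOm k m (M (xOm k n j)))
    (hd : ∀ j, ∃ v, M (dvOm k n (Pi.single j 1)) = dvOm k m v)
    (hp : ∀ j, parAlg k m (M (xOm k n j)) = M (xOm k n j)) (x : Om k n) :
    M (dOm k n x) = dOm k m (M x) := by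
  have hpar : M.comp (parAlg k n) = (parAlg k m).comp M := by
    apply om_algHom_ext
    · intro j; simp [hp]
    · intro j; obtain ⟨v, hv⟩ := hd j; simp [hv]
  have h1 := (dOm_skew (k := k) n).algHom_comp M
  have h2 := (dOm_skew (k := k) m).comp_algHom M
  rw [hpar] at h1
  refine LinearMap.congr_fun (om_ext k h1 h2 ?_ ?_) x
  · intro j; simp [hx]
  · intro j; obtain ⟨v, hv⟩ := hd j; simp [hv]

/-- An algebra map that is compatible with the Euler contractions of the coordinates and their
differentials is compatible with the Euler contraction of all forms. The image of `x_j` is only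
assumed to be the contraction of a constant one-form, so that maps between simplices of different
dimension are allowed. -/
theorem map_eul {m n : ℕ} (M : Om k n →ₐ[k] Om k m)
    (hx : ∀ j, eul k m (M (xOm k n j)) = 0)
    (hd : ∀ j, ∃ v, M (dvOm k n (Pi.single j 1)) = dvOm k m v ∧
      M (xOm k n j) = eul k m (dvOm k m v))
    (hp : ∀ j, parAlg k m (M (xOm k n j)) = M (xOm k n j)) (x : Om k n) :
    M (eul k n x) = eul k m (M x) := by
  have hpar : M.comp (parAlg k n) = (parAlg k m).comp M := by
    apply om_algHom_ext
    · intro j; simp [hp]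
    · intro j; obtain ⟨v, hv, -⟩ := hd j; simp [hv]
  have h1 := (eul_skew (k := k) n).algHom_comp M
  have h2 := (eul_skew (k := k) m).comp_algHom M
  rw [hpar] at h1
  refine LinearMap.congr_fun (om_ext k h1 h2 ?_ ?_) x
  · intro j; simp [hx]
  · intro j; obtain ⟨v, hv, hv'⟩ := hd j; simp [hv, hv']

theorem trans_dOm {n : ℕ} (i : Fin (n + 1)) (x : Om k n) :
    trans k n i (dOm k n x) = dOm k n (trans k n i x) := by
  apply map_dOm
  · intro j
    rw [trans_xOm]
    split_ifs <;> simp [(dOm_skew (k := k) n).map_one]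
  · intro j; exact ⟨_, trans_dvOm i _⟩
  · intro j
    rw [trans_xOm]
    split_ifs <;> simp

theorem transInv_dOm {n : ℕ} (i : Fin (n + 1)) (x : Om k n) :
    transInv k n i (dOm k n x) = dOm k n (transInv k n i x) := by
  conv_rhs => rw [← transInv_trans i (dOm k n (transInv k n i x))]
  rw [trans_dOm, trans_transInv]

/-- Cone integration with apex `e_i` is conjugate by a translation to cone integration with apex
`e_0`. -/
theorem coneInt_eq {n : ℕ} (i : Fin (n + 1)) (q : ℕ) (f : Pol k n) :
    coneInt k n i q f =
      MvPolynomial.aeval (fun j : Fin n => MvPolynomial.X j - (if i = j.succ then 1 else 0))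
        (coneInt k n 0 q
          (MvPolynomial.aeval
            (fun j : Fin n => MvPolynomial.X j + (if i = j.succ then 1 else 0)) f)) := by
  set s : Pol k n →ₐ[k] Pol k n :=
    MvPolynomial.aeval (fun j : Fin n => MvPolynomial.X j - (if i = j.succ then 1 else 0))
  set t : Pol k n →ₐ[k] Pol k n :=
    MvPolynomial.aeval (fun j : Fin n => MvPolynomial.X j + (if i = j.succ then 1 else 0))
  have key : (MvPolynomial.aeval (R := k) (S₁ := Polynomial (Pol k n)) fun j : Fin n =>
      Polynomial.X * Polynomial.C (MvPolynomial.X j) +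
        (1 - Polynomial.X) * (if i = j.succ then 1 else 0)) =
      ((Polynomial.mapAlgHom s).comp
      (MvPolynomial.aeval (R := k) (S₁ := Polynomial (Pol k n)) fun j : Fin n =>
      Polynomial.X * Polynomial.C (MvPolynomial.X j) +
        (1 - Polynomial.X) * (if (0 : Fin (n + 1)) = j.succ then 1 else 0))).comp t := by
    apply MvPolynomial.algHom_ext
    intro j
    simp only [AlgHom.comp_apply, MvPolynomial.aeval_X, t, map_add, s,
      (Fin.succ_ne_zero j).symm, if_false, mul_zero, add_zero]
    split_ifs with h
    · simp [h]; ring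
    · simp [h]
  have hl (g : Polynomial (Pol k n)) : Polynomial.lsum (fun a => ((a + q + 1 : ℕ) : k)⁻¹ •
      (LinearMap.id : Pol k n →ₗ[k] Pol k n)) (Polynomial.mapAlgHom s g) =
      s (Polynomial.lsum (fun a => ((a + q + 1 : ℕ) : k)⁻¹ •
      (LinearMap.id : Pol k n →ₗ[k] Pol k n)) g) := by
    induction g using Polynomial.induction_on' with
    | add p q hp hq => simp only [map_add, hp, hq]
    | monomial a r => simp [Polynomial.lsum_apply, Polynomial.sum_monomial_index]
  rw [coneInt, LinearMap.comp_apply, AlgHom.toLinearMap_apply, key, AlgHom.comp_apply,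
    AlgHom.comp_apply, hl]
  rfl

/-- The Poincaré homotopy at `e_i` is conjugate to the radial homotopy by a translation. -/
theorem poincare_eq {n : ℕ} (i : Fin (n + 1)) (x : Om k n) :
    poincare k n i x = transInv k n i (poincare k n 0 (trans k n i x)) := by
  suffices h : poincare k n i =
      (transInv k n i).toLinearMap ∘ₗ poincare k n 0 ∘ₗ (trans k n i).toLinearMap by
    rw [h]; rfl
  apply TensorProduct.ext'
  intro f η
  simp only [poincare, trans, transInv, LinearMap.sum_apply, LinearMap.comp_apply,
    AlgHom.toLinearMap_apply, Algebra.TensorProduct.map_tmul, TensorProduct.map_tmul, map_sum,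
    LinearMap.mulLeft_apply, AlgHom.coe_id, id]
  refine Finset.sum_congr rfl fun j _ => Finset.sum_congr rfl fun q _ => ?_
  rw [coneInt_eq i, map_mul]
  congr 2
  simp [(Fin.succ_ne_zero j).symm]

/-- Evaluation at the vertex `e_i`. -/
def evVert (k : Type*) [Field k] (n : ℕ) (i : Fin (n + 1)) : Om k n →ₐ[k] k :=
  (aug k n).comp (trans k n i)

theorem poincare_one {n : ℕ} (i : Fin (n + 1)) : poincare k n i 1 = 0 := by
  rw [poincare_eq i, map_one, poincare_zero_one, map_zero]

variable [CharZero k]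

/-- The Poincaré lemma for the contraction onto the vertex `e_i`. -/
theorem poincare_homotopy {n : ℕ} (i : Fin (n + 1)) (x : Om k n) :
    dOm k n (poincare k n i x) + poincare k n i (dOm k n x) = x - evVert k n i x • 1 := by
  rw [poincare_eq i x, poincare_eq i (dOm k n x), ← transInv_dOm, trans_dOm, ← map_add,
    poincare_zero_homotopy, map_sub, map_smul, transInv_trans, map_one]
  rfl

theorem poincare_sq {n : ℕ} (i : Fin (n + 1)) (x : Om k n) :
    poincare k n i (poincare k n i x) = 0 := by
  rw [poincare_eq i, poincare_eq i x, trans_transInv, poincare_zero_sq, map_zero]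

end Poincare

/-! ### Pullback along affine maps of simplices -/

section Pullback

variable {k : Type*} [Field k]

theorem tOm_zero (n : ℕ) : tOm k n 0 = 1 - ∑ j, xOm k n j := by
  simp [tOm, tPol, xOm, TensorProduct.sub_tmul, TensorProduct.sum_tmul,
    Algebra.TensorProduct.one_def]

@[simp] theorem tOm_succ {n : ℕ} (j : Fin n) : tOm k n j.succ = xOm k n j := rfl

theorem dtOm_eq {n : ℕ} (i : Fin (n + 1)) : dtOm k n i = dvOm k n (dtVec k n i) := rfl

theorem dvOm_sum {n : ℕ} {ι : Type*} (s : Finset ι) (v : ι → Fin n → k) :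
    dvOm k n (∑ i ∈ s, v i) = ∑ i ∈ s, dvOm k n (v i) := by
  simp [dvOm, TensorProduct.tmul_sum]

theorem dvOm_neg {n : ℕ} (v : Fin n → k) : dvOm k n (-v) = -dvOm k n v := by
  simp [dvOm, TensorProduct.tmul_neg]

theorem sum_tOm (n : ℕ) : ∑ i, tOm k n i = 1 := by
  rw [Fin.sum_univ_succ, tOm_zero]
  simp

theorem sum_dtVec (n : ℕ) : ∑ i, dtVec k n i = 0 := by
  rw [Fin.sum_univ_succ]
  simp [dtVec]

theorem sum_dtOm (n : ℕ) : ∑ i, dtOm k n i = 0 := by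
  simp only [dtOm_eq, ← dvOm_sum, sum_dtVec]
  simp [dvOm]

theorem dOm_tOm {n : ℕ} (i : Fin (n + 1)) : dOm k n (tOm k n i) = dtOm k n i := by
  cases i using Fin.cases with
  | zero =>
    rw [tOm_zero, dtOm_eq]
    simp [dtVec, dvOm_neg, dvOm_sum, (dOm_skew (k := k) n).map_one]
  | succ j => simp [dtOm_eq, dtVec]

theorem parAlg_tOm {n : ℕ} (i : Fin (n + 1)) : parAlg k n (tOm k n i) = tOm k n i := by
  simp [tOm, parAlg_tmul]

theorem eul_dtOm {n : ℕ} (i : Fin (n + 1)) :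
    eul k n (dtOm k n i) = tOm k n i - (if i = 0 then 1 else 0) := by
  cases i using Fin.cases with
  | zero =>
    rw [tOm_zero, dtOm_eq]
    simp [dtVec, dvOm_neg, dvOm_sum]
  | succ j => simp [dtOm_eq, dtVec]

theorem pullOm_xOm {m n : ℕ} (θ : Fin (m + 1) →o Fin (n + 1)) (j : Fin n) :
    pullOm k θ (xOm k n j) = ∑ i with θ i = j.succ, tOm k m i := by
  simp [pullOm, xOm, tOm, TensorProduct.sum_tmul]

theorem pullOm_dvOm {m n : ℕ} (θ : Fin (m + 1) →o Fin (n + 1)) (j : Fin n) :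
    pullOm k θ (dvOm k n (Pi.single j 1)) = ∑ i with θ i = j.succ, dtOm k m i := by
  simp only [pullOm, dvOm, dtOm, Algebra.TensorProduct.map_tmul, map_one,
    ExteriorAlgebra.map_apply_ι, ← TensorProduct.tmul_sum, ← map_sum]
  congr 2
  simp [Fintype.linearCombination_apply_single]

theorem sum_fiber {m n : ℕ} (θ : Fin (m + 1) →o Fin (n + 1)) {M : Type*} [AddCommGroup M]
    (f : Fin (m + 1) → M) :
    ∑ i with θ i = 0, f i = ∑ i, f i - ∑ j : Fin n, ∑ i with θ i = j.succ, f i := by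
  rw [eq_sub_iff_add_eq, ← Finset.sum_fiberwise Finset.univ θ f, Fin.sum_univ_succ]

theorem pullOm_tOm {m n : ℕ} (θ : Fin (m + 1) →o Fin (n + 1)) (j : Fin (n + 1)) :
    pullOm k θ (tOm k n j) = ∑ i with θ i = j, tOm k m i := by
  cases j using Fin.cases with
  | zero =>
    rw [tOm_zero, map_sub, map_one, map_sum, sum_fiber, sum_tOm]
    simp only [pullOm_xOm]
  | succ j => rw [tOm_succ, pullOm_xOm]

theorem pullOm_dtOm {m n : ℕ} (θ : Fin (m + 1) →o Fin (n + 1)) (j : Fin (n + 1)) :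
    pullOm k θ (dtOm k n j) = ∑ i with θ i = j, dtOm k m i := by
  cases j using Fin.cases with
  | zero =>
    rw [sum_fiber, sum_dtOm]
    simp only [← pullOm_dvOm, ← map_sum, ← dvOm_sum, zero_sub, ← map_neg, ← dvOm_neg]
    rfl
  | succ j => rw [← pullOm_dvOm]; rfl

theorem sum_fiber_comp {l m n : ℕ} (θ : Fin (l + 1) →o Fin (m + 1))
    (ψ : Fin (m + 1) →o Fin (n + 1)) {M : Type*} [AddCommMonoid M] (f : Fin (l + 1) → M)
    (j : Fin (n + 1)) :
    ∑ i with ψ.comp θ i = j, f i = ∑ i with ψ i = j, ∑ a with θ a = i, f a := by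
  rw [← Finset.sum_fiberwise_of_maps_to (t := Finset.univ.filter fun i => ψ i = j) (g := θ)
    (by intro i hi; simpa using hi)]
  refine Finset.sum_congr rfl fun i hi => Finset.sum_congr ?_ fun _ _ => rfl
  ext a
  simp only [Finset.mem_filter, Finset.mem_univ, true_and, OrderHom.comp_coe,
    Function.comp_apply] at hi ⊢
  constructor
  · exact fun h => h.2
  · rintro rfl; exact ⟨hi, rfl⟩

theorem pullOm_comp {l m n : ℕ} (θ : Fin (l + 1) →o Fin (m + 1))
    (ψ : Fin (m + 1) →o Fin (n + 1)) (x : Om k n) :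
    pullOm k (ψ.comp θ) x = pullOm k θ (pullOm k ψ x) := by
  have : pullOm k (ψ.comp θ) = (pullOm k θ).comp (pullOm k ψ) := by
    apply om_algHom_ext
    · intro j
      simp only [AlgHom.comp_apply, pullOm_xOm, map_sum, pullOm_tOm, sum_fiber_comp]
    · intro j
      simp only [AlgHom.comp_apply, pullOm_dvOm, map_sum, pullOm_dtOm, sum_fiber_comp]
  exact DFunLike.congr_fun this x

theorem pullOm_id {n : ℕ} (x : Om k n) :
    pullOm k (OrderHom.id : Fin (n + 1) →o Fin (n + 1)) x = x := by
  have : pullOm k (OrderHom.id : Fin (n + 1) →o Fin (n + 1)) = AlgHom.id k _ := by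
    apply om_algHom_ext
    · intro j
      simp [pullOm_xOm, Finset.sum_filter]
    · intro j
      simp [pullOm_dvOm, Finset.sum_filter, dtOm_eq, dtVec]
  exact DFunLike.congr_fun this x

theorem pullOm_dvOm' {m n : ℕ} (θ : Fin (m + 1) →o Fin (n + 1)) (j : Fin n) :
    pullOm k θ (dvOm k n (Pi.single j 1)) = dvOm k m (∑ i with θ i = j.succ, dtVec k m i) := by
  rw [pullOm_dvOm, dvOm_sum]
  rfl

theorem pullOm_dOm {m n : ℕ} (θ : Fin (m + 1) →o Fin (n + 1)) (x : Om k n) :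
    pullOm k θ (dOm k n x) = dOm k m (pullOm k θ x) := by
  apply map_dOm
  · intro j; simp only [pullOm_dvOm, pullOm_xOm, map_sum, dOm_tOm]
  · intro j; exact ⟨_, pullOm_dvOm' θ j⟩
  · intro j; simp only [pullOm_xOm, map_sum, parAlg_tOm]

theorem pullOm_parAlg {m n : ℕ} (θ : Fin (m + 1) →o Fin (n + 1)) (x : Om k n) :
    pullOm k θ (parAlg k n x) = parAlg k m (pullOm k θ x) := by
  have : (pullOm k θ).comp (parAlg k n) = (parAlg k m).comp (pullOm k θ) := by
    apply om_algHom_ext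
    · intro j; simp [pullOm_xOm, parAlg_tOm]
    · intro j; simp [pullOm_dvOm']
  exact DFunLike.congr_fun this x

theorem trans_tOm {n : ℕ} (i j : Fin (n + 1)) :
    trans k n j (tOm k n i) =
      tOm k n i + (if i = j then 1 else 0) - (if i = 0 then 1 else 0) := by
  cases i using Fin.cases with
  | zero =>
    rw [tOm_zero, map_sub, map_one, map_sum]
    simp only [trans_xOm, Finset.sum_add_distrib, if_true]
    cases j using Fin.cases with
    | zero => simp [(Fin.succ_ne_zero _).symm]
    | succ j => simp [(Fin.succ_ne_zero _).symm]
  | succ i => simp [trans_xOm, eq_comm]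

theorem evVert_tOm {n : ℕ} (i j : Fin (n + 1)) :
    evVert k n j (tOm k n i) = if i = j then 1 else 0 := by
  have h (i) : aug k n (tOm k n i) = if i = 0 then 1 else 0 := by
    cases i using Fin.cases with
    | zero => rw [tOm_zero]; simp
    | succ i => simp
  simp only [evVert, AlgHom.comp_apply, trans_tOm, map_add, map_sub, h]
  split_ifs <;> simp

theorem evVert_pullOm {m n : ℕ} (θ : Fin (m + 1) →o Fin (n + 1)) (j : Fin (m + 1))
    (x : Om k n) : evVert k m j (pullOm k θ x) = evVert k n (θ j) x := by
  have hd (n : ℕ) (j : Fin (n + 1)) (v) : evVert k n j (dvOm k n v) = 0 := by simp [evVert]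
  have : (evVert k m j).comp (pullOm k θ) = evVert k n (θ j) := by
    apply om_algHom_ext
    · intro l
      rw [AlgHom.comp_apply, pullOm_xOm, map_sum, ← tOm_succ, evVert_tOm]
      simp only [evVert_tOm]
      rw [Finset.sum_filter]
      simp_rw [← ite_and, and_comm (a := θ _ = l.succ), ite_and]
      simp [eq_comm]
    · intro l
      simp [pullOm_dvOm', hd]
  exact DFunLike.congr_fun this x

variable [CharZero k]

/-- The Poincaré homotopies are natural for the affine maps of simplices. -/
theorem pullOm_poincare {m n : ℕ} (θ : Fin (m + 1) →o Fin (n + 1)) (j : Fin (m + 1))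
    (x : Om k n) :
    pullOm k θ (poincare k n (θ j) x) = poincare k m j (pullOm k θ x) := by
  set M : Om k n →ₐ[k] Om k m :=
    (trans k m j).comp ((pullOm k θ).comp (transInv k n (θ j))) with hM
  have hMx (l : Fin n) : M (xOm k n l) =
      eul k m (dvOm k m (∑ i with θ i = l.succ, dtVec k m i)) := by
    have h1 : ∑ i with θ i = l.succ, (if i = j then (1 : Om k m) else 0) =
        if θ j = l.succ then 1 else 0 := by
      rw [Finset.sum_filter]
      simp_rw [← ite_and, and_comm (a := θ _ = l.succ), ite_and]
      simp
    simp only [hM, AlgHom.comp_apply, transInv_xOm, map_sub, pullOm_xOm, map_sum, trans_tOm,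
      dvOm_sum, ← dtOm_eq, eul_dtOm, Finset.sum_sub_distrib, Finset.sum_add_distrib, h1]
    have h2 : trans k m j (pullOm k θ (if θ j = l.succ then 1 else 0)) =
        if θ j = l.succ then 1 else 0 := by split_ifs <;> simp
    rw [h2]
    abel
  have hMd (l : Fin n) : M (dvOm k n (Pi.single l 1)) =
      dvOm k m (∑ i with θ i = l.succ, dtVec k m i) := by
    simp only [hM, AlgHom.comp_apply, transInv_dvOm, pullOm_dvOm', trans_dvOm]
  have hp : ∀ l, parAlg k m (M (xOm k n l)) = M (xOm k n l) := by
    intro l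
    rw [hMx, eul_dvOm]
    simp
  have h1 (x) : M (poincare k n 0 x) = poincare k m 0 (M x) := by
    apply map_poincare_zero
    · intro x
      simp only [hM, AlgHom.comp_apply, transInv_dOm, pullOm_dOm, trans_dOm]
    · apply map_eul
      · intro l; rw [hMx, eul_eul]
      · intro l; exact ⟨_, hMd l, hMx l⟩
      · exact hp
  rw [poincare_eq j, poincare_eq (θ j)]
  have h2 : trans k m j (pullOm k θ x) = M (trans k n (θ j) x) := by
    simp [hM]
  rw [h2, ← h1]
  simp [hM]

end Pullback

/-! ### The grading of forms -/

section Grading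

variable {k : Type*} [Field k]

/-- The forms of degree `p`. -/
def omGr (k : Type*) [Field k] (n : ℕ) (p : ℤ) : Submodule k (Om k n) :=
  Submodule.span k {x | ∃ (f : Pol k n) (q : ℕ) (η : Lam k n), (q : ℤ) = p ∧
    η ∈ ⋀[k]^q (Fin n → k) ∧ x = f ⊗ₜ η}

theorem tmul_mem_omGr {n q : ℕ} {η : Lam k n} (f : Pol k n) (hη : η ∈ ⋀[k]^q (Fin n → k)) :
    f ⊗ₜ η ∈ omGr k n q :=
  Submodule.subset_span ⟨f, q, η, rfl, hη, rfl⟩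

theorem map_omGr {M : Type*} [AddCommGroup M] [Module k M] {n : ℕ} {p : ℤ}
    (T : Om k n →ₗ[k] M) (S : Submodule k M)
    (h : ∀ f (q : ℕ) η, (q : ℤ) = p → η ∈ ⋀[k]^q (Fin n → k) → T (f ⊗ₜ η) ∈ S)
    {x : Om k n} (hx : x ∈ omGr k n p) : T x ∈ S := by
  suffices h : omGr k n p ≤ S.comap T from h hx
  refine Submodule.span_le.2 ?_
  rintro _ ⟨f, q, η, hq, hη, rfl⟩
  exact h f q η hq hη

theorem mul_mem_omGr {n : ℕ} {p q : ℤ} {x y : Om k n} (hx : x ∈ omGr k n p)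
    (hy : y ∈ omGr k n q) : x * y ∈ omGr k n (p + q) := by
  refine map_omGr (LinearMap.mulRight k y) _ (fun f a η ha hη => ?_) hx
  refine map_omGr (LinearMap.mulLeft k (f ⊗ₜ[k] η)) _ (fun g b ξ hb hξ => ?_) hy
  rw [LinearMap.mulLeft_apply, Algebra.TensorProduct.tmul_mul_tmul, ← ha, ← hb]
  exact_mod_cast tmul_mem_omGr (f * g) (SetLike.mul_mem_graded hη hξ)

theorem one_mem_omGr (n : ℕ) : (1 : Om k n) ∈ omGr k n 0 :=
  tmul_mem_omGr (k := k) (n := n) (q := 0) 1 (by simp)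

theorem dvOm_mem_omGr {n : ℕ} (v : Fin n → k) : dvOm k n v ∈ omGr k n 1 :=
  tmul_mem_omGr (k := k) (n := n) (q := 1) 1 (by simp)

theorem dOm_mem_omGr {n : ℕ} {p : ℤ} {x : Om k n} (hx : x ∈ omGr k n p) :
    dOm k n x ∈ omGr k n (p + 1) := by
  refine map_omGr (dOm k n) _ (fun f a η ha hη => ?_) hx
  rw [dOm, LinearMap.sum_apply, ← ha]
  refine sum_mem fun j _ => ?_
  exact_mod_cast tmul_mem_omGr _ (ι_mul_mem _ hη)

theorem contract_tmul_mem {n q : ℕ} (f : Pol k n) (c : Module.Dual k (Fin n → k))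
    {η : Lam k n} (hη : η ∈ ⋀[k]^q (Fin n → k)) :
    f ⊗ₜ CliffordAlgebra.contractLeft (Q := (0 : QuadraticForm k (Fin n → k))) c η ∈
      omGr k n ((q : ℤ) - 1) := by
  cases q with
  | zero =>
    have : CliffordAlgebra.contractLeft (Q := (0 : QuadraticForm k (Fin n → k))) c η = 0 := by
      refine extPow_induction (C := fun η => CliffordAlgebra.contractLeft
        (Q := (0 : QuadraticForm k (Fin n → k))) c η = 0) ?_ ?_ ?_ ?_ hη
      · rw [map_zero]
      · intro a b ha hb; rw [map_add, ha, hb, add_zero]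
      · intro r a ha; rw [map_smul, ha, smul_zero]
      · exact contract_ιMulti_zero c
    rw [this, TensorProduct.tmul_zero]
    exact zero_mem _
  | succ q =>
    have := tmul_mem_omGr f (contract_mem c hη)
    simpa using this

theorem eul_mem_omGr {n : ℕ} {p : ℤ} {x : Om k n} (hx : x ∈ omGr k n p) :
    eul k n x ∈ omGr k n (p - 1) := by
  refine map_omGr (eul k n) _ (fun f a η ha hη => ?_) hx
  rw [eul, LinearMap.sum_apply, ← ha]
  exact sum_mem fun j _ => contract_tmul_mem _ _ hη

theorem poincare_mem_omGr {n : ℕ} {p : ℤ} (i : Fin (n + 1)) {x : Om k n}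
    (hx : x ∈ omGr k n p) : poincare k n i x ∈ omGr k n (p - 1) := by
  refine map_omGr (poincare k n i) _ (fun f a η ha hη => ?_) hx
  simp only [poincare, LinearMap.sum_apply]
  rw [← ha]
  refine sum_mem fun j _ => sum_mem fun q _ => ?_
  rw [TensorProduct.map_tmul, LinearMap.comp_apply, LinearMap.comp_apply]
  cases a with
  | zero =>
    have := contract_tmul_mem (k := k) (n := n) 1 (LinearMap.proj j) hη
    have h0 : CliffordAlgebra.contractLeft (Q := (0 : QuadraticForm k (Fin n → k)))
        (LinearMap.proj j) η = 0 := by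
      refine extPow_induction (C := fun η => CliffordAlgebra.contractLeft
        (Q := (0 : QuadraticForm k (Fin n → k))) (LinearMap.proj j) η = 0) ?_ ?_ ?_ ?_ hη
      · rw [map_zero]
      · intro a b ha hb; rw [map_add, ha, hb, add_zero]
      · intro r a ha; rw [map_smul, ha, smul_zero]
      · exact contract_ιMulti_zero _
    rw [h0, map_zero, TensorProduct.tmul_zero]
    exact zero_mem _
  | succ a =>
    rw [proj_of_mem (contract_mem _ hη)]
    by_cases hq : q = a
    · rw [if_pos hq]
      have := tmul_mem_omGr (k := k) ((LinearMap.mulLeft k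
        (MvPolynomial.X j - (if i = j.succ then 1 else 0) : Pol k n)) (coneInt k n i q f))
        (contract_mem (LinearMap.proj j) hη)
      simpa using this
    · rw [if_neg hq, TensorProduct.tmul_zero]; exact zero_mem _

theorem map_mem_extPow {m n q : ℕ} (g : (Fin n → k) →ₗ[k] (Fin m → k)) {η : Lam k n}
    (hη : η ∈ ⋀[k]^q (Fin n → k)) : ExteriorAlgebra.map g η ∈ ⋀[k]^q (Fin m → k) := by
  refine extPow_induction (C := fun η => ExteriorAlgebra.map g η ∈ ⋀[k]^q (Fin m → k))
    ?_ ?_ ?_ ?_ hη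
  · rw [map_zero]; exact zero_mem _
  · intro a b ha hb; rw [map_add]; exact add_mem ha hb
  · intro r a ha; rw [map_smul]; exact Submodule.smul_mem _ _ ha
  · intro v; rw [ExteriorAlgebra.map_apply_ιMulti]; exact ιMulti_mem _

theorem pullOm_mem_omGr {m n : ℕ} {p : ℤ} (θ : Fin (m + 1) →o Fin (n + 1)) {x : Om k n}
    (hx : x ∈ omGr k n p) : pullOm k θ x ∈ omGr k m p := by
  refine map_omGr (pullOm k θ).toLinearMap _ (fun f a η ha hη => ?_) hx
  rw [← ha]
  exact tmul_mem_omGr _ (map_mem_extPow _ hη)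

theorem parAlg_of_mem {n : ℕ} {p : ℤ} {x : Om k n} (hx : x ∈ omGr k n p) :
    parAlg k n x = ((p.negOnePow : ℤ) : k) • x := by
  have hlam (q : ℕ) (η : Lam k n) (hη : η ∈ ⋀[k]^q (Fin n → k)) :
      CliffordAlgebra.involute η = ((-1 : k) ^ q) • η := by
    refine extPow_induction (C := fun η : Lam k n =>
      CliffordAlgebra.involute η = ((-1 : k) ^ q) • η) ?_ ?_ ?_ ?_ hη
    · rw [map_zero, smul_zero]
    · intro a b ha hb; rw [map_add, smul_add, ha, hb]
    · intro r a ha; rw [map_smul, ha, smul_comm]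
    · intro v
      clear hη η hx x p
      induction q with
      | zero => rw [ExteriorAlgebra.ιMulti_zero_apply, map_one, pow_zero, one_smul]
      | succ q ih =>
        have key2 (v : Fin n → k) :
          CliffordAlgebra.involute (ExteriorAlgebra.ι k v) = -ExteriorAlgebra.ι k v :=
            CliffordAlgebra.involute_ι _
        rw [ExteriorAlgebra.ιMulti_succ_apply, map_mul, ih, key2, mul_smul_comm, pow_succ,
          mul_neg_one, neg_mul, smul_neg, neg_smul]
  have : (parAlg k n).toLinearMap x - ((p.negOnePow : ℤ) : k) • x ∈ (⊥ : Submodule k (Om k n)) := by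
    refine map_omGr ((parAlg k n).toLinearMap - ((p.negOnePow : ℤ) : k) • LinearMap.id) ⊥
      (fun f a η ha hη => ?_) hx
    rw [Submodule.mem_bot, LinearMap.sub_apply, sub_eq_zero, AlgHom.toLinearMap_apply, parAlg_tmul,
      hlam a η hη, ← ha]
    simp [TensorProduct.tmul_smul, Int.negOnePow_def]
  rw [Submodule.mem_bot, sub_eq_zero] at this
  exact this

/-- Every form is a sum of homogeneous forms. -/
theorem om_gr_ext {M : Type*} [AddCommGroup M] [Module k M] {n : ℕ} {f g : Om k n →ₗ[k] M}
    (h : ∀ (p : ℤ), ∀ x ∈ omGr k n p, f x = g x) : f = g := by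
  refine LinearMap.ext fun x => ?_
  induction x using om_induction with
  | hadd a b ha hb => rw [map_add, map_add, ha, hb]
  | hsmul c a ha => rw [map_smul, map_smul, ha]
  | h a p v => exact h p _ (tmul_mem_omGr _ (ιMulti_mem v))

theorem smul_eq_neg_neg_smul {V : Type*} [AddCommGroup V] [Module k V] (c : k) (y : V) :
    c • y = -(-c • y) := by
  rw [neg_smul, neg_neg]

theorem anticomm_parAlg {n : ℕ} {T : Om k n →ₗ[k] Om k n}
    (h : ∀ p : ℤ, ∀ x ∈ omGr k n p, T x ∈ omGr k n (p - 1)) (x : Om k n) :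
    T (parAlg k n x) = -parAlg k n (T x) := by
  suffices h : T ∘ₗ (parAlg k n).toLinearMap = -((parAlg k n).toLinearMap ∘ₗ T) from
    LinearMap.congr_fun h x
  refine om_gr_ext fun p x hx => ?_
  simp only [LinearMap.comp_apply, AlgHom.toLinearMap_apply, LinearMap.neg_apply]
  have hs : (((p - 1).negOnePow : ℤ) : k) = -((p.negOnePow : ℤ) : k) := by
    rw [Int.negOnePow_sub]; simp
  rw [parAlg_of_mem hx, parAlg_of_mem (h p x hx), map_smul, hs]
  exact smul_eq_neg_neg_smul (V := Om k n) ((p.negOnePow : ℤ) : k) (T x)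

end Grading

/-! ### Basic forms and their pullbacks -/

section BasicForms

variable {k : Type*} [Field k]

/-- The inclusion of the face opposite to the vertex `e_0`. -/
def succHom (n : ℕ) : Fin (n + 1) →o Fin (n + 2) :=
  ⟨Fin.succ, fun _ _ h => Fin.succ_le_succ_iff.2 h⟩

@[simp] theorem succHom_apply {n : ℕ} (i : Fin (n + 1)) : succHom n i = i.succ := rfl

theorem pullOm_succHom_xOm {n : ℕ} (j : Fin (n + 1)) :
    pullOm k (succHom n) (xOm k (n + 1) j) = tOm k n j := by
  rw [pullOm_xOm]
  simp [Finset.sum_filter]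

theorem pullOm_succHom_dvOm {n : ℕ} (j : Fin (n + 1)) :
    pullOm k (succHom n) (dvOm k (n + 1) (Pi.single j 1)) = dtOm k n j := by
  rw [pullOm_dvOm]
  simp [Finset.sum_filter]

/-- The form `dx_{i_0} ⋯ dx_{i_p}` on the simplex of dimension `n + 1`, whose coordinates
restrict to `t_0, …, t_n` on the face opposite to `e_0`. -/
def wedge (k : Type*) [Field k] (n : ℕ) (l : List (Fin (n + 1))) : Om k (n + 1) :=
  (l.map fun i => dvOm k (n + 1) (Pi.single i 1)).prod

/-- The form `∑_j (-1)^j t_{i_j} dt_{i_0} ⋯ (omit dt_{i_j}) ⋯ dt_{i_p}`, obtained from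
`dx_{i_0} ⋯ dx_{i_p}` by contraction with the Euler field and restriction to a face. -/
def elemForm (k : Type*) [Field k] (n : ℕ) (l : List (Fin (n + 1))) : Om k n :=
  pullOm k (succHom n) (eul k (n + 1) (wedge k n l))

theorem wedge_cons {n : ℕ} (i : Fin (n + 1)) (l : List (Fin (n + 1))) :
    wedge k n (i :: l) = dvOm k (n + 1) (Pi.single i 1) * wedge k n l := rfl

theorem dvOm_sq {n : ℕ} (v : Fin n → k) : dvOm k n v * dvOm k n v = 0 := by
  simp [dvOm]

theorem dvOm_mul_swap {n : ℕ} (v w : Fin n → k) :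
    dvOm k n v * dvOm k n w = -(dvOm k n w * dvOm k n v) := by
  rw [eq_neg_iff_add_eq_zero]
  simp only [dvOm, Algebra.TensorProduct.tmul_mul_tmul, ← TensorProduct.tmul_add,
    ExteriorAlgebra.ι_add_mul_swap, TensorProduct.tmul_zero]

theorem wedge_cons_of_mem {n : ℕ} (i : Fin (n + 1)) (l : List (Fin (n + 1))) (h : i ∈ l) :
    wedge k n (i :: l) = 0 := by
  induction l with
  | nil => simp at h
  | cons a l ih =>
    rw [wedge_cons, wedge_cons, ← mul_assoc]
    rcases List.mem_cons.1 h with rfl | h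
    · rw [dvOm_sq, zero_mul]
    · rw [dvOm_mul_swap, om_neg_mul, mul_assoc, ← wedge_cons, ih h, mul_zero, neg_zero]

theorem wedge_cons_erase {n : ℕ} (i : Fin (n + 1)) (l : List (Fin (n + 1))) (h : i ∈ l) :
    wedge k n (i :: l.erase i) = (-1 : k) ^ (l.idxOf i) • wedge k n l := by
  induction l with
  | nil => simp at h
  | cons a l ih =>
    by_cases ha : a = i
    · subst ha; simp
    · have h' : i ∈ l := (List.mem_cons.1 h).resolve_left (Ne.symm ha)
      rw [List.erase_cons_tail (by simpa using ha), List.idxOf_cons_ne _ ha, wedge_cons,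
        wedge_cons, ← mul_assoc, dvOm_mul_swap, om_neg_mul, mul_assoc, ← wedge_cons i, ih h',
        om_mul_smul, ← wedge_cons, Nat.succ_eq_add_one, pow_succ, mul_neg_one]
      exact (neg_smul (M := Om k (n + 1)) _ _).symm

/-- Elementary forms are alternating: an index that occurs in the list can be moved to the front.
-/
theorem elemForm_cons_erase {n : ℕ} (i : Fin (n + 1)) (l : List (Fin (n + 1))) (h : i ∈ l) :
    elemForm k n (i :: l.erase i) = (-1 : k) ^ (l.idxOf i) • elemForm k n l := by
  simp only [elemForm, wedge_cons_erase i l h, map_smul]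

theorem elemForm_cons_of_mem {n : ℕ} (i : Fin (n + 1)) (l : List (Fin (n + 1))) (h : i ∈ l) :
    elemForm k n (i :: l) = 0 := by
  simp only [elemForm, wedge_cons_of_mem i l h, map_zero]

theorem eul_wedge_cons {n : ℕ} (i : Fin (n + 1)) (l : List (Fin (n + 1))) :
    eul k (n + 1) (wedge k n (i :: l)) = xOm k (n + 1) i * wedge k n l -
      dvOm k (n + 1) (Pi.single i 1) * eul k (n + 1) (wedge k n l) := by
  rw [wedge_cons, eul_skew]
  simp only [eul_dvOm_single, AlgHom.coe_id, id, parAlg_dvOm, om_neg_mul]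
  rw [sub_eq_add_neg]

theorem dOm_wedge {n : ℕ} (l : List (Fin (n + 1))) : dOm k (n + 1) (wedge k n l) = 0 := by
  induction l with
  | nil => exact (dOm_skew _).map_one
  | cons i l ih => rw [wedge_cons, dOm_skew, ih]; simp

theorem wt_wedge {n : ℕ} (l : List (Fin (n + 1))) :
    wt k (n + 1) (wedge k n l) = (l.length : k) • wedge k n l := by
  induction l with
  | nil => simpa [wedge] using (wt_der (k := k) (n + 1)).map_one
  | cons i l ih =>
    have h1 : wt k (n + 1) (dvOm k (n + 1) (Pi.single i 1)) =
        (1 : k) • dvOm k (n + 1) (Pi.single i 1) := by simp [wt]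
    rw [wedge_cons, wt_mul_of_eigen h1 ih, List.length_cons, Nat.cast_succ,
      add_comm (1 : k)]

theorem dOm_elemForm {n : ℕ} (l : List (Fin (n + 1))) :
    dOm k n (elemForm k n l) = (l.length : k) • pullOm k (succHom n) (wedge k n l) := by
  rw [elemForm, ← pullOm_dOm, ← map_smul, ← wt_wedge]
  simp [wt, dOm_wedge]

/-- As the barycentric coordinates sum to `1`, summing `t_i dt_{i_1} ⋯ dt_{i_p} - ⋯` over all `i`
leaves `dt_{i_1} ⋯ dt_{i_p}`. -/
theorem sum_elemForm_cons {n : ℕ} (l : List (Fin (n + 1))) :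
    ∑ i, elemForm k n (i :: l) = pullOm k (succHom n) (wedge k n l) := by
  simp only [elemForm, eul_wedge_cons, map_sub, map_mul, pullOm_succHom_xOm, pullOm_succHom_dvOm,
    Finset.sum_sub_distrib, ← Finset.sum_mul, sum_tOm, sum_dtOm, one_mul, zero_mul, sub_zero]

theorem xOm_comm {n : ℕ} (j : Fin n) (a : Om k n) : xOm k n j * a = a * xOm k n j := by
  induction a using TensorProduct.induction_on with
  | zero => simp
  | add x y hx hy => rw [mul_add, add_mul, hx, hy]
  | tmul f η => simp [xOm, mul_comm]

theorem eul_wedge_ofFn {n p : ℕ} (v : Fin (p + 1) → Fin (n + 1)) :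
    eul k (n + 1) (wedge k n (List.ofFn v)) = ∑ j : Fin (p + 1), ((-1 : k) ^ (j : ℕ)) •
      (xOm k (n + 1) (v j) * wedge k n (List.ofFn fun l => v (j.succAbove l))) := by
  induction p with
  | zero =>
    simp [List.ofFn_succ, wedge]
  | succ p ih =>
    rw [List.ofFn_succ, eul_wedge_cons, ih, sub_eq_add_neg]
    conv_rhs => rw [Fin.sum_univ_succ]
    congr 1
    · simp
    · rw [Finset.mul_sum, ← Finset.sum_neg_distrib]
      refine Finset.sum_congr rfl fun j _ => ?_
      have : (List.ofFn fun l => v (j.succ.succAbove l)) =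
          v 0 :: List.ofFn fun l => v (j.succAbove l).succ := by
        rw [List.ofFn_succ]; simp
      rw [this, wedge_cons, om_mul_smul, ← mul_assoc, ← mul_assoc, xOm_comm, Fin.val_succ,
        pow_succ, mul_neg_one]
      exact (neg_smul (M := Om k (n + 1)) _ _).symm

theorem pullOm_wedge {n : ℕ} (l : List (Fin (n + 1))) :
    pullOm k (succHom n) (wedge k n l) = (l.map (dtOm k n)).prod := by
  rw [wedge, map_list_prod, List.map_map]
  congr 2
  ext i
  exact pullOm_succHom_dvOm i

theorem Face.sort_eq {n : ℕ} (I : Face n) : I.1.sort = List.ofFn I.vert := by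
  rw [← Finset.listMap_orderEmbOfFin_finRange I.1 I.card_eq, List.ofFn_eq_map]
  rfl

/-- The basic form `ω_I` is a multiple of an elementary form. -/
theorem basicForm_eq {n : ℕ} (I : Face n) :
    basicForm k n I = (I.dim.factorial : k) • elemForm k n I.1.sort := by
  rw [basicForm, elemForm, Face.sort_eq, eul_wedge_ofFn, map_sum]
  congr 1
  refine Finset.sum_congr rfl fun j _ => ?_
  rw [map_smul, map_mul, pullOm_succHom_xOm, pullOm_wedge, List.map_ofFn]
  rfl

theorem wedge_ofFn {n p : ℕ} (v : Fin p → Fin (n + 1)) :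
    wedge k n (List.ofFn v) = 1 ⊗ₜ ExteriorAlgebra.ιMulti k p (fun j => Pi.single (v j) 1) := by
  rw [ExteriorAlgebra.ιMulti_apply]
  change _ = (Algebra.TensorProduct.includeRight : Lam k (n + 1) →ₐ[k] Om k (n + 1)) _
  rw [map_list_prod, wedge, List.map_ofFn, List.map_ofFn]
  rfl

theorem sort_image_of_strictMono {n p : ℕ} {r : Fin p → Fin (n + 1)} (hr : StrictMono r) :
    (Finset.univ.image r).sort = List.ofFn r := by
  have h1 : Finset.univ.image r = (List.ofFn r).toFinset := by
    ext a; simp [List.mem_ofFn]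
  rw [h1, List.toFinset_sort _ (List.nodup_ofFn.2 hr.injective)]
  exact (List.pairwise_ofFn.2 fun i j h => (hr h).le)

/-- The extension of `θ` by a new smallest vertex. -/
def coneHom {m n : ℕ} (θ : Fin (m + 1) →o Fin (n + 1)) : Fin (m + 2) →o Fin (n + 2) :=
  ⟨Fin.cases 0 fun i => (θ i).succ, by
    intro a b h
    cases a using Fin.cases with
    | zero => exact Fin.zero_le _
    | succ a =>
      cases b using Fin.cases with
      | zero => exact absurd h (by simp)
      | succ b => exact Fin.succ_le_succ_iff.2 (θ.monotone (Fin.succ_le_succ_iff.1 h))⟩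

@[simp] theorem coneHom_zero {m n : ℕ} (θ : Fin (m + 1) →o Fin (n + 1)) : coneHom θ 0 = 0 := rfl

@[simp] theorem coneHom_succ {m n : ℕ} (θ : Fin (m + 1) →o Fin (n + 1)) (i : Fin (m + 1)) :
    coneHom θ i.succ = (θ i).succ := rfl

theorem sum_coneHom {m n : ℕ} (θ : Fin (m + 1) →o Fin (n + 1)) {M : Type*} [AddCommMonoid M]
    (f : Fin (m + 2) → M) (j : Fin (n + 1)) :
    ∑ i with coneHom θ i = j.succ, f i = ∑ i with θ i = j, f i.succ := by
  rw [Finset.sum_filter, Fin.sum_univ_succ, Finset.sum_filter]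
  simp [(Fin.succ_ne_zero _).symm]

theorem pullOm_coneHom_eul {m n : ℕ} (θ : Fin (m + 1) →o Fin (n + 1)) (x : Om k (n + 1)) :
    pullOm k (coneHom θ) (eul k (n + 1) x) = eul k (m + 1) (pullOm k (coneHom θ) x) := by
  apply map_eul
  · intro j; rw [pullOm_xOm, sum_coneHom]; simp
  · intro j
    refine ⟨_, pullOm_dvOm' _ j, ?_⟩
    rw [dvOm_sum, pullOm_xOm, sum_coneHom, sum_coneHom, map_sum]
    refine Finset.sum_congr rfl fun i _ => ?_
    rw [← dtOm_eq, eul_dtOm]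
    simp
  · intro j; simp only [pullOm_xOm, map_sum, parAlg_tOm]

/-- Elementary forms pull back to sums of elementary forms, one for each lift of the indices. -/
theorem pullOm_elemForm_ofFn {m n p : ℕ} (θ : Fin (m + 1) →o Fin (n + 1))
    (v : Fin p → Fin (n + 1)) :
    pullOm k θ (elemForm k n (List.ofFn v)) =
      ∑ r ∈ Fintype.piFinset fun q => Finset.univ.filter fun a => θ a = v q,
        elemForm k m (List.ofFn r) := by
  have hcomp : (succHom n).comp θ = (coneHom θ).comp (succHom m) := by
    ext i; rfl
  rw [elemForm, ← pullOm_comp, hcomp, pullOm_comp, pullOm_coneHom_eul]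
  simp only [elemForm, ← map_sum]
  congr 2
  simp only [wedge_ofFn, ← TensorProduct.tmul_sum]
  rw [pullOm, Algebra.TensorProduct.map_tmul, map_one, ExteriorAlgebra.map_apply_ιMulti]
  congr 1
  have := MultilinearMap.map_sum_finset (ExteriorAlgebra.ιMulti k p).toMultilinearMap
    (fun _ a => (Pi.single a 1 : Fin (m + 1) → k))
    (fun q : Fin p => Finset.univ.filter fun a => θ a = v q)
  refine Eq.trans ?_ this
  rw [AlternatingMap.coe_multilinearMap]
  congr 1
  funext q
  simp only [Function.comp_apply, Fintype.linearCombination_apply_single, one_smul, sum_coneHom]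
  rfl

/-- The basic forms pull back to sums of basic forms. -/
theorem pullOm_basicForm {m n : ℕ} (θ : Fin (m + 1) →o Fin (n + 1)) (I : Face n) :
    pullOm k θ (basicForm k n I) =
      ∑ J : Face m with J.1.image θ = I.1 ∧ J.1.card = I.1.card, basicForm k m J := by
  rw [basicForm_eq, map_smul, Face.sort_eq, pullOm_elemForm_ofFn, Finset.smul_sum]
  have hI : Finset.univ.image I.vert = I.1 := Finset.image_orderEmbOfFin_univ I.1 I.card_eq
  have hIm : StrictMono I.vert := (I.1.orderEmbOfFin I.card_eq).strictMono
  have hmono (r : Fin (I.dim + 1) → Fin (m + 1)) (hr : ∀ q, θ (r q) = I.vert q) :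
      StrictMono r := by
    intro a b hab
    refine θ.monotone.reflect_lt ?_
    rw [hr, hr]
    exact hIm hab
  have hcard (r : Fin (I.dim + 1) → Fin (m + 1)) (hr : ∀ q, θ (r q) = I.vert q) :
      (Finset.univ.image r).card = I.dim + 1 := by
    rw [Finset.card_image_of_injective _ (hmono r hr).injective, Finset.card_univ,
      Fintype.card_fin]
  -- strictly monotone lifts of the vertices of `I` are the faces mapped bijectively onto `I`
  refine Finset.sum_bij (fun r _ => (⟨Finset.univ.image r, Finset.univ_nonempty.image r⟩ : Face m))
    ?_ ?_ ?_ ?_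
  · intro r hr
    simp only [Fintype.mem_piFinset, Finset.mem_filter, Finset.mem_univ, true_and] at hr ⊢
    refine ⟨?_, ?_⟩
    · rw [Finset.image_image, ← hI]
      congr 1
      funext q; exact hr q
    · rw [hcard r hr, I.card_eq]
  · intro r hr r' hr' h
    simp only [Fintype.mem_piFinset, Finset.mem_filter, Finset.mem_univ, true_and] at hr hr'
    have h' : Finset.univ.image r = Finset.univ.image r' := congrArg Subtype.val h
    have h1 := Finset.orderEmbOfFin_unique (hcard r hr)
      (fun x => Finset.mem_image_of_mem r (Finset.mem_univ x)) (hmono r hr)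
    have h2 := Finset.orderEmbOfFin_unique (hcard r hr)
      (fun x => h' ▸ Finset.mem_image_of_mem r' (Finset.mem_univ x)) (hmono r' hr')
    exact h1.trans h2.symm
  · intro J hJ
    simp only [Finset.mem_filter, Finset.mem_univ, true_and] at hJ
    have hc : J.1.card = I.dim + 1 := by rw [hJ.2, I.card_eq]
    have hinj : Set.InjOn θ J.1 := by
      rw [← Finset.card_image_iff, hJ.1, hJ.2]
    refine ⟨J.1.orderEmbOfFin hc, ?_, ?_⟩
    · simp only [Fintype.mem_piFinset, Finset.mem_filter, Finset.mem_univ, true_and]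
      have hm : StrictMono fun q => θ (J.1.orderEmbOfFin hc q) := by
        intro a b hab
        refine lt_of_le_of_ne (θ.monotone ((J.1.orderEmbOfFin hc).strictMono hab).le) fun h => ?_
        have := hinj (Finset.orderEmbOfFin_mem _ hc a) (Finset.orderEmbOfFin_mem _ hc b) h
        exact hab.ne ((J.1.orderEmbOfFin hc).injective this)
      have := Finset.orderEmbOfFin_unique I.card_eq (f := fun q => θ (J.1.orderEmbOfFin hc q))
        (fun x => by
          rw [← hJ.1]
          exact Finset.mem_image_of_mem _ (Finset.orderEmbOfFin_mem _ hc x)) hm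
      intro q
      exact congrFun this q
    · exact Subtype.ext (Finset.image_orderEmbOfFin_univ J.1 hc)
  · intro r hr
    simp only [Fintype.mem_piFinset, Finset.mem_filter, Finset.mem_univ, true_and] at hr
    rw [basicForm_eq]
    simp only [sort_image_of_strictMono (hmono r hr)]
    have : Face.dim (⟨Finset.univ.image r, Finset.univ_nonempty.image r⟩ : Face m) = I.dim := by
      rw [Face.dim, hcard r hr, Nat.add_sub_cancel]
    rw [this]

theorem wedge_mem_omGr {n : ℕ} (l : List (Fin (n + 1))) :
    wedge k n l ∈ omGr k (n + 1) l.length := by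
  induction l with
  | nil => exact one_mem_omGr _
  | cons i l ih =>
    rw [wedge_cons, List.length_cons, Nat.cast_succ, add_comm (l.length : ℤ)]
    exact mul_mem_omGr (dvOm_mem_omGr _) ih

theorem basicForm_mem_omGr {n : ℕ} (I : Face n) : basicForm k n I ∈ omGr k n I.dim := by
  rw [basicForm_eq]
  refine Submodule.smul_mem _ _ (pullOm_mem_omGr _ ?_)
  have := eul_mem_omGr (wedge_mem_omGr (k := k) I.1.sort)
  rwa [Finset.length_sort, I.card_eq, Nat.cast_succ, add_sub_cancel_right] at this

/-- The differential of a basic form is a sum of multiples of elementary forms. -/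
theorem dOm_basicForm {n : ℕ} (I : Face n) :
    dOm k n (basicForm k n I) =
      (I.1.card.factorial : k) • ∑ i ∈ I.1ᶜ, elemForm k n (i :: I.1.sort) := by
  rw [basicForm_eq, map_smul, dOm_elemForm, ← sum_elemForm_cons, smul_smul, Finset.length_sort,
    I.card_eq, Nat.factorial_succ, mul_comm]
  push_cast
  congr 1
  rw [← Finset.sum_compl_add_sum I.1, add_eq_left]
  refine Finset.sum_eq_zero fun i hi => elemForm_cons_of_mem _ _ ?_
  simpa using hi

end BasicForms

/-! ### Integration over simplices -/

section Integral

variable {k : Type*} [Field k]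

theorem topLam_ιMulti {n p : ℕ} (hp : p ≠ n) (v : Fin p → Fin n → k) :
    topLam k n (ExteriorAlgebra.ιMulti k p v) = 0 := by
  rw [topLam, ExteriorAlgebra.liftAlternating_apply_ιMulti, Pi.single_eq_of_ne hp]
  rfl

theorem topLam_ιMulti_self {n : ℕ} (v : Fin n → Fin n → k) :
    topLam k n (ExteriorAlgebra.ιMulti k n v) = Matrix.det (Matrix.of v) := by
  rw [topLam, ExteriorAlgebra.liftAlternating_apply_ιMulti, Pi.single_eq_same]
  rfl

theorem topLam_of_mem {n p : ℕ} (hp : p ≠ n) {η : Lam k n} (hη : η ∈ ⋀[k]^p (Fin n → k)) :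
    topLam k n η = 0 := by
  refine extPow_induction (C := fun η : Lam k n => topLam k n η = 0) ?_ ?_ ?_ ?_ hη
  · rw [map_zero]
  · intro a b ha hb; rw [map_add, ha, hb, add_zero]
  · intro r a ha; rw [map_smul, ha, smul_zero]
  · exact topLam_ιMulti hp

theorem integ_tmul {n : ℕ} (f : Pol k n) (η : Lam k n) :
    integ k n (f ⊗ₜ η) = intPol k n f * topLam k n η := rfl

theorem integ_of_mem {n : ℕ} {p : ℤ} (hp : p ≠ n) {x : Om k n} (hx : x ∈ omGr k n p) :
    integ k n x = 0 := by
  have := map_omGr (integ k n) ⊥ (fun f q η hq hη => ?_) hx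
  · simpa using this
  · rw [Submodule.mem_bot, integ_tmul, topLam_of_mem (by omega) hη, mul_zero]

/-- The linear part of the inclusion of the face opposite to `e_0`. -/
def succLin (k : Type*) [Field k] (n : ℕ) : (Fin (n + 1) → k) →ₗ[k] (Fin n → k) :=
  Fintype.linearCombination k fun j : Fin (n + 1) =>
    ∑ i ∈ Finset.univ.filter (fun i => succHom n i = j.succ), dtVec k n i

theorem succLin_single {n : ℕ} (j : Fin (n + 1)) :
    succLin k n (Pi.single j 1) = dtVec k n j := by
  simp [succLin, Finset.sum_filter]

/-- Contraction with a coordinate field transverse to the face opposite to `e_0`, followed by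
restriction to this face, preserves the coefficient of the volume form. -/
theorem topLam_contract {n : ℕ} (j : Fin (n + 1)) (v : Fin (n + 1) → Fin (n + 1) → k) :
    topLam k n (ExteriorAlgebra.map (succLin k n) (CliffordAlgebra.contractLeft
      (Q := (0 : QuadraticForm k (Fin (n + 1) → k))) (LinearMap.proj j)
      (ExteriorAlgebra.ιMulti k (n + 1) v))) =
    topLam k (n + 1) (ExteriorAlgebra.ιMulti k (n + 1) v) := by
  -- Both sides are multiples of the determinant, so they can be compared on the basis `w`, whose
  -- vector `s` is conormal to the face.
  let s : Fin (n + 1) → k := fun _ => 1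
  let w : Fin (n + 1) → Fin (n + 1) → k := Fin.cons s fun i => Pi.single i.succ 1
  let f : (Fin (n + 1) → k) [⋀^Fin (n + 1)]→ₗ[k] k :=
    ((topLam k n) ∘ₗ (ExteriorAlgebra.map (succLin k n)).toLinearMap ∘ₗ
      (CliffordAlgebra.contractLeft
      (Q := (0 : QuadraticForm k (Fin (n + 1) → k))) (LinearMap.proj j))).compAlternatingMap
      (ExteriorAlgebra.ιMulti k (n + 1))
  have hs : succLin k n s = 0 := by
    have : s = ∑ i, Pi.single i 1 := by ext; simp [s]
    rw [this, map_sum]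
    simp only [succLin_single, sum_dtVec]
  have hdet : Matrix.det (Matrix.of w) = 1 := by
    rw [Matrix.det_of_isUpperTriangular]
    · rw [Fin.prod_univ_succ]
      simp [w, s]
    · intro a b hab
      cases a using Fin.cases with
      | zero => exact absurd hab (by simp)
      | succ a =>
        have : b ≠ a.succ := hab.ne
        simp [w, this]
  have hfw : f w = 1 := by
    have h1 : Matrix.vecTail w = fun i : Fin n => Pi.single i.succ (1 : k) := rfl
    have h0 : w 0 = s := rfl
    change topLam k n (ExteriorAlgebra.map (succLin k n) (CliffordAlgebra.contractLeft
      (Q := (0 : QuadraticForm k (Fin (n + 1) → k))) (LinearMap.proj j)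
      (ExteriorAlgebra.ιMulti k (n + 1) w))) = 1
    rw [ExteriorAlgebra.ιMulti_succ_apply, contract_ι_mul, h0, map_sub, map_mul,
      ExteriorAlgebra.map_apply_ι, hs, map_zero, zero_mul, sub_zero, h1, map_smul,
      ExteriorAlgebra.map_apply_ιMulti]
    have h2 : (succLin k n ∘ fun i : Fin n => Pi.single i.succ (1 : k)) =
        fun i => Pi.single i 1 := by
      funext i
      simp [succLin_single, dtVec]
    rw [h2, map_smul, topLam_ιMulti_self]
    have h3 : Matrix.of (fun i : Fin n => (Pi.single i (1 : k) : Fin n → k)) = 1 := by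
      ext a b; simp [Matrix.one_apply, Pi.single_apply, eq_comm]
    rw [h3, Matrix.det_one]
    simp [s]
  have key : f = Matrix.detRowAlternating := by
    have h := AlternatingMap.eq_smul_basis_det (Pi.basisFun k (Fin (n + 1))) f
    rw [Pi.basisFun_det] at h
    have h' : f w = f (Pi.basisFun k (Fin (n + 1))) * Matrix.det (Matrix.of w) :=
      DFunLike.congr_fun h w
    rw [hfw, hdet, mul_one] at h'
    rw [h, ← h', one_smul]
  have := DFunLike.congr_fun key v
  rw [topLam_ιMulti_self]
  exact this

theorem intPol_monomial {n : ℕ} (a : Fin n →₀ ℕ) :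
    intPol k n (MvPolynomial.monomial a 1) =
      (∏ j, ((a j).factorial : k)) / (((∑ j, a j) + n).factorial : k) := by
  have := (MvPolynomial.basisMonomials (Fin n) k).constr_basis k (fun a =>
    (∏ j, ((a j).factorial : k)) / (((∑ j, a j) + n).factorial : k)) a
  rwa [MvPolynomial.coe_basisMonomials] at this

variable [CharZero k]

/-- Dirichlet's formula for the integral of a monomial in the barycentric coordinates. -/
theorem intPol_prod_tPol {n : ℕ} (c : ℕ) (b : Fin n →₀ ℕ) :
    intPol k n (tPol k n 0 ^ c * MvPolynomial.monomial b 1) =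
      ((c.factorial : k) * ∏ j, ((b j).factorial : k)) / ((c + (∑ j, b j) + n).factorial : k) := by
  induction c generalizing b with
  | zero => simp [intPol_monomial]
  | succ c ih =>
    -- `t_0 = 1 - t_1 - ⋯ - t_n` lowers the exponent of `t_0`
    have h1 : tPol k n 0 ^ (c + 1) * MvPolynomial.monomial b 1 =
        tPol k n 0 ^ c * MvPolynomial.monomial b 1 -
          ∑ j, tPol k n 0 ^ c * MvPolynomial.monomial (b + Finsupp.single j 1) 1 := by
      have h0 : tPol k n 0 = 1 - ∑ j, MvPolynomial.X j := rfl
      rw [pow_succ, ← Finset.mul_sum, mul_assoc, ← mul_sub]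
      congr 1
      conv_lhs => rw [h0]
      rw [sub_mul, one_mul, Finset.sum_mul]
      congr 1
      refine Finset.sum_congr rfl fun j _ => ?_
      rw [MvPolynomial.X, MvPolynomial.monomial_mul, one_mul, add_comm]
    rw [h1, map_sub, map_sum, ih]
    simp only [ih]
    have h2 (j : Fin n) : ∏ i, (((b + Finsupp.single j 1 : Fin n →₀ ℕ) i).factorial : k) =
        (b j + 1) * ∏ i, ((b i).factorial : k) := by
      rw [← Finset.mul_prod_erase _ _ (Finset.mem_univ j),
        ← Finset.mul_prod_erase (a := j) Finset.univ (fun i => ((b i).factorial : k))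
          (Finset.mem_univ j), ← mul_assoc]
      congr 1
      · simp [Nat.factorial_succ]
      · refine Finset.prod_congr rfl fun i hi => ?_
        have : i ≠ j := (Finset.mem_erase.1 hi).1
        simp [this.symm]
    have h3 (j : Fin n) : c + (∑ i, (b + Finsupp.single j 1 : Fin n →₀ ℕ) i) + n =
        (c + (∑ i, b i) + n) + 1 := by
      simp only [Finsupp.add_apply, Finset.sum_add_distrib]
      have : ∑ i, (Finsupp.single j 1 : Fin n →₀ ℕ) i = 1 := by
        simp [Finsupp.single_apply]
      omega
    simp only [h2, h3]
    have h4 : c + 1 + (∑ i, b i) + n = (c + (∑ i, b i) + n) + 1 := by omega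
    rw [h4, ← Finset.sum_div, ← Finset.mul_sum, ← Finset.sum_mul, Finset.sum_add_distrib,
      Nat.factorial_succ, Nat.factorial_succ]
    simp only [Finset.sum_const, Finset.card_univ, Fintype.card_fin, nsmul_eq_mul, mul_one]
    have h5 : (((c + (∑ i, b i) + n).factorial : ℕ) : k) ≠ 0 :=
      Nat.cast_ne_zero.2 (Nat.factorial_ne_zero _)
    have h6 : ((c + (∑ i, b i) + n + 1 : ℕ) : k) ≠ 0 := Nat.cast_ne_zero.2 (Nat.succ_ne_zero _)
    push_cast at h6 ⊢
    field_simp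
    ring_nf

theorem intPol_aeval_tPol {n : ℕ} (a : Fin (n + 1) →₀ ℕ) :
    intPol k n (MvPolynomial.aeval (tPol k n) (MvPolynomial.monomial a (1 : k))) =
      (∏ j, ((a j).factorial : k)) / ((a.degree + n).factorial : k) := by
  have h1 : MvPolynomial.aeval (tPol k n) (MvPolynomial.monomial a (1 : k)) =
      tPol k n 0 ^ (a 0) * MvPolynomial.monomial a.tail 1 := by
    rw [MvPolynomial.aeval_monomial, map_one, one_mul, Finsupp.prod_fintype _ _ (by simp),
      Fin.prod_univ_succ, MvPolynomial.monomial_eq, map_one, one_mul,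
      Finsupp.prod_fintype _ _ (by simp)]
    rfl
  rw [h1, intPol_prod_tPol, Fin.prod_univ_succ, Finsupp.degree_eq_sum, Fin.sum_univ_succ]
  rfl

/-- Integration over a simplex is radial integration followed by integration over the face
opposite to the apex. -/
theorem integ_succ (n : ℕ) (x : Om k (n + 1)) :
    integ k (n + 1) x = integ k n (pullOm k (succHom n) (poincare k (n + 1) 0 x)) := by
  induction x using om_induction with
  | hadd a b ha hb => simp only [map_add, ha, hb]
  | hsmul c a ha => simp only [map_smul, ha]
  | h a p v =>
    by_cases hp : p = n + 1
    · subst hp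
      have h1 (f : Pol k (n + 1)) (η) : pullOm k (succHom n) (f ⊗ₜ η) =
          (MvPolynomial.aeval (tPol k n) f) ⊗ₜ ExteriorAlgebra.map (succLin k n) η := by
        have : (fun j : Fin (n + 1) => ∑ i with succHom n i = j.succ, tPol k n i) =
            tPol k n := by
          funext j; simp [Finset.sum_filter]
        rw [← this]; rfl
      rw [poincare_zero_basis, map_smul, map_smul, eul, LinearMap.sum_apply, map_sum, map_sum]
      simp only [TensorProduct.map_tmul, LinearMap.mulLeft_apply, h1, integ_tmul,
        topLam_contract, map_mul, MvPolynomial.aeval_X, ← Finset.sum_mul]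
      have h2 : ∑ i, tPol k n i = 1 := by
        rw [Fin.sum_univ_succ]
        simp [tPol]
      rw [← map_sum, ← Finset.sum_mul, h2, one_mul, intPol_aeval_tPol, intPol_monomial,
        smul_eq_mul, ← mul_assoc, ← add_assoc, Nat.factorial_succ, ← Finsupp.degree_eq_sum,
        ← add_assoc]
      congr 1
      rw [Nat.cast_mul, div_mul_eq_div_div_swap, div_eq_mul_inv _ (((a.degree + n + 1 : ℕ)) : k),
        mul_comm]
    · rw [integ_of_mem (p := p) (by omega) (tmul_mem_omGr _ (ιMulti_mem v)),
        integ_of_mem (p := p - 1) (by omega)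
          (pullOm_mem_omGr _ (poincare_mem_omGr _ (tmul_mem_omGr _ (ιMulti_mem v))))]

end Integral

/-! ### Iterated Poincaré homotopies -/

section Dupont

variable {k : Type*} [Field k]

/-- The iterated homotopy `h^{i_p} ⋯ h^{i_0}` for the list `i_0, …, i_p`. -/
def iterH (k : Type*) [Field k] (n : ℕ) (l : List (Fin (n + 1))) : Module.End k (Om k n) :=
  (l.map (poincare k n)).reverse.prod

@[simp] theorem iterH_nil (n : ℕ) (x : Om k n) : iterH k n [] x = x := rfl

@[simp] theorem iterH_cons {n : ℕ} (i : Fin (n + 1)) (l : List (Fin (n + 1))) (x : Om k n) :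
    iterH k n (i :: l) x = iterH k n l (poincare k n i x) := by
  simp [iterH]

theorem dupont_apply (n : ℕ) (x : Om k n) :
    dupont k n x = ∑ I : Face n, ((-1 : k) ^ I.dim) • (basicForm k n I * iterH k n I.1.sort x) := by
  rw [dupont, LinearMap.sum_apply]
  refine Finset.sum_congr rfl fun I _ => ?_
  rw [Face.sort_eq, iterH, List.map_ofFn]
  rfl

theorem iterH_mem_omGr {n : ℕ} {p : ℤ} (l : List (Fin (n + 1))) {x : Om k n}
    (hx : x ∈ omGr k n p) : iterH k n l x ∈ omGr k n (p - l.length) := by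
  induction l generalizing p x with
  | nil => simpa using hx
  | cons i l ih =>
    have := ih (poincare_mem_omGr i hx)
    rw [iterH_cons, List.length_cons, Nat.cast_succ]
    rwa [sub_sub, add_comm] at this

theorem dupont_mem_omGr {n : ℕ} {p : ℤ} {x : Om k n} (hx : x ∈ omGr k n p) :
    dupont k n x ∈ omGr k n (p - 1) := by
  rw [dupont_apply]
  refine sum_mem fun I _ => Submodule.smul_mem _ _ ?_
  have := mul_mem_omGr (basicForm_mem_omGr I) (iterH_mem_omGr I.1.sort hx)
  rw [Finset.length_sort, I.card_eq, Nat.cast_succ] at this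
  convert this using 2
  ring

theorem iterH_one {n : ℕ} {l : List (Fin (n + 1))} (hl : l ≠ []) : iterH k n l 1 = 0 := by
  cases l with
  | nil => exact absurd rfl hl
  | cons i l => rw [iterH_cons, poincare_one, map_zero]

variable [CharZero k]

theorem pullOm_iterH {m n : ℕ} (θ : Fin (m + 1) →o Fin (n + 1)) (l : List (Fin (m + 1)))
    (x : Om k n) : pullOm k θ (iterH k n (l.map θ) x) = iterH k m l (pullOm k θ x) := by
  induction l generalizing x with
  | nil => rfl
  | cons i l ih => rw [List.map_cons, iterH_cons, iterH_cons, ih, pullOm_poincare]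

/-- An iterated homotopy vanishes if two successive vertices coincide, since `h^i h^i = 0`. -/
theorem iterH_of_not_nodup {n : ℕ} {l : List (Fin (n + 1))} (hs : l.Pairwise (· ≤ ·))
    (hl : ¬ l.Nodup) (x : Om k n) : iterH k n l x = 0 := by
  induction l generalizing x with
  | nil => simp at hl
  | cons i l ih =>
    rw [List.pairwise_cons] at hs
    rw [iterH_cons]
    by_cases h : l.Nodup
    · rw [List.nodup_cons, not_and_or, not_not] at hl
      have hi : i ∈ l := hl.resolve_right (not_not.2 h)
      cases l with
      | nil => simp at hi
      | cons a l =>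
        have : a = i := by
          refine le_antisymm ?_ (hs.1 a (by simp))
          rcases List.mem_cons.1 hi with rfl | hi
          · exact le_rfl
          · exact (List.pairwise_cons.1 hs.2).1 i hi
        rw [this, iterH_cons, poincare_sq, map_zero]
    · exact ih hs.2 h _

/-- Integration over the simplex is iterated radial integration. -/
theorem integ_eq (n : ℕ) (x : Om k n) :
    integ k n x = evVert k n (Fin.last n) (iterH k n ((List.finRange n).map Fin.castSucc) x) := by
  induction n with
  | zero =>
    have : (integ k 0) = (evVert k 0 (Fin.last 0)).toLinearMap := by
      refine LinearMap.ext fun x => ?_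
      induction x using om_induction with
      | hadd a b ha hb => simp only [map_add, ha, hb]
      | hsmul c a ha => simp only [map_smul, ha]
      | h a p v =>
        cases p with
        | zero =>
          have ha : a = 0 := Subsingleton.elim _ _
          subst ha
          rw [integ_tmul, topLam_ιMulti_self, intPol_monomial]
          simp [← Algebra.TensorProduct.one_def]
        | succ p =>
          have : v 0 = 0 := Subsingleton.elim _ _
          have : ExteriorAlgebra.ιMulti k (p + 1) v = 0 := by
            rw [ExteriorAlgebra.ιMulti_succ_apply, this, map_zero, zero_mul]
          simp [this]
    rw [this]; rfl
  | succ n ih =>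
    have h1 : (List.finRange (n + 1)).map Fin.castSucc =
        0 :: ((List.finRange n).map Fin.castSucc).map (succHom n) := by
      rw [List.finRange_succ]
      simp [Function.comp_def]
    rw [h1, iterH_cons, integ_succ, ih, ← pullOm_iterH, evVert_pullOm]
    rfl

theorem Face.sort_dropLast {n : ℕ} (I : Face n) :
    I.1.sort.dropLast = ((List.finRange I.dim).map Fin.castSucc).map I.vert := by
  rw [Face.sort_eq, List.ofFn_succ_last]
  simp [List.ofFn_eq_map, Function.comp_def]

/-- The coefficients of `p_n` as iterated radial integrals. -/
theorem proj_eq {n : ℕ} (I : Face n) (x : Om k n) :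
    proj k n x I = evVert k n (I.vert (Fin.last _)) (iterH k n I.1.sort.dropLast x) := by
  rw [Face.sort_dropLast, ← evVert_pullOm, pullOm_iterH, ← integ_eq]
  rfl

/-- The graded commutator of `d` with an iterated homotopy. -/
theorem commutator_iterH {n : ℕ} (l : List (Fin (n + 1))) (hl : l ≠ []) (hn : l.Nodup)
    (x : Om k n) :
    dOm k n (iterH k n l x) - (-1 : k) ^ l.length • iterH k n l (dOm k n x) =
      ∑ i ∈ l.toFinset, (-1 : k) ^ (l.length - 1 - l.idxOf i) • iterH k n (l.erase i) x -
        evVert k n (l.getLast hl) (iterH k n l.dropLast x) • 1 := by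
  induction l generalizing x with
  | nil => exact absurd rfl hl
  | cons a l ih =>
    have hp : poincare k n a (dOm k n x) =
        x - evVert k n a x • 1 - dOm k n (poincare k n a x) := by
      rw [← poincare_homotopy]; abel
    rw [List.nodup_cons] at hn
    rw [List.toFinset_cons, Finset.sum_insert (by simpa using hn.1), iterH_cons, iterH_cons, hp]
    have hsum : ∑ i ∈ l.toFinset, (-1 : k) ^ ((a :: l).length - 1 - (a :: l).idxOf i) •
          iterH k n ((a :: l).erase i) x =
        ∑ i ∈ l.toFinset, (-1 : k) ^ (l.length - 1 - l.idxOf i) •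
          iterH k n (l.erase i) (poincare k n a x) := by
      refine Finset.sum_congr rfl fun i hi => ?_
      have hi' : i ∈ l := by simpa using hi
      have ha : a ≠ i := by rintro rfl; exact hn.1 hi'
      rw [List.erase_cons_tail (by simpa using ha), List.idxOf_cons_ne _ ha, iterH_cons,
        List.length_cons]
      congr 2
      omega
    rw [hsum]
    by_cases h : l = []
    · subst h
      simp
      module
    · have := ih h hn.2 (poincare k n a x)
      rw [List.getLast_cons h, List.dropLast_cons_of_ne_nil h, iterH_cons, add_sub_assoc, ← this,
        map_sub, map_sub, map_smul, iterH_one h, smul_zero, sub_zero]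
      simp only [List.length_cons, List.idxOf_cons_self, List.erase_cons_head, pow_succ,
        Nat.add_sub_cancel, Nat.sub_zero, mul_neg_one]
      module

end Dupont

/-! ### The Dupont contraction -/

section Contraction

variable {k : Type*} [Field k]

theorem incl_apply {n : ℕ} (c : Cc k n) : incl k n c = ∑ I, c I • basicForm k n I := by
  rw [incl, Fintype.linearCombination_apply]

theorem incl_single {n : ℕ} (I : Face n) : incl k n (Pi.single I 1) = basicForm k n I := by
  rw [incl, Fintype.linearCombination_apply_single, one_smul]

theorem parAlg_basicForm {n : ℕ} (I : Face n) :
    parAlg k n (basicForm k n I) = (-1 : k) ^ I.dim • basicForm k n I := by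
  rw [parAlg_of_mem (basicForm_mem_omGr I)]
  simp [Int.negOnePow_def]

theorem sum_face {n : ℕ} {M : Type*} [AddCommGroup M] (f : Finset (Fin (n + 1)) → M) :
    ∑ I : Face n, f I.1 = ∑ I : Finset (Fin (n + 1)), f I - f ∅ := by
  rw [eq_sub_iff_add_eq, ← Finset.sum_erase_add Finset.univ f (Finset.mem_univ ∅), add_left_inj]
  refine (Finset.sum_subtype _ (fun I => ?_) _).symm
  simp [Finset.nonempty_iff_ne_empty]

theorem sort_erase {n : ℕ} (I : Finset (Fin (n + 1))) (i : Fin (n + 1)) :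
    (I.erase i).sort = I.sort.erase i := by
  have h : (I.erase i) = (I.sort.erase i).toFinset := by
    ext a
    simp [(Finset.sort_nodup I (· ≤ ·)).mem_erase_iff]
  rw [h, List.toFinset_sort _ ((Finset.sort_nodup I (· ≤ ·)).erase i)]
  exact List.Pairwise.sublist List.erase_sublist (Finset.pairwise_sort I (· ≤ ·))

variable [CharZero k]

/-- Dupont's homotopy is a homotopy from `i_n p_n` to the identity. -/
theorem dupont_homotopy (n : ℕ) (x : Om k n) :
    dOm k n (dupont k n x) + dupont k n (dOm k n x) = x - incl k n (proj k n x) := by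
  -- the contributions of pairs of a face and a vertex; they cancel in pairs, except for the empty
  -- set, which contributes `x`
  let F (I : Finset (Fin (n + 1))) (i : Fin (n + 1)) : Om k n :=
    ((-1 : k) ^ I.card * (I.card.factorial : k)) •
      (elemForm k n (i :: I.sort) * iterH k n I.sort x)
  have hterm (I : Face n) :
      dOm k n ((-1 : k) ^ I.dim • (basicForm k n I * iterH k n I.1.sort x)) +
        (-1 : k) ^ I.dim • (basicForm k n I * iterH k n I.1.sort (dOm k n x)) =
      -∑ i ∈ I.1ᶜ, F I.1 i + ∑ i ∈ I.1, F (I.1.erase i) i - proj k n x I • basicForm k n I := by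
    have hne : I.1.sort ≠ [] := by
      intro h
      have := congrArg List.length h
      rw [Finset.length_sort, I.card_eq] at this
      simp at this
    have hsq : (-1 : k) ^ I.dim * (-1 : k) ^ I.dim = 1 := by
      rw [← mul_pow]; simp
    have h1 : dOm k n ((-1 : k) ^ I.dim • (basicForm k n I * iterH k n I.1.sort x)) +
        (-1 : k) ^ I.dim • (basicForm k n I * iterH k n I.1.sort (dOm k n x)) =
        (-1 : k) ^ I.dim • (dOm k n (basicForm k n I) * iterH k n I.1.sort x) +
        basicForm k n I * (dOm k n (iterH k n I.1.sort x) -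
          (-1 : k) ^ I.1.sort.length • iterH k n I.1.sort (dOm k n x)) := by
      rw [map_smul, dOm_skew, AlgHom.coe_id, id, parAlg_basicForm, om_smul_mul, smul_add,
        smul_smul, hsq, one_smul, mul_sub, om_mul_smul, Finset.length_sort, I.card_eq, pow_succ,
        mul_neg_one]
      module
    have hlast : I.1.sort.getLast hne = I.vert (Fin.last _) := by
      simp only [I.sort_eq]
      rw [List.getLast_ofFn_succ]
    rw [h1, commutator_iterH _ hne (Finset.sort_nodup _ _), hlast, ← proj_eq, mul_sub,
      om_mul_smul, mul_one, ← add_sub_assoc]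
    congr 1
    congr 1
    · rw [dOm_basicForm, om_smul_mul, Finset.sum_mul, smul_smul, Finset.smul_sum,
        ← Finset.sum_neg_distrib]
      refine Finset.sum_congr rfl fun i _ => ?_
      simp only [F, I.card_eq, pow_succ]
      module
    · rw [Finset.mul_sum, Finset.sort_toFinset]
      refine Finset.sum_congr rfl fun i hi => ?_
      have hi' : i ∈ I.1.sort := by simpa using hi
      have hidx : I.1.sort.idxOf i ≤ I.dim := by
        have := List.idxOf_lt_length_iff.2 hi'
        rw [Finset.length_sort, I.card_eq] at this
        omega
      simp only [F]
      rw [sort_erase, elemForm_cons_erase i _ hi', Finset.card_erase_of_mem hi, I.card_eq,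
        Nat.add_sub_cancel, basicForm_eq, om_mul_smul, om_smul_mul, om_smul_mul, smul_smul,
        smul_smul, Finset.length_sort, I.card_eq, Nat.add_sub_cancel]
      congr 1
      obtain ⟨c, hc⟩ := Nat.exists_eq_add_of_le hidx
      have e1 : I.dim - I.1.sort.idxOf i = c := by omega
      have e2 : (-1 : k) ^ I.dim = (-1) ^ (I.1.sort.idxOf i) * (-1) ^ c := by
        conv_lhs => rw [hc]
        rw [pow_add]
      have hsq' : (-1 : k) ^ I.1.sort.idxOf i * (-1 : k) ^ I.1.sort.idxOf i = 1 := by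
        rw [← mul_pow]; simp
      rw [e1, e2]
      linear_combination (-(-1 : k) ^ c * (I.dim.factorial : k)) * hsq'
  have hswap : ∑ I : Finset (Fin (n + 1)), ∑ i ∈ I, F (I.erase i) i =
      ∑ I : Finset (Fin (n + 1)), ∑ i ∈ Iᶜ, F I i := by
    rw [Finset.sum_sigma', Finset.sum_sigma']
    refine Finset.sum_bij' (fun p _ => ⟨p.1.erase p.2, p.2⟩) (fun p _ => ⟨insert p.2 p.1, p.2⟩)
      ?_ ?_ ?_ ?_ ?_
    · rintro ⟨I, i⟩ h; simp
    · rintro ⟨I, i⟩ h; simp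
    · rintro ⟨I, i⟩ h
      simp only [Finset.mem_sigma, Finset.mem_univ, true_and] at h
      simp [Finset.insert_erase h]
    · rintro ⟨I, i⟩ h
      simp only [Finset.mem_sigma, Finset.mem_univ, true_and, Finset.mem_compl] at h
      simp [Finset.erase_insert h]
    · rintro ⟨I, i⟩ h; rfl
  have hempty : ∑ i ∈ (∅ : Finset (Fin (n + 1)))ᶜ, F ∅ i = x := by
    simp only [F, Finset.compl_empty, Finset.sort_empty, iterH_nil, Finset.card_empty, pow_zero,
      Nat.factorial_zero, Nat.cast_one, mul_one, one_smul, ← Finset.sum_mul, sum_elemForm_cons]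
    simp [wedge]
  rw [dupont_apply, dupont_apply, map_sum, ← Finset.sum_add_distrib,
    Finset.sum_congr rfl fun I _ => hterm I, Finset.sum_sub_distrib, Finset.sum_add_distrib,
    Finset.sum_neg_distrib, sum_face (fun I => ∑ i ∈ Iᶜ, F I i), hempty,
    sum_face (fun I => ∑ i ∈ I, F (I.erase i) i), hswap, incl_apply]
  simp

/-- Dupont's homotopy is simplicial. -/
theorem pullOm_dupont {m n : ℕ} (θ : Fin (m + 1) →o Fin (n + 1)) (x : Om k n) :
    pullOm k θ (dupont k n x) = dupont k m (pullOm k θ x) := by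
  have hnd (J : Face m) : (J.1.sort.map θ).Nodup ↔ (J.1.image θ).card = J.1.card := by
    rw [Finset.card_image_iff]
    constructor
    · intro h a ha b hb hab
      exact List.inj_on_of_nodup_map h (by simpa using ha) (by simpa using hb) hab
    · intro h
      refine (Finset.sort_nodup J.1 (· ≤ ·)).map_on fun a ha b hb hab => ?_
      exact h (by simpa using ha) (by simpa using hb) hab
  have hsorted (J : Face m) : (J.1.sort.map θ).Pairwise (· ≤ ·) :=
    (Finset.pairwise_sort J.1 (· ≤ ·)).map θ fun a b h => θ.monotone h
  have hsort (J : Face m) (h : (J.1.image θ).card = J.1.card) :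
      (J.1.image θ).sort = J.1.sort.map θ := by
    have h1 : J.1.image θ = (J.1.sort.map θ).toFinset := by
      ext a; simp
    rw [h1, List.toFinset_sort _ ((hnd J).2 h)]
    exact hsorted J
  simp only [dupont_apply, map_sum, map_smul, map_mul, pullOm_basicForm, Finset.sum_mul,
    Finset.smul_sum]
  simp only [Finset.sum_filter]
  rw [Finset.sum_comm]
  refine Finset.sum_congr rfl fun J _ => ?_
  by_cases h : (J.1.image θ).card = J.1.card
  · rw [Finset.sum_eq_single (⟨J.1.image θ, J.2.image θ⟩ : Face n)]
    · rw [if_pos ⟨rfl, h.symm⟩, hsort J h, pullOm_iterH]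
      simp only [Face.dim, h]
    · intro I _ hI
      rw [if_neg]
      rintro ⟨h1, -⟩
      exact hI (Subtype.ext h1.symm)
    · intro h; exact absurd (Finset.mem_univ _) h
  · -- a face that `θ` collapses contributes to neither side
    rw [← pullOm_iterH, iterH_of_not_nodup (hsorted J) ((hnd J).not.2 h), map_zero, mul_zero,
      smul_zero]
    refine Finset.sum_eq_zero fun I _ => if_neg ?_
    rintro ⟨h1, h2⟩
    exact h (by rw [h1, h2])

/-- The top basic form is normalised to have integral one. -/
theorem integ_basicForm_univ (n : ℕ) :
    integ k n (basicForm k n ⟨Finset.univ, Finset.univ_nonempty⟩) = 1 := by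
  have hd : Face.dim (⟨Finset.univ, Finset.univ_nonempty⟩ : Face n) = n := by simp [Face.dim]
  have hl : (Finset.univ : Finset (Fin (n + 1))).sort = List.ofFn id := by
    rw [← sort_image_of_strictMono strictMono_id, Finset.image_id]
  have h1 : eul k (n + 1) (wedge k n (List.ofFn id)) =
      ((n + 1 : ℕ) : k) • poincare k (n + 1) 0 (wedge k n (List.ofFn id)) := by
    rw [← poincare_zero_wt, wt_wedge, map_smul, List.length_ofFn]
  have h3 : Matrix.of (fun i : Fin (n + 1) => (Pi.single i (1 : k) : Fin (n + 1) → k)) = 1 := by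
    ext a b; simp [Matrix.one_apply, Pi.single_apply, eq_comm]
  have h4 : intPol k (n + 1) 1 = 1 / ((n + 1).factorial : k) := by
    simpa using intPol_monomial (k := k) (0 : Fin (n + 1) →₀ ℕ)
  rw [basicForm_eq, elemForm, hd, hl, h1, map_smul, map_smul, map_smul, ← integ_succ, wedge_ofFn,
    integ_tmul, topLam_ιMulti_self, smul_eq_mul, smul_eq_mul]
  simp only [id]
  rw [h3, Matrix.det_one, h4, Nat.factorial_succ]
  have h5 : (n.factorial : k) ≠ 0 := Nat.cast_ne_zero.2 n.factorial_ne_zero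
  have h6 : ((n + 1 : ℕ) : k) ≠ 0 := Nat.cast_ne_zero.2 n.succ_ne_zero
  push_cast at h6 ⊢
  field_simp

omit [CharZero k] in
theorem proj_eq_zero_of_mem {n : ℕ} {p : ℤ} {x : Om k n} (hx : x ∈ omGr k n p) (J : Face n)
    (hJ : p ≠ J.dim) : proj k n x J = 0 :=
  integ_of_mem hJ (pullOm_mem_omGr _ hx)

theorem proj_basicForm {n : ℕ} (I : Face n) : proj k n (basicForm k n I) = Pi.single I 1 := by
  funext J
  by_cases hd : I.dim = J.dim
  · change integ k J.dim (pullOm k J.vert (basicForm k n I)) = _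
    have himg : Finset.univ.image J.vert = J.1 := Finset.image_orderEmbOfFin_univ J.1 J.card_eq
    have huniv (J' : Face J.dim) (h : J'.1.card = I.1.card) :
        J' = ⟨Finset.univ, Finset.univ_nonempty⟩ := by
      refine Subtype.ext (Finset.eq_univ_of_card _ ?_)
      rw [h, I.card_eq, hd, Fintype.card_fin]
    rw [pullOm_basicForm]
    by_cases h : J = I
    · subst h
      rw [Finset.sum_eq_single (⟨Finset.univ, Finset.univ_nonempty⟩ : Face J.dim),
        integ_basicForm_univ, Pi.single_eq_same]
      · intro J' hJ' hne
        exact absurd (huniv J' (Finset.mem_filter.1 hJ').2.2) hne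
      · intro hn
        refine absurd (Finset.mem_filter.2 ⟨Finset.mem_univ _, himg, ?_⟩) hn
        rw [J.card_eq]; simp
    · rw [Pi.single_eq_of_ne h, Finset.sum_eq_zero, map_zero]
      intro J' hJ'
      have hJ'2 := (Finset.mem_filter.1 hJ').2
      rw [huniv J' hJ'2.2, himg] at hJ'2
      exact absurd (Subtype.ext hJ'2.1) h
  · rw [proj_eq_zero_of_mem (basicForm_mem_omGr I) J (by exact_mod_cast hd),
      Pi.single_eq_of_ne (by rintro rfl; exact hd rfl)]

/-- `p_n` is a retraction of `i_n`. -/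
theorem proj_incl {n : ℕ} (c : Cc k n) : proj k n (incl k n c) = c := by
  rw [incl_apply, map_sum]
  simp only [map_smul, proj_basicForm]
  exact (pi_eq_sum_univ' c).symm

theorem incl_proj_of_mem {n : ℕ} {x : Om k n} (hx : x ∈ LinearMap.range (incl k n)) :
    incl k n (proj k n x) = x := by
  obtain ⟨c, rfl⟩ := hx
  rw [proj_incl]

omit [CharZero k] in
theorem basicForm_mem_range {n : ℕ} (I : Face n) :
    basicForm k n I ∈ LinearMap.range (incl k n) := ⟨_, incl_single I⟩

/-- The elementary form of a face is a multiple of the basic form, by characteristic zero, and so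
lies in the image of `i_n`. -/
theorem elemForm_mem_range {n : ℕ} (I : Face n) :
    elemForm k n I.1.sort ∈ LinearMap.range (incl k n) := by
  have : elemForm k n I.1.sort = (I.dim.factorial : k)⁻¹ • basicForm k n I := by
    rw [basicForm_eq, smul_smul, inv_mul_cancel₀ (Nat.cast_ne_zero.2 (Nat.factorial_ne_zero _)),
      one_smul]
  rw [this]
  exact Submodule.smul_mem _ _ (basicForm_mem_range I)

/-- `C_n` is a subcomplex of the forms. -/
theorem dOm_incl {n : ℕ} (c : Cc k n) : dOm k n (incl k n c) = incl k n (dC k n c) := by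
  refine (incl_proj_of_mem ?_).symm
  rw [incl_apply, map_sum]
  refine sum_mem fun I _ => ?_
  rw [map_smul, dOm_basicForm]
  refine Submodule.smul_mem _ _ (Submodule.smul_mem _ _ (sum_mem fun i hi => ?_))
  have hi' : i ∉ I.1 := by simpa using hi
  have h := elemForm_cons_erase (k := k) i (insert i I.1).sort (by simp)
  rw [← sort_erase, Finset.erase_insert hi'] at h
  rw [h]
  exact Submodule.smul_mem _ _ (elemForm_mem_range ⟨insert i I.1, Finset.insert_nonempty _ _⟩)

/-- The `C_n` are closed under pullback along the simplicial maps. -/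
theorem pullOm_incl {m n : ℕ} (θ : Fin (m + 1) →o Fin (n + 1)) (c : Cc k n) :
    pullOm k θ (incl k n c) = incl k m (pullC k θ c) := by
  refine (incl_proj_of_mem ?_).symm
  rw [incl_apply, map_sum]
  refine sum_mem fun I _ => ?_
  rw [map_smul, pullOm_basicForm]
  exact Submodule.smul_mem _ _ (sum_mem fun J _ => basicForm_mem_range J)

/-- Stokes' theorem, deduced from the homotopy identity. -/
theorem proj_dOm {n : ℕ} (x : Om k n) : proj k n (dOm k n x) = dC k n (proj k n x) := by
  have h1 := dupont_homotopy n x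
  have h2 := dupont_homotopy n (dOm k n x)
  rw [dOm_dOm, map_zero, add_zero] at h2
  have h3 : incl k n (proj k n x) = x - dOm k n (dupont k n x) - dupont k n (dOm k n x) := by
    rw [sub_sub, h1]; abel
  simp only [dC, LinearMap.comp_apply]
  rw [h3, map_sub, map_sub, map_sub, dOm_dOm, h2, sub_zero, map_sub (proj k n) (dOm k n x),
    proj_incl]
  abel

theorem dC_dC {n : ℕ} (c : Cc k n) : dC k n (dC k n c) = 0 := by
  rw [← proj_incl (dC k n (dC k n c)), ← dOm_incl, ← dOm_incl, dOm_dOm, map_zero]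

theorem pullC_id (n : ℕ) :
    pullC k (OrderHom.id : Fin (n + 1) →o Fin (n + 1)) = LinearMap.id := by
  refine LinearMap.ext fun c => ?_
  simp only [pullC, LinearMap.comp_apply, AlgHom.toLinearMap_apply, pullOm_id, proj_incl,
    LinearMap.id_apply]

theorem pullC_comp {l m n : ℕ} (θ : Fin (l + 1) →o Fin (m + 1)) (ψ : Fin (m + 1) →o Fin (n + 1)) :
    pullC k (ψ.comp θ) = pullC k θ ∘ₗ pullC k ψ := by
  refine LinearMap.ext fun c => ?_
  conv_lhs => rw [pullC, LinearMap.comp_apply, LinearMap.comp_apply, AlgHom.toLinearMap_apply,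
    pullOm_comp, pullOm_incl]
  rfl

omit [CharZero k] in
theorem dupont_parAlg {n : ℕ} (x : Om k n) :
    dupont k n (parAlg k n x) = -parAlg k n (dupont k n x) :=
  anticomm_parAlg (fun _ _ h => dupont_mem_omGr h) x

end Contraction

/-! ### Series of words with coefficients in a graded algebra -/

section Series

variable {k : Type*} [Field k] {m n : ℕ}

/-- The sign `(-1)^|w|` of a word. -/
def ws (k : Type*) [Field k] {n : ℕ} (w : List (Face n)) : k := (((wdeg w).negOnePow : ℤ) : k)

@[simp] theorem wdeg_nil : wdeg ([] : List (Face n)) = 0 := rfl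

theorem wdeg_cons (I : Face n) (w : List (Face n)) :
    wdeg (I :: w) = (1 - (I.dim : ℤ)) + wdeg w := by
  simp [wdeg]

theorem wdeg_append (u v : List (Face n)) : wdeg (u ++ v) = wdeg u + wdeg v := by
  simp [wdeg]

theorem wdeg_singleton (I : Face n) : wdeg [I] = 1 - (I.dim : ℤ) := by simp [wdeg]

theorem ws_nil : ws k ([] : List (Face n)) = 1 := by simp [ws]

theorem ws_cons (I : Face n) (w : List (Face n)) : ws k (I :: w) = ws k [I] * ws k w := by
  simp [ws, wdeg_cons, Int.negOnePow_add]

theorem negOnePow_mul_self (p : ℤ) :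
    ((p.negOnePow : ℤ) : k) * ((p.negOnePow : ℤ) : k) = 1 := by
  rcases Int.even_or_odd p with h | h
  · simp [Int.negOnePow_even p h]
  · simp [Int.negOnePow_odd p h]

theorem ws_mul_self (w : List (Face n)) : ws k w * ws k w = 1 := negOnePow_mul_self _

section Twist

variable {B : Type*} [Ring B] [Algebra k B] (π : B →ₐ[k] B)

/-- The power `π^|w|` of an involution `π`. -/
def twist (w : List (Face n)) : B →ₐ[k] B :=
  open Classical in if Even (wdeg w) then AlgHom.id k B else π

theorem twist_of_even {w : List (Face n)} (h : Even (wdeg w)) : twist π w = AlgHom.id k B :=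
  if_pos h

theorem twist_of_odd {w : List (Face n)} (h : ¬ Even (wdeg w)) : twist π w = π := if_neg h

@[simp] theorem twist_nil : twist π ([] : List (Face n)) = AlgHom.id k B :=
  twist_of_even π (by simp)

theorem twist_congr {u : List (Face m)} {v : List (Face n)}
    (h : Even (wdeg u) ↔ Even (wdeg v)) : twist π u = twist π v := by
  simp only [twist, h]

theorem twist_comm (w : List (Face n)) (b : B) : twist π w (π b) = π (twist π w b) := by
  by_cases h : Even (wdeg w)
  · simp [twist_of_even π h]
  · simp [twist_of_odd π h]

theorem twist_cons (hπ : ∀ b, π (π b) = b) (I : Face n) (w : List (Face n)) (b : B) :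
    twist π (I :: w) b = twist π w (twist π [I] b) := by
  have hd : wdeg (I :: w) = wdeg [I] + wdeg w := by simp [wdeg]
  by_cases h1 : Even (wdeg [I]) <;> by_cases h2 : Even (wdeg w)
  · rw [twist_of_even π h1, twist_of_even π h2, twist_of_even]
    · rfl
    · rw [hd]; exact h1.add h2
  · rw [twist_of_even π h1, twist_of_odd π h2, twist_of_odd]
    · rfl
    · rw [hd, Int.even_add]; tauto
  · rw [twist_of_odd π h1, twist_of_even π h2, twist_of_odd]
    · rfl
    · rw [hd, Int.even_add]; tauto
  · rw [twist_of_odd π h1, twist_of_odd π h2, twist_of_even, hπ]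
    · rfl
    · rw [hd, Int.even_add]; tauto

theorem twist_id (w : List (Face n)) : twist (AlgHom.id k B) w = AlgHom.id k B := by
  simp [twist]

/-- The product of `B`-valued series `∑_w F(w) w` in the graded tensor product of `B` and the
completed tensor algebra, `π` being the parity involution of `B`. -/
def conv (F G : List (Face n) → B) (w : List (Face n)) : B :=
  ∑ a ∈ Finset.range (w.length + 1), F (w.take a) * twist π (w.take a) (G (w.drop a))

theorem conv_nil (F G : List (Face n) → B) : conv π F G [] = F [] * G [] := by
  simp [conv]

theorem conv_cons (hπ : ∀ b, π (π b) = b) (F G : List (Face n) → B) (I : Face n)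
    (w : List (Face n)) :
    conv π F G (I :: w) = F [] * G (I :: w) +
      conv π (fun u => F (I :: u)) (fun u => twist π [I] (G u)) w := by
  rw [conv, List.length_cons, Finset.sum_range_succ', add_comm]
  congr 1
  refine Finset.sum_congr rfl fun a _ => ?_
  rw [List.take_succ_cons, List.drop_succ_cons, twist_cons π hπ I (w.take a)]

theorem conv_add_left (F F' G : List (Face n) → B) (w : List (Face n)) :
    conv π (fun u => F u + F' u) G w = conv π F G w + conv π F' G w := by
  simp only [conv, add_mul, Finset.sum_add_distrib]

theorem conv_add_right (F G G' : List (Face n) → B) (w : List (Face n)) :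
    conv π F (fun u => G u + G' u) w = conv π F G w + conv π F G' w := by
  simp only [conv, map_add, mul_add, Finset.sum_add_distrib]

theorem conv_mul_left (b : B) (F G : List (Face n) → B) (w : List (Face n)) :
    conv π (fun u => b * F u) G w = b * conv π F G w := by
  simp only [conv, mul_assoc, Finset.mul_sum]

theorem conv_smul_left (c : k) (F G : List (Face n) → B) (w : List (Face n)) :
    conv π (fun u => c • F u) G w = c • conv π F G w := by
  simp only [conv, Algebra.smul_mul_assoc, Finset.smul_sum]

theorem conv_smul_right (c : k) (F G : List (Face n) → B) (w : List (Face n)) :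
    conv π F (fun u => c • G u) w = c • conv π F G w := by
  simp only [conv, map_smul, Algebra.mul_smul_comm, Finset.smul_sum]

theorem conv_sum_left {ι : Type*} (s : Finset ι) (F : ι → List (Face n) → B)
    (G : List (Face n) → B) (w : List (Face n)) :
    conv π (fun u => ∑ i ∈ s, F i u) G w = ∑ i ∈ s, conv π (F i) G w := by
  simp only [conv, Finset.sum_mul]
  exact Finset.sum_comm

theorem map_conv (φ : B →ₐ[k] B) (hφ : ∀ b, φ (π b) = π (φ b)) (F G : List (Face n) → B)
    (w : List (Face n)) :
    φ (conv π F G w) = conv π (fun u => φ (F u)) (fun u => φ (G u)) w := by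
  simp only [conv, map_sum, map_mul]
  refine Finset.sum_congr rfl fun a _ => ?_
  by_cases h : Even (wdeg (w.take a))
  · simp [twist_of_even π h]
  · simp [twist_of_odd π h, hφ]

/-- The product of series is associative. -/
theorem conv_assoc (hπ : ∀ b, π (π b) = b) (F G H : List (Face n) → B) (w : List (Face n)) :
    conv π (conv π F G) H w = conv π F (conv π G H) w := by
  induction w generalizing F G H with
  | nil => simp only [conv_nil, mul_assoc]
  | cons I w ih =>
    rw [conv_cons π hπ, conv_cons π hπ F]
    have h1 : (fun u => conv π F G (I :: u)) = fun u => F [] * G (I :: u) +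
        conv π (fun u => F (I :: u)) (fun u => twist π [I] (G u)) u := by
      funext u; rw [conv_cons π hπ]
    have h2 : (fun u => twist π [I] (conv π G H u)) =
        conv π (fun u => twist π [I] (G u)) (fun u => twist π [I] (H u)) := by
      funext u; exact map_conv π _ (twist_comm π _) _ _ _
    rw [h1, h2, conv_add_left, conv_mul_left, ih, conv_nil, conv_cons π hπ G, mul_add]
    simp only [mul_assoc, add_assoc]

end Twist

section Derivation

variable {M : Type*} [AddCommGroup M] [Module k M] (dL : Face n → List (Face n) → k)

/-- The part of the derivation `serD` acting on the first letter. -/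
def serT (F : List (Face n) → M) (w : List (Face n)) : M :=
  ∑ b ∈ Finset.range (w.length + 1), ∑ I : Face n, dL I (w.take b) • F (I :: w.drop b)

/-- The derivation of `M`-valued series that extends `v_I ↦ dL I`. -/
def serD (F : List (Face n) → M) (w : List (Face n)) : M :=
  ∑ a ∈ Finset.range (w.length + 1), ∑ b ∈ Finset.range (w.length + 1 - a), ∑ I : Face n,
    (ws k (w.take a) * dL I ((w.drop a).take b)) • F (w.take a ++ I :: (w.drop a).drop b)

theorem serD_nil (F : List (Face n) → M) : serD dL F [] = serT dL F [] := by
  simp [serD, serT, ws_nil]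

theorem serD_cons (F : List (Face n) → M) (x : Face n) (w : List (Face n)) :
    serD dL F (x :: w) = serT dL F (x :: w) + ws k [x] • serD dL (fun u => F (x :: u)) w := by
  rw [serD, List.length_cons, Finset.sum_range_succ', add_comm]
  congr 1
  · simp [serT, ws_nil]
  · simp only [serD, Finset.smul_sum]
    refine Finset.sum_congr rfl fun a _ => ?_
    rw [Nat.add_sub_add_right]
    refine Finset.sum_congr rfl fun b _ => Finset.sum_congr rfl fun I _ => ?_
    simp only [List.take_succ_cons, List.drop_succ_cons, List.cons_append, smul_smul,
      ← mul_assoc, ws_cons x (List.take a w)]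

theorem serD_add (F G : List (Face n) → M) (w : List (Face n)) :
    serD dL (fun u => F u + G u) w = serD dL F w + serD dL G w := by
  simp only [serD, smul_add, Finset.sum_add_distrib]

theorem serD_sub (F G : List (Face n) → M) (w : List (Face n)) :
    serD dL (fun u => F u - G u) w = serD dL F w - serD dL G w := by
  simp only [serD, smul_sub, Finset.sum_sub_distrib]

theorem serD_map {M' : Type*} [AddCommGroup M'] [Module k M'] (T : M →ₗ[k] M')
    (F : List (Face n) → M) (w : List (Face n)) :
    serD dL (fun u => T (F u)) w = T (serD dL F w) := by
  simp only [serD, map_sum, map_smul]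

theorem serD_smul (c : k) (F : List (Face n) → M) (w : List (Face n)) :
    serD dL (fun u => c • F u) w = c • serD dL F w := by
  simpa using serD_map dL (LinearMap.lsmul k M c) F w

theorem serD_zero (w : List (Face n)) : serD dL (fun _ => (0 : M)) w = 0 := by
  simp [serD]

theorem serD_sum {ι : Type*} (s : Finset ι) (F : ι → List (Face n) → M) (w : List (Face n)) :
    serD dL (fun u => ∑ i ∈ s, F i u) w = ∑ i ∈ s, serD dL (F i) w := by
  classical
  induction s using Finset.induction_on with
  | empty => simp only [Finset.sum_empty, serD_zero]
  | insert i s hi ih => simp only [Finset.sum_insert hi, serD_add, ih]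

variable {B : Type*} [Ring B] [Algebra k B] (π : B →ₐ[k] B)

/-- The values of `dL` have degree one more than the letters, modulo 2. -/
def OddLetters (dL : Face n → List (Face n) → k) : Prop :=
  ∀ I u, dL I u ≠ 0 → (Even (wdeg u) ↔ ¬ Even (wdeg [I]))

/-- Multiplying a product of series by the scalar series `dL I` on the left: moving it next to the
first factor costs the parity involution on the second one, as `dL I` has the parity opposite to
that of the letter `I`. -/
theorem scalar_conv_conv (hπ : ∀ b, π (π b) = b) (hdL : OddLetters dL) (I : Face n)
    (F G : List (Face n) → B) (w : List (Face n)) :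
    ∑ b ∈ Finset.range (w.length + 1), dL I (w.take b) •
      conv π F (fun u => twist π [I] (G u)) (w.drop b) =
    conv π (fun v => ∑ b ∈ Finset.range (v.length + 1), dL I (v.take b) • F (v.drop b))
      (fun u => π (G u)) w := by
  have key (H : List (Face n) → B) (v : List (Face n)) :
      ∑ b ∈ Finset.range (v.length + 1), dL I (v.take b) • H (v.drop b) =
      conv π (fun u => dL I u • (1 : B)) (fun u => π (twist π [I] (H u))) v := by
    refine Finset.sum_congr rfl fun b _ => ?_
    by_cases h : dL I (v.take b) = 0
    · simp [h]
    · have h1 := hdL I _ h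
      rw [Algebra.smul_mul_assoc, one_mul]
      congr 1
      by_cases h2 : Even (wdeg [I])
      · rw [twist_of_even π h2, twist_of_odd π (by tauto)]
        simp [hπ]
      · rw [twist_of_odd π h2, twist_of_even π (by tauto)]
        simp [hπ]
  have htt (b : B) : twist π [I] (twist π [I] b) = b := by
    by_cases h2 : Even (wdeg [I])
    · simp [twist_of_even π h2]
    · simp [twist_of_odd π h2, hπ]
  rw [key]
  have h1 : (fun u => π (twist π [I] (conv π F (fun u => twist π [I] (G u)) u))) =
      conv π (fun u => π (twist π [I] (F u))) (fun u => π (G u)) := by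
    funext u
    rw [map_conv π (twist π [I]) (twist_comm π _), map_conv π π (fun _ => rfl)]
    simp only [htt]
  rw [h1, ← conv_assoc π hπ]
  congr 1
  funext v
  rw [key]

/-- The Leibniz rule for the part of the derivation that acts on the first letter. -/
theorem serT_conv (hπ : ∀ b, π (π b) = b) (hdL : OddLetters dL) (F G : List (Face n) → B)
    (w : List (Face n)) :
    serT dL (conv π F G) w = F [] * serT dL G w + conv π (serT dL F) (fun u => π (G u)) w := by
  have hs {M : Type _} [AddCommGroup M] [Module k M] (F : List (Face n) → M) (w) :
    serT dL F w = ∑ I : Face n, ∑ b ∈ Finset.range (w.length + 1),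
      dL I (w.take b) • F (I :: w.drop b) := Finset.sum_comm
  have h0 : conv π (serT dL F) (fun u => π (G u)) w = ∑ I : Face n,
      conv π (fun v => ∑ b ∈ Finset.range (v.length + 1), dL I (v.take b) • F (I :: v.drop b))
      (fun u => π (G u)) w := by
    rw [← conv_sum_left]
    congr 1
    funext v
    exact hs F v
  rw [hs, hs, h0, Finset.mul_sum, ← Finset.sum_add_distrib]
  refine Finset.sum_congr rfl fun I _ => ?_
  rw [← scalar_conv_conv dL π hπ hdL I (fun u => F (I :: u)) G w, Finset.mul_sum,
    ← Finset.sum_add_distrib]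
  refine Finset.sum_congr rfl fun b _ => ?_
  rw [conv_cons π hπ, smul_add, Algebra.mul_smul_comm]

/-- The Leibniz rule for `serD`. -/
theorem serD_conv (hπ : ∀ b, π (π b) = b) (hdL : OddLetters dL) (F G : List (Face n) → B)
    (w : List (Face n)) :
    serD dL (conv π F G) w = conv π (serD dL F) (fun u => π (G u)) w +
      conv π (fun u => ws k u • F u) (serD dL G) w := by
  induction w generalizing F G with
  | nil =>
    rw [serD_nil, serT_conv dL π hπ hdL, conv_nil, conv_nil, conv_nil, serD_nil, serD_nil, ws_nil,
      one_smul, add_comm]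
  | cons x w ih =>
    have h1 : (fun u => conv π F G (x :: u)) = fun u => F [] * G (x :: u) +
        conv π (fun u => F (x :: u)) (fun u => twist π [x] (G u)) u := by
      funext u; rw [conv_cons π hπ]
    have h2 : serD dL (fun u => F [] * G (x :: u)) w = F [] * serD dL (fun u => G (x :: u)) w :=
      serD_map dL (LinearMap.mulLeft k (F [])) _ w
    have h3 : serD dL (fun u => twist π [x] (G u)) = fun u => twist π [x] (serD dL G u) := by
      funext u; exact serD_map dL (twist π [x]).toLinearMap _ u
    have h4 : (fun u => serD dL F (x :: u)) =
        fun u => serT dL F (x :: u) + ws k [x] • serD dL (fun u => F (x :: u)) u := by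
      funext u; exact serD_cons dL F x u
    have h5 : (fun u => ws k (x :: u) • F (x :: u)) =
        fun u => ws k [x] • (ws k u • F (x :: u)) := by
      funext u; rw [ws_cons, mul_smul]
    have h6 : (fun u => twist π [x] (π (G u))) = fun u => π (twist π [x] (G u)) := by
      funext u; exact twist_comm π _ _
    rw [serD_cons, h1, serD_add, h2, ih, h3, serT_conv dL π hπ hdL, conv_cons π hπ (serD dL F),
      conv_cons π hπ (fun u => ws k u • F u), conv_cons π hπ (serT dL F), h4, h5, h6,
      conv_add_left, conv_smul_left, conv_smul_left, ws_nil, one_smul, serD_nil,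
      serD_cons dL G, mul_add, Algebra.mul_smul_comm]
    simp only [smul_add]
    abel

end Derivation

section Push

variable {M : Type*} [AddCommGroup M] [Module k M] (c : Face n → Face m → k)

/-- Substitution of `∑_I c I J • v_I` for each letter `v_J` in an `M`-valued series. -/
def serPush (F : List (Face m) → M) (w : List (Face n)) : M :=
  ∑ u : Fin w.length → Face m, (∏ a : Fin w.length, c (w.get a) (u a)) • F (List.ofFn u)

theorem serPush_nil (F : List (Face m) → M) : serPush c F [] = F [] := by
  simp [serPush]

theorem serPush_cons (F : List (Face m) → M) (I : Face n) (w : List (Face n)) :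
    serPush c F (I :: w) = ∑ J, c I J • serPush c (fun u => F (J :: u)) w := by
  rw [serPush]
  simp only [List.length_cons]
  rw [← Equiv.sum_comp (Fin.consEquiv fun _ : Fin (w.length + 1) => Face m),
    Fintype.sum_prod_type]
  refine Finset.sum_congr rfl fun J _ => ?_
  rw [serPush, Finset.smul_sum]
  refine Finset.sum_congr rfl fun u _ => ?_
  rw [Fin.prod_univ_succ, smul_smul, List.ofFn_succ]
  simp [Fin.consEquiv]

theorem serPush_add (F G : List (Face m) → M) (w : List (Face n)) :
    serPush c (fun u => F u + G u) w = serPush c F w + serPush c G w := by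
  simp only [serPush, smul_add, Finset.sum_add_distrib]

theorem serPush_sub (F G : List (Face m) → M) (w : List (Face n)) :
    serPush c (fun u => F u - G u) w = serPush c F w - serPush c G w := by
  simp only [serPush, smul_sub, Finset.sum_sub_distrib]

theorem serPush_smul (r : k) (F : List (Face m) → M) (w : List (Face n)) :
    serPush c (fun u => r • F u) w = r • serPush c F w := by
  simp only [serPush, Finset.smul_sum, smul_smul, mul_comm]

theorem serPush_sum {ι : Type*} (s : Finset ι) (F : ι → List (Face m) → M) (w : List (Face n)) :
    serPush c (fun u => ∑ i ∈ s, F i u) w = ∑ i ∈ s, serPush c (F i) w := by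
  simp only [serPush, Finset.smul_sum]
  exact Finset.sum_comm

theorem serPush_map {M' : Type*} [AddCommGroup M'] [Module k M'] (T : M →ₗ[k] M')
    (F : List (Face m) → M) (w : List (Face n)) :
    serPush c (fun u => T (F u)) w = T (serPush c F w) := by
  simp only [serPush, map_sum, map_smul]

variable {B : Type*} [Ring B] [Algebra k B] (π : B →ₐ[k] B)

/-- Substitutions that preserve degrees are multiplicative. -/
theorem serPush_conv (hπ : ∀ b, π (π b) = b) (hc : ∀ I J, c I J ≠ 0 → I.dim = J.dim)
    (F G : List (Face m) → B) (w : List (Face n)) :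
    serPush c (conv π F G) w = conv π (serPush c F) (serPush c G) w := by
  induction w generalizing F G with
  | nil => rw [serPush_nil, conv_nil, conv_nil, serPush_nil, serPush_nil]
  | cons I w ih =>
    rw [serPush_cons, conv_cons π hπ]
    have h1 (J : Face m) : (fun u => conv π F G (J :: u)) = fun u => F [] * G (J :: u) +
        conv π (fun u => F (J :: u)) (fun u => twist π [J] (G u)) u := by
      funext u; rw [conv_cons π hπ]
    have h2 (J : Face m) : serPush c (fun u => F [] * G (J :: u)) w =
        F [] * serPush c (fun u => G (J :: u)) w :=
      serPush_map c (LinearMap.mulLeft k (F [])) _ w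
    have h3 (J : Face m) : serPush c (fun u => twist π [J] (G u)) =
        fun u => twist π [J] (serPush c G u) := by
      funext u; exact serPush_map c (twist π [J]).toLinearMap _ u
    have h4 : (fun u => serPush c F (I :: u)) =
        fun u => ∑ J, c I J • serPush c (fun v => F (J :: v)) u := by
      funext u; exact serPush_cons c F I u
    rw [h4, conv_sum_left, serPush_nil, serPush_cons c G, Finset.mul_sum,
      ← Finset.sum_add_distrib]
    refine Finset.sum_congr rfl fun J _ => ?_
    rw [h1, serPush_add, h2, ih, h3, conv_smul_left, smul_add, Algebra.mul_smul_comm]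
    by_cases hIJ : c I J = 0
    · simp [hIJ]
    · have : twist π [J] = twist π [I] := twist_congr π (by
        rw [wdeg_singleton, wdeg_singleton, hc I J hIJ])
      rw [this]

theorem serPush_split (g : List (Face m) → k) (G : List (Face m) → M) (w : List (Face n)) :
    serPush c (fun v => ∑ b ∈ Finset.range (v.length + 1), g (v.take b) • G (v.drop b)) w =
      ∑ b ∈ Finset.range (w.length + 1), serPush c g (w.take b) • serPush c G (w.drop b) := by
  induction w generalizing g with
  | nil => simp [serPush_nil]
  | cons I w ih =>
    have h1 (J : Face m) : (fun u : List (Face m) => ∑ b ∈ Finset.range ((J :: u).length + 1),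
        g ((J :: u).take b) • G ((J :: u).drop b)) = fun u =>
        (∑ b ∈ Finset.range (u.length + 1), (fun v => g (J :: v)) (u.take b) • G (u.drop b)) +
          g [] • G (J :: u) := by
      funext u
      rw [List.length_cons, Finset.sum_range_succ']
      rfl
    have h2 (J : Face m) : serPush c (fun u : List (Face m) =>
        ∑ b ∈ Finset.range ((J :: u).length + 1), g ((J :: u).take b) • G ((J :: u).drop b)) w =
        (∑ b ∈ Finset.range (w.length + 1),
          serPush c (fun v => g (J :: v)) (w.take b) • serPush c G (w.drop b)) +
        g [] • serPush c (fun u => G (J :: u)) w := by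
      rw [h1, serPush_add]
      exact congrArg₂ (· + ·) (ih fun v => g (J :: v)) (serPush_smul c _ _ w)
    rw [serPush_cons, List.length_cons, Finset.sum_range_succ']
    simp only [h2, List.take_succ_cons, List.drop_succ_cons,
      List.take_zero, List.drop_zero, serPush_nil, serPush_cons c g, serPush_cons c G,
      smul_add, Finset.sum_add_distrib, Finset.smul_sum, Finset.sum_smul, smul_assoc]
    congr 1
    · exact Finset.sum_comm
    · exact Finset.sum_congr rfl fun J _ => smul_comm _ _ _

theorem serT_eq_sum (dL : Face n → List (Face n) → k) (F : List (Face n) → M)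
    (w : List (Face n)) : serT dL F w = ∑ I : Face n, ∑ b ∈ Finset.range (w.length + 1),
      dL I (w.take b) • F (I :: w.drop b) := Finset.sum_comm

theorem serPush_serT (dL : Face m → List (Face m) → k) (dL' : Face n → List (Face n) → k)
    (hd : ∀ J w, serPush c (dL J) w = ∑ I, c I J * dL' I w)
    (F : List (Face m) → M) (w : List (Face n)) :
    serPush c (serT dL F) w = serT dL' (serPush c F) w := by
  have h1 : serT dL F = fun v => ∑ J : Face m, ∑ b ∈ Finset.range (v.length + 1),
      dL J (v.take b) • F (J :: v.drop b) := by
    funext v; exact serT_eq_sum dL F v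
  rw [h1, serPush_sum]
  have h2 (J : Face m) := serPush_split c (dL J) (fun u => F (J :: u)) w
  simp only [h2, hd, serT, serPush_cons, Finset.sum_smul, Finset.smul_sum]
  rw [Finset.sum_comm]
  refine Finset.sum_congr rfl fun b _ => ?_
  rw [Finset.sum_comm]
  refine Finset.sum_congr rfl fun I _ => Finset.sum_congr rfl fun J _ => ?_
  rw [smul_smul, mul_comm]

/-- A degree preserving substitution that commutes with derivations on letters commutes with
them. -/
theorem serPush_serD (hc : ∀ I J, c I J ≠ 0 → I.dim = J.dim)
    (dL : Face m → List (Face m) → k) (dL' : Face n → List (Face n) → k)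
    (hd : ∀ J w, serPush c (dL J) w = ∑ I, c I J * dL' I w)
    (F : List (Face m) → M) (w : List (Face n)) :
    serPush c (serD dL F) w = serD dL' (serPush c F) w := by
  induction w generalizing F with
  | nil => rw [serPush_nil, serD_nil, serD_nil, ← serPush_serT c dL dL' hd, serPush_nil]
  | cons I w ih =>
    have h1 (J : Face m) : (fun u => serD dL F (J :: u)) = fun u => serT dL F (J :: u) +
        ws k [J] • serD dL (fun v => F (J :: v)) u := by
      funext u; exact serD_cons dL F J u
    have h4 : (fun u => serPush c F (I :: u)) =
        fun u => ∑ J, c I J • serPush c (fun v => F (J :: v)) u := by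
      funext u; exact serPush_cons c F I u
    have h5 (G : Face m → List (Face n) → M) :
        serD dL' (fun u => ∑ J, c I J • G J u) w = ∑ J, c I J • serD dL' (G J) w := by
      simp only [serD_sum, serD_smul]
    rw [serD_cons, serPush_cons, ← serPush_serT c dL dL' hd, serPush_cons c (serT dL F), h4, h5,
      Finset.smul_sum, ← Finset.sum_add_distrib]
    refine Finset.sum_congr rfl fun J _ => ?_
    rw [h1, serPush_add, serPush_smul, ih, smul_add, smul_comm (ws k [I])]
    by_cases hIJ : c I J = 0
    · simp [hIJ]
    · have : ws k [J] = ws k [I] := by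
        rw [ws, ws, wdeg_singleton, wdeg_singleton, hc I J hIJ]
      rw [this]

end Push

end Series

/-! ### Koszul signs of words -/

section PairSign

variable {n : ℕ}

theorem pairSign_nil : pairSign ([] : List (Face n)) = 1 := by simp [pairSign]

theorem prod_negOnePow {ι : Type*} (s : Finset ι) (e : ι → ℤ) :
    ∏ i ∈ s, ((e i).negOnePow : ℤ) = ((∑ i ∈ s, e i).negOnePow : ℤ) := by
  classical
  induction s using Finset.induction_on with
  | empty => simp
  | insert i s hi ih =>
    rw [Finset.prod_insert hi, Finset.sum_insert hi, Int.negOnePow_add, ih, Units.val_mul]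

theorem pairSign_cons (I : Face n) (w : List (Face n)) :
    pairSign (I :: w) = (((1 - (I.dim : ℤ)) * wdeg w).negOnePow : ℤ) * pairSign w := by
  have h1 : wdeg w = ∑ b : Fin w.length, (1 - ((w.get b).dim : ℤ)) := by
    rw [wdeg, ← List.sum_ofFn]
    congr 1
    conv_lhs => rw [← List.ofFn_get w, List.map_ofFn]
    rfl
  simp only [pairSign, Finset.prod_filter]
  simp only [List.length_cons]
  rw [Fin.prod_univ_succ, h1, Finset.mul_sum, ← prod_negOnePow]
  congr 1
  · rw [Fin.prod_univ_succ]
    simp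
  · refine Finset.prod_congr rfl fun a _ => ?_
    rw [Fin.prod_univ_succ]
    simp

theorem pairSign_singleton (I : Face n) : pairSign [I] = 1 := by
  rw [pairSign_cons, pairSign_nil]; simp

theorem pairSign_append (u v : List (Face n)) :
    pairSign (u ++ v) = pairSign u * pairSign v * ((wdeg u * wdeg v).negOnePow : ℤ) := by
  induction u with
  | nil => simp [pairSign_nil]
  | cons I u ih =>
    rw [List.cons_append, pairSign_cons, pairSign_cons, ih, wdeg_append, wdeg_cons, mul_add,
      add_mul, Int.negOnePow_add, Int.negOnePow_add]
    push_cast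
    ring

end PairSign

/-! ### The universal form-valued series -/

section Universal

variable {k : Type*} [Field k] {m n : ℕ}

/-- The sum over binary trees with leaves decorated by the basic forms of the letters of a word. -/
def treeForm (k : Type*) [Field k] {n : ℕ} (w : List (Face n)) : Om k n :=
  (comTransfer k n).inner (w.map fun J => Pi.single J 1)

/-- The sum of the operations `b` over all ways to cut a word in two. -/
def treeCut (k : Type*) [Field k] {n : ℕ} (w : List (Face n)) : Om k n :=
  ∑ a ∈ Finset.range (w.length + 1), -(parAlg k n (treeForm k (w.take a)) *
    treeForm k (w.drop a))

theorem comTransfer_b (x y : Om k n) : (comTransfer k n).b x y = -(parAlg k n x * y) := by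
  change ((-1 : k) • ((LinearMap.mul k (Om k n)) ∘ₗ parOm k n)) x y = _
  rw [parOm_eq]
  simp

theorem treeForm_nil : treeForm k ([] : List (Face n)) = 0 := by
  simp [treeForm, TransferData.inner]

theorem treeForm_singleton (I : Face n) : treeForm k [I] = basicForm k n I := by
  simp [treeForm, TransferData.inner, comTransfer, incl_single]

theorem treeCut_nil : treeCut k ([] : List (Face n)) = 0 := by
  simp [treeCut, treeForm_nil]

theorem treeCut_singleton (I : Face n) : treeCut k [I] = 0 := by
  simp [treeCut, Finset.sum_range_succ, treeForm_nil]

theorem treeCut_cons_cons (I J : Face n) (w : List (Face n)) :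
    treeCut k (I :: J :: w) = ∑ a ∈ Finset.range (w.length + 1),
      (comTransfer k n).b (treeForm k ((I :: J :: w).take (a + 1)))
        (treeForm k ((I :: J :: w).drop (a + 1))) := by
  rw [treeCut, List.length_cons, List.length_cons, Finset.sum_range_succ',
    Finset.sum_range_succ]
  have h1 : (I :: J :: w).drop (w.length + 1 + 1) = [] := by simp
  rw [h1, List.take_zero, treeForm_nil, map_zero, mul_zero, zero_mul, neg_zero, add_zero,
    add_zero]
  exact Finset.sum_congr rfl fun a _ => (comTransfer_b _ _).symm

theorem treeForm_cons_cons (I J : Face n) (w : List (Face n)) :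
    treeForm k (I :: J :: w) = -dupont k n (treeCut k (I :: J :: w)) := by
  rw [treeCut_cons_cons, treeForm, List.map_cons, List.map_cons, TransferData.inner,
    Finset.sum_range, List.length_map]
  simp only [treeForm, List.map_take, List.map_drop, List.map_cons]
  rfl

theorem treeForm_eq (w : List (Face n)) (hw : ∀ I, w ≠ [I]) :
    treeForm k w = -dupont k n (treeCut k w) := by
  match w with
  | [] => rw [treeForm_nil, treeCut_nil, map_zero, neg_zero]
  | [I] => exact absurd rfl (hw I)
  | I :: J :: w => exact treeForm_cons_cons I J w

theorem cInfty_map (w : List (Face n)) (hw : ∀ I, w ≠ [I]) :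
    cInfty k n (w.map fun J => Pi.single J 1) = proj k n (treeCut k w) := by
  match w with
  | [] => rw [treeCut_nil, map_zero]; rfl
  | [I] => exact absurd rfl (hw I)
  | I :: J :: w =>
    rw [treeCut_cons_cons, List.map_cons, List.map_cons, cInfty, TransferData.outer]
    simp only [treeForm, List.map_take, List.map_drop, List.map_cons, List.length_cons,
      List.length_map, Nat.add_sub_cancel]
    rfl

/-- The product of form-valued series. -/
def omConv (F G : List (Face n) → Om k m) : List (Face n) → Om k m :=
  conv (parAlg k m) F G

section
variable (F F' G G' H : List (Face n) → Om k m) (w : List (Face n))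

theorem omConv_apply : omConv F G w = 
  ∑ a ∈ Finset.range (w.length + 1),
    F (w.take a) * twist (parAlg k m) (w.take a) (G (w.drop a)) := rfl

theorem parAlg_omConv : parAlg k m (omConv F G w) =
   omConv (fun u => parAlg k m (F u)) (fun u => parAlg k m (G u)) w :=
  map_conv (parAlg k m) (parAlg k m) (fun b => Eq.refl (parAlg k m (parAlg k m b))) F G w

theorem omConv_assoc : omConv (omConv F G) H w = omConv F (omConv G H) w :=
  conv_assoc (parAlg k m) parAlg_parAlg F G H w

theorem omConv_add_left :
    omConv (fun u => F u + F' u) G w = omConv F G w + omConv F' G w := 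
  conv_add_left (parAlg k m) F F' G w

theorem omConv_add_right :
    omConv F (fun u => G u + G' u) w = omConv F G w + omConv F G' w := 
  conv_add_right (parAlg k m) F G G' w
theorem omConv_smul_left (c : k) : omConv (fun u => c • F u) G w = c • omConv F G w := 
  conv_smul_left (parAlg k m) c F G w
theorem omConv_smul_right (c : k) : omConv F (fun u => c • G u) w = c • omConv F G w := 
  conv_smul_right (parAlg k m) c F G w
theorem serD_omConv (dL : Face n → List (Face n) → k) (hdL : OddLetters dL) :
    serD dL (omConv F G) w = omConv (serD dL F) (fun u => parAlg k m (G u)) w +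
      omConv (fun u => ws k u • F u) (serD dL G) w := 
  serD_conv dL (parAlg k m) parAlg_parAlg hdL F G w
end

theorem serPush_omConv {l : ℕ} (c : Face n → Face l → k) (hc : ∀ I J, c I J ≠ 0 → I.dim = J.dim)
    (F G : List (Face l) → Om k m) (w : List (Face n)) :
    serPush c (omConv F G) w = omConv (serPush c F) (serPush c G) w := 
  serPush_conv c (parAlg k m) parAlg_parAlg hc F G w

section CharZero

variable [CharZero k]

theorem treeForm_mem (w : List (Face n)) : treeForm k w ∈ omGr k n (1 - wdeg w) := by
  induction h : w.length using Nat.strong_induction_on generalizing w with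
  | _ r ih =>
    by_cases hw : ∃ I, w = [I]
    · obtain ⟨I, rfl⟩ := hw
      rw [treeForm_singleton, wdeg_singleton, sub_sub_cancel]
      exact basicForm_mem_omGr I
    · push Not at hw
      rw [treeForm_eq w hw]
      have h1 : (1 : ℤ) - wdeg w = (2 - wdeg w) - 1 := by ring
      rw [h1]
      refine neg_mem (dupont_mem_omGr (sum_mem fun a ha => neg_mem ?_))
      have ha' : a ≤ w.length := Nat.lt_succ_iff.1 (Finset.mem_range.1 ha)
      rcases Nat.eq_zero_or_pos a with rfl | ha0
      · rw [List.take_zero, treeForm_nil, map_zero, zero_mul]; exact zero_mem _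
      rcases ha'.eq_or_lt with rfl | ha1
      · rw [List.drop_length, treeForm_nil, mul_zero]; exact zero_mem _
      have m1 := ih (w.take a).length (by rw [List.length_take]; omega) _ rfl
      have m2 := ih (w.drop a).length (by rw [List.length_drop]; omega) _ rfl
      rw [parAlg_of_mem m1]
      have m3 := mul_mem_omGr (Submodule.smul_mem _
        (((1 - wdeg (w.take a)).negOnePow : ℤ) : k) m1) m2
      have e : 1 - wdeg (w.take a) + (1 - wdeg (w.drop a)) = 2 - wdeg w := by
        rw [← wdeg_take_add_drop w a]; ring
      rwa [e] at m3

/-- The form-valued series `∑_w ± (tree sum of w) w`, that is the image of the universal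
Maurer–Cartan element `∑_I ω_I v_I` under the transferred quasi-isomorphism from `C_n` to the
forms. -/
def univForm (k : Type*) [Field k] {n : ℕ} (w : List (Face n)) : Om k n :=
  (pairSign w : k) • treeForm k w

/-- The universal series `∑_I ω_I v_I` with coefficients in `C_n`. -/
def univCochain (k : Type*) [Field k] {n : ℕ} (w : List (Face n)) : Cc k n :=
  fun J => letter k n J w

theorem univCochain_of_ne (w : List (Face n)) (hw : ∀ I, w ≠ [I]) : univCochain k w = 0 := by
  funext J
  exact if_neg (hw J)

theorem univCochain_singleton (I : Face n) : univCochain k [I] = Pi.single I 1 := by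
  funext J
  simp only [univCochain, letter, List.cons.injEq, and_true, Pi.single_apply, eq_comm]

theorem univForm_nil : univForm k ([] : List (Face n)) = 0 := by
  rw [univForm, treeForm_nil, smul_zero]

theorem univForm_mem (w : List (Face n)) : univForm k w ∈ omGr k n (1 - wdeg w) :=
  Submodule.smul_mem _ _ (treeForm_mem w)

theorem twist_of_mem {m : ℕ} {p : ℤ} (u : List (Face m)) {x : Om k n} (hx : x ∈ omGr k n p) :
    twist (parAlg k n) u x = (((wdeg u * p).negOnePow : ℤ) : k) • x := by
  by_cases h : Even (wdeg u)
  · rw [twist_of_even _ h, Int.negOnePow_even _ (h.mul_right p)]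
    simp
  · rw [twist_of_odd _ h, parAlg_of_mem hx]
    congr 3
    rw [Int.not_even_iff_odd] at h
    obtain ⟨c, hc⟩ := h
    rw [hc, add_mul, one_mul, Int.negOnePow_add, Int.negOnePow_even (2 * c * p)
      (by rw [mul_assoc]; exact even_two_mul _), one_mul]

theorem smul_eq_smul_neg_smul {V : Type*} [AddCommGroup V] [Module k V] {a b c : k}
    (h : a = -(b * c)) (x : V) : a • x = b • -(c • x) := by
  rw [h]; module

theorem smul_eq_neg_smul {V : Type*} [AddCommGroup V] [Module k V] {a b : k}
    (h : a = -b) (x : V) : a • x = -(b • x) := by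
  rw [h]; module

theorem conv_univForm (w : List (Face n)) :
    omConv (univForm k) (univForm k) w = (pairSign w : k) • treeCut k w := by
  rw [omConv_apply, treeCut, Finset.smul_sum]
  refine Finset.sum_congr rfl fun a _ => ?_
  rw [twist_of_mem _ (univForm_mem _), parAlg_of_mem (treeForm_mem _)]
  have h1 : pairSign w = pairSign (w.take a) * pairSign (w.drop a) *
      ((wdeg (w.take a) * wdeg (w.drop a)).negOnePow : ℤ) := by
    rw [← pairSign_append, List.take_append_drop]
  rw [univForm, univForm, om_smul_mul, om_mul_smul, om_mul_smul, om_smul_mul, smul_smul, smul_smul]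
  refine smul_eq_smul_neg_smul ?_ _
  have h2 : ((wdeg (w.take a) * (1 - wdeg (w.drop a))).negOnePow : ℤ) =
      -(((wdeg (w.take a) * wdeg (w.drop a)).negOnePow : ℤ) *
        ((1 - wdeg (w.take a)).negOnePow : ℤ)) := by
    rw [mul_sub, mul_one, Int.negOnePow_sub, Int.negOnePow_sub]
    simp [mul_comm]
  rw [h1, h2]
  push_cast
  ring

/-- The fixed point equation `α = i(∑_I ω_I v_I) - h(α α)` of the universal series `α`: a tree is
a leaf or is cut at its root. -/
theorem univForm_eq (w : List (Face n)) : univForm k w = incl k n (univCochain k w) -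
    dupont k n (omConv (univForm k) (univForm k) w) := by
  rw [conv_univForm, map_smul]
  by_cases hw : ∃ I, w = [I]
  · obtain ⟨I, rfl⟩ := hw
    rw [treeCut_singleton, map_zero, smul_zero, sub_zero, univCochain_singleton, incl_single,
      univForm, pairSign_singleton, treeForm_singleton, Int.cast_one, one_smul]
  · push Not at hw
    rw [univCochain_of_ne w hw, map_zero, zero_sub, univForm, treeForm_eq w hw, smul_neg]

/-- The parity operator of `C_n`. -/
def parC (k : Type*) [Field k] (n : ℕ) : Cc k n →ₗ[k] Cc k n :=
  LinearMap.pi fun I => ((-1 : k) ^ I.dim) • LinearMap.proj I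

theorem parC_apply (c : Cc k n) (I : Face n) : parC k n c I = (-1) ^ I.dim * c I := rfl

theorem parC_parC (c : Cc k n) : parC k n (parC k n c) = c := by
  funext I
  rw [parC_apply, parC_apply, ← mul_assoc, ← mul_pow]
  simp

theorem incl_parC (c : Cc k n) : incl k n (parC k n c) = parAlg k n (incl k n c) := by
  rw [incl_apply, incl_apply, map_sum]
  refine Finset.sum_congr rfl fun I _ => ?_
  rw [map_smul, parAlg_basicForm, parC_apply, smul_smul, mul_comm]

theorem incl_injective : Function.Injective (incl k n) :=
  Function.LeftInverse.injective proj_incl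

theorem incl_proj (x : Om k n) : incl k n (proj k n x) =
    x - (dOm k n (dupont k n x) + dupont k n (dOm k n x)) := by
  rw [dupont_homotopy, sub_sub_cancel]

theorem proj_parAlg (x : Om k n) : proj k n (parAlg k n x) = parC k n (proj k n x) := by
  apply incl_injective
  rw [incl_parC, incl_proj, incl_proj, map_sub, map_add, dupont_parAlg, dOm_parAlg, map_neg,
    map_neg, dOm_parAlg, dupont_parAlg, neg_neg, neg_neg]

theorem dC_parC (c : Cc k n) : dC k n (parC k n c) = -parC k n (dC k n c) := by
  apply incl_injective
  rw [map_neg, incl_parC, ← dOm_incl, ← dOm_incl, incl_parC, dOm_parAlg]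

theorem dC_pullC (θ : Fin (m + 1) →o Fin (n + 1)) (c : Cc k n) :
    dC k m (pullC k θ c) = pullC k θ (dC k n c) := by
  apply incl_injective
  rw [← dOm_incl, ← pullOm_incl, ← pullOm_incl, ← dOm_incl, pullOm_dOm]

theorem parC_pullC (θ : Fin (m + 1) →o Fin (n + 1)) (c : Cc k n) :
    parC k m (pullC k θ c) = pullC k θ (parC k n c) := by
  apply incl_injective
  rw [incl_parC, ← pullOm_incl, ← pullOm_incl, incl_parC, pullOm_parAlg]

theorem proj_pullOm (θ : Fin (m + 1) →o Fin (n + 1)) (x : Om k n) :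
    proj k m (pullOm k θ x) = pullC k θ (proj k n x) := by
  apply incl_injective
  rw [← pullOm_incl, incl_proj, incl_proj, map_sub, map_add, pullOm_dOm, pullOm_dupont,
    pullOm_dupont, pullOm_dOm]

/-- The differentials of the letters in terms of the universal series `α`: up to parity they are
the coefficients of `-(d(∑_I ω_I v_I) + p(α α))`. -/
theorem dLetter_eq (I : Face n) (w : List (Face n)) :
    dLetter k n I w = -parC k n (dC k n (univCochain k w) +
      proj k n (omConv (univForm k) (univForm k) w)) I := by
  have hs : (((1 - (I.dim : ℤ)).negOnePow : ℤ) : k) = -(-1) ^ I.dim := by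
    rw [Int.negOnePow_sub]
    simp [Int.negOnePow_def]
  rw [dLetter, hs, conv_univForm, map_smul, parC_apply]
  by_cases hw : ∃ I, w = [I]
  · obtain ⟨J, rfl⟩ := hw
    rw [treeCut_singleton, map_zero, smul_zero, add_zero, univCochain_singleton,
      pairSign_singleton, List.map_cons, List.map_nil, cInfty]
    simp
  · push Not at hw
    rw [cInfty_map w hw, univCochain_of_ne w hw, map_zero, zero_add, Pi.smul_apply, smul_eq_mul]
    ring

theorem dLetter_nil (I : Face n) : dLetter k n I [] = 0 := by
  simp [dLetter, cInfty]

/-- The operations of the transferred structure have degree `+1`. -/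
theorem dLetter_degree (I : Face n) (w : List (Face n)) (h : dLetter k n I w ≠ 0) :
    wdeg w = (1 - (I.dim : ℤ)) + 1 := by
  by_contra hne
  apply h
  rw [dLetter_eq, parC_apply, Pi.add_apply, conv_univForm, ← conv_univForm]
  have h2 : proj k n (omConv (univForm k) (univForm k) w) I = 0 := by
    rw [omConv_apply]
    refine proj_eq_zero_of_mem (p := 2 - wdeg w)
      (sum_mem (S := omGr k n (2 - wdeg w)) fun a _ => ?_) I (by omega)
    rw [twist_of_mem _ (univForm_mem _)]
    have e : 2 - wdeg w = 1 - wdeg (w.take a) + (1 - wdeg (w.drop a)) := by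
      rw [← wdeg_take_add_drop w a]; ring
    rw [e]
    exact mul_mem_omGr (univForm_mem _) (Submodule.smul_mem _ _ (univForm_mem _))
  have h3 : dC k n (univCochain k w) I = 0 := by
    by_cases hw : ∃ I, w = [I]
    · obtain ⟨J, rfl⟩ := hw
      rw [wdeg_singleton] at hne
      rw [univCochain_singleton]
      change proj k n (dOm k n (incl k n (Pi.single J 1))) I = 0
      rw [incl_single]
      exact proj_eq_zero_of_mem (dOm_mem_omGr (basicForm_mem_omGr J)) I (by omega)
    · push Not at hw
      rw [univCochain_of_ne w hw, map_zero]
      rfl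
  rw [h2, h3, add_zero, mul_zero, neg_zero]

theorem oddLetters_dLetter : OddLetters (dLetter k n) := by
  intro I u h
  rw [dLetter_degree I u h, wdeg_singleton, Int.even_add_one]

end CharZero

/-! ### The Stasheff identities -/

theorem serD_eq_zero {M : Type*} [AddCommGroup M] [Module k M] (dL : Face n → List (Face n) → k)
    (F : List (Face n) → M) (hF : ∀ I u, F (I :: u) = 0) (w : List (Face n)) :
    serD dL F w = 0 := by
  have hF' (u v : List (Face n)) (I : Face n) : F (u ++ I :: v) = 0 := by
    cases u <;> simp [hF]
  simp [serD, hF']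

theorem serD_letter (dL : Face n → List (Face n) → k) (J : Face n) (w : List (Face n)) :
    serD dL (letter k n J) w = dL J w := by
  have hT : serT dL (letter k n J) w = dL J w := by
    rw [serT, Finset.sum_eq_single w.length, Finset.sum_eq_single J]
    · simp [letter]
    · intro I _ hI
      simp [letter, hI]
    · simp
    · intro b hb hbw
      have hb' : b < w.length := lt_of_le_of_ne (Nat.lt_succ_iff.1 (Finset.mem_range.1 hb)) hbw
      refine Finset.sum_eq_zero fun I _ => ?_
      have : ¬ (I :: w.drop b = [J]) := by
        intro h
        have := congrArg List.length h
        simp at this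
        omega
      simp [letter, this]
    · simp
  cases w with
  | nil => rw [serD_nil, hT]
  | cons x w =>
    rw [serD_cons, hT, serD_eq_zero, smul_zero, add_zero]
    intro I u
    simp [letter]

theorem serD_univCochain (dL : Face n → List (Face n) → k) (w : List (Face n)) :
    serD dL (univCochain k) w = fun I => dL I w := by
  funext I
  rw [← serD_letter dL I w]
  exact (serD_map dL (LinearMap.proj I) (univCochain k) w).symm

section CharZero

variable [CharZero k]

theorem parC_serD_univCochain (w : List (Face n)) :
    parC k n (serD (dLetter k n) (univCochain k) w) = -(dC k n (univCochain k w) +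
      proj k n (omConv (univForm k) (univForm k) w)) := by
  rw [serD_univCochain]
  have : (fun I => dLetter k n I w) = -parC k n (dC k n (univCochain k w) +
      proj k n (omConv (univForm k) (univForm k) w)) := by
    funext I; exact dLetter_eq I w
  rw [this, map_neg, parC_parC]

/-- The total differential of form-valued series: the de Rham differential of the coefficients
plus, up to the parity of the coefficients, the derivation of the words. -/
def totD (F : List (Face n) → Om k n) (w : List (Face n)) : Om k n :=
  parAlg k n (serD (dLetter k n) F w) + dOm k n (F w)

/-- A product of series vanishes in length `r` if the first factor vanishes in smaller lengths and
the second one has no constant term. -/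
theorem conv_mul_mem_zero (F G : List (Face n) → Om k n) (r : ℕ) (hF : ∀ w, w.length < r → F w = 0)
    (hG : G [] = 0) (w : List (Face n)) (hw : w.length = r) :
    omConv F G w = 0 := by
  rw [omConv_apply]
  refine Finset.sum_eq_zero fun a ha => ?_
  have ha' : a ≤ w.length := Nat.lt_succ_iff.1 (Finset.mem_range.1 ha)
  rcases ha'.eq_or_lt with rfl | ha1
  · rw [List.drop_length, hG, map_zero, mul_zero]
  · rw [hF _ (by rw [List.length_take]; omega), zero_mul]

/-- A product of series vanishes in length `r` if the second factor vanishes in smaller lengths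
and the first one has no constant term. -/
theorem conv_mul_mem_zero' (F G : List (Face n) → Om k n) (r : ℕ)
    (hG : ∀ w, w.length < r → G w = 0)
    (hF : F [] = 0) (w : List (Face n)) (hw : w.length = r) :
    omConv F G w = 0 := by
  rw [omConv_apply]
  refine Finset.sum_eq_zero fun a ha => ?_
  rcases Nat.eq_zero_or_pos a with rfl | ha0
  · rw [List.take_zero, hF, zero_mul]
  · have ha' : a ≤ w.length := Nat.lt_succ_iff.1 (Finset.mem_range.1 ha)
    rw [hG _ (by rw [List.length_drop]; omega), map_zero, mul_zero]

theorem parAlg_serD_conv (w : List (Face n)) :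
    parAlg k n (serD (dLetter k n) (omConv (univForm k) (univForm k)) w) =
      omConv (fun u => parAlg k n (serD (dLetter k n) (univForm k) u)) (univForm k) w -
      omConv (univForm k)
        (fun u => parAlg k n (serD (dLetter k n) (univForm k) u)) w := by
  rw [serD_omConv _ _ _ _ oddLetters_dLetter, map_add,
    parAlg_omConv,
    parAlg_omConv, sub_eq_add_neg]
  simp only [parAlg_parAlg]
  congr 1
  have h1 : (fun u : List (Face n) => parAlg k n (ws k u • univForm k u)) =
      fun u => (-1 : k) • univForm k u := by
    funext u
    rw [map_smul, parAlg_of_mem (univForm_mem u), smul_smul]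
    congr 1
    rw [Int.negOnePow_sub, ws]
    have := negOnePow_mul_self (k := k) (wdeg u)
    simp only [Int.negOnePow_one, Units.val_mul, Units.val_neg, Units.val_one, Int.cast_mul,
      Int.cast_neg, Int.cast_one]
    linear_combination -this
  rw [h1, omConv_smul_left]
  exact neg_one_smul (M := Om k n) k _

theorem dOm_conv (w : List (Face n)) :
    dOm k n (omConv (univForm k) (univForm k) w) =
      omConv (fun u => dOm k n (univForm k u)) (univForm k) w -
      omConv (univForm k) (fun u => dOm k n (univForm k u)) w := by
  rw [omConv_apply, map_sum, omConv_apply, omConv_apply, ← Finset.sum_sub_distrib]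
  refine Finset.sum_congr rfl fun a _ => ?_
  rw [dOm_skew, AlgHom.id_apply, sub_eq_add_neg]
  congr 1
  rw [parAlg_of_mem (univForm_mem _), twist_of_mem _ (univForm_mem _), map_smul,
    twist_of_mem _ (dOm_mem_omGr (univForm_mem _)), om_smul_mul, om_mul_smul, om_mul_smul,
    smul_smul]
  refine (smul_eq_neg_smul ?_ _)
  rw [Int.negOnePow_sub, mul_add, Int.negOnePow_add, mul_one]
  have := negOnePow_mul_self (k := k) (wdeg (w.take a))
  push_cast
  rw [mul_comm]
  simp

/-- The universal series `α` satisfies the Maurer–Cartan equation `Dα + α α = 0`. The defect `E`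
satisfies `E = h(E α - α E)`, as `d h + h d = 1 - i p`, and so vanishes by induction on the length
of words. -/
theorem totD_univForm (w : List (Face n)) :
    totD (univForm k) w + omConv (univForm k) (univForm k) w = 0 := by
  set E : List (Face n) → Om k n := fun w =>
    totD (univForm k) w + omConv (univForm k) (univForm k) w with hE
  change E w = 0
  -- the fixed point equation and the homotopy identity express `E` through `h`
  have h1 (w : List (Face n)) : E w = dupont k n
      (totD (omConv (univForm k) (univForm k)) w) := by
    have e1 : univForm k (n := n) = fun w => incl k n (univCochain k w) -
        dupont k n (omConv (univForm k) (univForm k) w) := by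
      funext u; exact univForm_eq u
    have e2 : serD (dLetter k n) (univForm k (n := n)) w =
        incl k n (serD (dLetter k n) (univCochain k) w) -
        dupont k n (serD (dLetter k n) (omConv (univForm k) (univForm k)) w) := by
      conv_lhs => rw [e1]
      rw [serD_sub, serD_map _ (incl k n) (univCochain k) w, serD_map _ (dupont k n)
        (omConv (univForm k) (univForm k)) w]
    have e3 := dupont_homotopy n (omConv (univForm k) (univForm k) w)
    have e4 : dOm k n (univForm k w) = incl k n (dC k n (univCochain k w)) -
        dOm k n (dupont k n (omConv (univForm k) (univForm k) w)) := by
      rw [univForm_eq w, map_sub, dOm_incl]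
    simp only [hE, totD]
    rw [e2, e4, map_sub (parAlg k n), ← incl_parC, parC_serD_univCochain,
      map_neg (incl k n), map_add (incl k n), map_add (dupont k n), dupont_parAlg]
    rw [← eq_sub_iff_add_eq] at e3
    rw [e3]
    abel
  have h2 (w : List (Face n)) : totD (omConv (univForm k) (univForm k)) w =
      omConv E (univForm k) w - omConv (univForm k) E w := by
    simp only [hE, totD]
    rw [parAlg_serD_conv, dOm_conv, omConv_add_left, omConv_add_left, omConv_add_right,
      omConv_add_right, omConv_assoc]
    abel
  induction h : w.length using Nat.strong_induction_on generalizing w with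
  | _ r ih =>
    have hlt (u : List (Face n)) (hu : u.length < r) : E u = 0 := ih _ hu u rfl
    rw [h1, h2, conv_mul_mem_zero _ _ r hlt univForm_nil w h,
      conv_mul_mem_zero' _ _ r hlt univForm_nil w h, sub_zero, map_zero]

theorem proj_totD_conv (w : List (Face n)) :
    proj k n (totD (omConv (univForm k) (univForm k)) w) = 0 := by
  have e3 : (fun u => totD (univForm k (n := n)) u) =
      fun u => (-1 : k) • omConv (univForm k) (univForm k) u := by
    funext u
    rw [eq_neg_of_add_eq_zero_left (totD_univForm u)]
    exact (neg_one_smul k _).symm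
  have e1 := omConv_add_left (fun u => parAlg k n (serD (dLetter k n) (univForm k) u))
    (fun u => dOm k n (univForm k u)) (univForm k) w
  have e2 := omConv_add_right (univForm k)
    (fun u => parAlg k n (serD (dLetter k n) (univForm k) u))
    (fun u => dOm k n (univForm k u)) w
  change omConv (fun u => totD (univForm k) u) _ w = _ at e1
  change omConv (univForm k) (fun u => totD (univForm k) u) w = _ at e2
  rw [e3, omConv_smul_left] at e1
  rw [e3, omConv_smul_right, ← omConv_assoc] at e2
  have : totD (omConv (univForm k) (univForm k)) w = 0 := by
    rw [totD, parAlg_serD_conv, dOm_conv, sub_add_sub_comm, ← e1, ← e2]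
    exact sub_self _
  rw [this, map_zero]

/-- The Stasheff identities for the transferred structure on `C_n`. They follow from the
Maurer–Cartan equation for the universal series `α`, because `D(α α) = 0`. -/
theorem serD_dLetter (I : Face n) (w : List (Face n)) :
    serD (dLetter k n) (dLetter k n I) w = 0 := by
  have h2 : (fun w : List (Face n) => parC k n (serD (dLetter k n) (univCochain k) w)) =
      fun w => (-1 : k) • (dC k n (univCochain k w) +
        proj k n (omConv (univForm k) (univForm k) w)) := by
    funext u
    rw [parC_serD_univCochain, neg_one_smul]
  have h3 : parC k n (serD (dLetter k n) (fun u =>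
      parC k n (serD (dLetter k n) (univCochain k) u)) w) = 0 := by
    have e2 := proj_totD_conv (k := k) w
    rw [totD, map_add, proj_dOm] at e2
    have e3 := parC_serD_univCochain (k := k) w
    rw [h2, serD_smul, serD_add, serD_map _ (dC k n) (univCochain k) w, serD_map _ (proj k n)
      (omConv (univForm k) (univForm k)) w, neg_one_smul, map_neg, map_add,
      ← proj_parAlg, ← neg_neg (parC k n (dC k n _)), ← dC_parC, e3, map_neg (dC k n),
      map_add (dC k n), dC_dC, zero_add, neg_neg, add_comm, e2, neg_zero]
  rw [serD_map _ (parC k n) (serD (dLetter k n) (univCochain k)) w, parC_parC] at h3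
  have h4 : serD (dLetter k n) (univCochain k) = fun w I => dLetter k n I w := by
    funext w; exact serD_univCochain _ w
  rw [h4] at h3
  have h5 : dLetter k n I = fun u => (LinearMap.proj I : Cc k n →ₗ[k] k)
      ((fun (w : List (Face n)) J => dLetter k n J w) u) := rfl
  conv_lhs => rw [h5]
  rw [serD_map _ (LinearMap.proj I : Cc k n →ₗ[k] k), h3]
  rfl

/-! ### Naturality of the transferred structure -/

/-- The matrix of `θ^* : C_n → C_m`. -/
def pullCoef (k : Type*) [Field k] {m n : ℕ} (θ : Fin (m + 1) →o Fin (n + 1)) (I : Face n)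
    (J : Face m) : k := pullC k θ (Pi.single I 1) J

theorem pullCoef_dim (θ : Fin (m + 1) →o Fin (n + 1)) (I : Face n) (J : Face m)
    (h : pullCoef k θ I J ≠ 0) : I.dim = J.dim := by
  by_contra hne
  refine h ?_
  change proj k m (pullOm k θ (incl k n (Pi.single I 1))) J = 0
  rw [incl_single]
  exact proj_eq_zero_of_mem (pullOm_mem_omGr θ (basicForm_mem_omGr I)) J (by exact_mod_cast hne)

theorem pullC_apply (θ : Fin (m + 1) →o Fin (n + 1)) (c : Cc k n) (J : Face m) :
    pullC k θ c J = ∑ I, pullCoef k θ I J * c I := by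
  conv_lhs => rw [pi_eq_sum_univ' c, map_sum, Finset.sum_apply]
  refine Finset.sum_congr rfl fun I _ => ?_
  rw [map_smul, Pi.smul_apply, smul_eq_mul, mul_comm]
  rfl

theorem serPush_univCochain (θ : Fin (m + 1) →o Fin (n + 1)) (w : List (Face n)) :
    serPush (pullCoef k θ) (univCochain k) w = pullC k θ (univCochain k w) := by
  match w with
  | [] => rw [serPush_nil, univCochain_of_ne _ (by simp), univCochain_of_ne _ (by simp), map_zero]
  | [I] =>
    simp only [serPush_cons, serPush_nil, univCochain_singleton]
    exact (pi_eq_sum_univ' _).symm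
  | I :: I' :: w =>
    rw [univCochain_of_ne _ (by simp), map_zero, serPush_cons]
    refine Finset.sum_eq_zero fun J _ => ?_
    rw [serPush_cons]
    simp [serPush, univCochain_of_ne]

theorem pullOm_omConv (θ : Fin (m + 1) →o Fin (n + 1)) (F G : List (Face n) → Om k n)
    (w : List (Face n)) : pullOm k θ (omConv F G w) =
      omConv (fun u => pullOm k θ (F u)) (fun u => pullOm k θ (G u)) w := by
  simp only [omConv_apply, map_sum, map_mul]
  refine Finset.sum_congr rfl fun a _ => ?_
  by_cases h : Even (wdeg (w.take a))
  · simp [twist_of_even _ h]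
  · simp [twist_of_odd _ h, pullOm_parAlg]

/-- The universal series is natural in the simplex, by the fixed point equation and the naturality
of `i_n` and `h_n`. -/
theorem serPush_univForm (θ : Fin (m + 1) →o Fin (n + 1)) (w : List (Face n)) :
    serPush (pullCoef k θ) (univForm k) w = pullOm k θ (univForm k w) := by
  induction h : w.length using Nat.strong_induction_on generalizing w with
  | _ r ih =>
    have e1 : univForm k (n := m) = fun w => incl k m (univCochain k w) -
        dupont k m (omConv (univForm k) (univForm k) w) := by
      funext u; exact univForm_eq u
    have e2 : serPush (pullCoef k θ) (univForm k) w =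
        incl k m (serPush (pullCoef k θ) (univCochain k) w) -
        dupont k m (serPush (pullCoef k θ)
          (omConv (univForm k) (univForm k)) w) := by
      conv_lhs => rw [e1]
      rw [serPush_sub, serPush_map _ (incl k m) (univCochain k) w, serPush_map _ (dupont k m)
        (omConv (univForm k) (univForm k)) w]
    rw [e2, serPush_omConv _ (pullCoef_dim θ), serPush_univCochain, univForm_eq w,
      map_sub, pullOm_incl, pullOm_dupont, pullOm_omConv θ]
    congr 2
    rw [omConv_apply, omConv_apply]
    refine Finset.sum_congr rfl fun a ha => ?_
    have ha' : a ≤ w.length := Nat.lt_succ_iff.1 (Finset.mem_range.1 ha)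
    rcases Nat.eq_zero_or_pos a with rfl | ha0
    · rw [List.take_zero, serPush_nil, univForm_nil, univForm_nil, map_zero, zero_mul, zero_mul]
    rcases ha'.eq_or_lt with rfl | ha1
    · rw [List.drop_length]
      simp [serPush_nil, univForm_nil]
    rw [ih (w.take a).length (by rw [List.length_take]; omega) _ rfl,
      ih (w.drop a).length (by rw [List.length_drop]; omega) _ rfl]

/-- The transferred structure on `C_n` is natural in the simplex. -/
theorem serPush_dLetter (θ : Fin (m + 1) →o Fin (n + 1)) (J : Face m) (w : List (Face n)) :
    serPush (pullCoef k θ) (dLetter k m J) w = ∑ I, pullCoef k θ I J * dLetter k n I w := by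
  have h0 (u : List (Face n)) : serPush (pullCoef k θ) (univForm k) u =
    pullOm k θ (univForm k u) := serPush_univForm θ u
  have h1 : dLetter k m J = fun u => (LinearMap.proj J ∘ₗ (-parC k m)) (dC k m (univCochain k u) +
      proj k m (omConv (univForm k) (univForm k) u)) := by
    funext u; rw [dLetter_eq]; rfl
  rw [h1, serPush_map _ (LinearMap.proj J ∘ₗ (-parC k m)) (fun u => dC k m (univCochain k u) +
      proj k m (omConv (univForm k) (univForm k) u)) w, serPush_add,
    serPush_map _ (dC k m) (univCochain k) w, serPush_map _ (proj k m)
    (omConv (univForm k) (univForm k)) w, serPush_omConv _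
    (pullCoef_dim θ), serPush_univCochain, funext h0, ← pullOm_omConv, proj_pullOm,
    dC_pullC, ← map_add]
  change (-parC k m (pullC k θ _)) J = _
  rw [parC_pullC, ← map_neg, pullC_apply]
  refine Finset.sum_congr rfl fun I _ => ?_
  rw [dLetter_eq]
  rfl

/-- Substitution commutes with the differential. -/
theorem serPush_dSer {M : Type*} [AddCommGroup M] [Module k M] (θ : Fin (m + 1) →o Fin (n + 1))
    (F : List (Face m) → M) (w : List (Face n)) :
    serPush (pullCoef k θ) (serD (dLetter k m) F) w =
      serD (dLetter k n) (serPush (pullCoef k θ) F) w :=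
  serPush_serD _ (pullCoef_dim θ) _ _ (serPush_dLetter θ) F w

end CharZero

end Universal

/-! ### The differential of the completed tensor algebra -/

section TensorAlgebra

variable {k : Type*} [Field k] {m n : ℕ}

/-- The product of the completed tensor algebra. -/
def tmul (k : Type*) [Field k] (n : ℕ) : TSer k n →ₗ[k] TSer k n →ₗ[k] TSer k n :=
  LinearMap.mk₂ k (conv (AlgHom.id k k))
    (fun f f' g => funext fun w => conv_add_left _ f f' g w)
    (fun c f g => funext fun w => conv_smul_left _ c f g w)
    (fun f g g' => funext fun w => conv_add_right _ f g g' w)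
    (fun c f g => funext fun w => conv_smul_right _ c f g w)

theorem tmul_eq_conv (f g : TSer k n) : tmul k n f g = conv (AlgHom.id k k) f g := rfl

theorem tmul_apply (f g : TSer k n) (w : List (Face n)) :
    tmul k n f g w = ∑ a ∈ Finset.range (w.length + 1), f (w.take a) * g (w.drop a) := by
  rw [tmul_eq_conv, conv]
  simp only [twist_id]
  rfl

theorem tmul_assoc (f g h : TSer k n) :
    tmul k n (tmul k n f g) h = tmul k n f (tmul k n g h) :=
  funext fun w => conv_assoc (AlgHom.id k k) (fun _ => rfl) f g h w

/-- The operator `f ↦ (-1)^{i|f|} f` on series. -/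
def sgnSer (k : Type*) [Field k] (n : ℕ) (i : ℤ) : TSer k n →ₗ[k] TSer k n where
  toFun f w := (((i * wdeg w).negOnePow : ℤ) : k) * f w
  map_add' f g := funext fun w => mul_add _ _ _
  map_smul' c f := funext fun w => by simp only [Pi.smul_apply, smul_eq_mul, RingHom.id_apply]; ring

theorem sgnSer_apply (i : ℤ) (f : TSer k n) (w : List (Face n)) :
    sgnSer k n i f w = (((i * wdeg w).negOnePow : ℤ) : k) * f w := rfl

theorem sgnSer_sgnSer (i j : ℤ) (f : TSer k n) :
    sgnSer k n i (sgnSer k n j f) = sgnSer k n (i + j) f := by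
  funext w
  rw [sgnSer_apply, sgnSer_apply, sgnSer_apply, add_mul, Int.negOnePow_add, ← mul_assoc]
  push_cast
  ring

theorem sgnSer_tmul (i : ℤ) (f g : TSer k n) :
    sgnSer k n i (tmul k n f g) = tmul k n (sgnSer k n i f) (sgnSer k n i g) := by
  funext w
  rw [sgnSer_apply, tmul_apply, tmul_apply, Finset.mul_sum]
  refine Finset.sum_congr rfl fun a _ => ?_
  rw [sgnSer_apply, sgnSer_apply, ← wdeg_take_add_drop w a, mul_add, Int.negOnePow_add]
  push_cast
  ring

/-- Series supported on words of degree `i`. -/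
def homSer (k : Type*) [Field k] (n : ℕ) (i : ℤ) : Submodule k (TSer k n) where
  carrier := {f | ∀ w, wdeg w ≠ i → f w = 0}
  zero_mem' := fun _ _ => rfl
  add_mem' := fun {f g} hf hg w hw => by rw [Pi.add_apply, hf w hw, hg w hw, add_zero]
  smul_mem' := fun c f hf w hw => by rw [Pi.smul_apply, hf w hw, smul_zero]

theorem sgnSer_of_mem {i j : ℤ} {f : TSer k n} (hf : f ∈ homSer k n j) :
    sgnSer k n i f = (((i * j).negOnePow : ℤ) : k) • f := by
  funext w
  by_cases hw : wdeg w = j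
  · rw [sgnSer_apply, hw]; rfl
  · rw [sgnSer_apply, Pi.smul_apply, hf w hw, mul_zero, smul_zero]

theorem ws_smul_of_mem {i : ℤ} {f : TSer k n} (hf : f ∈ homSer k n i) :
    (fun u => ws k u • f u) = ((i.negOnePow : ℤ) : k) • f := by
  have := sgnSer_of_mem (i := 1) hf
  rw [one_mul] at this
  rw [← this]
  funext w
  rw [sgnSer_apply, one_mul]
  rfl

theorem tbr_of_mem {i : ℤ} {f : TSer k n} (hf : f ∈ homSer k n i) (g : TSer k n) :
    tbr k n f g = tmul k n f g - tmul k n (sgnSer k n i g) f := by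
  funext w
  rw [Pi.sub_apply, tbr_apply, tmul_apply, tmul_apply, ← Finset.sum_sub_distrib]
  refine Finset.sum_congr rfl fun a _ => ?_
  congr 1
  by_cases hw : wdeg (w.drop a) = i
  · rw [sgnSer_apply, hw, mul_comm i]; ring
  · rw [hf _ hw, mul_zero, mul_zero, mul_zero]

theorem tmul_mem_homSer {i j : ℤ} {f g : TSer k n} (hf : f ∈ homSer k n i)
    (hg : g ∈ homSer k n j) : tmul k n f g ∈ homSer k n (i + j) := by
  intro w hw
  rw [tmul_apply]
  refine Finset.sum_eq_zero fun a _ => ?_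
  have hd := wdeg_take_add_drop w a
  by_cases h : wdeg (w.take a) = i
  · rw [hg (w.drop a) (by omega), mul_zero]
  · rw [hf _ h, zero_mul]

theorem tbr_mem_homSer {i j : ℤ} {f g : TSer k n} (hf : f ∈ homSer k n i)
    (hg : g ∈ homSer k n j) : tbr k n f g ∈ homSer k n (i + j) := by
  rw [tbr_of_mem hf, sgnSer_of_mem hg]
  refine sub_mem (tmul_mem_homSer hf hg) ?_
  rw [map_smul, LinearMap.smul_apply, add_comm]
  exact Submodule.smul_mem _ _ (tmul_mem_homSer hg hf)

theorem letter_mem_homSer (I : Face n) : letter k n I ∈ homSer k n (1 - (I.dim : ℤ)) := by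
  intro w hw
  refine if_neg ?_
  rintro rfl
  exact hw (wdeg_singleton I)

theorem tbr_antisymm {i j : ℤ} {f g : TSer k n} (hf : f ∈ homSer k n i) (hg : g ∈ homSer k n j) :
    tbr k n f g = -((((i * j).negOnePow : ℤ) : k) • tbr k n g f) := by
  rw [tbr_of_mem hf, tbr_of_mem hg, sgnSer_of_mem hf, sgnSer_of_mem hg, map_smul, map_smul,
    LinearMap.smul_apply, LinearMap.smul_apply, smul_sub, smul_smul, mul_comm j i,
    negOnePow_mul_self, one_smul]
  abel

/-- The Jacobi identity, in the form of the derivation rule for `ad f`. -/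
theorem tbr_jacobi {i j : ℤ} {f g : TSer k n} (hf : f ∈ homSer k n i) (hg : g ∈ homSer k n j)
    (h : TSer k n) : tbr k n f (tbr k n g h) = tbr k n (tbr k n f g) h +
      (((i * j).negOnePow : ℤ) : k) • tbr k n g (tbr k n f h) := by
  rw [tbr_of_mem (tbr_mem_homSer hf hg), tbr_of_mem hf, tbr_of_mem hg, tbr_of_mem hf g,
    tbr_of_mem hf h, tbr_of_mem hg]
  simp only [map_sub, LinearMap.sub_apply, sgnSer_tmul, sgnSer_sgnSer, sgnSer_of_mem hf,
    sgnSer_of_mem hg, map_smul, LinearMap.smul_apply, tmul_assoc, smul_sub, smul_smul,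
    mul_comm j i, negOnePow_mul_self, one_smul, add_comm j i]
  abel

theorem dSer_eq (f : TSer k n) : dSer k n f = serD (dLetter k n) f := by
  funext w
  simp only [serD, smul_eq_mul]
  rfl

theorem pushSer_eq (θ : Fin (m + 1) →o Fin (n + 1)) (f : TSer k m) :
    pushSer k θ f = serPush (pullCoef k θ) f := by
  funext w
  simp only [serPush, smul_eq_mul, mul_comm _ (f _)]
  rfl

theorem lenPart_apply (r : ℕ) (f : TSer k n) (w : List (Face n)) :
    lenPart k n r f w = if w.length = r then f w else 0 := rfl

theorem lenPart_of_length {r : ℕ} {f : TSer k n} {w : List (Face n)} (hw : w.length = r) :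
    lenPart k n r f w = f w := if_pos hw

/-- Left shift of a series by the letter `I`: the coefficient of `w` becomes that of `I w`. -/
def shift (k : Type*) [Field k] {n : ℕ} (I : Face n) : TSer k n →ₗ[k] TSer k n where
  toFun f w := f (I :: w)
  map_add' _ _ := rfl
  map_smul' _ _ := rfl

theorem shift_apply (I : Face n) (f : TSer k n) (w : List (Face n)) :
    shift k I f w = f (I :: w) := rfl

theorem letter_tmul_nil (I : Face n) (f : TSer k n) : tmul k n (letter k n I) f [] = 0 := by
  rw [tmul_eq_conv, conv_nil]; simp [letter]

theorem letter_tmul_cons (I J : Face n) (f : TSer k n) (w : List (Face n)) :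
    tmul k n (letter k n I) f (J :: w) = if J = I then f w else 0 := by
  rw [tmul_apply, List.length_cons, Finset.sum_range_succ', Finset.sum_eq_single 0]
  · simp [letter]
  · intro a ha ha0
    have : ¬ ((J :: w).take (a + 1) = [I]) := by
      intro h
      have := congrArg List.length h
      rw [List.length_take, List.length_cons] at this
      have h2 := Finset.mem_range.1 ha
      simp only [List.length_cons, List.length_nil] at this
      omega
    rw [letter, if_neg this, zero_mul]
  · simp

/-- Every series is determined by its constant term and its left shifts. -/
theorem eq_sum_letter_tmul (f : TSer k n) :
    f = f [] • (fun w => if w = [] then 1 else 0) + ∑ I, tmul k n (letter k n I) (shift k I f) := by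
  funext w
  rw [Pi.add_apply, Finset.sum_apply]
  cases w with
  | nil => simp [letter_tmul_nil]
  | cons J w => simp [letter_tmul_cons, shift_apply]

section CharZero

variable [CharZero k]

theorem dSer_letter (I : Face n) : dSer k n (letter k n I) = dLetter k n I := by
  funext w
  rw [dSer_eq, serD_letter]

/-- The differential is an odd derivation of the completed tensor algebra. -/
theorem dSer_tmul {i : ℤ} {f : TSer k n} (hf : f ∈ homSer k n i) (g : TSer k n) :
    dSer k n (tmul k n f g) = tmul k n (dSer k n f) g +
      ((i.negOnePow : ℤ) : k) • tmul k n f (dSer k n g) := by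
  funext w
  have := serD_conv (dLetter k n) (AlgHom.id k k) (fun _ => rfl) oddLetters_dLetter f g w
  rw [dSer_eq, tmul_eq_conv, this, ws_smul_of_mem hf, ← LinearMap.smul_apply, ← map_smul,
    dSer_eq, dSer_eq]
  rfl

theorem dSer_mem_homSer {i : ℤ} {f : TSer k n} (hf : f ∈ homSer k n i) :
    dSer k n f ∈ homSer k n (i + 1) := by
  intro w hw
  rw [dSer, LinearMap.coe_mk, AddHom.coe_mk]
  refine Finset.sum_eq_zero fun a _ => Finset.sum_eq_zero fun b _ =>
    Finset.sum_eq_zero fun I _ => ?_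
  by_cases h : dLetter k n I ((w.drop a).take b) = 0
  · rw [h, mul_zero, zero_mul]
  · have h1 := dLetter_degree I _ h
    rw [hf, mul_zero]
    rw [wdeg_append, wdeg_cons]
    have h2 := wdeg_take_add_drop w a
    have h3 := wdeg_take_add_drop (w.drop a) b
    omega

theorem dSer_sgnSer (i : ℤ) (f : TSer k n) :
    dSer k n (sgnSer k n i f) = ((i.negOnePow : ℤ) : k) • sgnSer k n i (dSer k n f) := by
  funext w
  rw [Pi.smul_apply, sgnSer_apply]
  simp only [dSer, LinearMap.coe_mk, AddHom.coe_mk, Finset.mul_sum, Finset.smul_sum]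
  refine Finset.sum_congr rfl fun a _ => Finset.sum_congr rfl fun b _ =>
    Finset.sum_congr rfl fun I _ => ?_
  by_cases h : dLetter k n I ((w.drop a).take b) = 0
  · rw [h]; simp
  · have h1 := dLetter_degree I _ h
    have h2 := wdeg_take_add_drop w a
    have h3 := wdeg_take_add_drop (w.drop a) b
    have h4 : wdeg w = wdeg (w.take a ++ I :: (w.drop a).drop b) + 1 := by
      rw [wdeg_append, wdeg_cons]; omega
    rw [sgnSer_apply, h4, mul_add, mul_one, Int.negOnePow_add]
    have h5 := negOnePow_mul_self (k := k) i
    push_cast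
    rw [smul_eq_mul]
    linear_combination (-(((wdeg (w.take a)).negOnePow : ℤ) : k) *
      dLetter k n I ((w.drop a).take b) *
        (((i * wdeg (w.take a ++ I :: (w.drop a).drop b)).negOnePow
        : ℤ) : k) * f (w.take a ++ I :: (w.drop a).drop b)) * h5

theorem dSer_tbr {i : ℤ} {f : TSer k n} (hf : f ∈ homSer k n i) (g : TSer k n) :
    dSer k n (tbr k n f g) = tbr k n (dSer k n f) g +
      ((i.negOnePow : ℤ) : k) • tbr k n f (dSer k n g) := by
  have hg : ∀ w, (fun u => ws k u • sgnSer k n i g u) w = sgnSer k n (i + 1) g w := by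
    intro w
    change ws k w • sgnSer k n i g w = _
    rw [add_comm, ← sgnSer_sgnSer, sgnSer_apply 1, one_mul]; rfl
  have h2 : dSer k n (tmul k n (sgnSer k n i g) f) = tmul k n (dSer k n (sgnSer k n i g)) f +
      tmul k n (sgnSer k n (i + 1) g) (dSer k n f) := by
    funext w
    have := serD_conv (dLetter k n) (AlgHom.id k k) (fun _ => rfl) oddLetters_dLetter
      (sgnSer k n i g) f w
    rw [dSer_eq, tmul_eq_conv, this, funext hg, dSer_eq, dSer_eq]
    rfl
  rw [tbr_of_mem (dSer_mem_homSer hf), tbr_of_mem hf, tbr_of_mem hf, map_sub, dSer_tmul hf, h2,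
    dSer_sgnSer, map_smul, LinearMap.smul_apply, smul_sub]
  abel

theorem dSer_dSer (f : TSer k n) : dSer k n (dSer k n f) = 0 := by
  funext w
  change _ = (0 : k)
  induction w generalizing f with
  | nil =>
    rw [dSer_eq, serD_nil]
    simp [serT, dLetter_nil]
  | cons x w ih =>
    have h1 : dSer k n (fun w => if w = [] then 1 else 0) = 0 := by
      funext u
      rw [dSer_eq]
      exact serD_eq_zero _ _ (fun _ _ => if_neg (by simp)) u
    have h2 (I : Face n) (g : TSer k n) : dSer k n (dSer k n (tmul k n (letter k n I) g)) =
        tmul k n (letter k n I) (dSer k n (dSer k n g)) := by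
      have h3 : dSer k n (dLetter k n I) = 0 := by
        funext u; rw [dSer_eq, serD_dLetter]; rfl
      have h4 := dSer_mem_homSer (letter_mem_homSer (k := k) I)
      rw [dSer_letter] at h4
      rw [dSer_tmul (letter_mem_homSer I), map_add, map_smul, dSer_tmul (letter_mem_homSer I),
        dSer_letter, dSer_tmul h4, h3, map_zero, LinearMap.zero_apply, zero_add, smul_add,
        smul_smul, negOnePow_mul_self, one_smul, Int.negOnePow_succ]
      simp
    rw [eq_sum_letter_tmul f, map_add, map_add, map_smul, h1, smul_zero, map_zero, zero_add,
      map_sum, map_sum]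
    simp only [h2, Finset.sum_apply, letter_tmul_cons, ih, ite_self, Finset.sum_const_zero]

end CharZero

end TensorAlgebra

/-! ### Naturality of homotopy transfer -/

section Transfer

variable {k : Type*} [Field k] {V W V' W' : Type*} [AddCommGroup V] [Module k V]
  [AddCommGroup W] [Module k W] [AddCommGroup V'] [Module k V'] [AddCommGroup W'] [Module k W']

theorem TransferData.inner_cons_cons (T : TransferData k V W) (w w' : W) (l : List W) :
    T.inner (w :: w' :: l) = -T.h (∑ a ∈ Finset.range ((w :: w' :: l).length - 1),
      T.b (T.inner ((w :: w' :: l).take (a + 1))) (T.inner ((w :: w' :: l).drop (a + 1)))) := by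
  rw [TransferData.inner, Finset.sum_range]
  rfl

/-- Naturality of homotopy transfer. -/
theorem TransferData.map_inner (T : TransferData k V W) (T' : TransferData k V' W')
    (f : V →ₗ[k] V') (g : W →ₗ[k] W') (hi : ∀ w, f (T.i w) = T'.i (g w))
    (hh : ∀ v, f (T.h v) = T'.h (f v)) (hb : ∀ v v', f (T.b v v') = T'.b (f v) (f v'))
    (l : List W) : f (T.inner l) = T'.inner (l.map g) := by
  induction h : l.length using Nat.strong_induction_on generalizing l with
  | _ r ih =>
    match l with
    | [] => simp [TransferData.inner]
    | [w] => simp [TransferData.inner, hi]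
    | w :: w' :: l =>
      rw [List.map_cons, List.map_cons, TransferData.inner_cons_cons, TransferData.inner_cons_cons,
        map_neg, hh, map_sum, ← List.map_cons, ← List.map_cons, List.length_map]
      congr 2
      refine Finset.sum_congr rfl fun a ha => ?_
      have ha' := Finset.mem_range.1 ha
      rw [hb, ih _ _ _ rfl, ih _ _ _ rfl, List.map_take, List.map_drop]
      · rw [List.length_drop]; omega
      · rw [List.length_take]; omega

theorem TransferData.map_outer (T : TransferData k V W) (T' : TransferData k V' W')
    (f : V →ₗ[k] V') (g : W →ₗ[k] W') (hi : ∀ w, f (T.i w) = T'.i (g w))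
    (hh : ∀ v, f (T.h v) = T'.h (f v)) (hb : ∀ v v', f (T.b v v') = T'.b (f v) (f v'))
    (hp : ∀ v, g (T.p v) = T'.p (f v)) (l : List W) :
    g (T.outer l) = T'.outer (l.map g) := by
  rw [TransferData.outer, TransferData.outer, hp, map_sum, List.length_map]
  congr 1
  refine Finset.sum_congr rfl fun a _ => ?_
  rw [hb, T.map_inner T' f g hi hh hb, T.map_inner T' f g hi hh hb, List.map_take, List.map_drop]

end Transfer

/-! ### Morphisms of graded Lie algebras -/

section GradedLie

variable {k : Type*} [Field k] {L : Type*} [AddCommGroup L] [Module k L] {D : DGLieData k L}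
  {L' : Type*} [AddCommGroup L'] [Module k L'] {D' : DGLieData k L'} {n : ℕ}

theorem DGLieData.par_of_mem (D : DGLieData k L) {i : ℤ} {x : L} (hx : x ∈ D.gr i) :
    D.par x = ((i.negOnePow : ℤ) : k) • x := by
  have h1 : (LinearEquiv.ofBijective (DirectSum.coeLinearMap D.gr) D.internal).symm x =
      DirectSum.lof k ℤ (fun i => D.gr i) i ⟨x, hx⟩ := by
    refine (LinearEquiv.symm_apply_eq _).2 ?_
    exact (DirectSum.coeLinearMap_lof D.gr i ⟨x, hx⟩).symm
  rw [DGLieData.par, LinearMap.comp_apply, LinearEquiv.coe_coe, h1, DirectSum.toModule_lof]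
  rfl

/-- Induction on homogeneous elements. -/
theorem DGLieData.induction_on (D : DGLieData k L) {C : L → Prop} (x : L)
    (h : ∀ i, ∀ x ∈ D.gr i, C x) (hadd : ∀ x y, C x → C y → C (x + y)) : C x := by
  have hx : x ∈ ⨆ i, D.gr i := by
    rw [D.internal.submodule_iSup_eq_top]; trivial
  refine Submodule.iSup_induction D.gr (motive := C) hx h (h 0 0 (zero_mem _)) hadd

/-- A morphism of the underlying graded Lie algebras. -/
structure IsGradedLieHom (D : DGLieData k L) (D' : DGLieData k L') (f : L →ₗ[k] L') : Prop where
  map_gr : ∀ i : ℤ, ∀ x ∈ D.gr i, f x ∈ D'.gr i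
  map_bracket : ∀ x y : L, f (D.bracket x y) = D'.bracket (f x) (f y)

theorem IsDGLieHom.graded {f : L →ₗ[k] L'} (hf : IsDGLieHom D D' f) : IsGradedLieHom D D' f :=
  ⟨hf.map_gr, hf.map_bracket⟩

theorem IsGradedLieHom.map_par {f : L →ₗ[k] L'} (hf : IsGradedLieHom D D' f) (x : L) :
    f (D.par x) = D'.par (f x) := by
  refine D.induction_on (C := fun x => f (D.par x) = D'.par (f x)) x (fun i x hx => ?_)
    fun x y hx hy => ?_
  · rw [D.par_of_mem hx, D'.par_of_mem (hf.map_gr i x hx), map_smul]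
  · simp only [map_add, hx, hy]

theorem IsGradedLieHom.map_bracketing {f : L →ₗ[k] L'} (hf : IsGradedLieHom D D' f) {m : ℕ} {x : L}
    (hx : IsBracketing (fun a b => D.bracket a b) Set.univ m x) :
    IsBracketing (fun a b => D'.bracket a b) Set.univ m (f x) := by
  induction hx with
  | of x _ => exact IsBracketing.of _ trivial
  | bracket a b x y _ _ hx hy =>
    rw [hf.map_bracket]
    exact IsBracketing.bracket a b _ _ hx hy

theorem IsGradedLieHom.map_filt {f : L →ₗ[k] L'} (hf : IsGradedLieHom D D' f) {N : ℕ} {x : L}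
    (hx : x ∈ D.filt N) : f x ∈ D'.filt N := by
  suffices h : D.filt N ≤ (D'.filt N).comap f from h hx
  refine Submodule.span_le.2 ?_
  rintro x ⟨m, hm, hx⟩
  exact Submodule.subset_span ⟨m, hm, hf.map_bracketing hx⟩

theorem brOm_tmul (a b : L) (ω η : Om k n) : brOm D n (a ⊗ₜ ω) (b ⊗ₜ η) =
    D.bracket a b ⊗ₜ (((2 : k)⁻¹ • (ω + parAlg k n ω)) * η) +
    D.bracket a (D.par b) ⊗ₜ (((2 : k)⁻¹ • (ω - parAlg k n ω)) * η) := by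
  rw [brOm, parOm_eq]
  rfl

theorem lieTransfer_b_tmul (a b : L) (ω η : Om k n) : (lieTransfer D n).b (a ⊗ₜ ω) (b ⊗ₜ η) =
    -brOm D n (D.par a ⊗ₜ parAlg k n ω) (b ⊗ₜ η) := by
  change ((-1 : k) • (brOm D n ∘ₗ TensorProduct.map D.par (parOm k n))) (a ⊗ₜ ω) (b ⊗ₜ η) = _
  rw [parOm_eq, LinearMap.smul_apply, LinearMap.comp_apply, TensorProduct.map_tmul,
    LinearMap.smul_apply, neg_one_smul]
  rfl

variable [CharZero k]

theorem IsGradedLieHom.map_lieTransfer_b {f : L →ₗ[k] L'} (hf : IsGradedLieHom D D' f)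
    (x y : L ⊗[k] Om k n) : TensorProduct.map f LinearMap.id ((lieTransfer D n).b x y) =
      (lieTransfer D' n).b (TensorProduct.map f LinearMap.id x)
        (TensorProduct.map f LinearMap.id y) := by
  induction x with
  | zero => simp only [map_zero, LinearMap.zero_apply]
  | add x x' hx hx' => simp only [map_add, LinearMap.add_apply, hx, hx']
  | tmul a ω =>
    induction y with
    | zero => simp only [map_zero]
    | add y y' hy hy' => simp only [map_add, hy, hy']
    | tmul b η =>
      simp only [lieTransfer_b_tmul, brOm_tmul, TensorProduct.map_tmul, LinearMap.id_apply,
        map_neg, map_add, hf.map_bracket, hf.map_par]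

/-- The term `(1 / r!) ℓ_r(x, …, x)` of the Maurer–Cartan equation, `r ≥ 2`. For equal arguments
of degree one all permutations contribute the same, so only the division by `2^{r-1}` is left; see
`lBr_const`. -/
def mcTerm (D : DGLieData k L) (n r : ℕ) (x : L ⊗[k] Cc k n) : L ⊗[k] Cc k n :=
  ((2 : k) ^ (r - 1))⁻¹ • (lieTransfer D n).outer (List.replicate r x)

/-- For equal arguments of degree one the Koszul signs are trivial, and the sum over the
permutations cancels `1 / r!`. -/
theorem lBr_const (r : ℕ) (x : L ⊗[k] Cc k n) :
    ((r.factorial : k)⁻¹) • lBr D n r (fun _ => 1) (fun _ => x) = mcTerm D n r x := by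
  have h1 (σ : Equiv.Perm (Fin r)) : permSign (fun _ : Fin r => (1 : ℤ)) σ = 1 := by
    simp [permSign]
  have hr : (r.factorial : k) ≠ 0 := by exact_mod_cast r.factorial_ne_zero
  rw [lBr, mcTerm]
  simp only [h1, one_smul, List.ofFn_const, Finset.sum_const, Finset.card_univ,
    Fintype.card_perm, Fintype.card_fin]
  rw [← Nat.cast_smul_eq_nsmul k, smul_smul, smul_smul]
  congr 1
  field_simp

theorem IsGradedLieHom.map_mcTerm {f : L →ₗ[k] L'} (hf : IsGradedLieHom D D' f) (r : ℕ)
    (x : L ⊗[k] Cc k n) : TensorProduct.map f LinearMap.id (mcTerm D n r x) =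
      mcTerm D' n r (TensorProduct.map f LinearMap.id x) := by
  rw [mcTerm, mcTerm, map_smul, (lieTransfer D n).map_outer (lieTransfer D' n)
    (TensorProduct.map f LinearMap.id) (TensorProduct.map f LinearMap.id), List.map_replicate]
  · intro w
    change (TensorProduct.map f LinearMap.id ∘ₗ TensorProduct.map LinearMap.id (incl k n)) w =
      (TensorProduct.map LinearMap.id (incl k n) ∘ₗ TensorProduct.map f LinearMap.id) w
    rw [← TensorProduct.map_comp, ← TensorProduct.map_comp]
    rfl
  · intro w
    change (TensorProduct.map f LinearMap.id ∘ₗ TensorProduct.map D.par (dupont k n)) w =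
      (TensorProduct.map D'.par (dupont k n) ∘ₗ TensorProduct.map f LinearMap.id) w
    rw [← TensorProduct.map_comp, ← TensorProduct.map_comp]
    congr 2
    exact LinearMap.ext fun x => hf.map_par x
  · exact fun v v' => hf.map_lieTransfer_b v v'
  · intro w
    change (TensorProduct.map f LinearMap.id ∘ₗ TensorProduct.map LinearMap.id (proj k n)) w =
      (TensorProduct.map LinearMap.id (proj k n) ∘ₗ TensorProduct.map f LinearMap.id) w
    rw [← TensorProduct.map_comp, ← TensorProduct.map_comp]
    rfl

theorem brOm_of_mem {p j : ℤ} {a b : L} {ω : Om k n} (hb : b ∈ D.gr j) (hω : ω ∈ omGr k n p)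
    (η : Om k n) : brOm D n (a ⊗ₜ ω) (b ⊗ₜ η) =
      (((p * j).negOnePow : ℤ) : k) • (D.bracket a b ⊗ₜ (ω * η)) := by
  rw [brOm_tmul, parAlg_of_mem hω, D.par_of_mem hb, map_smul, TensorProduct.smul_tmul,
    ← TensorProduct.tmul_add, ← TensorProduct.tmul_smul]
  congr 1
  have h2 : (2 : k) ≠ 0 := two_ne_zero
  rcases Int.even_or_odd p with hp | hp
  · rw [Int.negOnePow_even p hp, Int.negOnePow_even _ (hp.mul_right j)]
    simp only [Units.val_one, Int.cast_one, one_smul, sub_self, smul_zero, zero_mul, add_zero]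
    rw [← two_smul k ω, smul_smul, inv_mul_cancel₀ h2, one_smul]
  · have e2 : ((p * j).negOnePow : ℤ) = (j.negOnePow : ℤ) := by
      obtain ⟨c, rfl⟩ := hp
      rw [add_mul, one_mul, Int.negOnePow_add, mul_assoc, Int.negOnePow_even _ (even_two_mul _),
        one_mul]
    rw [e2, Int.negOnePow_odd p hp]
    simp only [Units.val_neg, Units.val_one, Int.cast_neg, Int.cast_one]
    have e3 : ω + (-1 : k) • ω = 0 := by module
    have e4 : ω - (-1 : k) • ω = (2 : k) • ω := by
      module
    rw [e3, e4, smul_zero, zero_mul, zero_add, smul_smul, inv_mul_cancel₀ h2, one_smul]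

end GradedLie

/-! ### Graded commutativity of forms -/

section Commutativity

variable {k : Type*} [Field k] {n : ℕ}

theorem ι_mul_comm {b : ℕ} (v : Fin n → k) {ξ : Lam k n} (hξ : ξ ∈ ⋀[k]^b (Fin n → k)) :
    ExteriorAlgebra.ι k v * ξ = (-1 : k) ^ b • (ξ * ExteriorAlgebra.ι k v) := by
  refine extPow_induction (C := fun ξ : Lam k n => ExteriorAlgebra.ι k v * ξ =
    (-1 : k) ^ b • (ξ * ExteriorAlgebra.ι k v)) ?_ ?_ ?_ ?_ hξ
  · simp
  · intro a b ha hb; rw [mul_add, ha, hb, add_mul, smul_add]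
  · intro c a ha; rw [mul_smul_comm, ha, smul_mul_assoc, smul_comm]
  · intro u
    clear hξ
    induction b with
    | zero => simp
    | succ b ih =>
      have h1 (x y : Fin n → k) : ExteriorAlgebra.ι k x * ExteriorAlgebra.ι k y =
          -(ExteriorAlgebra.ι k y * ExteriorAlgebra.ι k x) :=
        eq_neg_of_add_eq_zero_left (ExteriorAlgebra.ι_add_mul_swap x y)
      rw [ExteriorAlgebra.ιMulti_succ_apply, ← mul_assoc, h1, neg_mul, mul_assoc, ih, mul_smul_comm,
        pow_succ, mul_neg_one, neg_smul, mul_assoc]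

theorem lam_mul_comm {a b : ℕ} {η ξ : Lam k n} (hη : η ∈ ⋀[k]^a (Fin n → k))
    (hξ : ξ ∈ ⋀[k]^b (Fin n → k)) : η * ξ = (-1 : k) ^ (a * b) • (ξ * η) := by
  refine extPow_induction (C := fun η : Lam k n => η * ξ = (-1 : k) ^ (a * b) • (ξ * η))
    ?_ ?_ ?_ ?_ hη
  · simp
  · intro x y hx hy; rw [add_mul, hx, hy, mul_add, smul_add]
  · intro c x hx; rw [smul_mul_assoc, hx, mul_smul_comm, smul_comm]
  · intro u
    clear hη
    induction a with
    | zero => simp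
    | succ a ih =>
      rw [ExteriorAlgebra.ιMulti_succ_apply, mul_assoc, ih, mul_smul_comm, ← mul_assoc,
        ι_mul_comm _ hξ, smul_mul_assoc, smul_smul, ← pow_add, mul_assoc, Nat.succ_mul]

/-- Graded commutativity of forms. -/
theorem omGr_mul_comm {p q : ℤ} {x y : Om k n} (hx : x ∈ omGr k n p) (hy : y ∈ omGr k n q) :
    x * y = (((p * q).negOnePow : ℤ) : k) • (y * x) := by
  have key : (LinearMap.mulRight k y - (((p * q).negOnePow : ℤ) : k) • LinearMap.mulLeft k y) x ∈
      (⊥ : Submodule k (Om k n)) := by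
    refine map_omGr _ _ (fun f a η ha hη => ?_) hx
    have key2 : (LinearMap.mulLeft k (f ⊗ₜ[k] η) - (((p * q).negOnePow : ℤ) : k) •
        LinearMap.mulRight k (f ⊗ₜ[k] η)) y ∈ (⊥ : Submodule k (Om k n)) := by
      refine map_omGr _ _ (fun g b ξ hb hξ => ?_) hy
      rw [Submodule.mem_bot, LinearMap.sub_apply, LinearMap.smul_apply, LinearMap.mulLeft_apply,
        LinearMap.mulRight_apply, Algebra.TensorProduct.tmul_mul_tmul,
        Algebra.TensorProduct.tmul_mul_tmul, lam_mul_comm hη hξ, mul_comm f g,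
        TensorProduct.tmul_smul, ← ha, ← hb, sub_eq_zero]
      congr 1
      rw [← Nat.cast_mul, Int.negOnePow_def, zpow_natCast]
      simp
    exact key2
  rw [Submodule.mem_bot, LinearMap.sub_apply, sub_eq_zero] at key
  exact key

end Commutativity

theorem negOnePow_eq_ite {k : Type*} [Field k] (p : ℤ) :
    ((p.negOnePow : ℤ) : k) = if Even p then 1 else -1 := by
  split_ifs with h
  · simp [Int.negOnePow_even p h]
  · simp [Int.negOnePow_odd p (Int.not_even_iff_odd.1 h)]

/-! ### The total degree of Lie algebra valued forms -/

section TotalDegree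

variable {k : Type*} [Field k] {L : Type*} [AddCommGroup L] [Module k L] (D : DGLieData k L)

/-- The elements of total degree `m` of `𝔤 ⊗ Ω_n`. -/
def totGr (n : ℕ) (m : ℤ) : Submodule k (L ⊗[k] Om k n) :=
  Submodule.span k {x | ∃ (i : ℤ) (a : L) (ω : Om k n), a ∈ D.gr i ∧ ω ∈ omGr k n (m - i) ∧
    x = a ⊗ₜ ω}

variable {D} {n : ℕ}

theorem tmul_mem_totGr {i m : ℤ} {a : L} {ω : Om k n} (ha : a ∈ D.gr i)
    (hω : ω ∈ omGr k n (m - i)) : a ⊗ₜ[k] ω ∈ totGr D n m :=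
  Submodule.subset_span ⟨i, a, ω, ha, hω, rfl⟩

theorem lieTransfer_h_mem {m : ℤ} {x : L ⊗[k] Om k n} (hx : x ∈ totGr D n m) :
    (lieTransfer D n).h x ∈ totGr D n (m - 1) := by
  suffices h : totGr D n m ≤ (totGr D n (m - 1)).comap (lieTransfer D n).h from h hx
  refine Submodule.span_le.2 ?_
  rintro _ ⟨i, a, ω, ha, hω, rfl⟩
  change D.par a ⊗ₜ dupont k n ω ∈ totGr D n (m - 1)
  rw [D.par_of_mem ha]
  refine tmul_mem_totGr (i := i) (Submodule.smul_mem _ _ ha) ?_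
  have := dupont_mem_omGr hω
  rwa [sub_right_comm] at this

variable [CharZero k]

theorem lieTransfer_b_of_mem {i j : ℤ} {a b : L} {ω η : Om k n} (ha : a ∈ D.gr i)
    (hb : b ∈ D.gr j) (hω : ω ∈ omGr k n (1 - i)) :
    (lieTransfer D n).b (a ⊗ₜ ω) (b ⊗ₜ η) =
      ((((1 - i) * j).negOnePow : ℤ) : k) • (D.bracket a b ⊗ₜ (ω * η)) := by
  rw [lieTransfer_b_tmul, D.par_of_mem ha, parAlg_of_mem hω, TensorProduct.smul_tmul_smul,
    map_smul, LinearMap.smul_apply, brOm_of_mem hb hω]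
  have : ((i.negOnePow : ℤ) : k) * (((1 - i).negOnePow : ℤ) : k) = -1 := by
    have h := negOnePow_mul_self (k := k) i
    rw [Int.negOnePow_sub, Int.negOnePow_one]
    push_cast
    linear_combination -h
  rw [this, neg_one_smul, neg_neg]

theorem lieTransfer_b_mem (hD : ∀ i j : ℤ, ∀ x ∈ D.gr i, ∀ y ∈ D.gr j,
    D.bracket x y ∈ D.gr (i + j)) {x y : L ⊗[k] Om k n} (hx : x ∈ totGr D n 1)
    (hy : y ∈ totGr D n 1) : (lieTransfer D n).b x y ∈ totGr D n 2 := by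
  have h := Submodule.apply_mem_map₂ (lieTransfer D n).b hx hy
  rw [totGr, Submodule.map₂_span_span] at h
  refine (Submodule.span_le.2 ?_ : _ ≤ totGr D n 2) h
  rintro _ ⟨_, ⟨i, a, ω, ha, hω, rfl⟩, _, ⟨j, b, η, hb, hη, rfl⟩, rfl⟩
  change (lieTransfer D n).b (a ⊗ₜ ω) (b ⊗ₜ η) ∈ totGr D n 2
  rw [lieTransfer_b_of_mem ha hb hω]
  refine Submodule.smul_mem _ _ (tmul_mem_totGr (hD i j a ha b hb) ?_)
  have := mul_mem_omGr hω hη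
  have e : (1 : ℤ) - i + (1 - j) = 2 - (i + j) := by ring
  rwa [e] at this

end TotalDegree

/-! ### Coefficients of Lie algebra valued cochains -/

section Coefficients

variable {k : Type*} [Field k] {L : Type*} [AddCommGroup L] [Module k L] {n : ℕ}

/-- The coefficient of `ω_I` of an element of `𝔤 ⊗ C_n`. -/
def coef (k : Type*) [Field k] (L : Type*) [AddCommGroup L] [Module k L] {n : ℕ} (I : Face n) :
    L ⊗[k] Cc k n →ₗ[k] L :=
  (TensorProduct.rid k L).toLinearMap ∘ₗ TensorProduct.map LinearMap.id (LinearMap.proj I)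

theorem coef_tmul (I : Face n) (a : L) (c : Cc k n) : coef k L I (a ⊗ₜ c) = c I • a := by
  simp [coef]

theorem eq_sum_coef (x : L ⊗[k] Cc k n) : x = ∑ I, coef k L I x ⊗ₜ Pi.single I 1 := by
  induction x with
  | zero => simp
  | add x y hx hy =>
    conv_lhs => rw [hx, hy]
    simp only [map_add, TensorProduct.add_tmul, Finset.sum_add_distrib]
  | tmul a c =>
    conv_lhs => rw [pi_eq_sum_univ' c, TensorProduct.tmul_sum]
    refine Finset.sum_congr rfl fun I _ => ?_
    rw [coef_tmul, TensorProduct.smul_tmul]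

theorem coef_sum_tmul (a : Face n → L) (I : Face n) :
    coef k L I (∑ J, a J ⊗ₜ Pi.single J 1) = a I := by
  rw [map_sum, Finset.sum_eq_single I]
  · simp [coef_tmul]
  · intro J _ hJ
    rw [coef_tmul, Pi.single_eq_of_ne hJ.symm, zero_smul]
  · simp

theorem coef_ext {x y : L ⊗[k] Cc k n} (h : ∀ I, coef k L I x = coef k L I y) : x = y := by
  rw [eq_sum_coef x, eq_sum_coef y]
  simp only [h]

theorem coef_map {L' : Type*} [AddCommGroup L'] [Module k L'] (f : L →ₗ[k] L') (I : Face n)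
    (x : L ⊗[k] Cc k n) :
    coef k L' I (TensorProduct.map f LinearMap.id x) = f (coef k L I x) := by
  induction x with
  | zero => simp
  | add x y hx hy => simp only [map_add, hx, hy]
  | tmul a c => rw [TensorProduct.map_tmul, coef_tmul, coef_tmul, map_smul]; rfl

theorem mem_grTens_iff {D : DGLieData k L} {m : ℤ} {x : L ⊗[k] Cc k n} :
    x ∈ grTens D n m ↔ ∀ I : Face n, coef k L I x ∈ D.gr (m - I.dim) := by
  constructor
  · intro hx I
    suffices h : grTens D n m ≤ (D.gr (m - I.dim)).comap (coef k L I) from h hx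
    refine iSup_le fun J => ?_
    rintro _ ⟨a, ha, rfl⟩
    change coef k L I (a ⊗ₜ Pi.single J 1) ∈ D.gr (m - I.dim)
    rw [coef_tmul]
    by_cases h : I = J
    · subst h; exact Submodule.smul_mem _ _ ha
    · rw [Pi.single_eq_of_ne h, zero_smul]; exact zero_mem _
  · intro h
    rw [eq_sum_coef x]
    exact sum_mem fun I _ => (le_iSup (fun I : Face n => (D.gr (m - I.dim)).map
      ((TensorProduct.mk k L (Cc k n)).flip (Pi.single I 1))) I) ⟨_, h I, rfl⟩

theorem mem_filtTens_iff {D : DGLieData k L} {N : ℕ} {x : L ⊗[k] Cc k n} :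
    x ∈ filtTens D n N ↔ ∀ I : Face n, coef k L I x ∈ D.filt N := by
  constructor
  · rintro ⟨y, rfl⟩ I
    rw [coef_map]
    exact (coef k (↥(D.filt N)) I y).2
  · intro h
    refine ⟨∑ I, (⟨coef k L I x, h I⟩ : D.filt N) ⊗ₜ Pi.single I 1, ?_⟩
    refine coef_ext fun I => ?_
    rw [coef_map, coef_sum_tmul]
    rfl

end Coefficients

/-! ### Lie series and evaluation at words -/

section LieSeries

variable {k : Type*} [Field k] {n : ℕ}

theorem liePoly_length {r : ℕ} {f : TSer k n} (hf : f ∈ liePoly k n r) (w : List (Face n))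
    (hw : w.length ≠ r) : f w = 0 := by
  suffices h : ∀ r f, IsBracketing (fun a b => tbr k n a b) (Set.range (letter k n)) r f →
      ∀ w : List (Face n), w.length ≠ r → f w = 0 by
    suffices h' : liePoly k n r ≤ (LinearMap.proj w : TSer k n →ₗ[k] k).ker from h' hf
    refine Submodule.span_le.2 fun f hf => ?_
    exact h r f hf w hw
  intro r f hf
  induction hf with
  | of f hf =>
    obtain ⟨I, rfl⟩ := hf
    intro w hw
    refine if_neg ?_
    rintro rfl
    exact hw rfl
  | bracket a b f g _ _ hf hg =>
    intro w hw
    rw [tbr_apply]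
    refine Finset.sum_eq_zero fun c hc => ?_
    have hc' : c ≤ w.length := Nat.lt_succ_iff.1 (Finset.mem_range.1 hc)
    have h1 : (w.take c).length = c := by rw [List.length_take]; omega
    have h2 : (w.drop c).length = w.length - c := List.length_drop
    have e1 : f (w.take c) * g (w.drop c) = 0 := by
      by_cases h : c = a
      · rw [hg _ (by omega), mul_zero]
      · rw [hf _ (by omega), zero_mul]
    have e2 : g (w.take c) * f (w.drop c) = 0 := by
      by_cases h : c = b
      · rw [hf _ (by omega), mul_zero]
      · rw [hg _ (by omega), zero_mul]
    rw [e1, e2, mul_zero, sub_zero]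

theorem lenPart_of_liePoly {r : ℕ} {f : TSer k n} (hf : f ∈ liePoly k n r) (s : ℕ) :
    lenPart k n s f = if s = r then f else 0 := by
  funext w
  rw [lenPart_apply]
  by_cases h : s = r
  · subst h
    rw [if_pos rfl]
    refine ite_eq_left_iff.2 fun hw => (liePoly_length hf w hw).symm
  · rw [if_neg h]
    refine ite_eq_right_iff.2 fun hw => liePoly_length hf w (by omega)

theorem lenPart_mem_liePoly {f : TSer k n} (hf : f ∈ lieSer k n) (r : ℕ) :
    lenPart k n r f ∈ liePoly k n r := by
  suffices h : lieSer k n ≤ (liePoly k n r).comap (lenPart k n r) from h hf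
  exact iSup_le fun m f hf => hf.2 r

theorem letter_mem_lieDeg (I : Face n) : letter k n I ∈ lieDeg k n (1 - (I.dim : ℤ)) :=
  ⟨letter_mem_homSer I, lenPart_mem_liePoly (letter_mem k n I)⟩

theorem gen_mem_gr (I : Face n) : gen k n I ∈ (mc k n).gr (1 - (I.dim : ℤ)) :=
  letter_mem_lieDeg I

theorem mc_par_apply (f : lieSer k n) (w : List (Face n)) :
    ((mc k n).par f).1 w = ws k w * f.1 w := by
  refine (mc k n).induction_on (C := fun f => ((mc k n).par f).1 w = ws k w * f.1 w) f
    (fun i f hf => ?_) fun f g hf hg => ?_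
  · rw [(mc k n).par_of_mem hf]
    have hf' : f.1 ∈ homSer k n i := hf.1
    exact (congrFun (ws_smul_of_mem hf') w).symm
  · rw [map_add]
    exact (congrArg₂ (· + ·) hf hg).trans (mul_add _ _ _).symm

/-- The value at a word of a Lie series with coefficients in `M`. -/
def evW {M : Type*} [AddCommGroup M] [Module k M] (w : List (Face n)) :
    lieSer k n ⊗[k] M →ₗ[k] M :=
  TensorProduct.lift (LinearMap.lsmul k M ∘ₗ (LinearMap.proj w ∘ₗ (lieSer k n).subtype))

section

variable {M M' : Type*} [AddCommGroup M] [Module k M] [AddCommGroup M'] [Module k M']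

theorem evW_tmul (w : List (Face n)) (f : lieSer k n) (x : M) :
    evW w (f ⊗ₜ[k] x) = f.1 w • x := rfl

theorem evW_map (w : List (Face n)) (T : M →ₗ[k] M') (x : lieSer k n ⊗[k] M) :
    evW w (TensorProduct.map LinearMap.id T x) = T (evW w x) := by
  induction x with
  | zero => simp
  | add x y hx hy => simp only [map_add, hx, hy]
  | tmul a c => rw [TensorProduct.map_tmul, evW_tmul, evW_tmul, map_smul]; rfl

theorem evW_map_par (w : List (Face n)) (T : M →ₗ[k] M') (x : lieSer k n ⊗[k] M) :
    evW w (TensorProduct.map (mc k n).par T x) = ws k w • T (evW w x) := by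
  induction x with
  | zero => simp
  | add x y hx hy => simp only [map_add, hx, hy, smul_add]
  | tmul a c =>
    rw [TensorProduct.map_tmul, evW_tmul, evW_tmul, map_smul, mc_par_apply, smul_smul]

end

theorem coef_apply (I : Face n) (x : lieSer k n ⊗[k] Cc k n) (w : List (Face n)) :
    (coef k (lieSer k n) I x).1 w = evW w x I := by
  induction x with
  | zero => simp
  | add x y hx hy => simp only [map_add, Submodule.coe_add, Pi.add_apply, hx, hy]
  | tmul a c =>
    rw [coef_tmul, evW_tmul, Pi.smul_apply, smul_eq_mul, mul_comm]; rfl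

variable [CharZero k]

/-- The product of two decomposable Lie algebra valued forms, as form-valued series. -/
theorem omConv_ev_tmul {i j : ℤ} {a b : lieSer k n} {ω η : Om k n} (ha : a.1 ∈ homSer k n i)
    (hη : η ∈ omGr k n (1 - j)) (w : List (Face n)) :
    omConv (fun u => evW u (a ⊗ₜ ω)) (fun u => evW u (b ⊗ₜ η)) w =
      ((((i * (1 - j)).negOnePow : ℤ) : k) * tmul k n a.1 b.1 w) • (ω * η) := by
  rw [omConv_apply, tmul_apply, Finset.mul_sum, Finset.sum_smul]
  refine Finset.sum_congr rfl fun c _ => ?_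
  rw [evW_tmul, evW_tmul, map_smul, twist_of_mem _ hη, om_smul_mul, om_mul_smul, om_mul_smul,
    smul_smul, smul_smul]
  by_cases hu : wdeg (w.take c) = i
  · rw [hu]; congr 1; ring
  · rw [ha _ hu]; simp

/-- On elements of total degree one the bracket of `mc_n ⊗ Ω_n` is the graded commutator in the
completed tensor algebra with coefficients in `Ω_n`, that is, up to sign, the sum of the two
products. -/
theorem lieTransfer_mc_b {x y : lieSer k n ⊗[k] Om k n} (hx : x ∈ totGr (mc k n) n 1)
    (hy : y ∈ totGr (mc k n) n 1) (w : List (Face n)) :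
    evW w ((lieTransfer (mc k n) n).b x y) =
      ws k w • (omConv (fun u => evW u x) (fun u => evW u y) w +
        omConv (fun u => evW u y) (fun u => evW u x) w) := by
  induction hx using Submodule.span_induction with
  | zero =>
    rw [map_zero, LinearMap.zero_apply, map_zero]
    simp [omConv_apply]
  | add x x' _ _ hx hx' =>
    simp only [map_add, LinearMap.add_apply, hx, hx', omConv_add_left, omConv_add_right]
    module
  | smul c x _ hx =>
    simp only [map_smul, LinearMap.smul_apply, hx, omConv_smul_left, omConv_smul_right]
    module
  | mem x hx =>
    obtain ⟨i, a, ω, ha, hω, rfl⟩ := hx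
    induction hy using Submodule.span_induction with
    | zero =>
      rw [map_zero, map_zero]
      simp [omConv_apply]
    | add y y' _ _ hy hy' =>
      simp only [map_add, hy, hy', omConv_add_left, omConv_add_right]
      module
    | smul c y _ hy =>
      simp only [map_smul, hy, omConv_smul_left, omConv_smul_right]
      module
    | mem y hy =>
      obtain ⟨j, b, η, hb, hη, rfl⟩ := hy
      have ha' : a.1 ∈ homSer k n i := ha.1
      have hb' : b.1 ∈ homSer k n j := hb.1
      rw [lieTransfer_b_of_mem ha hb hω, map_smul, evW_tmul, omConv_ev_tmul ha' hη,
        omConv_ev_tmul hb' hω, omGr_mul_comm hη hω]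
      change _ • (tbr k n a.1 b.1 w) • _ = _
      rw [tbr_of_mem ha', sgnSer_of_mem hb', map_smul, Pi.sub_apply, LinearMap.smul_apply,
        Pi.smul_apply]
      by_cases hw : wdeg w = i + j
      · have hws : ws k w = (((i + j).negOnePow : ℤ) : k) := by rw [ws, hw]
        rw [hws]
        simp only [smul_smul, ← add_smul, smul_eq_mul]
        congr 1
        -- the remaining sign identity depends only on the parities of `i` and `j`
        by_cases hi : Even i <;> by_cases hj : Even j <;>
          simp only [negOnePow_eq_ite, Int.even_mul, Int.even_sub, Int.even_add, hi, hj,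
            Int.not_even_one] <;> norm_num <;> ring
      · rw [tmul_mem_homSer ha' hb' w hw, tmul_mem_homSer hb' ha' w (by omega)]
        simp

end LieSeries

/-! ### Transfer at a repeated argument -/

section Replicate

variable {k : Type*} [Field k] {V W : Type*} [AddCommGroup V] [Module k V]
  [AddCommGroup W] [Module k W]

/-- The tree sum at a repeated argument, with the trees cut at the root. -/
theorem TransferData.inner_replicate (T : TransferData k V W) (x : W) (r : ℕ) :
    T.inner (List.replicate (r + 2) x) =
      (-1 : k) • T.h (∑ a ∈ Finset.range (r + 1), T.b (T.inner (List.replicate (a + 1) x))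
        (T.inner (List.replicate (r - a + 1) x))) := by
  rw [List.replicate_succ, List.replicate_succ, TransferData.inner_cons_cons, ← List.replicate_succ,
    ← List.replicate_succ, List.length_replicate, neg_one_smul]
  congr 2
  refine Finset.sum_congr rfl fun a ha => ?_
  have ha' : a < r + 1 := Finset.mem_range.1 ha
  rw [List.take_replicate, List.drop_replicate]
  have h1 : min (a + 1) (r + 1 + 1) = a + 1 := by omega
  have h2 : r + 1 + 1 - (a + 1) = r - a + 1 := by omega
  rw [h1, h2]

theorem TransferData.outer_replicate (T : TransferData k V W) (x : W) (r : ℕ) :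
    T.outer (List.replicate (r + 2) x) =
      T.p (∑ a ∈ Finset.range (r + 1), T.b (T.inner (List.replicate (a + 1) x))
        (T.inner (List.replicate (r - a + 1) x))) := by
  rw [TransferData.outer, List.length_replicate]
  congr 1
  refine Finset.sum_congr rfl fun a ha => ?_
  have ha' : a < r + 1 := Finset.mem_range.1 ha
  rw [List.take_replicate, List.drop_replicate]
  have h1 : min (a + 1) (r + 2) = a + 1 := by omega
  have h2 : r + 2 - (a + 1) = r - a + 1 := by omega
  rw [h1, h2]

end Replicate

/-! ### The universal Maurer–Cartan element -/

section UniversalLie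

variable {k : Type*} [Field k] [CharZero k] {m n : ℕ}

/-- The universal element `∑_I v_I ⊗ ω_I` of `mc_n ⊗ C_n`. -/
def univ (k : Type*) [Field k] (n : ℕ) : lieSer k n ⊗[k] Cc k n := canon n LinearMap.id

theorem evW_univ (w : List (Face n)) : evW w (univ k n) = univCochain k w := by
  rw [univ, canon, map_sum]
  funext J
  rw [Finset.sum_apply, Finset.sum_eq_single J]
  · simp [evW_tmul, gen, univCochain]
  · intro I _ hI
    simp [evW_tmul, Pi.single_eq_of_ne hI.symm]
  · simp

theorem mc_bracket_mem (i j : ℤ) (x : lieSer k n) (hx : x ∈ (mc k n).gr i) (y : lieSer k n)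
    (hy : y ∈ (mc k n).gr j) : (mc k n).bracket x y ∈ (mc k n).gr (i + j) :=
  lieDeg_bracket k n i j x y hx hy

theorem inner_univ_mem (r : ℕ) :
    (lieTransfer (mc k n) n).inner (List.replicate r (univ k n)) ∈ totGr (mc k n) n 1 := by
  induction r using Nat.strong_induction_on with
  | _ r ih =>
    match r with
    | 0 => simp [TransferData.inner]
    | 1 =>
      rw [List.replicate_one, TransferData.inner]
      change TensorProduct.map LinearMap.id (incl k n) (canon n LinearMap.id) ∈ totGr (mc k n) n 1
      rw [canon, map_sum]
      refine sum_mem fun I _ => ?_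
      rw [TensorProduct.map_tmul, incl_single]
      refine tmul_mem_totGr (gen_mem_gr I) ?_
      rw [sub_sub_cancel]
      exact basicForm_mem_omGr I
    | r + 2 =>
      rw [TransferData.inner_replicate]
      refine Submodule.smul_mem _ _ ?_
      have hb : ∀ a ∈ Finset.range (r + 1), (lieTransfer (mc k n) n).b
          ((lieTransfer (mc k n) n).inner (List.replicate (a + 1) (univ k n)))
          ((lieTransfer (mc k n) n).inner (List.replicate (r - a + 1) (univ k n))) ∈
            totGr (mc k n) n 2 := fun a ha => by
        have ha' := Finset.mem_range.1 ha
        have h1 := ih (a + 1) (by omega)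
        have h2 := ih (r - a + 1) (by omega)
        generalize (lieTransfer (mc k n) n).inner (List.replicate (a + 1) (univ k n)) = y at h1 ⊢
        generalize (lieTransfer (mc k n) n).inner (List.replicate (r - a + 1) (univ k n)) = z
          at h2 ⊢
        exact lieTransfer_b_mem mc_bracket_mem h1 h2
      exact lieTransfer_h_mem (m := 2) (sum_mem hb)

/-- The part of word length `r` of the universal form-valued series, multiplied by `2^{r-1}`: the
number of planar representatives of a binary tree with `r` leaves. -/
def univFormPart (k : Type*) [Field k] {n : ℕ} (r : ℕ) (w : List (Face n)) : Om k n :=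
  if w.length = r then (2 : k) ^ (r - 1) • univForm k w else 0

theorem omConv_univFormPart (p q : ℕ) (w : List (Face n)) :
    omConv (univFormPart k (p + 1)) (univFormPart k (q + 1)) w =
      if w.length = p + q + 2 then (2 : k) ^ (p + q) •
        (univForm k (w.take (p + 1)) * twist (parAlg k n) (w.take (p + 1))
          (univForm k (w.drop (p + 1)))) else 0 := by
  rw [omConv_apply]
  have hz (c : ℕ) (hc : c ∈ Finset.range (w.length + 1)) (h : c ≠ p + 1 ∨ w.length ≠ p + q + 2) :
      univFormPart k (p + 1) (w.take c) * twist (parAlg k n) (w.take c)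
        (univFormPart k (q + 1) (w.drop c)) = 0 := by
    have hc' := Finset.mem_range.1 hc
    have h1 : (w.take c).length = c := by rw [List.length_take]; omega
    have h2 : (w.drop c).length = w.length - c := List.length_drop
    by_cases hcp : c = p + 1
    · rw [univFormPart, univFormPart, if_neg (c := (w.drop c).length = q + 1) (by omega),
        map_zero (twist (parAlg k n) _), mul_zero]
    · rw [univFormPart, if_neg (by omega), zero_mul]
  split_ifs with h
  · rw [Finset.sum_eq_single (p + 1)]
    · have h1 : (w.take (p + 1)).length = p + 1 := by rw [List.length_take]; omega
      have h2 : (w.drop (p + 1)).length = q + 1 := by rw [List.length_drop]; omega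
      rw [univFormPart, univFormPart, if_pos h1, if_pos h2, map_smul, om_smul_mul, om_mul_smul,
        smul_smul, ← pow_add]
      rfl
    · intro c hc hcp
      exact hz c hc (Or.inl hcp)
    · intro hc
      exact absurd (Finset.mem_range.2 (by omega)) hc
  · exact Finset.sum_eq_zero fun c hc => hz c hc (Or.inr h)

theorem sum_omConv_univFormPart (r : ℕ) (w : List (Face n)) :
    ∑ a ∈ Finset.range (r + 1), omConv (univFormPart k (a + 1)) (univFormPart k (r - a + 1)) w =
      if w.length = r + 2 then (2 : k) ^ r • omConv (univForm k) (univForm k) w else 0 := by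
  split_ifs with h
  · rw [omConv_apply, Finset.sum_range_succ _ w.length, List.drop_length, univForm_nil,
      map_zero (twist (parAlg k n) _), mul_zero, add_zero, h, Finset.sum_range_succ' _ (r + 1),
      List.take_zero, univForm_nil, zero_mul, add_zero, Finset.smul_sum]
    refine Finset.sum_congr rfl fun a ha => ?_
    have ha' := Finset.mem_range.1 ha
    rw [omConv_univFormPart, if_pos (by omega)]
    congr 2
    omega
  · refine Finset.sum_eq_zero fun a ha => ?_
    have ha' := Finset.mem_range.1 ha
    rw [omConv_univFormPart, if_neg (by omega)]

/-- The sum over all cuts of the trees with `r + 2` leaves, at the universal element. -/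
theorem evW_sum_b (r : ℕ) (Y : ℕ → lieSer k n ⊗[k] Om k n)
    (hY : ∀ a ≤ r, Y a ∈ totGr (mc k n) n 1)
    (hY' : ∀ a ≤ r, ∀ w, evW w (Y a) = univFormPart k (a + 1) w) (w : List (Face n)) :
    evW w (∑ a ∈ Finset.range (r + 1), (lieTransfer (mc k n) n).b (Y a) (Y (r - a))) =
      if w.length = r + 2 then
        (ws k w * (2 : k) ^ (r + 1)) • omConv (univForm k) (univForm k) w else 0 := by
  have h1 : ∀ a ∈ Finset.range (r + 1), evW w ((lieTransfer (mc k n) n).b (Y a) (Y (r - a))) =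
      ws k w • (omConv (univFormPart k (a + 1)) (univFormPart k (r - a + 1)) w +
        omConv (univFormPart k (r - a + 1)) (univFormPart k (a + 1)) w) := by
    intro a ha
    have ha' := Finset.mem_range.1 ha
    rw [lieTransfer_mc_b (hY a (by omega)) (hY _ (by omega)), funext (hY' a (by omega)),
      funext (hY' (r - a) (by omega))]
  have h2 : ∑ a ∈ Finset.range (r + 1),
      omConv (univFormPart k (r - a + 1)) (univFormPart k (a + 1)) w =
      ∑ a ∈ Finset.range (r + 1),
        omConv (univFormPart k (a + 1)) (univFormPart k (r - a + 1)) w := by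
    rw [← Finset.sum_range_reflect]
    refine Finset.sum_congr rfl fun a ha => ?_
    have ha' := Finset.mem_range.1 ha
    have e1 : r + 1 - 1 - a = r - a := by omega
    have e2 : r - (r - a) = a := by omega
    rw [e1, e2]
  rw [map_sum, Finset.sum_congr rfl h1, ← Finset.smul_sum, Finset.sum_add_distrib, h2,
    sum_omConv_univFormPart]
  split_ifs with h
  · rw [pow_succ]; module
  · rw [add_zero, smul_zero]

/-- The tree sums of the universal element of `mc_n ⊗ C_n` give back the universal form-valued
series. -/
theorem evW_inner_univ (r : ℕ) (w : List (Face n)) :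
    evW w ((lieTransfer (mc k n) n).inner (List.replicate r (univ k n))) = univFormPart k r w := by
  induction r using Nat.strong_induction_on generalizing w with
  | _ r ih =>
    match r with
    | 0 =>
      rw [List.replicate_zero, TransferData.inner, map_zero, univFormPart]
      split_ifs with h
      · rw [List.length_eq_zero_iff.1 h, univForm_nil, smul_zero]
      · rfl
    | 1 =>
      rw [List.replicate_one, TransferData.inner]
      change evW w (TensorProduct.map LinearMap.id (incl k n) (univ k n)) = _
      rw [evW_map, evW_univ, univFormPart]
      split_ifs with h
      · obtain ⟨I, rfl⟩ := List.length_eq_one_iff.1 h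
        rw [Nat.sub_self, pow_zero, one_smul, univCochain_singleton, incl_single, univForm,
          pairSign_singleton, treeForm_singleton, Int.cast_one, one_smul]
      · rw [univCochain_of_ne w (by rintro I rfl; exact h rfl), map_zero]
    | r + 2 =>
      have h1 := evW_sum_b r
        (fun a => (lieTransfer (mc k n) n).inner (List.replicate (a + 1) (univ k n)))
        (fun a _ => inner_univ_mem _) (fun a ha w => ih (a + 1) (by omega) w) w
      rw [TransferData.inner_replicate, map_smul]
      change (-1 : k) • evW w (TensorProduct.map (mc k n).par (dupont k n) _) = _
      rw [evW_map_par, h1, univFormPart]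
      split_ifs with h
      · rw [univForm_eq w, univCochain_of_ne w (by rintro I rfl; simp at h), map_zero, map_smul,
          smul_smul, smul_smul, zero_sub]
        have h2 : r + 2 - 1 = r + 1 := rfl
        have h3 : -1 * ws k w * (ws k w * 2 ^ (r + 1)) = -2 ^ (r + 1) := by
          linear_combination (-2 ^ (r + 1)) * ws_mul_self (k := k) w
        rw [h2, h3]
        module
      · rw [map_zero, smul_zero, smul_zero]

/-- The transferred brackets of the universal element are the homogeneous parts of the
differentials of the letters. -/
theorem coef_mcTerm_univ {r : ℕ} (hr : 2 ≤ r) (I : Face n) :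
    (coef k (lieSer k n) I (mcTerm (mc k n) n r (univ k n))).1 =
      -lenPart k n r (dLetter k n I) := by
  obtain ⟨r, rfl⟩ := Nat.exists_eq_add_of_le' hr
  funext w
  have h1 := evW_sum_b r
    (fun a => (lieTransfer (mc k n) n).inner (List.replicate (a + 1) (univ k n)))
    (fun a _ => inner_univ_mem _) (fun a ha w => evW_inner_univ (a + 1) w) w
  rw [coef_apply, mcTerm, map_smul, TransferData.outer_replicate]
  change (_ • evW w (TensorProduct.map LinearMap.id (proj k n) _)) I = -(lenPart k n _ _ w)
  rw [evW_map, h1, lenPart_apply]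
  have h2 : r + 2 - 1 = r + 1 := rfl
  split_ifs with h
  · rw [map_smul, smul_smul, h2, mul_left_comm, inv_mul_cancel₀ (pow_ne_zero _ two_ne_zero),
      mul_one]
    by_cases hz : dLetter k n I w = 0
    · have hz' := hz
      rw [dLetter_eq, univCochain_of_ne w (by rintro I rfl; simp at h), map_zero, zero_add,
        parC_apply] at hz'
      have hp : proj k n (omConv (univForm k) (univForm k) w) I = 0 := by
        have h3 := neg_eq_zero.1 hz'
        exact (mul_eq_zero.1 h3).resolve_left (pow_ne_zero _ (by norm_num))
      rw [hz, Pi.smul_apply, hp, smul_zero, neg_zero]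
    · have hd := dLetter_degree I w hz
      rw [dLetter_eq, univCochain_of_ne w (by rintro I rfl; simp at h), map_zero, zero_add,
        parC_apply, Pi.smul_apply, neg_neg, smul_eq_mul, ws, hd]
      congr 1
      rw [Int.negOnePow_add, Int.negOnePow_sub]
      simp [Int.negOnePow_def]
  · rw [map_zero, smul_zero, neg_zero]
    rfl

theorem liePoly_one (f : TSer k n) (hf : ∀ w : List (Face n), w.length ≠ 1 → f w = 0) :
    f ∈ liePoly k n 1 := by
  have : f = ∑ I, f [I] • letter k n I := by
    funext w
    rw [Finset.sum_apply]
    by_cases hw : w.length = 1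
    · obtain ⟨J, rfl⟩ := List.length_eq_one_iff.1 hw
      simp [letter]
    · rw [hf w hw]
      refine (Finset.sum_eq_zero fun I _ => ?_).symm
      have : w ≠ [I] := by rintro rfl; exact hw rfl
      simp [letter, this]
  rw [this]
  exact sum_mem fun I _ => Submodule.smul_mem _ _ (Submodule.subset_span
    (IsBracketing.of _ ⟨I, rfl⟩))

/-- The differentials of the letters are Lie series: their homogeneous parts are the transferred
brackets of the universal element, hence coefficients of elements of `mc_n ⊗ C_n`. -/
theorem dLetter_mem (I : Face n) : dLetter k n I ∈ lieDeg k n (1 - (I.dim : ℤ) + 1) := by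
  refine ⟨fun w hw => by_contra fun h => hw (dLetter_degree I w h), fun r => ?_⟩
  match r with
  | 0 =>
    have : lenPart k n 0 (dLetter k n I) = 0 := by
      funext w
      rw [lenPart_apply]
      split_ifs with h
      · rw [List.length_eq_zero_iff.1 h, dLetter_nil]; rfl
      · rfl
    rw [this]
    exact zero_mem _
  | 1 => exact liePoly_one _ fun w hw => if_neg hw
  | r + 2 =>
    have h := lenPart_mem_liePoly (coef k (lieSer k n) I (mcTerm (mc k n) n (r + 2) (univ k n))).2
      (r + 2)
    rw [coef_mcTerm_univ (by omega), map_neg] at h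
    have h2 : lenPart k n (r + 2) (lenPart k n (r + 2) (dLetter k n I)) =
        lenPart k n (r + 2) (dLetter k n I) := by
      funext w
      simp only [lenPart_apply]
      split_ifs <;> rfl
    rw [h2] at h
    exact (Submodule.neg_mem_iff _).1 h

end UniversalLie

/-! ### The cosimplicial dg Lie algebra of Lie series -/

section Structure

variable {k : Type*} [Field k] [CharZero k] {l m n : ℕ}

theorem bracketing_homSer {r : ℕ} {f : TSer k n}
    (hf : IsBracketing (fun a b => tbr k n a b) (Set.range (letter k n)) r f) :
    ∃ i, f ∈ homSer k n i := by
  induction hf with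
  | of f hf => obtain ⟨I, rfl⟩ := hf; exact ⟨_, letter_mem_homSer I⟩
  | bracket a b f g _ _ hf hg =>
    obtain ⟨i, hi⟩ := hf
    obtain ⟨j, hj⟩ := hg
    exact ⟨i + j, tbr_mem_homSer hi hj⟩

theorem dSer_congr {f g : TSer k n} (w : List (Face n))
    (h : ∀ u : List (Face n), u.length ≤ w.length → f u = g u) : dSer k n f w = dSer k n g w := by
  simp only [dSer, LinearMap.coe_mk, AddHom.coe_mk]
  refine Finset.sum_congr rfl fun a ha => Finset.sum_congr rfl fun b hb =>
    Finset.sum_congr rfl fun I _ => ?_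
  rcases Nat.eq_zero_or_pos b with rfl | hb0
  · rw [List.take_zero, dLetter_nil]; ring
  · rw [h]
    have ha' := Finset.mem_range.1 ha
    have hb' := Finset.mem_range.1 hb
    rw [List.length_append, List.length_cons, List.length_take, List.length_drop, List.length_drop]
    omega

theorem eq_sum_lenPart (f : TSer k n) (r : ℕ) (w : List (Face n)) (hw : w.length ≤ r) :
    f w = (∑ s ∈ Finset.range (r + 1), lenPart k n s f) w := by
  rw [Finset.sum_apply, Finset.sum_eq_single w.length]
  · exact (if_pos rfl).symm
  · intro s _ hs
    exact if_neg hs.symm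
  · intro h
    exact absurd (Finset.mem_range.2 (by omega)) h

theorem lenPart_dSer_liePoly {s : ℕ} {f : TSer k n} (hf : f ∈ liePoly k n s) (r : ℕ) :
    lenPart k n r (dSer k n f) ∈ liePoly k n r := by
  suffices h : ∀ s f, IsBracketing (fun a b => tbr k n a b) (Set.range (letter k n)) s f →
      ∀ r, lenPart k n r (dSer k n f) ∈ liePoly k n r by
    suffices h' : liePoly k n s ≤ (liePoly k n r).comap (lenPart k n r ∘ₗ dSer k n) from h' hf
    exact Submodule.span_le.2 fun f hf => h s f hf r
  intro s f hf
  induction hf with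
  | of f hf =>
    obtain ⟨I, rfl⟩ := hf
    intro r
    rw [dSer_letter]
    exact (dLetter_mem I).2 r
  | bracket a b f g hf hg ihf ihg =>
    intro r
    obtain ⟨i, hi⟩ := bracketing_homSer hf
    have hf' : f ∈ liePoly k n a := Submodule.subset_span hf
    have hg' : g ∈ liePoly k n b := Submodule.subset_span hg
    have hl {c : ℕ} {h : TSer k n} (hh : h ∈ liePoly k n c) (t : ℕ) :
        lenPart k n t h ∈ liePoly k n t := by
      rw [lenPart_of_liePoly hh]
      split_ifs with e
      · rw [e]; exact hh
      · exact zero_mem _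
    have key {u v : TSer k n} (hu : ∀ t, lenPart k n t u ∈ liePoly k n t)
        (hv : ∀ t, lenPart k n t v ∈ liePoly k n t) :
        lenPart k n r (tbr k n u v) ∈ liePoly k n r := by
      rw [lenPart_bracket]
      refine sum_mem fun c hc => ?_
      have := liePoly_bracket k n c (r - c) _ _ (hu c) (hv (r - c))
      rwa [Nat.add_sub_cancel' (Nat.lt_succ_iff.1 (Finset.mem_range.1 hc))] at this
    change lenPart k n r (dSer k n (tbr k n f g)) ∈ _
    rw [dSer_tbr hi, map_add, map_smul]
    exact add_mem (key ihf (hl hg')) (Submodule.smul_mem _ _ (key (hl hf') ihg))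

/-- The differential of a Lie series is a Lie series, as the differentials of the letters are. -/
theorem dSer_mem_lieDeg {i : ℤ} {f : TSer k n} (hf : f ∈ lieDeg k n i) :
    dSer k n f ∈ lieDeg k n (i + 1) := by
  refine ⟨dSer_mem_homSer hf.1, fun r => ?_⟩
  have : lenPart k n r (dSer k n f) =
      ∑ s ∈ Finset.range (r + 1), lenPart k n r (dSer k n (lenPart k n s f)) := by
    rw [← map_sum, ← map_sum]
    funext w
    rw [lenPart_apply, lenPart_apply]
    split_ifs with hw
    · exact dSer_congr w fun u hu => eq_sum_lenPart f r u (by omega)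
    · rfl
  rw [this]
  exact sum_mem fun s _ => lenPart_dSer_liePoly (hf.2 s) r

theorem map_lieSer_le {M : Type*} [AddCommGroup M] [Module k M] {T : TSer k n →ₗ[k] M}
    {S : Submodule k M} (h : ∀ i, ∀ f ∈ lieDeg k n i, T f ∈ S) {f : TSer k n}
    (hf : f ∈ lieSer k n) : T f ∈ S := by
  suffices h' : lieSer k n ≤ S.comap T from h' hf
  exact iSup_le fun i f hf => h i f hf

/-- The differential preserves Lie series. -/
theorem dSer_mem_lieSer {f : TSer k n} (hf : f ∈ lieSer k n) : dSer k n f ∈ lieSer k n :=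
  map_lieSer_le (fun _ _ h => lieDeg_le k n _ (dSer_mem_lieDeg h)) hf

theorem restrictTo_apply {V V' : Type*} [AddCommGroup V] [Module k V] [AddCommGroup V']
    [Module k V'] {A : Submodule k V} {B : Submodule k V'} {f : V →ₗ[k] V'}
    (h : ∀ x ∈ A, f x ∈ B) (x : A) : (restrictTo A B f x).1 = f x := by
  rw [restrictTo, dif_pos h]
  rfl

theorem mc_d_apply (x : lieSer k n) : ((mc k n).d x).1 = dSer k n x.1 :=
  restrictTo_apply (fun _ => dSer_mem_lieSer) x

theorem mc_bracket_apply (x y : lieSer k n) : ((mc k n).bracket x y).1 = tbr k n x.1 y.1 := rfl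

theorem coe_zsmul_negOnePow (p : ℤ) (x : lieSer k n) :
    (((p.negOnePow : ℤ) • x : lieSer k n) : TSer k n) = ((p.negOnePow : ℤ) : k) • x.1 := by
  rw [Int.cast_smul_eq_zsmul]; rfl

theorem mc_isDGLie (n : ℕ) : (mc k n).IsDGLie where
  bracket_mem i j x hx y hy := mc_bracket_mem i j x hx y hy
  d_mem i x hx := by
    change ((mc k n).d x).1 ∈ lieDeg k n (i + 1)
    rw [mc_d_apply]
    exact dSer_mem_lieDeg hx
  antisymm i j x hx y hy := Subtype.ext <| by
    rw [Submodule.coe_neg, coe_zsmul_negOnePow]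
    exact tbr_antisymm hx.1 hy.1
  jacobi i j x hx y hy z := Subtype.ext <| by
    rw [Submodule.coe_add, coe_zsmul_negOnePow]
    exact tbr_jacobi hx.1 hy.1 z.1
  leibniz i x hx y := Subtype.ext <| by
    rw [Submodule.coe_add, coe_zsmul_negOnePow, mc_d_apply, mc_bracket_apply, mc_bracket_apply,
      mc_bracket_apply, mc_d_apply, mc_d_apply]
    exact dSer_tbr hx.1 y.1
  d_d x := Subtype.ext <| by
    rw [mc_d_apply, mc_d_apply, dSer_dSer]
    rfl

theorem wdeg_ofFn {r : ℕ} (u : Fin r → Face n) :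
    wdeg (List.ofFn u) = ∑ a, (1 - ((u a).dim : ℤ)) := by
  rw [wdeg, List.map_ofFn, List.sum_ofFn]
  rfl

theorem pushSer_mem_homSer (θ : Fin (m + 1) →o Fin (n + 1)) {i : ℤ} {f : TSer k m}
    (hf : f ∈ homSer k m i) : pushSer k θ f ∈ homSer k n i := by
  intro w hw
  rw [pushSer_eq, serPush]
  refine Finset.sum_eq_zero fun u _ => ?_
  by_cases h : ∀ a, pullCoef k θ (w.get a) (u a) ≠ 0
  · rw [hf, smul_zero]
    rw [wdeg_ofFn]
    rw [← List.ofFn_get w, wdeg_ofFn] at hw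
    rwa [Finset.sum_congr rfl fun a _ => by rw [← pullCoef_dim θ _ _ (h a)]]
  · push Not at h
    obtain ⟨a, ha⟩ := h
    rw [Finset.prod_eq_zero (Finset.mem_univ a) ha, zero_smul]

theorem pushSer_tmul (θ : Fin (m + 1) →o Fin (n + 1)) (f g : TSer k m) :
    pushSer k θ (tmul k m f g) = tmul k n (pushSer k θ f) (pushSer k θ g) := by
  rw [pushSer_eq, pushSer_eq, pushSer_eq]
  funext w
  exact serPush_conv _ (AlgHom.id k k) (fun _ => rfl) (pullCoef_dim θ) f g w

theorem pushSer_sgnSer (θ : Fin (m + 1) →o Fin (n + 1)) (i : ℤ) (f : TSer k m) :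
    pushSer k θ (sgnSer k m i f) = sgnSer k n i (pushSer k θ f) := by
  funext w
  rw [sgnSer_apply, pushSer_eq, pushSer_eq, serPush, serPush, Finset.mul_sum]
  refine Finset.sum_congr rfl fun u _ => ?_
  by_cases h : ∀ a, pullCoef k θ (w.get a) (u a) ≠ 0
  · have : wdeg (List.ofFn u) = wdeg w := by
      conv_rhs => rw [← List.ofFn_get w]
      rw [wdeg_ofFn, wdeg_ofFn]
      exact Finset.sum_congr rfl fun a _ => by rw [pullCoef_dim θ _ _ (h a)]
    rw [sgnSer_apply, this]
    simp only [smul_eq_mul]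
    ring
  · push Not at h
    obtain ⟨a, ha⟩ := h
    rw [Finset.prod_eq_zero (Finset.mem_univ a) ha, zero_smul, zero_smul, mul_zero]

theorem pushSer_tbr (θ : Fin (m + 1) →o Fin (n + 1)) {i : ℤ} {f : TSer k m}
    (hf : f ∈ homSer k m i) (g : TSer k m) :
    pushSer k θ (tbr k m f g) = tbr k n (pushSer k θ f) (pushSer k θ g) := by
  rw [tbr_of_mem hf, tbr_of_mem (pushSer_mem_homSer θ hf), map_sub, pushSer_tmul, pushSer_tmul,
    pushSer_sgnSer]

theorem pushSer_letter (θ : Fin (m + 1) →o Fin (n + 1)) (J : Face m) :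
    pushSer k θ (letter k m J) = ∑ I, pullCoef k θ I J • letter k n I := by
  have h := fun w => congrFun (serPush_univCochain (k := k) θ w) J
  funext w
  have h1 : serPush (pullCoef k θ) (letter k m J) w =
      serPush (pullCoef k θ) (univCochain k) w J :=
    serPush_map (pullCoef k θ) (LinearMap.proj J : Cc k m →ₗ[k] k) (univCochain k) w
  rw [pushSer_eq, h1, h, pullC_apply, Finset.sum_apply]
  rfl

theorem pushSer_liePoly (θ : Fin (m + 1) →o Fin (n + 1)) {r : ℕ} {f : TSer k m}
    (hf : f ∈ liePoly k m r) : pushSer k θ f ∈ liePoly k n r := by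
  suffices h : ∀ s f, IsBracketing (fun a b => tbr k m a b) (Set.range (letter k m)) s f →
      pushSer k θ f ∈ liePoly k n s by
    suffices h' : liePoly k m r ≤ (liePoly k n r).comap (pushSer k θ) from h' hf
    exact Submodule.span_le.2 fun f hf => h r f hf
  intro s f hf
  induction hf with
  | of f hf =>
    obtain ⟨J, rfl⟩ := hf
    rw [pushSer_letter]
    exact sum_mem fun I _ => Submodule.smul_mem _ _ (Submodule.subset_span
      (IsBracketing.of _ ⟨I, rfl⟩))
  | bracket a b f g hf hg ihf ihg =>
    obtain ⟨i, hi⟩ := bracketing_homSer hf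
    rw [pushSer_tbr θ hi]
    exact liePoly_bracket k n a b _ _ ihf ihg

theorem lenPart_pushSer (θ : Fin (m + 1) →o Fin (n + 1)) (r : ℕ) (f : TSer k m) :
    lenPart k n r (pushSer k θ f) = pushSer k θ (lenPart k m r f) := by
  funext w
  rw [lenPart_apply, pushSer_eq, pushSer_eq, serPush, serPush]
  simp only [lenPart_apply, List.length_ofFn]
  split_ifs with h
  · rfl
  · simp

theorem pushSer_mem_lieDeg (θ : Fin (m + 1) →o Fin (n + 1)) {i : ℤ} {f : TSer k m}
    (hf : f ∈ lieDeg k m i) : pushSer k θ f ∈ lieDeg k n i := by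
  refine ⟨pushSer_mem_homSer θ hf.1, fun r => ?_⟩
  rw [lenPart_pushSer]
  exact pushSer_liePoly θ (hf.2 r)

theorem pushSer_mem_lieSer (θ : Fin (m + 1) →o Fin (n + 1)) {f : TSer k m}
    (hf : f ∈ lieSer k m) : pushSer k θ f ∈ lieSer k n :=
  map_lieSer_le (fun _ _ h => lieDeg_le k n _ (pushSer_mem_lieDeg θ h)) hf

theorem mcMap_apply (θ : Fin (m + 1) →o Fin (n + 1)) (x : lieSer k m) :
    (mcMap k θ x).1 = pushSer k θ x.1 :=
  restrictTo_apply (fun _ => pushSer_mem_lieSer θ) x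

theorem mcMap_isDGLieHom (θ : Fin (m + 1) →o Fin (n + 1)) :
    IsDGLieHom (mc k m) (mc k n) (mcMap k θ) where
  map_gr i x hx := by
    change (mcMap k θ x).1 ∈ lieDeg k n i
    rw [mcMap_apply]
    exact pushSer_mem_lieDeg θ hx
  map_bracket x y := by
    refine (mc k m).induction_on (C := fun x => mcMap k θ ((mc k m).bracket x y) =
      (mc k n).bracket (mcMap k θ x) (mcMap k θ y)) x (fun i x hx => Subtype.ext ?_)
      fun x x' hx hx' => ?_
    · have hx' : x.1 ∈ homSer k m i := hx.1
      rw [mcMap_apply, mc_bracket_apply, mc_bracket_apply, mcMap_apply, mcMap_apply,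
        pushSer_tbr θ hx']
    · simp only [map_add, LinearMap.add_apply, hx, hx']
  map_d x := Subtype.ext <| by
    rw [mcMap_apply, mc_d_apply, mc_d_apply, mcMap_apply, dSer_eq, pushSer_eq, pushSer_eq, dSer_eq]
    funext w
    exact serPush_dSer θ x.1 w

theorem mcMap_id (n : ℕ) :
    mcMap k (OrderHom.id : Fin (n + 1) →o Fin (n + 1)) = LinearMap.id := by
  refine LinearMap.ext fun x => Subtype.ext ?_
  rw [mcMap_apply, LinearMap.id_apply, pushSer_eq]
  have key (f : TSer k n) (w : List (Face n)) :
      serPush (pullCoef k (OrderHom.id : Fin (n + 1) →o Fin (n + 1))) f w = f w := by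
    induction w generalizing f with
    | nil => rw [serPush_nil]
    | cons I w ih =>
      rw [serPush_cons, Finset.sum_eq_single I]
      · rw [ih, pullCoef, pullC_id, LinearMap.id_apply, Pi.single_eq_same, one_smul]
      · intro J _ hJ
        rw [pullCoef, pullC_id, LinearMap.id_apply, Pi.single_eq_of_ne hJ, zero_smul]
      · simp
  exact funext (key x.1)

theorem mcMap_comp (θ : Fin (l + 1) →o Fin (m + 1)) (ψ : Fin (m + 1) →o Fin (n + 1)) :
    mcMap k (ψ.comp θ) = mcMap k ψ ∘ₗ mcMap k θ := by
  refine LinearMap.ext fun x => Subtype.ext ?_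
  rw [LinearMap.comp_apply, mcMap_apply, mcMap_apply, mcMap_apply, pushSer_eq, pushSer_eq,
    pushSer_eq]
  have hc (I : Face n) (K : Face l) : pullCoef k (ψ.comp θ) I K =
      ∑ J, pullCoef k ψ I J * pullCoef k θ J K := by
    rw [pullCoef, pullC_comp, LinearMap.comp_apply, pullC_apply]
    exact Finset.sum_congr rfl fun J _ => mul_comm _ _
  have key (f : TSer k l) (w : List (Face n)) : serPush (pullCoef k (ψ.comp θ)) f w =
      serPush (pullCoef k ψ) (serPush (pullCoef k θ) f) w := by
    induction w generalizing f with
    | nil => rw [serPush_nil, serPush_nil, serPush_nil]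
    | cons I w ih =>
      have h1 (J : Face m) : (fun u => serPush (pullCoef k θ) f (J :: u)) =
          fun u => ∑ K, pullCoef k θ J K • serPush (pullCoef k θ) (fun v => f (K :: v)) u :=
        funext fun u => serPush_cons _ _ _ _
      rw [serPush_cons, serPush_cons]
      simp only [h1, serPush_sum, serPush_smul, ih, hc, Finset.sum_smul, Finset.smul_sum, smul_smul]
      exact Finset.sum_comm
  exact funext (key x.1)

end Structure

/-! ### The canonical filtration -/

section Filtration

variable {k : Type*} [Field k] {L : Type*} [AddCommGroup L] [Module k L] {D : DGLieData k L}

theorem filt_antitone {M N : ℕ} (h : M ≤ N) : D.filt N ≤ D.filt M :=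
  Submodule.span_mono fun _ ⟨m, hm, hx⟩ => ⟨m, h.trans hm, hx⟩

theorem mem_filt_one (x : L) : x ∈ D.filt 1 :=
  Submodule.subset_span ⟨1, le_rfl, IsBracketing.of x trivial⟩

theorem filt_bracket {M N : ℕ} {x y : L} (hx : x ∈ D.filt M) (hy : y ∈ D.filt N) :
    D.bracket x y ∈ D.filt (M + N) := by
  have h := Submodule.apply_mem_map₂ D.bracket hx hy
  rw [DGLieData.filt, DGLieData.filt, Submodule.map₂_span_span] at h
  refine Submodule.span_mono ?_ h
  rintro _ ⟨x, ⟨a, ha, hx⟩, y, ⟨b, hb, hy⟩, rfl⟩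
  exact ⟨a + b, by omega, IsBracketing.bracket a b x y hx hy⟩

theorem filt_bracket_left {N : ℕ} {x : L} (hx : x ∈ D.filt N) (y : L) :
    D.bracket x y ∈ D.filt N :=
  filt_antitone (Nat.le_add_right N 1) (filt_bracket hx (mem_filt_one y))

theorem filt_bracket_right {N : ℕ} (x : L) {y : L} (hy : y ∈ D.filt N) :
    D.bracket x y ∈ D.filt N :=
  filt_antitone (Nat.le_add_left N 1) (filt_bracket (mem_filt_one x) hy)

theorem par_bracket (hD : D.IsDGLie) (x y : L) :
    D.par (D.bracket x y) = D.bracket (D.par x) (D.par y) := by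
  refine D.induction_on (C := fun x => D.par (D.bracket x y) = D.bracket (D.par x) (D.par y)) x
    (fun i x hx => ?_) fun x x' hx hx' => by simp only [map_add, LinearMap.add_apply, hx, hx']
  refine D.induction_on (C := fun y => D.par (D.bracket x y) = D.bracket (D.par x) (D.par y)) y
    (fun j y hy => ?_) fun y y' hy hy' => by simp only [map_add, hy, hy']
  rw [D.par_of_mem hx, D.par_of_mem hy, D.par_of_mem (hD.bracket_mem i j x hx y hy),
    Int.negOnePow_add, map_smul, map_smul, LinearMap.smul_apply, smul_smul, mul_comm]
  push_cast
  rfl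

theorem d_bracket (hD : D.IsDGLie) (x y : L) :
    D.d (D.bracket x y) = D.bracket (D.d x) y + D.bracket (D.par x) (D.d y) := by
  refine D.induction_on (C := fun x => D.d (D.bracket x y) =
    D.bracket (D.d x) y + D.bracket (D.par x) (D.d y)) x (fun i x hx => ?_) fun x x' hx hx' => ?_
  · rw [hD.leibniz i x hx, D.par_of_mem hx, map_smul, LinearMap.smul_apply, Int.cast_smul_eq_zsmul]
  · simp only [map_add, LinearMap.add_apply, hx, hx']
    abel

theorem d_mem_filt (hD : D.IsDGLie) {N : ℕ} {x : L} (hx : x ∈ D.filt N) : D.d x ∈ D.filt N := by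
  suffices h : ∀ m x, IsBracketing (fun a b => D.bracket a b) Set.univ m x →
      D.par x ∈ D.filt m ∧ D.d x ∈ D.filt m by
    suffices h' : D.filt N ≤ (D.filt N).comap D.d from h' hx
    refine Submodule.span_le.2 ?_
    rintro x ⟨m, hm, hx⟩
    exact filt_antitone hm (h m x hx).2
  intro m x hx
  induction hx with
  | of x _ => exact ⟨mem_filt_one _, mem_filt_one _⟩
  | bracket a b x y hx hy ihx ihy =>
    have hx' : x ∈ D.filt a := Submodule.subset_span ⟨a, le_rfl, hx⟩
    have hy' : y ∈ D.filt b := Submodule.subset_span ⟨b, le_rfl, hy⟩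
    refine ⟨?_, ?_⟩
    · rw [par_bracket hD]
      exact filt_bracket ihx.1 ihy.1
    · rw [d_bracket hD]
      exact add_mem (filt_bracket ihx.2 hy') (filt_bracket ihx.1 ihy.2)

end Filtration

/-! ### Dynkin operators and evaluation of Lie polynomials -/

section Dynkin

variable {k : Type*} [Field k] {L : Type*} [AddCommGroup L] [Module k L] {n : ℕ}

/-- The operator `ad a_1 ⋯ ad a_p` attached to a word of length `p`, extended linearly. -/
def dynAd (D : DGLieData k L) (a : Face n → L) : ℕ → TSer k n →ₗ[k] L →ₗ[k] L
  | 0 => (LinearMap.lsmul k (L →ₗ[k] L)).flip LinearMap.id ∘ₗ LinearMap.proj []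
  | p + 1 => ∑ I, (LinearMap.llcomp k L L L (D.bracket (a I)) ∘ₗ dynAd D a p) ∘ₗ shift k I

/-- The right-normed bracket `[a_1, [a_2, …, a_p]]` attached to a word of length `p`, extended
linearly. -/
def dynTh (D : DGLieData k L) (a : Face n → L) : ℕ → TSer k n →ₗ[k] L
  | 0 => 0
  | 1 => ∑ I, (LinearMap.lsmul k L).flip (a I) ∘ₗ LinearMap.proj [I]
  | p + 2 => ∑ I, (D.bracket (a I) ∘ₗ dynTh D a (p + 1)) ∘ₗ shift k I

variable {D : DGLieData k L} {a : Face n → L}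

theorem dynAd_zero (f : TSer k n) (z : L) : dynAd D a 0 f z = f [] • z := rfl

theorem dynAd_succ (p : ℕ) (f : TSer k n) (z : L) :
    dynAd D a (p + 1) f z = ∑ I, D.bracket (a I) (dynAd D a p (shift k I f) z) := by
  rw [dynAd, LinearMap.sum_apply, LinearMap.sum_apply]
  rfl

theorem dynTh_zero (f : TSer k n) : dynTh D a 0 f = 0 := rfl

theorem dynTh_one (f : TSer k n) : dynTh D a 1 f = ∑ I, f [I] • a I := by
  rw [dynTh, LinearMap.sum_apply]
  rfl

theorem dynTh_succ {p : ℕ} (hp : p ≠ 0) (f : TSer k n) :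
    dynTh D a (p + 1) f = ∑ I, D.bracket (a I) (dynTh D a p (shift k I f)) := by
  obtain ⟨p, rfl⟩ := Nat.exists_eq_succ_of_ne_zero hp
  rw [dynTh, LinearMap.sum_apply]
  rfl

theorem shift_tmul (I : Face n) (f g : TSer k n) :
    shift k I (tmul k n f g) = f [] • shift k I g + tmul k n (shift k I f) g := by
  funext w
  rw [Pi.add_apply, shift_apply, tmul_apply, tmul_apply, List.length_cons, Finset.sum_range_succ',
    add_comm]
  rfl

theorem tmul_of_length_zero {f : TSer k n} (hf : ∀ w : List (Face n), w.length ≠ 0 → f w = 0)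
    (g : TSer k n) : tmul k n f g = f [] • g := by
  funext w
  rw [tmul_apply, Finset.sum_eq_single 0]
  · simp
  · intro c hc hc0
    have hc' := Finset.mem_range.1 hc
    rw [hf, zero_mul]
    rw [List.length_take]
    omega
  · simp

theorem dynAd_tmul {p : ℕ} {f : TSer k n} (hf : ∀ w : List (Face n), w.length ≠ p → f w = 0)
    (q : ℕ) (g : TSer k n) (z : L) :
    dynAd D a (p + q) (tmul k n f g) z = dynAd D a p f (dynAd D a q g z) := by
  induction p generalizing f with
  | zero => rw [tmul_of_length_zero hf, zero_add, map_smul, LinearMap.smul_apply, dynAd_zero]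
  | succ p ih =>
    rw [Nat.add_right_comm, dynAd_succ, dynAd_succ]
    refine Finset.sum_congr rfl fun I _ => ?_
    rw [shift_tmul, hf [] (by simp), zero_smul, zero_add, ih]
    intro w hw
    exact hf _ (by simpa using hw)

theorem dynTh_tmul {p : ℕ} {f : TSer k n} (hf : ∀ w : List (Face n), w.length ≠ p → f w = 0)
    {q : ℕ} (hq : q ≠ 0) (g : TSer k n) :
    dynTh D a (p + q) (tmul k n f g) = dynAd D a p f (dynTh D a q g) := by
  induction p generalizing f with
  | zero => rw [tmul_of_length_zero hf, zero_add, map_smul, dynAd_zero]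
  | succ p ih =>
    rw [Nat.add_right_comm, dynTh_succ (by omega), dynAd_succ]
    refine Finset.sum_congr rfl fun I _ => ?_
    rw [shift_tmul, hf [] (by simp), zero_smul, zero_add, ih]
    intro w hw
    exact hf _ (by simpa using hw)

/-- `IsEval D a r f x`: the polynomial `f` and the element `x` are the values of the same iterated
bracket of `r` letters, in the tensor algebra and in `L` respectively. -/
inductive IsEval (D : DGLieData k L) (a : Face n → L) : ℕ → TSer k n → L → Prop
  | of (I : Face n) : IsEval D a 1 (letter k n I) (a I)
  | bracket (p q : ℕ) (f g : TSer k n) (x y : L) (hx : IsEval D a p f x)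
      (hy : IsEval D a q g y) : IsEval D a (p + q) (tbr k n f g) (D.bracket x y)

theorem IsBracketing.exists_isEval {r : ℕ} {f : TSer k n}
    (hf : IsBracketing (fun a b => tbr k n a b) (Set.range (letter k n)) r f) :
    ∃ x, IsEval D a r f x := by
  induction hf with
  | of f hf => obtain ⟨I, rfl⟩ := hf; exact ⟨a I, IsEval.of I⟩
  | bracket p q f g _ _ hf hg =>
    obtain ⟨x, hx⟩ := hf
    obtain ⟨y, hy⟩ := hg
    exact ⟨_, IsEval.bracket p q f g x y hx hy⟩

theorem IsEval.isBracketing {r : ℕ} {f : TSer k n} {x : L} (h : IsEval D a r f x) :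
    IsBracketing (fun a b => tbr k n a b) (Set.range (letter k n)) r f := by
  induction h with
  | of I => exact IsBracketing.of _ ⟨I, rfl⟩
  | bracket p q f g x y _ _ hx hy => exact IsBracketing.bracket p q f g hx hy

theorem IsEval.mem_liePoly {r : ℕ} {f : TSer k n} {x : L} (h : IsEval D a r f x) :
    f ∈ liePoly k n r := Submodule.subset_span h.isBracketing

theorem IsEval.isBracketing_right {r : ℕ} {f : TSer k n} {x : L} (h : IsEval D a r f x) :
    IsBracketing (fun a b => D.bracket a b) Set.univ r x := by
  induction h with
  | of I => exact IsBracketing.of _ trivial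
  | bracket p q f g x y _ _ hx hy => exact IsBracketing.bracket p q x y hx hy

theorem IsEval.ne_zero {r : ℕ} {f : TSer k n} {x : L} (h : IsEval D a r f x) : r ≠ 0 := by
  induction h with
  | of I => exact one_ne_zero
  | bracket p q f g x y _ _ hx hy => omega

theorem IsEval.homogeneous (hD : D.IsDGLie) (ha : ∀ I, a I ∈ D.gr (1 - (I.dim : ℤ))) {r : ℕ}
    {f : TSer k n} {x : L} (h : IsEval D a r f x) : ∃ i, f ∈ homSer k n i ∧ x ∈ D.gr i := by
  induction h with
  | of I => exact ⟨_, letter_mem_homSer I, ha I⟩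
  | bracket p q f g x y _ _ hx hy =>
    obtain ⟨i, hf, hx⟩ := hx
    obtain ⟨j, hg, hy⟩ := hy
    exact ⟨i + j, tbr_mem_homSer hf hg, hD.bracket_mem i j x hx y hy⟩

/-- The operator `ad a_1 ⋯ ad a_p`, extended linearly to polynomials, takes a Lie polynomial to
the adjoint action of its value. -/
theorem IsEval.dynAd_eq (hD : D.IsDGLie) (ha : ∀ I, a I ∈ D.gr (1 - (I.dim : ℤ))) {r : ℕ}
    {f : TSer k n} {x : L} (h : IsEval D a r f x) (z : L) : dynAd D a r f z = D.bracket x z := by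
  induction h generalizing z with
  | of I =>
    rw [dynAd_succ, Finset.sum_eq_single I]
    · rw [dynAd_zero, shift_apply]; simp [letter]
    · intro J _ hJ
      rw [dynAd_zero, shift_apply]; simp [letter, hJ]
    · simp
  | bracket p q f g x y hx hy ihx ihy =>
    obtain ⟨i, hf, hxi⟩ := hx.homogeneous hD ha
    obtain ⟨j, hg, hyj⟩ := hy.homogeneous hD ha
    have h1 := dynAd_tmul (D := D) (a := a) (liePoly_length hx.mem_liePoly) q g z
    have h2 := dynAd_tmul (D := D) (a := a) (liePoly_length hy.mem_liePoly) p f z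
    rw [add_comm] at h2
    rw [tbr_of_mem hf, sgnSer_of_mem hg, map_smul, LinearMap.smul_apply, map_sub, map_smul,
      LinearMap.sub_apply, LinearMap.smul_apply, h1, h2, ihx, ihy, ihx, ihy,
      hD.jacobi i j x hxi y hyj z, Int.cast_smul_eq_zsmul, add_sub_cancel_right]

/-- Dynkin's lemma: replacing words by right-normed brackets multiplies a Lie polynomial of length
`r` by `r`. -/
theorem IsEval.dynTh_eq (hD : D.IsDGLie) (ha : ∀ I, a I ∈ D.gr (1 - (I.dim : ℤ))) {r : ℕ}
    {f : TSer k n} {x : L} (h : IsEval D a r f x) : dynTh D a r f = (r : k) • x := by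
  induction h with
  | of I =>
    rw [dynTh_one, Finset.sum_eq_single I]
    · simp [letter]
    · intro J _ hJ
      simp [letter, hJ]
    · simp
  | bracket p q f g x y hx hy ihx ihy =>
    obtain ⟨i, hf, hxi⟩ := hx.homogeneous hD ha
    obtain ⟨j, hg, hyj⟩ := hy.homogeneous hD ha
    have h1 := dynTh_tmul (D := D) (a := a) (liePoly_length hx.mem_liePoly) hy.ne_zero g
    have h2 := dynTh_tmul (D := D) (a := a) (liePoly_length hy.mem_liePoly) hx.ne_zero f
    rw [add_comm] at h2
    have h3 : D.bracket x y = -((((i * j).negOnePow : ℤ) : k) • D.bracket y x) := by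
      rw [Int.cast_smul_eq_zsmul]; exact hD.antisymm i j x hxi y hyj
    rw [tbr_of_mem hf, sgnSer_of_mem hg, map_smul, LinearMap.smul_apply, map_sub, map_smul, h1, h2,
      ihx, ihy, hx.dynAd_eq hD ha, hy.dynAd_eq hD ha, map_smul, map_smul, smul_comm, sub_eq_add_neg,
      ← smul_neg, ← h3, Nat.cast_add, add_smul, add_comm]

/-- The value at `a` of a Lie polynomial of length `r`. By Dynkin's lemma it can be defined on all
polynomials, as the right-normed bracketing divided by `r`. -/
def lieEval (D : DGLieData k L) (a : Face n → L) (r : ℕ) : TSer k n →ₗ[k] L :=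
  (r : k)⁻¹ • dynTh D a r

theorem IsEval.lieEval_eq [CharZero k] (hD : D.IsDGLie) (ha : ∀ I, a I ∈ D.gr (1 - (I.dim : ℤ)))
    {r : ℕ} {f : TSer k n} {x : L} (h : IsEval D a r f x) : lieEval D a r f = x := by
  rw [lieEval, LinearMap.smul_apply, h.dynTh_eq hD ha, smul_smul, inv_mul_cancel₀, one_smul]
  exact_mod_cast h.ne_zero

theorem dynTh_mem_gr (hD : D.IsDGLie) (ha : ∀ I, a I ∈ D.gr (1 - (I.dim : ℤ))) (r : ℕ) {i : ℤ}
    {f : TSer k n} (hf : f ∈ homSer k n i) : dynTh D a r f ∈ D.gr i := by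
  induction r generalizing f i with
  | zero => rw [dynTh_zero]; exact zero_mem _
  | succ r ih =>
    rcases Nat.eq_zero_or_pos r with rfl | hr
    · rw [dynTh_one]
      refine sum_mem fun I _ => ?_
      by_cases h : wdeg [I] = i
      · rw [wdeg_singleton] at h
        rw [← h]
        exact Submodule.smul_mem _ _ (ha I)
      · rw [hf _ h, zero_smul]; exact zero_mem _
    · rw [dynTh_succ hr.ne']
      refine sum_mem fun I _ => ?_
      have h1 : shift k I f ∈ homSer k n (i - (1 - (I.dim : ℤ))) := by
        intro w hw
        refine hf _ ?_
        rw [wdeg_cons]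
        omega
      have h2 := hD.bracket_mem _ _ _ (ha I) _ (ih h1)
      rwa [add_sub_cancel] at h2

variable [CharZero k]

theorem lieEval_mem_gr (hD : D.IsDGLie) (ha : ∀ I, a I ∈ D.gr (1 - (I.dim : ℤ))) (r : ℕ) {i : ℤ}
    {f : TSer k n} (hf : f ∈ homSer k n i) : lieEval D a r f ∈ D.gr i :=
  Submodule.smul_mem _ _ (dynTh_mem_gr hD ha r hf)

theorem liePoly_induction {r : ℕ} {S : Submodule k (TSer k n)}
    (h : ∀ f x, IsEval D a r f x → f ∈ S) {f : TSer k n} (hf : f ∈ liePoly k n r) : f ∈ S := by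
  suffices h' : liePoly k n r ≤ S from h' hf
  refine Submodule.span_le.2 fun f hf => ?_
  obtain ⟨x, hx⟩ := IsBracketing.exists_isEval (D := D) (a := a) hf
  exact h f x hx

theorem lieEval_mem_filt (hD : D.IsDGLie) (ha : ∀ I, a I ∈ D.gr (1 - (I.dim : ℤ))) {r : ℕ}
    {f : TSer k n} (hf : f ∈ liePoly k n r) : lieEval D a r f ∈ D.filt r := by
  refine liePoly_induction (D := D) (a := a) (S := (D.filt r).comap (lieEval D a r))
    (fun f x h => ?_) hf
  change lieEval D a r f ∈ D.filt r
  rw [h.lieEval_eq hD ha]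
  exact Submodule.subset_span ⟨r, le_rfl, h.isBracketing_right⟩

/-- Evaluation of Lie polynomials is compatible with brackets. -/
theorem lieEval_tbr (hD : D.IsDGLie) (ha : ∀ I, a I ∈ D.gr (1 - (I.dim : ℤ))) {p q : ℕ}
    {f g : TSer k n} (hf : f ∈ liePoly k n p) (hg : g ∈ liePoly k n q) :
    lieEval D a (p + q) (tbr k n f g) = D.bracket (lieEval D a p f) (lieEval D a q g) := by
  have h1 : f ∈ ((lieEval D a (p + q) ∘ₗ (tbr k n).flip g) -
      (D.bracket.flip (lieEval D a q g) ∘ₗ lieEval D a p)).ker := by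
    refine liePoly_induction (D := D) (a := a) (fun f x hfx => ?_) hf
    have h2 : g ∈ ((lieEval D a (p + q) ∘ₗ tbr k n f) -
        (D.bracket (lieEval D a p f) ∘ₗ lieEval D a q)).ker := by
      refine liePoly_induction (D := D) (a := a) (fun g y hgy => ?_) hg
      rw [LinearMap.mem_ker, LinearMap.sub_apply, sub_eq_zero, LinearMap.comp_apply,
        LinearMap.comp_apply, hfx.lieEval_eq hD ha, hgy.lieEval_eq hD ha]
      exact (IsEval.bracket p q f g x y hfx hgy).lieEval_eq hD ha
    exact h2
  rw [LinearMap.mem_ker, LinearMap.sub_apply, sub_eq_zero] at h1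
  exact h1

theorem lieEval_letter (hD : D.IsDGLie) (ha : ∀ I, a I ∈ D.gr (1 - (I.dim : ℤ))) (I : Face n) :
    lieEval D a 1 (letter k n I) = a I := (IsEval.of I).lieEval_eq hD ha

end Dynkin

/-! ### Completeness of the Lie series -/

section Completeness

variable {k : Type*} [Field k] [CharZero k] {n : ℕ}

/-- The right-normed bracketing of generators has values in Lie polynomials. -/
theorem gen_coe_liePoly (p : ℕ) (f : TSer k n) :
    (dynTh (mc k n) (gen k n) p f).1 ∈ liePoly k n p := by
  induction p generalizing f with
  | zero => rw [dynTh_zero]; exact zero_mem _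
  | succ p ih =>
    rcases Nat.eq_zero_or_pos p with rfl | hp
    · rw [dynTh_one, ← Submodule.subtype_apply, map_sum]
      refine sum_mem fun I _ => ?_
      rw [map_smul]
      exact Submodule.smul_mem _ _ (Submodule.subset_span (IsBracketing.of _ ⟨I, rfl⟩))
    · rw [dynTh_succ hp.ne', ← Submodule.subtype_apply, map_sum]
      refine sum_mem fun I _ => ?_
      have := liePoly_bracket k n 1 p _ _
        (Submodule.subset_span (IsBracketing.of (letter k n I) ⟨I, rfl⟩)) (ih (shift k I f))
      rwa [add_comm] at this

theorem isEval_mc {r : ℕ} {f : TSer k n} {x : lieSer k n}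
    (h : IsEval (mc k n) (gen k n) r f x) : x.1 = f := by
  induction h with
  | of I => rfl
  | bracket p q f g x y _ _ hx hy => rw [mc_bracket_apply, hx, hy]

/-- Lie polynomials are their own values at the generators. -/
theorem lieEval_mc {r : ℕ} {f : TSer k n} (hf : f ∈ liePoly k n r) :
    (lieEval (mc k n) (gen k n) r f).1 = f := by
  have h : f ∈ ((lieSer k n).subtype ∘ₗ lieEval (mc k n) (gen k n) r - LinearMap.id).ker := by
    refine liePoly_induction (D := mc k n) (a := gen k n) (fun f x h => ?_) hf
    rw [LinearMap.mem_ker, LinearMap.sub_apply, sub_eq_zero, LinearMap.comp_apply,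
      h.lieEval_eq (mc_isDGLie n) gen_mem_gr]
    exact isEval_mc h
  rw [LinearMap.mem_ker, LinearMap.sub_apply, sub_eq_zero] at h
  exact h

/-- Lie series have no constant term. -/
theorem lenPart_zero {f : TSer k n} (hf : f ∈ lieSer k n) : f [] = 0 := by
  have h := lenPart_mem_liePoly hf 0
  suffices h' : liePoly k n 0 ≤ ⊥ from congrFun ((Submodule.mem_bot k).1 (h' h)) []
  refine Submodule.span_le.2 fun g hg => ?_
  obtain ⟨x, hx⟩ := IsBracketing.exists_isEval (D := mc k n) (a := gen k n) hg
  exact absurd rfl hx.ne_zero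

/-- Elements of the `N`-th step of the filtration vanish on words of length `< N`. -/
theorem mc_filt_length {N : ℕ} {x : lieSer k n} (hx : x ∈ (mc k n).filt N) (w : List (Face n))
    (hw : w.length < N) : x.1 w = 0 := by
  suffices h : ∀ m (x : lieSer k n), IsBracketing (fun a b => (mc k n).bracket a b) Set.univ m x →
      ∀ w : List (Face n), w.length < m → x.1 w = 0 by
    suffices h' : (mc k n).filt N ≤
        ((LinearMap.proj w : TSer k n →ₗ[k] k) ∘ₗ (lieSer k n).subtype).ker from h' hx
    refine Submodule.span_le.2 ?_
    rintro x ⟨m, hm, hx⟩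
    exact h m x hx w (by omega)
  intro m x hx
  induction hx with
  | of x _ =>
    intro w hw
    rw [List.length_eq_zero_iff.1 (Nat.lt_one_iff.1 hw)]
    exact lenPart_zero x.2
  | bracket a b x y _ _ hx hy =>
    intro w hw
    rw [mc_bracket_apply, tbr_apply]
    refine Finset.sum_eq_zero fun c hc => ?_
    have hc' : c ≤ w.length := Nat.lt_succ_iff.1 (Finset.mem_range.1 hc)
    have h1 : (w.take c).length = c := by rw [List.length_take]; omega
    have h2 : (w.drop c).length = w.length - c := List.length_drop
    have e1 : x.1 (w.take c) * y.1 (w.drop c) = 0 := by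
      by_cases h : c < a
      · rw [hx _ (by omega), zero_mul]
      · rw [hy _ (by omega), mul_zero]
    have e2 : y.1 (w.take c) * x.1 (w.drop c) = 0 := by
      by_cases h : c < b
      · rw [hy _ (by omega), zero_mul]
      · rw [hx _ (by omega), mul_zero]
    rw [e1, e2, mul_zero, sub_zero]

theorem lenPart_letter_tbr (I : Face n) (r : ℕ) (g : TSer k n) :
    lenPart k n (r + 1) (tbr k n (letter k n I) g) = tbr k n (letter k n I) (lenPart k n r g) := by
  have hl : letter k n I ∈ liePoly k n 1 := Submodule.subset_span (IsBracketing.of _ ⟨I, rfl⟩)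
  rw [lenPart_bracket, Finset.sum_eq_single 1]
  · rw [lenPart_of_liePoly hl, if_pos rfl, Nat.add_sub_cancel]
  · intro a _ ha
    rw [lenPart_of_liePoly hl, if_neg ha, map_zero, LinearMap.zero_apply]
  · intro h
    exact absurd (Finset.mem_range.2 (by omega)) h

/-- Lie series `g_I` with `f = ∑_I [v_I, g_I]` for a Lie series `f` without linear term: by
Dynkin's lemma `r f` is, in length `r`, the sum of the brackets of `v_I` with the right-normed
bracketing of the words `w` such that `v_I w` occurs in `f`. -/
def bracketCoef (f : TSer k n) (I : Face n) : TSer k n := fun w =>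
  ((w.length + 1 : ℕ) : k)⁻¹ * (dynTh (mc k n) (gen k n) w.length
    (shift k I (lenPart k n (w.length + 1) f))).1 w

theorem lenPart_bracketCoef (f : TSer k n) (I : Face n) (r : ℕ) :
    lenPart k n r (bracketCoef f I) = ((r + 1 : ℕ) : k)⁻¹ •
      (dynTh (mc k n) (gen k n) r (shift k I (lenPart k n (r + 1) f))).1 := by
  funext w
  rw [lenPart_apply, Pi.smul_apply, smul_eq_mul]
  split_ifs with h
  · subst h; rfl
  · rw [liePoly_length (gen_coe_liePoly r _) w h, mul_zero]

theorem bracketCoef_mem {m : ℤ} {f : TSer k n} (hf : f ∈ lieDeg k n m) (I : Face n) :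
    bracketCoef f I ∈ lieDeg k n (m - (1 - (I.dim : ℤ))) := by
  refine ⟨fun w hw => ?_, fun r => ?_⟩
  · have h1 : shift k I (lenPart k n (w.length + 1) f) ∈ homSer k n (m - (1 - (I.dim : ℤ))) := by
      intro u hu
      rw [shift_apply, lenPart_apply, hf.1, ite_self]
      rw [wdeg_cons]
      omega
    have h2 : (dynTh (mc k n) (gen k n) w.length
        (shift k I (lenPart k n (w.length + 1) f))).1 ∈ lieDeg k n (m - (1 - (I.dim : ℤ))) :=
      dynTh_mem_gr (mc_isDGLie n) gen_mem_gr _ h1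
    rw [bracketCoef, h2.1 w hw, mul_zero]
  · rw [lenPart_bracketCoef]
    exact Submodule.smul_mem _ _ (gen_coe_liePoly r _)

/-- A homogeneous Lie series without linear term is a finite sum of brackets with letters. -/
theorem eq_sum_bracketCoef {m : ℤ} {f : TSer k n} (hf : f ∈ lieDeg k n m)
    (h1 : ∀ w : List (Face n), w.length < 2 → f w = 0) :
    f = ∑ I, tbr k n (letter k n I) (bracketCoef f I) := by
  have hlen (r : ℕ) : lenPart k n r f =
      lenPart k n r (∑ I, tbr k n (letter k n I) (bracketCoef f I)) := by
    match r with
    | 0 =>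
      funext w
      rw [lenPart_apply, lenPart_apply]
      split_ifs with hw
      · rw [h1 w (by omega), Finset.sum_apply, List.length_eq_zero_iff.1 hw]
        refine (Finset.sum_eq_zero fun I _ => ?_).symm
        rw [tbr_apply]
        simp [letter]
      · rfl
    | 1 =>
      rw [map_sum]
      simp only [lenPart_letter_tbr, lenPart_bracketCoef, dynTh_zero]
      funext w
      rw [lenPart_apply]
      split_ifs with hw
      · rw [h1 w (by omega)]; simp
      · simp
    | r + 2 =>
      -- expand the right-normed bracketing of `f` along the first letter
      rw [map_sum]
      simp only [lenPart_letter_tbr, lenPart_bracketCoef, map_smul]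
      rw [← Finset.smul_sum]
      conv_lhs => rw [← lieEval_mc (hf.2 (r + 2)), lieEval, LinearMap.smul_apply,
        dynTh_succ (by omega)]
      rw [Submodule.coe_smul, ← Submodule.subtype_apply, map_sum]
      rfl
  funext w
  have := congrFun (hlen w.length) w
  rwa [lenPart_of_length rfl, lenPart_of_length rfl] at this

/-- Homogeneous Lie series that vanish on words of length `< N` lie in the `N`-th step of the
filtration. This is not immediate, as the filtration is spanned by finite sums of brackets; it
holds because there are only finitely many letters. -/
theorem mem_mc_filt {N : ℕ} {m : ℤ} {x : lieSer k n} (hx : x ∈ (mc k n).gr m)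
    (h : ∀ w : List (Face n), w.length < N → x.1 w = 0) : x ∈ (mc k n).filt N := by
  induction N generalizing m x with
  | zero => exact filt_antitone (Nat.zero_le 1) (mem_filt_one x)
  | succ N ih =>
    rcases Nat.eq_zero_or_pos N with rfl | hN
    · exact mem_filt_one x
    have hx' : x.1 ∈ lieDeg k n m := hx
    have h1 : x = ∑ I, (mc k n).bracket (gen k n I)
        ⟨bracketCoef x.1 I, lieDeg_le k n _ (bracketCoef_mem hx' I)⟩ := by
      refine Subtype.ext ((eq_sum_bracketCoef hx' fun w hw => h w (by omega)).trans ?_)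
      exact (map_sum (lieSer k n).subtype (fun I => (mc k n).bracket (gen k n I)
        ⟨bracketCoef x.1 I, lieDeg_le k n _ (bracketCoef_mem hx' I)⟩) Finset.univ).symm
    rw [h1]
    refine sum_mem fun I _ => ?_
    rw [add_comm]
    refine filt_bracket (mem_filt_one _) (ih (bracketCoef_mem hx' I) fun w hw => ?_)
    have h2 : shift k I (lenPart k n (w.length + 1) x.1) = 0 := by
      funext u
      rw [shift_apply, lenPart_apply]
      split_ifs with hu
      · exact h _ (by rw [hu]; omega)
      · rfl
    change bracketCoef x.1 I w = 0
    rw [bracketCoef, h2, map_zero]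
    exact mul_zero _

/-- Lie series are complete for the filtration by brackets, which is the filtration by word length
in each degree. -/
theorem mc_isComplete (n : ℕ) : (mc k n).IsComplete where
  separated i x _ h := Subtype.ext <| funext fun w =>
    mc_filt_length (h (w.length + 1)) w (Nat.lt_succ_self _)
  exists_limit i x hx h := by
    have h1 (w : List (Face n)) (M : ℕ) (hM : w.length + 1 ≤ M) :
        (x M).1 w = (x (w.length + 1)).1 w := by
      induction M, hM using Nat.le_induction with
      | base => rfl
      | succ M hM ih =>
        rw [← ih]
        have := mc_filt_length (h M) w (by omega)
        rwa [Submodule.coe_sub, Pi.sub_apply, sub_eq_zero] at this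
    have hx' (N : ℕ) : (x N).1 ∈ lieDeg k n i := hx N
    have hy : (fun w => (x (w.length + 1)).1 w : TSer k n) ∈ lieDeg k n i := by
      refine ⟨fun w hw => (hx' _).1 w hw, fun r => ?_⟩
      have : lenPart k n r (fun w => (x (w.length + 1)).1 w) = lenPart k n r (x (r + 1)).1 := by
        funext w
        rw [lenPart_apply, lenPart_apply]
        split_ifs with hw
        · rw [hw]
        · rfl
      rw [this]
      exact (hx' _).2 r
    refine ⟨⟨_, lieDeg_le k n i hy⟩, hy, fun N => ?_⟩
    refine mem_mc_filt (m := i) (sub_mem hy (hx N)) fun w hw => ?_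
    rw [Submodule.coe_sub, Pi.sub_apply, sub_eq_zero]
    exact (h1 w N hw).symm

end Completeness

/-! ### Truncation of Lie series -/

section Truncation

variable {k : Type*} [Field k] [CharZero k] {n : ℕ}

theorem lenPart_mem_lieDeg {i : ℤ} {f : TSer k n} (hf : f ∈ lieDeg k n i) (r : ℕ) :
    lenPart k n r f ∈ lieDeg k n i := by
  refine ⟨fun w hw => ?_, fun s => ?_⟩
  · rw [lenPart_apply, hf.1 w hw, ite_self]
  · rw [lenPart_of_liePoly (hf.2 r)]
    split_ifs with h
    · rw [h]; exact hf.2 r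
    · exact zero_mem _

/-- The part of word length `r` of a Lie series. -/
def lenLie (k : Type*) [Field k] [CharZero k] (n r : ℕ) : lieSer k n →ₗ[k] lieSer k n :=
  (lenPart k n r).restrict fun _ hf =>
    map_lieSer_le (fun _ _ h => lieDeg_le k n _ (lenPart_mem_lieDeg h r)) hf

theorem lenLie_coe (r : ℕ) (f : lieSer k n) : (lenLie k n r f).1 = lenPart k n r f.1 := rfl

theorem lenLie_mem_gr {i : ℤ} {f : lieSer k n} (hf : f ∈ (mc k n).gr i) (r : ℕ) :
    lenLie k n r f ∈ (mc k n).gr i := lenPart_mem_lieDeg hf r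

theorem lenLie_liePoly (r : ℕ) (f : lieSer k n) : (lenLie k n r f).1 ∈ liePoly k n r :=
  lenPart_mem_liePoly f.2 r

/-- The part of word length `< N` of a Lie series. -/
def truncLie (k : Type*) [Field k] [CharZero k] (n N : ℕ) : lieSer k n →ₗ[k] lieSer k n :=
  ∑ r ∈ Finset.range N, lenLie k n r

theorem truncLie_apply (N : ℕ) (f : lieSer k n) :
    truncLie k n N f = ∑ r ∈ Finset.range N, lenLie k n r f := by
  rw [truncLie, LinearMap.sum_apply]

theorem truncLie_mem_gr {i : ℤ} {f : lieSer k n} (hf : f ∈ (mc k n).gr i) (N : ℕ) :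
    truncLie k n N f ∈ (mc k n).gr i := by
  rw [truncLie_apply]
  exact sum_mem fun r _ => lenLie_mem_gr hf r

/-- Lie series are the limits of their truncations. -/
theorem sub_truncLie_mem_filt {i : ℤ} {f : lieSer k n} (hf : f ∈ (mc k n).gr i) (N : ℕ) :
    f - truncLie k n N f ∈ (mc k n).filt N := by
  refine mem_mc_filt (sub_mem hf (truncLie_mem_gr hf N)) fun w hw => ?_
  have h1 : (truncLie k n N f).1 = ∑ r ∈ Finset.range N, lenPart k n r f.1 := by
    rw [truncLie_apply]
    exact map_sum (lieSer k n).subtype _ _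
  obtain ⟨M, rfl⟩ : ∃ M, N = M + 1 := ⟨N - 1, by omega⟩
  rw [Submodule.coe_sub, Pi.sub_apply, h1, ← eq_sum_lenPart f.1 M w (by omega), sub_self]

/-- The iterated brackets of generators span the Lie polynomials. -/
theorem liePoly_le_span (r : ℕ) {f : lieSer k n} (hf : f.1 ∈ liePoly k n r)
    {S : Submodule k (lieSer k n)}
    (h : ∀ g : lieSer k n, IsBracketing (fun a b => (mc k n).bracket a b)
      (Set.range (gen k n)) r g → g ∈ S) : f ∈ S := by
  have hb {r : ℕ} {g : TSer k n} {x : lieSer k n} (hx : IsEval (mc k n) (gen k n) r g x) :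
      IsBracketing (fun a b => (mc k n).bracket a b) (Set.range (gen k n)) r x := by
    induction hx with
    | of I => exact IsBracketing.of _ ⟨I, rfl⟩
    | bracket p q _ _ x y _ _ hx hy => exact IsBracketing.bracket p q x y hx hy
  have key : f.1 ∈ S.map (lieSer k n).subtype :=
    liePoly_induction (S := S.map (lieSer k n).subtype) (D := mc k n) (a := gen k n)
      (fun g x hx => Submodule.mem_map.2 ⟨x, h x (hb hx), isEval_mc hx⟩) hf
  obtain ⟨g, hg, hgf⟩ := key
  rwa [← Subtype.ext hgf]

end Truncation

/-! ### Morphisms are determined by the generators -/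

section Continuity

variable {k : Type*} [Field k] [CharZero k] {n : ℕ} {L : Type*} [AddCommGroup L] [Module k L]
  {D : DGLieData k L}

/-- Two linear maps on Lie series that respect the grading and the filtration and agree on Lie
polynomials are equal. -/
theorem eq_of_liePoly (hc : D.IsComplete) {c : ℤ} {S T : lieSer k n →ₗ[k] L}
    (hS : ∀ i, ∀ f ∈ (mc k n).gr i, S f ∈ D.gr (i + c))
    (hT : ∀ i, ∀ f ∈ (mc k n).gr i, T f ∈ D.gr (i + c))
    (hS' : ∀ N, ∀ f ∈ (mc k n).filt N, S f ∈ D.filt N)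
    (hT' : ∀ N, ∀ f ∈ (mc k n).filt N, T f ∈ D.filt N)
    (h : ∀ r (f : lieSer k n), f.1 ∈ liePoly k n r → S f = T f) : S = T := by
  refine LinearMap.ext fun f => ?_
  refine (mc k n).induction_on (C := fun f => S f = T f) f (fun i f hf => ?_)
    fun f g hf hg => by rw [map_add, map_add, hf, hg]
  rw [← sub_eq_zero]
  refine hc.separated _ _ (sub_mem (hS i f hf) (hT i f hf)) fun N => ?_
  have h1 : S (truncLie k n N f) = T (truncLie k n N f) := by
    rw [truncLie_apply, map_sum, map_sum]
    exact Finset.sum_congr rfl fun r _ => h r _ (lenLie_liePoly r f)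
  have h2 : S f - T f = S (f - truncLie k n N f) - T (f - truncLie k n N f) := by
    rw [map_sub, map_sub, h1]; abel
  rw [h2]
  exact sub_mem (hS' N _ (sub_truncLie_mem_filt hf N)) (hT' N _ (sub_truncLie_mem_filt hf N))

/-- A morphism of graded Lie algebras from `mc_n` is determined by the images of the generators. -/
theorem IsGradedLieHom.ext_gen (hc : D.IsComplete) {φ ψ : lieSer k n →ₗ[k] L}
    (hφ : IsGradedLieHom (mc k n) D φ) (hψ : IsGradedLieHom (mc k n) D ψ)
    (h : ∀ I, φ (gen k n I) = ψ (gen k n I)) : φ = ψ := by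
  refine eq_of_liePoly hc (c := 0) (by simpa using hφ.map_gr) (by simpa using hψ.map_gr)
    (fun N f hf => hφ.map_filt hf) (fun N f hf => hψ.map_filt hf) fun r f hf => ?_
  refine sub_eq_zero.1 (liePoly_le_span r hf (S := (φ - ψ).ker) fun g hg => ?_)
  rw [LinearMap.mem_ker, LinearMap.sub_apply, sub_eq_zero]
  clear hf f
  induction hg with
  | of g hg => obtain ⟨I, rfl⟩ := hg; exact h I
  | bracket p q x y hx hy ihx ihy =>
    rw [hφ.map_bracket, hψ.map_bracket, ihx, ihy]

/-- A morphism of graded Lie algebras from `mc_n` that commutes with the differential on the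
generators commutes with it. -/
theorem IsGradedLieHom.isDGLieHom (hD : D.IsDGLie) (hc : D.IsComplete) {φ : lieSer k n →ₗ[k] L}
    (hφ : IsGradedLieHom (mc k n) D φ)
    (h : ∀ I, φ ((mc k n).d (gen k n I)) = D.d (φ (gen k n I))) : IsDGLieHom (mc k n) D φ := by
  refine ⟨hφ.map_gr, hφ.map_bracket, fun x => ?_⟩
  suffices h' : φ ∘ₗ (mc k n).d = D.d ∘ₗ φ from LinearMap.congr_fun h' x
  refine eq_of_liePoly hc (c := 1) (fun i f hf => hφ.map_gr _ _ ((mc_isDGLie n).d_mem i f hf))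
    (fun i f hf => hD.d_mem _ _ (hφ.map_gr i f hf))
    (fun N f hf => hφ.map_filt (d_mem_filt (mc_isDGLie n) hf))
    (fun N f hf => d_mem_filt hD (hφ.map_filt hf)) fun r f hf => ?_
  refine sub_eq_zero.1 (liePoly_le_span r hf (S := (φ ∘ₗ (mc k n).d - D.d ∘ₗ φ).ker)
    fun g hg => ?_)
  rw [LinearMap.mem_ker, LinearMap.sub_apply, sub_eq_zero, LinearMap.comp_apply,
    LinearMap.comp_apply]
  clear hf f
  induction hg with
  | of g hg => obtain ⟨I, rfl⟩ := hg; exact h I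
  | bracket p q x y hx hy ihx ihy =>
    rw [d_bracket (mc_isDGLie n), map_add, hφ.map_bracket, hφ.map_bracket, hφ.map_bracket,
      hφ.map_par, ihx, ihy, d_bracket hD]

end Continuity

/-! ### Extension of a map from the generators -/

section Extension

variable {k : Type*} [Field k] [CharZero k] {n : ℕ} {L : Type*} [AddCommGroup L] [Module k L]
  {D : DGLieData k L} {a : Face n → L}

/-- The partial sums of the value at `a` of a Lie series. -/
def partEval (D : DGLieData k L) (a : Face n → L) (N : ℕ) : lieSer k n →ₗ[k] L :=
  ∑ r ∈ Finset.range N, lieEval D a r ∘ₗ (lieSer k n).subtype ∘ₗ lenLie k n r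

theorem partEval_apply (N : ℕ) (f : lieSer k n) :
    partEval D a N f = ∑ r ∈ Finset.range N, lieEval D a r (lenPart k n r f.1) := by
  rw [partEval, LinearMap.sum_apply]
  rfl

theorem partEval_succ (N : ℕ) (f : lieSer k n) :
    partEval D a (N + 1) f = partEval D a N f + lieEval D a N (lenPart k n N f.1) := by
  rw [partEval_apply, partEval_apply, Finset.sum_range_succ]

/-- The evaluation at `a` of Lie series as the limit of its partial sums, in each degree. -/
theorem exists_evaluation (hD : D.IsDGLie) (hc : D.IsComplete)
    (ha : ∀ I, a I ∈ D.gr (1 - (I.dim : ℤ))) :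
    ∃ φ : lieSer k n →ₗ[k] L, (∀ i, ∀ f ∈ (mc k n).gr i, φ f ∈ D.gr i) ∧
      ∀ N f, φ f - partEval D a N f ∈ D.filt N := by
  have hs {i : ℤ} {f : lieSer k n} (hf : f ∈ (mc k n).gr i) (N : ℕ) :
      partEval D a N f ∈ D.gr i := by
    have hf' : f.1 ∈ lieDeg k n i := hf
    rw [partEval_apply]
    exact sum_mem fun r _ => lieEval_mem_gr hD ha r (lenPart_mem_lieDeg hf' r).1
  have hex (i : ℤ) (f : (mc k n).gr i) : ∃ y ∈ D.gr i, ∀ N, y - partEval D a N f.1 ∈ D.filt N := by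
    refine hc.exists_limit i (fun N => partEval D a N f.1) (fun N => hs f.2 N) fun N => ?_
    rw [partEval_succ, add_sub_cancel_left]
    exact lieEval_mem_filt hD ha (lenPart_mem_liePoly f.1.2 N)
  choose y hy hyN using hex
  have huniq {i : ℤ} {u v : L} (hu : u ∈ D.gr i) (hv : v ∈ D.gr i)
      (h : ∀ N, u - v ∈ D.filt N) : u = v :=
    sub_eq_zero.1 (hc.separated i _ (sub_mem hu hv) h)
  let Φ (i : ℤ) : (mc k n).gr i →ₗ[k] L :=
    { toFun := y i
      map_add' := fun f g => by
        refine huniq (hy i _) (add_mem (hy i f) (hy i g)) fun N => ?_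
        have := sub_mem (hyN i (f + g) N) (add_mem (hyN i f N) (hyN i g N))
        rw [Submodule.coe_add, map_add] at this
        convert this using 1
        abel
      map_smul' := fun c f => by
        refine huniq (hy i _) (Submodule.smul_mem _ _ (hy i f)) fun N => ?_
        have := sub_mem (hyN i (c • f) N) (Submodule.smul_mem _ c (hyN i f N))
        rw [Submodule.coe_smul, map_smul, smul_sub, sub_sub_sub_cancel_right] at this
        exact this }
  let φ : lieSer k n →ₗ[k] L := DirectSum.toModule k ℤ L Φ ∘ₗ
    (LinearEquiv.ofBijective (DirectSum.coeLinearMap (mc k n).gr)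
      (mc k n).internal).symm.toLinearMap
  have hφ (i : ℤ) (f : lieSer k n) (hf : f ∈ (mc k n).gr i) : φ f = y i ⟨f, hf⟩ := by
    have h1 : (LinearEquiv.ofBijective (DirectSum.coeLinearMap (mc k n).gr)
        (mc k n).internal).symm f = DirectSum.lof k ℤ (fun i => (mc k n).gr i) i ⟨f, hf⟩ := by
      refine (LinearEquiv.symm_apply_eq _).2 ?_
      exact (DirectSum.coeLinearMap_lof (mc k n).gr i ⟨f, hf⟩).symm
    change DirectSum.toModule k ℤ L Φ ((LinearEquiv.ofBijective _ _).symm f) = _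
    rw [h1, DirectSum.toModule_lof]
    rfl
  refine ⟨φ, fun i f hf => ?_, fun N f => ?_⟩
  · rw [hφ i f hf]
    exact hy i _
  · refine (mc k n).induction_on (C := fun f => φ f - partEval D a N f ∈ D.filt N) f
      (fun i f hf => ?_) fun f g hf hg => ?_
    · rw [hφ i f hf]
      exact hyN i ⟨f, hf⟩ N
    · rw [map_add, map_add, add_sub_add_comm]
      exact add_mem hf hg

/-- The universal property of `mc_n` as a completed free graded Lie algebra. -/
theorem exists_gradedLieHom (hD : D.IsDGLie) (hc : D.IsComplete)
    (ha : ∀ I, a I ∈ D.gr (1 - (I.dim : ℤ))) :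
    ∃ φ : lieSer k n →ₗ[k] L, IsGradedLieHom (mc k n) D φ ∧ ∀ I, φ (gen k n I) = a I := by
  obtain ⟨φ, hgr, hφ⟩ := exists_evaluation (k := k) (n := n) hD hc ha
  have huniq {i : ℤ} {u v : L} (hu : u ∈ D.gr i) (hv : v ∈ D.gr i)
      (h : ∀ N, u - v ∈ D.filt N) : u = v :=
    sub_eq_zero.1 (hc.separated i _ (sub_mem hu hv) h)
  have hpoly {r N : ℕ} (hN : r < N) {f : lieSer k n} (hf : f.1 ∈ liePoly k n r) :
      partEval D a N f = lieEval D a r f.1 := by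
    rw [partEval_apply, Finset.sum_eq_single r]
    · rw [lenPart_of_liePoly hf, if_pos rfl]
    · intro s _ hs
      rw [lenPart_of_liePoly hf, if_neg hs, map_zero]
    · intro h
      exact absurd (Finset.mem_range.2 hN) h
  have hφpoly {r : ℕ} {i : ℤ} {f : lieSer k n} (hfi : f ∈ (mc k n).gr i)
      (hf : f.1 ∈ liePoly k n r) : φ f = lieEval D a r f.1 := by
    have hfi' : f.1 ∈ lieDeg k n i := hfi
    refine huniq (hgr i f hfi) (lieEval_mem_gr hD ha r hfi'.1) fun N => ?_
    have := hφ (N + r + 1) f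
    rw [hpoly (by omega) hf] at this
    exact filt_antitone (by omega) this
  have hfilt {N : ℕ} {f : lieSer k n} (hf : f ∈ (mc k n).filt N) : φ f ∈ D.filt N := by
    have := hφ N f
    rw [partEval_apply, Finset.sum_eq_zero, sub_zero] at this
    · exact this
    · intro r hr
      have : lenPart k n r f.1 = 0 := by
        funext w
        rw [lenPart_apply]
        split_ifs with hw
        · exact mc_filt_length hf w (by have := Finset.mem_range.1 hr; omega)
        · rfl
      rw [this, map_zero]
  refine ⟨φ, ⟨hgr, fun x y => ?_⟩, fun I => ?_⟩
  · refine (mc k n).induction_on (C := fun x => φ ((mc k n).bracket x y) =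
      D.bracket (φ x) (φ y)) x (fun i x hx => ?_) fun x x' hx hx' => by
        simp only [map_add, LinearMap.add_apply, hx, hx']
    refine (mc k n).induction_on (C := fun y => φ ((mc k n).bracket x y) =
      D.bracket (φ x) (φ y)) y (fun j y hy => ?_) fun y y' hy hy' => by
        simp only [map_add, hy, hy']
    refine huniq (hgr _ _ ((mc_isDGLie n).bracket_mem i j x hx y hy))
      (hD.bracket_mem i j _ (hgr i x hx) _ (hgr j y hy)) fun N => ?_
    -- modulo the `N`-th step of the filtration the arguments may be replaced by polynomials
    set x' := truncLie k n N x with hx'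
    set y' := truncLie k n N y with hy'
    have h1 : φ ((mc k n).bracket x' y') = D.bracket (φ x') (φ y') := by
      rw [hx', hy', truncLie_apply, truncLie_apply]
      simp only [map_sum, LinearMap.sum_apply]
      refine Finset.sum_congr rfl fun r _ => Finset.sum_congr rfl fun s _ => ?_
      have hr := lenLie_mem_gr hx s
      have hs := lenLie_mem_gr hy r
      rw [hφpoly hr (lenLie_liePoly _ _), hφpoly hs (lenLie_liePoly _ _),
        hφpoly ((mc_isDGLie n).bracket_mem i j _ hr _ hs)
          (liePoly_bracket k n _ _ _ _ (lenLie_liePoly _ _) (lenLie_liePoly _ _)),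
        ← lieEval_tbr hD ha (lenLie_liePoly _ _) (lenLie_liePoly _ _)]
      rfl
    have hxf : x - x' ∈ (mc k n).filt N := sub_truncLie_mem_filt hx N
    have hyf : y - y' ∈ (mc k n).filt N := sub_truncLie_mem_filt hy N
    have h2 : φ ((mc k n).bracket x y) - D.bracket (φ x) (φ y) =
        φ ((mc k n).bracket (x - x') y) + φ ((mc k n).bracket x' (y - y')) -
        (D.bracket (φ (x - x')) (φ y) + D.bracket (φ x') (φ (y - y'))) := by
      simp only [map_sub, LinearMap.sub_apply, h1]
      abel
    rw [h2]
    exact sub_mem (add_mem (hfilt (filt_bracket_left hxf _)) (hfilt (filt_bracket_right _ hyf)))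
      (add_mem (filt_bracket_left (hfilt hxf) _) (filt_bracket_right _ (hfilt hyf)))
  · rw [hφpoly (gen_mem_gr I) (Submodule.subset_span (IsBracketing.of _ ⟨I, rfl⟩))]
    exact lieEval_letter hD ha I

end Extension

/-! ### The canonical map to Maurer–Cartan elements -/

section Canonical

variable {k : Type*} [Field k] [CharZero k] {n : ℕ} {L : Type*} [AddCommGroup L] [Module k L]
  {L' : Type*} [AddCommGroup L'] [Module k L'] {D : DGLieData k L} {D' : DGLieData k L'}

theorem coef_canon (φ : lieSer k n →ₗ[k] L) (I : Face n) :
    coef k L I (canon n φ) = φ (gen k n I) := coef_sum_tmul _ I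

/-- The element attached to `φ` is the image of the universal one. -/
theorem canon_eq_map (φ : lieSer k n →ₗ[k] L) :
    canon n φ = TensorProduct.map φ LinearMap.id (univ k n) :=
  coef_ext fun I => by rw [coef_canon, coef_map, univ, coef_canon, LinearMap.id_apply]

theorem canon_comp (f : L →ₗ[k] L') (φ : lieSer k n →ₗ[k] L) :
    canon n (f ∘ₗ φ) = TensorProduct.map f LinearMap.id (canon n φ) :=
  coef_ext fun I => by rw [coef_canon, coef_map, coef_canon, LinearMap.comp_apply]

theorem coef_pullTens {m : ℕ} (θ : Fin (m + 1) →o Fin (n + 1)) (x : L ⊗[k] Cc k n) (J : Face m) :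
    coef k L J (pullTens k L θ x) = ∑ I, pullCoef k θ I J • coef k L I x := by
  rw [pullTens]
  induction x with
  | zero => simp
  | add x y hx hy => simp only [map_add, hx, hy, smul_add, Finset.sum_add_distrib]
  | tmul a c =>
    rw [TensorProduct.map_tmul, LinearMap.id_apply, coef_tmul, pullC_apply, Finset.sum_smul]
    simp only [coef_tmul, mul_smul]

theorem mcMap_gen {m : ℕ} (θ : Fin (m + 1) →o Fin (n + 1)) (J : Face m) :
    mcMap k θ (gen k m J) = ∑ I, pullCoef k θ I J • gen k n I := by
  refine Subtype.ext ?_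
  rw [mcMap_apply]
  refine (pushSer_letter θ J).trans ?_
  exact (map_sum (lieSer k n).subtype (fun I => pullCoef k θ I J • gen k n I) Finset.univ).symm

theorem canon_comp_mcMap {m : ℕ} (θ : Fin (m + 1) →o Fin (n + 1)) (φ : lieSer k n →ₗ[k] L) :
    canon m (φ ∘ₗ mcMap k θ) = pullTens k L θ (canon n φ) :=
  coef_ext fun J => by
    rw [coef_canon, coef_pullTens, LinearMap.comp_apply, mcMap_gen, map_sum]
    simp only [map_smul, coef_canon]

theorem coef_dTens (x : L ⊗[k] Cc k n) (I : Face n) : coef k L I (dTens D n x) =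
    D.d (coef k L I x) + ∑ J, dC k n (Pi.single J 1) I • D.par (coef k L J x) := by
  rw [dTens, LinearMap.add_apply, map_add, coef_map]
  congr 1
  conv_lhs => rw [eq_sum_coef x, map_sum, map_sum]
  simp only [TensorProduct.map_tmul, coef_tmul]

/-- The linear part of the differential is the transpose of the differential of `C_n`. -/
theorem dLetter_singleton (I J : Face n) :
    dLetter k n I [J] = (-1) ^ J.dim * dC k n (Pi.single J 1) I := by
  have h1 : omConv (univForm k) (univForm k) [J] = 0 := by
    rw [conv_univForm, treeCut_singleton, smul_zero]
  have h2 : parC k n (Pi.single J (1 : k)) = ((-1 : k) ^ J.dim) • Pi.single J 1 := by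
    funext I
    rw [parC_apply, Pi.smul_apply, smul_eq_mul]
    rcases eq_or_ne I J with rfl | h
    · rfl
    · rw [Pi.single_eq_of_ne h, mul_zero, mul_zero]
  rw [dLetter_eq, h1, map_zero, add_zero, univCochain_singleton, ← Pi.neg_apply, ← dC_parC, h2,
    map_smul, Pi.smul_apply, smul_eq_mul]

theorem mc_d_gen (I : Face n) : ((mc k n).d (gen k n I)).1 = dLetter k n I := by
  rw [mc_d_apply]
  exact dSer_letter I

theorem lenLie_zero (f : lieSer k n) : lenLie k n 0 f = 0 := by
  refine Subtype.ext (funext fun w => ?_)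
  rw [lenLie_coe, lenPart_apply]
  split_ifs with h
  · rw [List.length_eq_zero_iff.1 h, lenPart_zero f.2]; rfl
  · rfl

theorem lenLie_one (f : lieSer k n) : lenLie k n 1 f = ∑ J, f.1 [J] • gen k n J := by
  refine Subtype.ext (Eq.trans (funext fun w => ?_)
    (map_sum (lieSer k n).subtype (fun J => f.1 [J] • gen k n J) Finset.univ).symm)
  rw [lenLie_coe, lenPart_apply, Finset.sum_apply]
  change _ = ∑ J, f.1 [J] * letter k n J w
  split_ifs with h
  · obtain ⟨K, rfl⟩ := List.length_eq_one_iff.1 h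
    rw [Finset.sum_eq_single K]
    · simp [letter]
    · intro J _ hJ
      simp [letter, hJ.symm]
    · simp
  · refine (Finset.sum_eq_zero fun J _ => ?_).symm
    rw [letter, if_neg, mul_zero]
    rintro rfl
    exact h rfl

/-- The partial sum of the Maurer–Cartan series of `x` up to the arity `R`. -/
def mcSum (D : DGLieData k L) (n R : ℕ) (x : L ⊗[k] Cc k n) : L ⊗[k] Cc k n :=
  dTens D n x + ∑ r ∈ Finset.Icc 2 R,
    ((r.factorial : k)⁻¹) • lBr D n r (fun _ => 1) (fun _ => x)

theorem IsGradedLieHom.coef_dTens_canon {φ : lieSer k n →ₗ[k] L}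
    (hφ : IsGradedLieHom (mc k n) D φ) (I : Face n) : coef k L I (dTens D n (canon n φ)) =
      D.d (φ (gen k n I)) - φ (lenLie k n 1 ((mc k n).d (gen k n I))) := by
  rw [coef_dTens, coef_canon, lenLie_one, map_sum, sub_eq_add_neg, ← Finset.sum_neg_distrib]
  congr 1
  refine Finset.sum_congr rfl fun J _ => ?_
  rw [coef_canon, D.par_of_mem (hφ.map_gr _ _ (gen_mem_gr J)), mc_d_gen, dLetter_singleton,
    map_smul, smul_smul, ← neg_smul]
  congr 1
  have hs : (((1 - (J.dim : ℤ)).negOnePow : ℤ) : k) = -(-1) ^ J.dim := by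
    rw [Int.negOnePow_sub]
    simp [Int.negOnePow_def]
  rw [hs]
  ring

theorem IsGradedLieHom.coef_mcTerm_canon {φ : lieSer k n →ₗ[k] L}
    (hφ : IsGradedLieHom (mc k n) D φ) {r : ℕ} (hr : 2 ≤ r) (I : Face n) :
    coef k L I (mcTerm D n r (canon n φ)) = -φ (lenLie k n r ((mc k n).d (gen k n I))) := by
  rw [canon_eq_map, ← hφ.map_mcTerm, coef_map, ← map_neg]
  congr 1
  refine Subtype.ext ?_
  rw [coef_mcTerm_univ hr, Submodule.coe_neg, lenLie_coe, mc_d_gen]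

/-- The Maurer–Cartan series of the element attached to `φ` is given by the differences of `d (φ
v_I)` and `φ (d v_I)`, the latter truncated. By naturality of the transfer this reduces to the
universal element. -/
theorem IsGradedLieHom.coef_mcSum_canon {φ : lieSer k n →ₗ[k] L}
    (hφ : IsGradedLieHom (mc k n) D φ) {R : ℕ} (hR : 1 ≤ R) (I : Face n) :
    coef k L I (mcSum D n R (canon n φ)) =
      D.d (φ (gen k n I)) - φ (truncLie k n (R + 1) ((mc k n).d (gen k n I))) := by
  have h1 : Finset.range (R + 1) = insert 0 (insert 1 (Finset.Icc 2 R)) := by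
    ext r
    simp only [Finset.mem_range, Finset.mem_insert, Finset.mem_Icc]
    omega
  rw [mcSum, map_add, hφ.coef_dTens_canon, map_sum, truncLie_apply, h1,
    Finset.sum_insert (by simp), Finset.sum_insert (by simp), lenLie_zero, zero_add, map_add,
    map_sum, sub_add_eq_sub_sub, sub_eq_add_neg _ (∑ r ∈ Finset.Icc 2 R, _),
    ← Finset.sum_neg_distrib]
  congr 1
  refine Finset.sum_congr rfl fun r hr => ?_
  rw [lBr_const, hφ.coef_mcTerm_canon (Finset.mem_Icc.1 hr).1]

/-- A morphism of graded Lie algebras commutes with the differential exactly when the attached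
element is Maurer–Cartan. -/
theorem IsGradedLieHom.canon_mem_MC_iff (hD : D.IsDGLie) (hc : D.IsComplete)
    {φ : lieSer k n →ₗ[k] L} (hφ : IsGradedLieHom (mc k n) D φ) :
    canon n φ ∈ MC D n ↔ IsDGLieHom (mc k n) D φ := by
  have hgr (I : Face n) : (mc k n).d (gen k n I) ∈ (mc k n).gr (1 - (I.dim : ℤ) + 1) :=
    (mc_isDGLie n).d_mem _ _ (gen_mem_gr I)
  have hrest (N : ℕ) (I : Face n) : φ ((mc k n).d (gen k n I)) -
      φ (truncLie k n N ((mc k n).d (gen k n I))) ∈ D.filt N := by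
    rw [← map_sub]
    exact hφ.map_filt (sub_truncLie_mem_filt (hgr I) N)
  constructor
  · rintro ⟨-, h⟩
    refine hφ.isDGLieHom hD hc fun I => ?_
    refine (sub_eq_zero.1 (hc.separated (1 - (I.dim : ℤ) + 1) _ (sub_mem
      (hD.d_mem _ _ (hφ.map_gr _ _ (gen_mem_gr I))) (hφ.map_gr _ _ (hgr I))) fun N => ?_)).symm
    obtain ⟨R₀, hR⟩ := h N
    have h1 := mem_filtTens_iff.1 (hR (R₀ + N + 1) (by omega)) I
    change coef k L I (mcSum D n (R₀ + N + 1) (canon n φ)) ∈ D.filt N at h1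
    rw [hφ.coef_mcSum_canon (by omega)] at h1
    have h2 := sub_mem h1 (filt_antitone (by omega : N ≤ R₀ + N + 1 + 1) (hrest _ I))
    rwa [sub_sub_sub_cancel_right] at h2
  · intro h
    refine ⟨mem_grTens_iff.2 fun I => ?_, fun N => ⟨N + 1, fun R hR => ?_⟩⟩
    · rw [coef_canon]
      exact hφ.map_gr _ _ (gen_mem_gr I)
    · refine mem_filtTens_iff.2 fun I => ?_
      change coef k L I (mcSum D n R (canon n φ)) ∈ D.filt N
      rw [hφ.coef_mcSum_canon (by omega), ← h.map_d]
      exact filt_antitone (by omega) (hrest _ I)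

/-- Morphisms out of `mc_n` correspond to Maurer–Cartan elements. -/
theorem bijOn_canon (hD : D.IsDGLie) (hc : D.IsComplete) : Set.BijOn (canon n)
    {φ : lieSer k n →ₗ[k] L | IsDGLieHom (mc k n) D φ} (MC D n) := by
  refine ⟨fun φ hφ => (hφ.graded.canon_mem_MC_iff hD hc).2 hφ, fun φ hφ ψ hψ h => ?_,
    fun x hx => ?_⟩
  · refine hφ.graded.ext_gen hc hψ.graded fun I => ?_
    rw [← coef_canon, ← coef_canon, h]
  · obtain ⟨φ, hφ, hI⟩ := exists_gradedLieHom hD hc (mem_grTens_iff.1 hx.1)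
    have h : canon n φ = x := coef_ext fun I => by rw [coef_canon, hI]
    exact ⟨φ, (hφ.canon_mem_MC_iff hD hc).1 (h ▸ hx), h⟩

theorem IsDGLieHom.comp {L₀ : Type*} [AddCommGroup L₀] [Module k L₀] {D₀ : DGLieData k L₀}
    {g : L →ₗ[k] L'} {f : L₀ →ₗ[k] L} (hg : IsDGLieHom D D' g) (hf : IsDGLieHom D₀ D f) :
    IsDGLieHom D₀ D' (g ∘ₗ f) where
  map_gr i x hx := hg.map_gr i _ (hf.map_gr i x hx)
  map_bracket x y := by simp only [LinearMap.comp_apply, hf.map_bracket, hg.map_bracket]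
  map_d x := by simp only [LinearMap.comp_apply, hf.map_d, hg.map_d]

/-- Maurer–Cartan elements pull back to Maurer–Cartan elements: they are the elements attached to
morphisms, and these can be composed with the cosimplicial maps. -/
theorem pullTens_mem_MC (hD : D.IsDGLie) (hc : D.IsComplete) {m : ℕ}
    (θ : Fin (m + 1) →o Fin (n + 1)) {x : L ⊗[k] Cc k n} (hx : x ∈ MC D n) :
    pullTens k L θ x ∈ MC D m := by
  obtain ⟨φ, hφ, rfl⟩ := (bijOn_canon hD hc).surjOn hx
  rw [← canon_comp_mcMap]
  exact (bijOn_canon hD hc).mapsTo (IsDGLieHom.comp hφ (mcMap_isDGLieHom θ))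

theorem map_mem_MC (hD : D.IsDGLie) (hc : D.IsComplete) (hD' : D'.IsDGLie) (hc' : D'.IsComplete)
    {f : L →ₗ[k] L'} (hf : IsDGLieHom D D' f) {x : L ⊗[k] Cc k n} (hx : x ∈ MC D n) :
    TensorProduct.map f LinearMap.id x ∈ MC D' n := by
  obtain ⟨φ, hφ, rfl⟩ := (bijOn_canon hD hc).surjOn hx
  rw [← canon_comp]
  exact (bijOn_canon hD' hc').mapsTo (hf.comp hφ)

end Canonical

end DGL

end

theorem theorem5p2 (k : Type*) [Field k] [CharZero k] :
    -- `mc_•` is a cosimplicial complete dg Lie algebra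
    (∀ n : ℕ, (∀ x ∈ DGL.lieSer k n, DGL.dSer k n x ∈ DGL.lieSer k n) ∧
      (DGL.mc k n).IsDGLie ∧ (DGL.mc k n).IsComplete) ∧
    (∀ (m n : ℕ) (θ : Fin (m + 1) →o Fin (n + 1)),
      (∀ x ∈ DGL.lieSer k m, DGL.pushSer k θ x ∈ DGL.lieSer k n) ∧
      DGL.IsDGLieHom (DGL.mc k m) (DGL.mc k n) (DGL.mcMap k θ)) ∧
    (∀ n : ℕ, DGL.mcMap k (OrderHom.id : Fin (n + 1) →o Fin (n + 1)) = LinearMap.id) ∧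
    (∀ (l m n : ℕ) (θ : Fin (l + 1) →o Fin (m + 1)) (ψ : Fin (m + 1) →o Fin (n + 1)),
      DGL.mcMap k (ψ.comp θ) = DGL.mcMap k ψ ∘ₗ DGL.mcMap k θ) ∧
    -- the maps `θ^*` make `C_•` (hence `𝔤 ⊗ C_•`) simplicial
    (∀ n : ℕ, DGL.pullC k (OrderHom.id : Fin (n + 1) →o Fin (n + 1)) = LinearMap.id) ∧
    (∀ (l m n : ℕ) (θ : Fin (l + 1) →o Fin (m + 1)) (ψ : Fin (m + 1) →o Fin (n + 1)),
      DGL.pullC k (ψ.comp θ) = DGL.pullC k θ ∘ₗ DGL.pullC k ψ) ∧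
    -- for every complete dg Lie algebra `𝔤`:
    ∀ (L : Type*) [AddCommGroup L] [Module k L] (D : DGL.DGLieData k L),
      D.IsDGLie → D.IsComplete →
      -- `MC(𝔤 ⊗ C_•)` is a simplicial set
      (∀ (m n : ℕ) (θ : Fin (m + 1) →o Fin (n + 1)), ∀ x ∈ DGL.MC D n,
        DGL.pullTens k L θ x ∈ DGL.MC D m) ∧
      -- the canonical map `φ ↦ ∑_I φ(v_I) ⊗ ω_I` is bijective in each simplicial degree,
      (∀ n : ℕ, Set.BijOn (DGL.canon n)
        {φ : DGL.lieSer k n →ₗ[k] L | DGL.IsDGLieHom (DGL.mc k n) D φ} (DGL.MC D n)) ∧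
      -- is a map of simplicial sets,
      (∀ (m n : ℕ) (θ : Fin (m + 1) →o Fin (n + 1)) (φ : DGL.lieSer k n →ₗ[k] L),
        DGL.IsDGLieHom (DGL.mc k n) D φ →
        DGL.canon m (φ ∘ₗ DGL.mcMap k θ) = DGL.pullTens k L θ (DGL.canon n φ)) ∧
      -- and is natural in `𝔤`
      (∀ (L' : Type*) [AddCommGroup L'] [Module k L'] (D' : DGL.DGLieData k L'),
        D'.IsDGLie → D'.IsComplete → ∀ f : L →ₗ[k] L', DGL.IsDGLieHom D D' f →
        ∀ n : ℕ,
          (∀ x ∈ DGL.MC D n, TensorProduct.map f LinearMap.id x ∈ DGL.MC D' n) ∧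
          (∀ φ : DGL.lieSer k n →ₗ[k] L, DGL.IsDGLieHom (DGL.mc k n) D φ →
            DGL.canon n (f ∘ₗ φ) = TensorProduct.map f LinearMap.id (DGL.canon n φ))) := by
  refine ⟨fun n => ⟨fun x hx => DGL.dSer_mem_lieSer hx, DGL.mc_isDGLie n, DGL.mc_isComplete n⟩,
    fun m n θ => ⟨fun x hx => DGL.pushSer_mem_lieSer θ hx, DGL.mcMap_isDGLieHom θ⟩, DGL.mcMap_id,
    fun l m n θ ψ => DGL.mcMap_comp θ ψ, DGL.pullC_id, fun l m n θ ψ => DGL.pullC_comp θ ψ,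
    fun L _ _ D hD hc => ⟨fun m n θ x hx => DGL.pullTens_mem_MC hD hc θ hx,
      fun n => DGL.bijOn_canon hD hc, fun m n θ φ _ => DGL.canon_comp_mcMap θ φ,
      fun L' _ _ D' hD' hc' f hf n => ⟨fun x hx => DGL.map_mem_MC hD hc hD' hc' hf hx,
        fun φ _ => DGL.canon_comp f φ⟩⟩⟩
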